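/- **Setting.** Let $g:\mathbb N\to[0,\infty)$ satisfy $g(0)=0$, $g(k)>0$ for $k\ge1$ and $\sup_{k\ge1}|g(k+1)-g(k)|<\infty$, and let $\alpha,\beta,\lambda,\delta>0$, $\theta\ge0$ and $T>0$. Put $g(k)!=\prod_{j=1}^kg(j)$, let $Z(\varphi)=\sum_{j\ge0}\varphi^j/g(j)!$ with radius of convergence $\varphi^*$, and assume $\lim_{\varphi\uparrow\varphi^*}Z(\varphi)=\infty$. Let $R(\varphi)=Z(\varphi)^{-1}\sum_{j\ge0}j\varphi^j/g(j)!$ on $[0,\varphi^*)$ and $\Phi=R^{-1}:[0,\infty)\to[0,\varphi^*)$. For $u\in[0,1]$ let $$\bar\varphi_\theta(u)=\begin{cases}\dfrac{-(\alpha\delta-\beta\lambda)u+\alpha\delta}{\lambda\delta},&\theta<1,\\[2mm]\dfrac{-(\alpha\delta-\beta\lambda)u+\alpha\delta+\alpha+\beta}{\lambda\delta+\lambda+\delta},&\theta=1,\\[2mm]\dfrac{\alpha+\beta}{\lambda+\delta},&\theta>1,\end{cases}$$ assume $\bar\varphi_\theta(u)<\varphi^*$ for all $u\in[0,1]$, and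 let $\bar\rho_\theta=R\circ\bar\varphi_\theta$. Let $\bar\nu_N$ be the product measure on $\mathbb N^{\{1,\dots,N-1\}}$ with marginals $\bar\nu_N\{\eta(x)=k\}=Z(\bar\varphi_N(x))^{-1}\bar\varphi_N(x)^k/g(k)!$, where $$\bar\varphi_N(x)=\frac{-(\alpha\delta-\beta\lambda)(x-1)+\alpha\delta(N-2)+(\alpha+\beta)N^\theta}{\lambda\delta(N-2)+(\lambda+\delta)N^\theta}$$ (this is well defined for all large $N$), and let $\chi_\theta(u)=\lim_{N\to\infty}\mathrm{Var}_{\bar\nu_N}(\eta(Nu))$, where $Nu$ stands for its integer part, replaced by the nearest site of $\{1,\dots,N-1\}$ if it lies outside this set. Let $\mathfrak A_\theta f=\Phi'(\bar\rho_\theta)\,\Delta f$ for $f\in C^\infty([0,1])$, where $\nabla=\partial_u$, $\Delta=\partial_u^2$ and derivatives at $0,1$ are one-sided. Let $\mathcal S_\theta$ be the space of $f\in C^\infty([0,1])$ such that for every integer $k\ge0$ the function $h=\mathfrak A_\theta^kf$ satisfies: $h(0)=h(1)=0$ if $0\le\theta<1$; $\partial_uh(0)=\lambda h(0)$ and $\partial_uh(1)=-\delta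 h(1)$ if $\theta=1$; $\partial_uh(0)=\partial_uh(1)=0$ if $\theta>1$. Equip $\mathcal S_\theta$ with the topology of the semi-norms $\|H\|_k=\sup_{u\in[0,1]}|\partial_u^kH(u)|$, $k\ge 0$, and its dual $\mathcal S_\theta'$ with the strong topology; $\mathcal C([0,T],\mathcal S_\theta')$ carries the $\sigma$-algebra generated by the maps $y\mapsto y_t(H)$, $t\in[0,T]$, $H\in\mathcal S_\theta$. For $h:[0,1]\to\mathbb R$ let $$\|h\|_{L^{2,\theta}}^2=2\int_0^1\Phi(\bar\rho_\theta(u))h(u)^2\,du+\mathbf 1_{\{\theta=1\}}\Big[\Big(\tfrac{\alpha}{\lambda^2}+\tfrac{\Phi(\bar\rho_\theta(0))}{\lambda}\Big)h(0)^2+\Big(\tfrac{\beta}{\delta^2}+\tfrac{\Phi(\bar\rho_\theta(1))}{\delta}\Big)h(1)^2\Big].$$ **Proposition.** There exists a stochastic process $\mathscr Y$ with values in $\mathcal C([0,T],\mathcal S_\theta')$, defined on some probability space, such that 1. for every $H\in\mathcal S_\theta$ the processes, indexed by $t\in[0,T]$, $$\mathscr M_t(H)=\mathscr Y_t(H)-\mathscr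 Y_0(H)-\int_0^t\mathscr Y_s\big(\Phi'(\bar\rho_\theta)\Delta H\big)\,ds,\qquad \mathscr N_t(H)=\mathscr M_t(H)^2-t\,\|\nabla H\|_{L^{2,\theta}}^2$$ are martingales with respect to $\mathcal F_t=\sigma\{\mathscr Y_s(H):s\le t,\ H\in\mathcal S_\theta\}$; 2. $\mathscr Y_0$ is a mean-zero Gaussian field with $\mathbb E[\mathscr Y_0(H)\mathscr Y_0(G)]=\int_0^1H(u)G(u)\chi_\theta(u)\,du$ for all $H,G\in\mathcal S_\theta$. Moreover, any two such processes, possibly defined on different probability spaces, have the same law on $\mathcal C([0,T],\mathcal S_\theta')$. -/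

import Mathlib

open MeasureTheory ProbabilityTheory Filter Set
open scoped Topology ENNReal NNReal

noncomputable section

namespace ZeroRange

/-! ### The model: jump rate, partition function, fugacity and density -/

/-- The parameters of the boundary-driven zero-range process: the jump rate `g`, the reservoir
parameters `α`, `lam` (left boundary), `β`, `δ` (right boundary), and the exponent `θ` tuning the
strength of the boundary dynamics. -/
structure Params where
  g : ℕ → ℝ
  α : ℝ
  lam : ℝ
  β : ℝ
  δ : ℝ
  θ : ℝ

/-- `g(k)! = ∏_{j=1}^k g(j)`. -/
def gFactorial (g : ℕ → ℝ) (k : ℕ) : ℝ := ∏ j ∈ Finset.Icc 1 k, g j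

/-- The partition function `Z(φ) = ∑_j φ^j / g(j)!`. -/
def Z (g : ℕ → ℝ) (φ : ℝ) : ℝ := ∑' j : ℕ, φ ^ j / gFactorial g j

/-- The radius of convergence `φ*` of the partition function. -/
def phiStar (g : ℕ → ℝ) : ℝ≥0∞ :=
  (FormalMultilinearSeries.ofScalars ℝ (fun j : ℕ => (gFactorial g j)⁻¹)).radius

/-- `R(φ) = Z(φ)⁻¹ ∑_j j φ^j / g(j)!`. -/
def R (g : ℕ → ℝ) (φ : ℝ) : ℝ := (Z g φ)⁻¹ * ∑' j : ℕ, (j : ℝ) * φ ^ j / gFactorial g j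

/-- `Φ`, the inverse of `R : [0, φ*) → [0, ∞)`. -/
def Phi (g : ℕ → ℝ) : ℝ → ℝ :=
  Function.invFunOn (R g) {φ : ℝ | 0 ≤ φ ∧ ENNReal.ofReal φ < phiStar g}

/-- The asymptotic fugacity profile, on `[0, 1]`, in the regimes `θ < 1`, `θ = 1`, `θ > 1`. -/
def fugacity (p : Params) (u : ℝ) : ℝ :=
  if p.θ < 1 then
    (-(p.α * p.δ - p.β * p.lam) * u + p.α * p.δ) / (p.lam * p.δ)
  else if p.θ = 1 then
    (-(p.α * p.δ - p.β * p.lam) * u + p.α * p.δ + p.α + p.β) / (p.lam * p.δ + p.lam + p.δ)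
  else
    (p.α + p.β) / (p.lam + p.δ)

/-- The limit density profile `ρ̄_θ = R ∘ φ̄_θ`. -/
def rhoBar (p : Params) (u : ℝ) : ℝ := R p.g (fugacity p u)

/-! ### The invariant measures and the limiting variance -/

/-- The bulk `I_N = {1, …, N - 1}`. -/
abbrev Bulk (N : ℕ) : Type := ↥(Finset.Icc 1 (N - 1))

/-- The fugacity profile of the system of size `N` at the site `x`. -/
def fugacityN (p : Params) (N x : ℕ) : ℝ :=
  (-(p.α * p.δ - p.β * p.lam) * ((x : ℝ) - 1) + p.α * p.δ * ((N : ℝ) - 2)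
      + (p.α + p.β) * (N : ℝ) ^ p.θ)
    / (p.lam * p.δ * ((N : ℝ) - 2) + (p.lam + p.δ) * (N : ℝ) ^ p.θ)

/-- The one-site law on `ℕ` with fugacity `φ`: it gives mass `Z(φ)⁻¹ φ^k / g(k)!` to `k`. -/
def siteLaw (g : ℕ → ℝ) (φ : ℝ) : Measure ℕ :=
  Measure.sum fun k : ℕ =>
    ENNReal.ofReal ((Z g φ)⁻¹ * (φ ^ k / gFactorial g k)) • Measure.dirac k

/-- The invariant product measure on the configurations `η : I_N → ℕ`. -/
def nuBar (p : Params) (N : ℕ) : Measure (Bulk N → ℕ) :=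
  Measure.pi fun x => siteLaw p.g (fugacityN p N x)

/-- The site `Nu` of the bulk: the integer part of `N u`, moved to the nearest bulk site when it
lies outside `I_N` (for `u ∈ (0, 1)` this does not happen once `N` is large). -/
def site (N : ℕ) (u : ℝ) : ℕ := max 1 (min ⌊(N : ℝ) * u⌋₊ (N - 1))

/-- `Var_{ν̄_N}(η(Nu))`; the bulk is empty for `N ≤ 1`, where the value is irrelevant. -/
def siteVariance (p : Params) (u : ℝ) (N : ℕ) : ℝ :=
  if h : site N u ∈ Finset.Icc 1 (N - 1) then
    variance (fun η : Bulk N → ℕ => (η ⟨site N u, h⟩ : ℝ)) (nuBar p N)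
  else 0

/-- `χ_θ(u) = lim_{N → ∞} Var_{ν̄_N}(η(Nu))`. -/
def chi (p : Params) (u : ℝ) : ℝ := limUnder atTop (siteVariance p u)

/-! ### Smooth functions on `[0, 1]` -/

/-- A function on `[0, 1]` seen as a function on `ℝ` (constant outside `[0, 1]`); only its values
on `[0, 1]` are ever used. -/
def ext (h : unitInterval → ℝ) : ℝ → ℝ := Set.IccExtend zero_le_one h

/-- The `k`-th derivative on `[0, 1]`, one-sided at the endpoints. -/
def D (k : ℕ) (h : unitInterval → ℝ) (u : unitInterval) : ℝ :=
  iteratedDerivWithin k (ext h) (Icc 0 1) u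

/-- `h` belongs to `C^∞([0, 1])`. -/
def IsSmooth (h : unitInterval → ℝ) : Prop := ContDiffOn ℝ ((⊤ : ℕ∞) : WithTop ℕ∞) (ext h) (Icc 0 1)

theorem IsSmooth.add {h₁ h₂ : unitInterval → ℝ} (a₁ : IsSmooth h₁) (a₂ : IsSmooth h₂) :
    IsSmooth (h₁ + h₂) :=
  ContDiffOn.add a₁ a₂

theorem IsSmooth.smul {h : unitInterval → ℝ} (c : ℝ) (a : IsSmooth h) : IsSmooth (c • h) :=
  ContDiffOn.const_smul c a

theorem isSmooth_zero : IsSmooth 0 := contDiffOn_const (c := (0 : ℝ))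

theorem D_add (k : ℕ) {h₁ h₂ : unitInterval → ℝ} (a₁ : IsSmooth h₁) (a₂ : IsSmooth h₂) :
    D k (h₁ + h₂) = D k h₁ + D k h₂ := by
  funext u
  exact iteratedDerivWithin_add u.2 (uniqueDiffOn_Icc zero_lt_one)
    ((a₁ u u.2).of_le (by exact_mod_cast le_top)) ((a₂ u u.2).of_le (by exact_mod_cast le_top))

theorem D_smul (k : ℕ) (c : ℝ) (h : unitInterval → ℝ) : D k (c • h) = c • D k h := by
  funext u
  exact iteratedDerivWithin_const_smul_field c (ext h)

theorem D_zero (k : ℕ) : D k 0 = 0 := by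
  have := D_smul k 0 0
  simpa using this

theorem bddAbove_D (k : ℕ) {h : unitInterval → ℝ} (a : IsSmooth h) :
    BddAbove (range fun u => |D k h u|) := by
  have hc : Continuous (D k h) := by
    have := ContDiffOn.continuousOn_iteratedDerivWithin (m := k) a
      (by exact_mod_cast le_top) (uniqueDiffOn_Icc zero_lt_one)
    exact continuousOn_iff_continuous_domRestrict.1 this
  exact (isCompact_range hc.abs).bddAbove

/-- The real vector space `C^∞([0, 1])`, as a subspace of all functions on `[0, 1]`. -/
def smoothSubmodule : Submodule ℝ (unitInterval → ℝ) where
  carrier := {h | IsSmooth h}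
  add_mem' := fun a₁ a₂ => IsSmooth.add a₁ a₂
  zero_mem' := isSmooth_zero
  smul_mem' := fun c _ a => IsSmooth.smul c a

/-- The space `C^∞([0, 1])`; as a type of its own, so that it carries the topology below and not
the topology of pointwise convergence. -/
def SmoothFun : Type := ↥smoothSubmodule

instance : AddCommGroup SmoothFun := inferInstanceAs (AddCommGroup ↥smoothSubmodule)

instance : Module ℝ SmoothFun := inferInstanceAs (Module ℝ ↥smoothSubmodule)

/-- The underlying function on `[0, 1]`. -/
def SmoothFun.toFun (H : SmoothFun) : unitInterval → ℝ := Subtype.val H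

theorem SmoothFun.isSmooth (H : SmoothFun) : IsSmooth H.toFun := Subtype.property H

/-- The semi-norm `‖H‖_k = sup_{u ∈ [0, 1]} |∂_u^k H(u)|`. -/
def smoothSeminorm (k : ℕ) : Seminorm ℝ SmoothFun :=
  Seminorm.of (fun H => ⨆ u : unitInterval, |D k H.toFun u|)
    (by
      intro H G
      refine ciSup_le fun u => ?_
      have e : D k (H + G).toFun u = D k H.toFun u + D k G.toFun u :=
        congrFun (D_add k H.isSmooth G.isSmooth) u
      rw [e]
      exact (abs_add_le _ _).trans (add_le_add (le_ciSup (bddAbove_D k H.isSmooth) u)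
        (le_ciSup (bddAbove_D k G.isSmooth) u)))
    (by
      intro c H
      have e : ∀ u, |D k (c • H).toFun u| = ‖c‖ * |D k H.toFun u| := fun u => by
        have : D k (c • H).toFun u = c * D k H.toFun u := congrFun (D_smul k c H.toFun) u
        rw [this, abs_mul, Real.norm_eq_abs]
      simp only [e]
      exact (Real.mul_iSup_of_nonneg (norm_nonneg c) _).symm)

def smoothSeminormFamily : SeminormFamily ℝ SmoothFun ℕ := smoothSeminorm

/-- The locally convex topology of `C^∞([0, 1])` generated by the semi-norms `‖·‖_k`. -/
instance : TopologicalSpace SmoothFun := smoothSeminormFamily.moduleFilterBasis.topology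

/-! ### The operator `𝔄_θ` and the space of test functions -/

/-- `Φ'(ρ̄_θ(u))`. -/
def diffusivity (p : Params) (u : ℝ) : ℝ := deriv (Phi p.g) (rhoBar p u)

/-- `𝔄_θ h(u) = Φ'(ρ̄_θ(u)) Δh(u)`, for `u ∈ [0, 1]`. -/
def opA (p : Params) (h : unitInterval → ℝ) (u : unitInterval) : ℝ :=
  diffusivity p u * D 2 h u

/-- The boundary conditions for `θ ≥ 0`: Dirichlet for `θ < 1`, Robin for `θ = 1` and Neumann for
`θ > 1`. -/
def BoundaryCondition (p : Params) (h : unitInterval → ℝ) : Prop :=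
  if p.θ < 1 then h 0 = 0 ∧ h 1 = 0
  else if p.θ = 1 then D 1 h 0 = p.lam * h 0 ∧ D 1 h 1 = -p.δ * h 1
  else D 1 h 0 = 0 ∧ D 1 h 1 = 0

theorem BoundaryCondition.add {p : Params} {h₁ h₂ : unitInterval → ℝ} (a₁ : IsSmooth h₁)
    (a₂ : IsSmooth h₂) (b₁ : BoundaryCondition p h₁) (b₂ : BoundaryCondition p h₂) :
    BoundaryCondition p (h₁ + h₂) := by
  unfold BoundaryCondition at *
  rw [D_add 1 a₁ a₂]
  simp only [Pi.add_apply]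
  split_ifs at * <;> constructor <;> linarith [b₁.1, b₁.2, b₂.1, b₂.2]

theorem BoundaryCondition.smul {p : Params} {h : unitInterval → ℝ} (c : ℝ)
    (b : BoundaryCondition p h) : BoundaryCondition p (c • h) := by
  unfold BoundaryCondition at *
  rw [D_smul]
  simp only [Pi.smul_apply, smul_eq_mul]
  split_ifs at * <;> rw [b.1, b.2] <;> constructor <;> ring

theorem boundaryCondition_zero (p : Params) : BoundaryCondition p 0 := by
  unfold BoundaryCondition
  rw [D_zero]
  simp

theorem opA_add (p : Params) {h₁ h₂ : unitInterval → ℝ} (a₁ : IsSmooth h₁) (a₂ : IsSmooth h₂) :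
    opA p (h₁ + h₂) = opA p h₁ + opA p h₂ := by
  funext u
  simp only [opA, D_add 2 a₁ a₂, Pi.add_apply, mul_add]

theorem opA_smul (p : Params) (c : ℝ) (h : unitInterval → ℝ) :
    opA p (c • h) = c • opA p h := by
  funext u
  simp only [opA, D_smul, Pi.smul_apply, smul_eq_mul]
  ring

theorem opA_iterate_add (p : Params) {h₁ h₂ : unitInterval → ℝ}
    (a₁ : ∀ k, IsSmooth ((opA p)^[k] h₁)) (a₂ : ∀ k, IsSmooth ((opA p)^[k] h₂)) (k : ℕ) :
    (opA p)^[k] (h₁ + h₂) = (opA p)^[k] h₁ + (opA p)^[k] h₂ := by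
  induction k with
  | zero => rfl
  | succ k ih => simp only [Function.iterate_succ_apply', ih, opA_add p (a₁ k) (a₂ k)]

theorem opA_iterate_smul (p : Params) (c : ℝ) (h : unitInterval → ℝ) (k : ℕ) :
    (opA p)^[k] (c • h) = c • (opA p)^[k] h := by
  induction k with
  | zero => rfl
  | succ k ih => simp only [Function.iterate_succ_apply', ih, opA_smul]

theorem opA_iterate_zero (p : Params) (k : ℕ) : (opA p)^[k] 0 = 0 := by
  have := opA_iterate_smul p 0 0 k
  simpa using this

/-- The space of test functions `𝒮_θ` for `θ ≥ 0`: the functions `H ∈ C^∞([0, 1])` for which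
`𝔄_θ^k H` satisfies the boundary condition for every `k ≥ 0`. (That `𝔄_θ^k H` is smooth is no
restriction when the coefficient `Φ'(ρ̄_θ)` is smooth on `[0, 1]`; it is listed so that the operator
maps `𝒮_θ` to itself by definition.) -/
def testSubmodule (p : Params) : Submodule ℝ SmoothFun where
  carrier := {H | ∀ k : ℕ, IsSmooth ((opA p)^[k] H.toFun) ∧
    BoundaryCondition p ((opA p)^[k] H.toFun)}
  add_mem' := by
    intro H G hH hG k
    have e : (opA p)^[k] (H + G).toFun = (opA p)^[k] H.toFun + (opA p)^[k] G.toFun :=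
      opA_iterate_add p (fun k => (hH k).1) (fun k => (hG k).1) k
    rw [e]
    exact ⟨(hH k).1.add (hG k).1, (hH k).2.add (hH k).1 (hG k).1 (hG k).2⟩
  zero_mem' := by
    intro k
    have e : (opA p)^[k] (0 : SmoothFun).toFun = 0 := opA_iterate_zero p k
    rw [e]
    exact ⟨isSmooth_zero, boundaryCondition_zero p⟩
  smul_mem' := by
    intro c H hH k
    have e : (opA p)^[k] (c • H).toFun = c • (opA p)^[k] H.toFun :=
      opA_iterate_smul p c H.toFun k
    rw [e]
    exact ⟨(hH k).1.smul c, (hH k).2.smul c⟩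

/-- `𝒮_θ`, with the topology of the semi-norms `‖·‖_k` inherited from `C^∞([0, 1])`. -/
abbrev TestSpace (p : Params) : Type := ↥(testSubmodule p)

/-- The function on `[0, 1]` underlying a test function. -/
def TestSpace.fn {p : Params} (H : TestSpace p) : unitInterval → ℝ := H.1.toFun

/-- The operator `𝔄_θ : 𝒮_θ → 𝒮_θ`. -/
def testA (p : Params) (H : TestSpace p) : TestSpace p :=
  ⟨(⟨opA p H.fn, (H.2 1).1⟩ : ↥smoothSubmodule), fun k => H.2 (k + 1)⟩

/-- The square `⟨h, h⟩` of the norm of `L^{2,θ}`. -/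
def normSq (p : Params) (h : unitInterval → ℝ) : ℝ :=
  2 * (∫ u in (0 : ℝ)..1, Phi p.g (rhoBar p u) * ext h u * ext h u)
    + (if p.θ = 1 then (p.α / p.lam ^ 2 + Phi p.g (rhoBar p 0) / p.lam) * h 0 * h 0 else 0)
    + (if p.θ = 1 then (p.β / p.δ ^ 2 + Phi p.g (rhoBar p 1) / p.δ) * h 1 * h 1 else 0)

/-! ### Distribution-valued continuous processes and the martingale problem -/

/-- The topological dual `𝒮_θ'`, with the strong topology (uniform convergence on bounded sets). -/
abbrev DualSpace (p : Params) : Type := TestSpace p →L[ℝ] ℝ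

/-- The space `C([0, T], 𝒮_θ')`. -/
def PathSpace (p : Params) (T : ℝ) : Type := C(↥(Icc (0 : ℝ) T), DualSpace p)

/-- `y_t(H)`. -/
def PathSpace.eval {p : Params} {T : ℝ} (y : PathSpace p T) (t : ↥(Icc (0 : ℝ) T))
    (H : TestSpace p) : ℝ :=
  (show C(↥(Icc (0 : ℝ) T), DualSpace p) from y) t H

/-- The σ-algebra of the path space: generated by the coordinates `y ↦ y_t(H)`. -/
instance (p : Params) (T : ℝ) : MeasurableSpace (PathSpace p T) :=
  ⨆ (t : ↥(Icc (0 : ℝ) T)) (H : TestSpace p),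
    MeasurableSpace.comap (fun y : PathSpace p T => y.eval t H) inferInstance

theorem measurable_eval {p : Params} {T : ℝ} (t : ↥(Icc (0 : ℝ) T)) (H : TestSpace p) :
    Measurable (fun y : PathSpace p T => y.eval t H) :=
  Measurable.of_comap_le
    (le_iSup₂_of_le (f := fun (t : ↥(Icc (0 : ℝ) T)) (H : TestSpace p) =>
      MeasurableSpace.comap (fun y : PathSpace p T => y.eval t H) inferInstance) t H le_rfl)

section FieldProcess

variable {p : Params} {T : ℝ} {Ω : Type*}

/-- The filtration `ℱ_t = σ{Y_s(H) : s ≤ t, H ∈ 𝒮_θ}` of a process with paths in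
`C([0, T], 𝒮_θ')`. -/
def fieldFiltration [MeasurableSpace Ω] (Y : Ω → PathSpace p T) (hY : Measurable Y) :
    Filtration ↥(Icc (0 : ℝ) T) ‹MeasurableSpace Ω› where
  seq t := ⨆ (s : ↥(Icc (0 : ℝ) T)) (_ : s ≤ t) (H : TestSpace p),
    MeasurableSpace.comap (fun ω => (Y ω).eval s H) inferInstance
  mono' := fun _ _ h => iSup_mono fun _ => iSup_le fun hs => le_iSup_of_le (hs.trans h) le_rfl
  le' := fun _ => iSup_le fun s => iSup_le fun _ => iSup_le fun H =>
    ((measurable_eval s H).comp hY).comap_le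

/-- `M_t(H) = Y_t(H) - Y_0(H) - ∫_0^t Y_s(Φ'(ρ̄_θ) ΔH) ds`. -/
def processM (hT : 0 ≤ T) (Y : Ω → PathSpace p T) (H : TestSpace p) (t : ↥(Icc (0 : ℝ) T))
    (ω : Ω) : ℝ :=
  (Y ω).eval t H - (Y ω).eval ⟨0, left_mem_Icc.2 hT⟩ H
    - ∫ s in (0 : ℝ)..t, (Y ω).eval (projIcc 0 T hT s) (testA p H)

/-- `N_t(H) = M_t(H)² - t ‖∇H‖²`, with the norm of `L^{2,θ}`. -/
def processN (hT : 0 ≤ T) (Y : Ω → PathSpace p T) (H : TestSpace p) (t : ↥(Icc (0 : ℝ) T))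
    (ω : Ω) : ℝ :=
  processM hT Y H t ω ^ 2 - (t : ℝ) * normSq p (D 1 H.fn)

/-- `Y` is a process with paths in `C([0, T], 𝒮_θ')` that solves the martingale problem, started
from the mean-zero Gaussian field with covariance `(H, G) ↦ ∫ H G χ_θ`. -/
structure IsSolution [MeasurableSpace Ω] (hT : 0 ≤ T) (P : Measure Ω)
    (Y : Ω → PathSpace p T) : Prop where
  measurable : Measurable Y
  martingale_M : ∀ H : TestSpace p,
    Martingale (processM hT Y H) (fieldFiltration Y measurable) P
  martingale_N : ∀ H : TestSpace p,
    Martingale (processN hT Y H) (fieldFiltration Y measurable) P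
  gaussian : IsGaussianProcess
    (fun (H : TestSpace p) (ω : Ω) => (Y ω).eval ⟨0, left_mem_Icc.2 hT⟩ H) P
  mean_zero : ∀ H : TestSpace p, ∫ ω, (Y ω).eval ⟨0, left_mem_Icc.2 hT⟩ H ∂P = 0
  covariance : ∀ H G : TestSpace p,
    ∫ ω, (Y ω).eval ⟨0, left_mem_Icc.2 hT⟩ H * (Y ω).eval ⟨0, left_mem_Icc.2 hT⟩ G ∂P
      = ∫ u in (0 : ℝ)..1, ext H.fn u * ext G.fn u * chi p u

end FieldProcess

end ZeroRange

end

open MeasureTheory ProbabilityTheory Filter Set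
open scoped Topology ENNReal NNReal

noncomputable section

namespace ZeroRange

/-! ### Power series with the weights `1 / g(k)!` -/

/-! The equation is linear, so a solution is a deterministic functional of its initial value and its
martingale part. It therefore suffices to construct these two as Gaussian objects, and to show that
the martingale problem determines their joint law. An eigenbasis of 𝔄_θ turns the equation into a
countable family of scalar Ornstein–Uhlenbeck equations.

Spectral part. By `diffusivity_eq`, Φ'(ρ̄_θ) is the fugacity divided by the variance of the one-site
law, hence smooth and positive on [0, 1]. With w = 1/Φ'(ρ̄_θ), the operator 𝔄_θ = w⁻¹Δ is symmetric
and non-positive in L²(w du) under each boundary condition. An explicit continuous Green kernel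
(`exists_isGreen`) inverts it, up to constants in the Neumann case. The spectral theorem for the
resulting compact operator (`exists_eigenfunctions`) gives eigenfunctions e_i with eigenvalues -λ_i
≤ 0, and the Hilbert–Schmidt bound gives ∑ (1 + λ_i)⁻² < ∞. Elliptic regularity upgrades L²
convergence: every test function is the sum of its eigenexpansion in the topology of 𝒮_θ
(`nonempty_spectralData`), with coefficients decaying faster than any power of 1 + λ_i. Sequences of
polynomial growth thus define distributions, continuously in the strong topology
(`SpectralData.continuous_field`).

Existence. The limiting variance is the one-site variance at the limiting fugacity (`chi_eq`), so
the initial covariance is an L² inner product. The noise form is a Hilbert norm as well, with point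
masses at the endpoints in the Robin case. An isonormal Gaussian process over the orthogonal sum of
the initial space and L²(ℝ; noise space) carries all the randomness (`exists_isIsonormal`,
`exists_driving`). A chaining argument with fourth moments gives continuous versions of the noise
coefficients, with a common random bound of polynomial growth
(`IsIsonormal.exists_continuous_version`). The scalar equations are solved pathwise by `ouSol` and
summed. The martingale part of the sum is again isonormal; its increments are orthogonal to the
past, hence independent of it, and both martingale properties follow (`DrivenSystem.isSolution`).

Uniqueness. A continuous martingale X with bracket qt satisfies E[Z exp(iX_t)] = exp(-q(t-s)/2) E[Z
exp(iX_s)] for bounded ℱ_s-measurable Z (`HasBracket.integral_mul_exp`). This form of Lévy's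
characterisation is proved on grids, by a second-order Taylor expansion stopped at the first large
value or large increment. Peeling off the latest time repeatedly fixes the joint characteristic
function of the initial field and the martingale parts at finitely many times
(`IsSolution.integral_exp_fieldSum_eq`). These variables generate the σ-algebra of the path space,
because the path tested against e_i is recovered from them by `ouSol`
(`measurableSpace_pathSpace_le`). -/

/-- The (unnormalised) `m`-th moment `∑_j j^m φ^j / g(j)!`. -/
def moment (g : ℕ → ℝ) (m : ℕ) (φ : ℝ) : ℝ := ∑' j : ℕ, (j : ℝ) ^ m * φ ^ j / gFactorial g j

/-- The open interval `(0, φ*)`. -/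
def fugacityDomain (g : ℕ → ℝ) : Set ℝ := {φ : ℝ | 0 < φ ∧ ENNReal.ofReal φ < phiStar g}

/-- The variance of the one-site law of fugacity `φ`. -/
def siteVar (g : ℕ → ℝ) (φ : ℝ) : ℝ :=
  moment g 2 φ / moment g 0 φ - (moment g 1 φ / moment g 0 φ) ^ 2

theorem gFactorial_pos {g : ℕ → ℝ} (hg : ∀ k : ℕ, 1 ≤ k → 0 < g k) (k : ℕ) :
    0 < gFactorial g k :=
  Finset.prod_pos fun j hj => hg j (Finset.mem_Icc.1 hj).1

theorem Z_eq_moment (g : ℕ → ℝ) (φ : ℝ) : Z g φ = moment g 0 φ := by simp [Z, moment]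

theorem R_eq_moment (g : ℕ → ℝ) (φ : ℝ) : R g φ = moment g 1 φ / moment g 0 φ := by
  rw [R, Z_eq_moment, div_eq_inv_mul]
  simp [moment]

/-- For r strictly between φ and φ*, the terms r^j / g(j)! are bounded, so the series is dominated
by a multiple of ∑ j^m (φ/r)^j. -/
theorem summable_moment {g : ℕ → ℝ} (hg : ∀ k : ℕ, 1 ≤ k → 0 < g k) (m : ℕ) {φ : ℝ} (h0 : 0 ≤ φ)
    (h : ENNReal.ofReal φ < phiStar g) :
    Summable fun j : ℕ => (j : ℝ) ^ m * φ ^ j / gFactorial g j := by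
  obtain ⟨r, hr1, hr2⟩ := ENNReal.lt_iff_exists_nnreal_btwn.1 h
  have hφr : φ < r := by
    rw [ENNReal.ofReal, ENNReal.coe_lt_coe] at hr1
    exact (Real.toNNReal_lt_iff_lt_coe h0).1 hr1
  have hr0 : (0 : ℝ) < r := h0.trans_lt hφr
  have hs := FormalMultilinearSeries.summable_norm_mul_pow _ hr2
  obtain ⟨B, hB⟩ := hs.tendsto_atTop_zero.bddAbove_range
  have hq : ‖φ / r‖ < 1 := by
    rw [Real.norm_eq_abs, abs_of_nonneg (by positivity), div_lt_one hr0]; exact hφr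
  have h1 := (summable_pow_mul_geometric_of_norm_lt_one m hq).mul_left B
  refine Summable.of_nonneg_of_le (fun j => ?_) (fun j => ?_) h1
  · have := gFactorial_pos hg j; positivity
  · have hp := gFactorial_pos hg j
    have hb := hB ⟨j, rfl⟩
    simp only [FormalMultilinearSeries.norm_apply_eq_norm_coef,
      FormalMultilinearSeries.coeff_ofScalars, norm_inv, Real.norm_eq_abs, abs_of_pos hp] at hb
    have e : (j : ℝ) ^ m * φ ^ j / gFactorial g j
        = ((gFactorial g j)⁻¹ * (r : ℝ) ^ j) * ((j : ℝ) ^ m * (φ / r) ^ j) := by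
      rw [div_pow]; field_simp
    rw [e]
    exact mul_le_mul_of_nonneg_right hb (by positivity)

theorem isOpen_fugacityDomain (g : ℕ → ℝ) : IsOpen (fugacityDomain g) :=
  (isOpen_lt continuous_const continuous_id).inter
    (isOpen_lt ENNReal.continuous_ofReal continuous_const)

theorem convex_fugacityDomain (g : ℕ → ℝ) : Convex ℝ (fugacityDomain g) := by
  refine OrdConnected.convex ⟨fun x hx y hy z hz => ⟨hx.1.trans_le hz.1, ?_⟩⟩
  exact (ENNReal.ofReal_le_ofReal hz.2).trans_lt hy.2

theorem moment_pos {g : ℕ → ℝ} (hg : ∀ k : ℕ, 1 ≤ k → 0 < g k) (m : ℕ) {φ : ℝ}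
    (h : φ ∈ fugacityDomain g) : 0 < moment g m φ := by
  have h0 := h.1
  refine (summable_moment hg m h.1.le h.2).tsum_pos (fun j => ?_) 1 ?_
  · have := gFactorial_pos hg j; positivity
  · have := gFactorial_pos hg 1; positivity

/-- The operator φ d/dφ multiplies the j-th term by j, so it raises the order of the moment by one.
Termwise differentiation is justified by domination on an interval around φ by the moment of order m
+ 1 at some r < φ*. -/
theorem hasDerivAt_moment {g : ℕ → ℝ} (hg : ∀ k : ℕ, 1 ≤ k → 0 < g k) (m : ℕ) {φ : ℝ}
    (h : φ ∈ fugacityDomain g) : HasDerivAt (moment g m) (moment g (m + 1) φ / φ) φ := by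
  obtain ⟨r, hr1, hr2⟩ := ENNReal.lt_iff_exists_nnreal_btwn.1 h.2
  have hφr : φ < r := by
    rw [ENNReal.ofReal, ENNReal.coe_lt_coe] at hr1
    exact (Real.toNNReal_lt_iff_lt_coe h.1.le).1 hr1
  have hr0 : (0 : ℝ) < r := h.1.trans hφr
  have hs := summable_moment hg (m + 1) (φ := r) hr0.le (by rwa [ENNReal.ofReal_coe_nnreal])
  have key := hasDerivAt_tsum_of_isPreconnected (t := Ioo (φ / 2) r) (y₀ := φ) (y := φ)
    (g := fun (j : ℕ) (x : ℝ) => (j : ℝ) ^ m * x ^ j / gFactorial g j)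
    (g' := fun (j : ℕ) (x : ℝ) => (j : ℝ) ^ m * (j * x ^ (j - 1)) / gFactorial g j)
    (hs.mul_right (2 / φ)) isOpen_Ioo isPreconnected_Ioo
    (fun j x _ => ((hasDerivAt_pow j x).const_mul _).div_const _)
    (fun j x hx => ?_) ⟨by linarith [h.1], hφr⟩ (summable_moment hg m h.1.le h.2)
    ⟨by linarith [h.1], hφr⟩
  · have e : moment g (m + 1) φ / φ
        = ∑' j : ℕ, (j : ℝ) ^ m * (j * φ ^ (j - 1)) / gFactorial g j := by
      rw [moment, ← tsum_div_const]
      refine tsum_congr fun j => ?_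
      have h0 := h.1.ne'
      cases j with
      | zero => simp
      | succ j => simp only [Nat.add_sub_cancel, pow_succ]; field_simp
    rw [e]; exact key
  · have hp := gFactorial_pos hg j
    have hx0 : 0 < x := lt_trans (by linarith [h.1]) hx.1
    rw [Real.norm_eq_abs, abs_of_nonneg (by positivity)]
    cases j with
    | zero => simp
    | succ j =>
      have h0 := h.1
      -- Differentiation lowers the exponent by one; since φ/2 ≤ r, the factor 2/φ restores the full
      -- power of r at a cost independent of j.
      have h2 : x ^ j ≤ (r : ℝ) ^ (j + 1) * (2 / φ) := by
        have : x ^ j * (φ / 2) ≤ r ^ j * r :=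
          mul_le_mul (pow_le_pow_left₀ hx0.le hx.2.le j) (by linarith) (by linarith) (by positivity)
        rw [pow_succ]
        calc x ^ j = x ^ j * (φ / 2) * (2 / φ) := by field_simp
          _ ≤ r ^ j * r * (2 / φ) := mul_le_mul_of_nonneg_right this (by positivity)
      simp only [Nat.add_sub_cancel]
      calc ((j + 1 : ℕ) : ℝ) ^ m * (((j + 1 : ℕ) : ℝ) * x ^ j) / gFactorial g (j + 1)
          ≤ ((j + 1 : ℕ) : ℝ) ^ m * (((j + 1 : ℕ) : ℝ) * (r ^ (j + 1) * (2 / φ)))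
            / gFactorial g (j + 1) := by gcongr
        _ = ((j + 1 : ℕ) : ℝ) ^ (m + 1) * r ^ (j + 1) / gFactorial g (j + 1) * (2 / φ) := by
          rw [pow_succ]; ring

/-- The derivative of one moment is the next moment divided by φ, so the order of smoothness is
raised by induction for all moments at once. -/
theorem contDiffOn_moment {g : ℕ → ℝ} (hg : ∀ k : ℕ, 1 ≤ k → 0 < g k) (m : ℕ) :
    ContDiffOn ℝ ((⊤ : ℕ∞) : WithTop ℕ∞) (moment g m) (fugacityDomain g) := by
  rw [contDiffOn_infty]
  intro n
  induction n generalizing m with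
  | zero =>
    rw [Nat.cast_zero, contDiffOn_zero]
    exact fun φ h => (hasDerivAt_moment hg m h).continuousAt.continuousWithinAt
  | succ n ih =>
    rw [Nat.cast_succ, contDiffOn_succ_iff_deriv_of_isOpen (isOpen_fugacityDomain g)]
    refine ⟨fun φ h => (hasDerivAt_moment hg m h).differentiableAt.differentiableWithinAt,
      by simp, ?_⟩
    refine ((ih (m + 1)).div contDiffOn_id fun φ h => h.1.ne').congr fun φ h => ?_
    exact (hasDerivAt_moment hg m h).deriv

/-- After multiplication by the zeroth moment this is the series of (j - μ)² φ^j / g(j)!, whose term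
j = 0 is positive because the mean μ is. -/
theorem siteVar_pos {g : ℕ → ℝ} (hg : ∀ k : ℕ, 1 ≤ k → 0 < g k) {φ : ℝ}
    (h : φ ∈ fugacityDomain g) : 0 < siteVar g φ := by
  have h0 := moment_pos hg 0 h
  have h1 := moment_pos hg 1 h
  set μ := moment g 1 φ / moment g 0 φ with hμ
  have hs0 := summable_moment hg 0 h.1.le h.2
  have hs1 := summable_moment hg 1 h.1.le h.2
  have hs2 := summable_moment hg 2 h.1.le h.2
  have hs := (hs2.sub (hs1.mul_left (2 * μ))).add (hs0.mul_left (μ ^ 2))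
  have e : (∑' j : ℕ, ((j : ℝ) ^ 2 * φ ^ j / gFactorial g j
        - 2 * μ * ((j : ℝ) ^ 1 * φ ^ j / gFactorial g j)
        + μ ^ 2 * ((j : ℝ) ^ 0 * φ ^ j / gFactorial g j)))
      = moment g 2 φ - 2 * μ * moment g 1 φ + μ ^ 2 * moment g 0 φ := by
    rw [(hs2.sub (hs1.mul_left (2 * μ))).tsum_add (hs0.mul_left (μ ^ 2)),
      hs2.tsum_sub (hs1.mul_left (2 * μ)), tsum_mul_left, tsum_mul_left]
    rfl
  have hpos : 0 < moment g 2 φ - 2 * μ * moment g 1 φ + μ ^ 2 * moment g 0 φ := by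
    rw [← e]
    have hμ0 : 0 < μ := div_pos h1 h0
    have t : ∀ j : ℕ, (j : ℝ) ^ 2 * φ ^ j / gFactorial g j
        - 2 * μ * ((j : ℝ) ^ 1 * φ ^ j / gFactorial g j)
        + μ ^ 2 * ((j : ℝ) ^ 0 * φ ^ j / gFactorial g j)
        = ((j : ℝ) - μ) ^ 2 * φ ^ j / gFactorial g j := fun j => by ring
    have hφ := h.1
    refine hs.tsum_pos (fun j => ?_) 0 ?_
    · rw [t]; have := gFactorial_pos hg j; positivity
    · rw [t]; have := gFactorial_pos hg 0
      simp only [CharP.cast_eq_zero, zero_sub, neg_sq, pow_zero, mul_one]; positivity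
  have e2 : siteVar g φ
      = (moment g 2 φ - 2 * μ * moment g 1 φ + μ ^ 2 * moment g 0 φ) / moment g 0 φ := by
    rw [siteVar, hμ]; field_simp; ring
  rw [e2]; exact div_pos hpos h0

theorem contDiffOn_siteVar {g : ℕ → ℝ} (hg : ∀ k : ℕ, 1 ≤ k → 0 < g k) :
    ContDiffOn ℝ ((⊤ : ℕ∞) : WithTop ℕ∞) (siteVar g) (fugacityDomain g) :=
  ((contDiffOn_moment hg 2).div (contDiffOn_moment hg 0) fun _ h => (moment_pos hg 0 h).ne').sub
    (((contDiffOn_moment hg 1).div (contDiffOn_moment hg 0)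
      fun _ h => (moment_pos hg 0 h).ne').pow 2)

theorem hasDerivAt_R {g : ℕ → ℝ} (hg : ∀ k : ℕ, 1 ≤ k → 0 < g k) {φ : ℝ}
    (h : φ ∈ fugacityDomain g) : HasDerivAt (R g) (siteVar g φ / φ) φ := by
  have h0 := moment_pos hg 0 h
  have key := (hasDerivAt_moment hg 1 h).div (hasDerivAt_moment hg 0 h) h0.ne'
  have e : R g = moment g 1 / moment g 0 := funext fun x => R_eq_moment g x
  rw [e]
  refine key.congr_deriv ?_
  have := h.1.ne'
  simp only [siteVar]; field_simp

/-- On (0, φ*) the derivative of `R` is variance over fugacity, hence positive. The point 0 is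
separate because that formula divides by φ; there `R` vanishes, while it is positive elsewhere. -/
theorem injOn_R {g : ℕ → ℝ} (hg : ∀ k : ℕ, 1 ≤ k → 0 < g k) :
    InjOn (R g) {φ : ℝ | 0 ≤ φ ∧ ENNReal.ofReal φ < phiStar g} := by
  have hmono : StrictMonoOn (R g) (fugacityDomain g) := by
    refine strictMonoOn_of_deriv_pos (convex_fugacityDomain g)
      (fun φ h => (hasDerivAt_R hg h).continuousAt.continuousWithinAt) fun φ h => ?_
    have h := interior_subset h
    rw [(hasDerivAt_R hg h).deriv]
    exact div_pos (siteVar_pos hg h) h.1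
  have hz : R g 0 = 0 := by
    rw [R]
    have : ∀ j : ℕ, (j : ℝ) * 0 ^ j / gFactorial g j = 0 := fun j => by cases j <;> simp
    simp [this]
  have hp : ∀ φ ∈ fugacityDomain g, 0 < R g φ := fun φ h => by
    rw [R_eq_moment]; exact div_pos (moment_pos hg 1 h) (moment_pos hg 0 h)
  intro x hx y hy hxy
  rcases hx.1.eq_or_lt with hx0 | hx0 <;> rcases hy.1.eq_or_lt with hy0 | hy0
  · rw [← hx0, ← hy0]
  · have := hp y ⟨hy0, hy.2⟩
    rw [← hxy, ← hx0, hz] at this; exact absurd this (lt_irrefl _)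
  · have := hp x ⟨hx0, hx.2⟩
    rw [hxy, ← hy0, hz] at this; exact absurd this (lt_irrefl _)
  · exact hmono.injOn ⟨hx0, hx.2⟩ ⟨hy0, hy.2⟩ hxy

theorem Phi_R {g : ℕ → ℝ} (hg : ∀ k : ℕ, 1 ≤ k → 0 < g k) {φ : ℝ} (h : φ ∈ fugacityDomain g) :
    Phi g (R g φ) = φ :=
  (injOn_R hg).leftInvOn_invFunOn ⟨h.1.le, h.2⟩

theorem hasDerivAt_Phi {g : ℕ → ℝ} (hg : ∀ k : ℕ, 1 ≤ k → 0 < g k) {φ : ℝ}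
    (h : φ ∈ fugacityDomain g) : HasDerivAt (Phi g) (φ / siteVar g φ) (R g φ) := by
  have hU := (isOpen_fugacityDomain g).mem_nhds h
  have hcd : ContDiffAt ℝ 1 (R g) φ := by
    have e : R g = moment g 1 / moment g 0 := funext fun x => R_eq_moment g x
    rw [e]
    exact (((contDiffOn_moment hg 1).div (contDiffOn_moment hg 0)
      fun _ h => (moment_pos hg 0 h).ne').contDiffAt hU).of_le (by norm_cast)
  have hne : siteVar g φ / φ ≠ 0 := (div_pos (siteVar_pos hg h) h.1).ne'
  have hst : HasStrictDerivAt (R g) (siteVar g φ / φ) φ := by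
    have := hcd.hasStrictDerivAt one_ne_zero
    rwa [(hasDerivAt_R hg h).deriv] at this
  -- A non-zero strict derivative makes `R` map the neighbourhoods of φ onto those of R(φ).
  -- Identities known at the points R(x), with x near φ, thus hold at all points near R(φ), which
  -- gives the continuity of Φ and the local inverse relation.
  have hmap := hst.map_nhds_eq hne
  have hev : ∀ᶠ x in 𝓝 φ, Phi g (R g x) = x := by
    filter_upwards [hU] with x hx using Phi_R hg hx
  have key := HasDerivAt.of_local_left_inverse (f := R g) (g := Phi g) (a := R g φ)
    (f' := siteVar g φ / φ) ?_ ?_ hne ?_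
  · rwa [inv_div] at key
  · rw [ContinuousAt, ← hmap, tendsto_map'_iff, Phi_R hg h]
    exact tendsto_id.congr' (hev.mono fun x hx => hx.symm)
  · rw [Phi_R hg h]; exact hasDerivAt_R hg h
  · rw [← hmap, eventually_map]
    filter_upwards [hev] with x hx
    rw [hx]

/-! ### The macroscopic profiles -/

/-- The standing assumptions on the parameters that the analysis uses. -/
structure Params.Admissible (p : Params) : Prop where
  g_pos : ∀ k : ℕ, 1 ≤ k → 0 < p.g k
  α_pos : 0 < p.α
  lam_pos : 0 < p.lam
  β_pos : 0 < p.β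
  δ_pos : 0 < p.δ
  fugacity_lt : ∀ u ∈ Icc (0 : ℝ) 1, ENNReal.ofReal (fugacity p u) < phiStar p.g

namespace Params.Admissible

theorem fugacity_mem {p : Params} (hp : p.Admissible) {u : ℝ} (hu : u ∈ Icc (0 : ℝ) 1) : fugacity p u ∈ fugacityDomain p.g := by
  refine ⟨?_, hp.fugacity_lt u hu⟩
  have h1 := hp.α_pos
  have h2 := hp.lam_pos
  have h3 := hp.β_pos
  have h4 := hp.δ_pos
  -- This expression interpolates linearly between αδ at u = 0 and βλ at u = 1.
  have e : 0 < -(p.α * p.δ - p.β * p.lam) * u + p.α * p.δ := by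
    have : -(p.α * p.δ - p.β * p.lam) * u + p.α * p.δ
        = p.α * p.δ * (1 - u) + p.β * p.lam * u := by ring
    rw [this]
    rcases hu.1.eq_or_lt with h | h
    · rw [← h]; simp; positivity
    · have : 0 ≤ 1 - u := by linarith [hu.2]
      positivity
  rw [fugacity]
  split_ifs
  · positivity
  · positivity
  · positivity

end Params.Admissible

theorem contDiff_fugacity (p : Params) : ContDiff ℝ ((⊤ : ℕ∞) : WithTop ℕ∞) (fugacity p) := by
  unfold fugacity
  split_ifs <;> fun_prop

namespace Params.Admissible

theorem Phi_rhoBar {p : Params} (hp : p.Admissible) {u : ℝ} (hu : u ∈ Icc (0 : ℝ) 1) : Phi p.g (rhoBar p u) = fugacity p u :=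
  Phi_R hp.g_pos (hp.fugacity_mem hu)

/-- The closed form replaces the derivative of an abstract inverse function by a quotient of power
series, from which positivity and smoothness on [0, 1] are read off. -/
theorem diffusivity_eq {p : Params} (hp : p.Admissible) {u : ℝ} (hu : u ∈ Icc (0 : ℝ) 1) :
    diffusivity p u = fugacity p u / siteVar p.g (fugacity p u) :=
  (hasDerivAt_Phi hp.g_pos (hp.fugacity_mem hu)).deriv

theorem diffusivity_pos {p : Params} (hp : p.Admissible) {u : ℝ} (hu : u ∈ Icc (0 : ℝ) 1) : 0 < diffusivity p u := by
  rw [hp.diffusivity_eq hu]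
  exact div_pos (hp.fugacity_mem hu).1 (siteVar_pos hp.g_pos (hp.fugacity_mem hu))

theorem contDiffOn_siteVar_fugacity {p : Params} (hp : p.Admissible) :
    ContDiffOn ℝ ((⊤ : ℕ∞) : WithTop ℕ∞) (fun u => siteVar p.g (fugacity p u)) (Icc 0 1) :=
  (contDiffOn_siteVar hp.g_pos).comp (contDiff_fugacity p).contDiffOn
    fun _ hu => hp.fugacity_mem hu

theorem contDiffOn_diffusivity {p : Params} (hp : p.Admissible) :
    ContDiffOn ℝ ((⊤ : ℕ∞) : WithTop ℕ∞) (diffusivity p) (Icc 0 1) :=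
  ((contDiff_fugacity p).contDiffOn.div hp.contDiffOn_siteVar_fugacity
    fun _ hu => (siteVar_pos hp.g_pos (hp.fugacity_mem hu)).ne').congr
    fun _ hu => hp.diffusivity_eq hu

end Params.Admissible

end ZeroRange

end

open MeasureTheory ProbabilityTheory Filter Set
open scoped Topology ENNReal NNReal

noncomputable section

namespace ZeroRange

/-! ### The limiting variance -/

theorem lintegral_siteLaw (g : ℕ → ℝ) (φ : ℝ) (f : ℕ → ℝ≥0∞) :
    ∫⁻ k, f k ∂siteLaw g φ
      = ∑' k, ENNReal.ofReal ((Z g φ)⁻¹ * (φ ^ k / gFactorial g k)) * f k := by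
  rw [siteLaw, lintegral_sum_measure]
  refine tsum_congr fun k => ?_
  rw [lintegral_smul_measure, lintegral_dirac, smul_eq_mul]

/-! ### Moments of the one-site law. -/

section SiteLaw

variable {g : ℕ → ℝ} {φ : ℝ}

theorem siteLaw_weight_nonneg (hg : ∀ k : ℕ, 1 ≤ k → 0 < g k) (h : φ ∈ fugacityDomain g) (k : ℕ) :
    0 ≤ (Z g φ)⁻¹ * (φ ^ k / gFactorial g k) := by
  have h0 := moment_pos hg 0 h
  rw [← Z_eq_moment] at h0
  have h1 := h.1
  have := gFactorial_pos hg k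
  positivity

theorem summable_siteLaw (hg : ∀ k : ℕ, 1 ≤ k → 0 < g k) (h : φ ∈ fugacityDomain g) (m : ℕ) :
    Summable fun k : ℕ => (Z g φ)⁻¹ * (φ ^ k / gFactorial g k) * (k : ℝ) ^ m := by
  refine ((summable_moment hg m h.1.le h.2).mul_left (Z g φ)⁻¹).congr fun k => ?_
  ring

theorem isProbabilityMeasure_siteLaw (hg : ∀ k : ℕ, 1 ≤ k → 0 < g k)
    (h : φ ∈ fugacityDomain g) : IsProbabilityMeasure (siteLaw g φ) := by
  constructor
  have h0 := moment_pos hg 0 h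
  rw [← lintegral_one, lintegral_siteLaw]
  simp only [mul_one]
  rw [← ENNReal.ofReal_tsum_of_nonneg (siteLaw_weight_nonneg hg h)
    (by simpa using summable_siteLaw hg h 0), tsum_mul_left]
  have : (∑' k : ℕ, φ ^ k / gFactorial g k) = Z g φ := rfl
  rw [this, Z_eq_moment, inv_mul_cancel₀ h0.ne', ENNReal.ofReal_one]

theorem integrable_pow_siteLaw (hg : ∀ k : ℕ, 1 ≤ k → 0 < g k) (h : φ ∈ fugacityDomain g)
    (m : ℕ) : Integrable (fun k : ℕ => (k : ℝ) ^ m) (siteLaw g φ) := by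
  refine ⟨(measurable_of_countable _).aestronglyMeasurable, ?_⟩
  rw [HasFiniteIntegral, lintegral_siteLaw]
  have e : ∀ k : ℕ, ENNReal.ofReal ((Z g φ)⁻¹ * (φ ^ k / gFactorial g k)) * ‖(k : ℝ) ^ m‖ₑ
      = ENNReal.ofReal ((Z g φ)⁻¹ * (φ ^ k / gFactorial g k) * (k : ℝ) ^ m) := fun k => by
    rw [ENNReal.ofReal_mul (siteLaw_weight_nonneg hg h k), Real.enorm_of_nonneg (by positivity)]
  simp only [e]
  exact (summable_siteLaw hg h m).tsum_ofReal_lt_top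

theorem integral_pow_siteLaw (hg : ∀ k : ℕ, 1 ≤ k → 0 < g k) (h : φ ∈ fugacityDomain g)
    (m : ℕ) : ∫ k : ℕ, (k : ℝ) ^ m ∂siteLaw g φ = moment g m φ / moment g 0 φ := by
  have hi := integrable_pow_siteLaw hg h m
  rw [siteLaw] at hi ⊢
  rw [integral_sum_measure hi, moment, div_eq_inv_mul, ← tsum_mul_left]
  refine tsum_congr fun k => ?_
  rw [integral_smul_measure, integral_dirac,
    ENNReal.toReal_ofReal (siteLaw_weight_nonneg hg h k), smul_eq_mul, Z_eq_moment]
  ring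

theorem variance_siteLaw (hg : ∀ k : ℕ, 1 ≤ k → 0 < g k) (h : φ ∈ fugacityDomain g) :
    variance (fun k : ℕ => (k : ℝ)) (siteLaw g φ) = siteVar g φ := by
  have := isProbabilityMeasure_siteLaw hg h
  rw [variance_eq_sub]
  · have h1 := integral_pow_siteLaw hg h 1
    simp only [pow_one] at h1
    rw [h1]
    have h2 : ∫ k, ((fun k : ℕ => (k : ℝ)) ^ 2) k ∂siteLaw g φ = _ := integral_pow_siteLaw hg h 2
    rw [h2, siteVar]
  · rw [memLp_two_iff_integrable_sq (measurable_of_countable _).aestronglyMeasurable]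
    exact integrable_pow_siteLaw hg h 2

end SiteLaw

/-- This ratio compares the boundary terms of the fugacity with its bulk terms; its three limits
produce the three regimes of the macroscopic profile. -/
theorem tendsto_rpow_div_sub_two {θ : ℝ} :
    Tendsto (fun N : ℕ => (N : ℝ) ^ θ / ((N : ℝ) - 2)) atTop
      (if θ < 1 then 𝓝 0 else if θ = 1 then 𝓝 1 else atTop) := by
  have h1 : Tendsto (fun N : ℕ => (N : ℝ) / ((N : ℝ) - 2)) atTop (𝓝 1) := by
    have : Tendsto (fun x : ℝ => 1 + 2 / (x - 2)) atTop (𝓝 (1 + 0)) :=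
      tendsto_const_nhds.add ((tendsto_const_nhds (x := (2 : ℝ))).div_atTop
        (tendsto_atTop_add_const_right _ (-2) tendsto_id))
    rw [add_zero] at this
    refine (this.comp tendsto_natCast_atTop_atTop).congr' ?_
    filter_upwards [eventually_ge_atTop 3] with N hN
    have : (3 : ℝ) ≤ N := by exact_mod_cast hN
    have h2 : (N : ℝ) - 2 ≠ 0 := by linarith
    simp only [Function.comp]; field_simp; ring
  have e : (fun N : ℕ => (N : ℝ) ^ (θ - 1) * ((N : ℝ) / ((N : ℝ) - 2)))
      =ᶠ[atTop] fun N : ℕ => (N : ℝ) ^ θ / ((N : ℝ) - 2) := by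
    filter_upwards [eventually_ge_atTop 3] with N hN
    have : (3 : ℝ) ≤ N := by exact_mod_cast hN
    rw [Real.rpow_sub_one (by linarith)]
    field_simp
  refine Tendsto.congr' e ?_
  split_ifs with h h'
  · have := (tendsto_rpow_neg_atTop (y := 1 - θ) (by linarith)).comp tendsto_natCast_atTop_atTop
    simpa [Function.comp_def] using this.mul h1
  · subst h'; simpa using h1
  · have h0 : 0 < θ - 1 := by
      rcases lt_trichotomy θ 1 with h2 | h2 | h2
      · exact absurd h2 h
      · exact absurd h2 h'
      · linarith
    have := (tendsto_rpow_atTop h0).comp tendsto_natCast_atTop_atTop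
    exact Tendsto.atTop_mul_pos one_pos this h1

theorem tendsto_fugacityN {p : Params} (hp : p.Admissible) {x : ℕ → ℕ} {u : ℝ}
    (hx : Tendsto (fun N : ℕ => ((x N : ℝ) - 1) / ((N : ℝ) - 2)) atTop (𝓝 u)) :
    Tendsto (fun N => fugacityN p N (x N)) atTop (𝓝 (fugacity p u)) := by
  have h2 := hp.lam_pos
  have h4 := hp.δ_pos
  have hr := tendsto_rpow_div_sub_two (θ := p.θ)
  set v : ℕ → ℝ := fun N => ((x N : ℝ) - 1) / ((N : ℝ) - 2) with hv
  set r : ℕ → ℝ := fun N => (N : ℝ) ^ p.θ / ((N : ℝ) - 2) with hrdef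
  have hnum : Tendsto (fun N => -(p.α * p.δ - p.β * p.lam) * v N + p.α * p.δ) atTop
      (𝓝 (-(p.α * p.δ - p.β * p.lam) * u + p.α * p.δ)) :=
    (hx.const_mul _).add tendsto_const_nhds
  have e : (fun N => (-(p.α * p.δ - p.β * p.lam) * v N + p.α * p.δ + (p.α + p.β) * r N)
      / (p.lam * p.δ + (p.lam + p.δ) * r N)) =ᶠ[atTop] fun N => fugacityN p N (x N) := by
    filter_upwards [eventually_ge_atTop 3] with N hN
    have : (3 : ℝ) ≤ N := by exact_mod_cast hN
    have h0 : (N : ℝ) - 2 ≠ 0 := by linarith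
    have e1 : ((x N : ℝ) - 1) = v N * ((N : ℝ) - 2) := by simp only [hv]; field_simp
    have e2 : (N : ℝ) ^ p.θ = r N * ((N : ℝ) - 2) := by simp only [hrdef]; field_simp
    rw [fugacityN, e1, e2]
    have : -(p.α * p.δ - p.β * p.lam) * (v N * ((N : ℝ) - 2)) + p.α * p.δ * ((N : ℝ) - 2)
        + (p.α + p.β) * (r N * ((N : ℝ) - 2))
        = (-(p.α * p.δ - p.β * p.lam) * v N + p.α * p.δ + (p.α + p.β) * r N)
          * ((N : ℝ) - 2) := by ring
    rw [this]
    have : p.lam * p.δ * ((N : ℝ) - 2) + (p.lam + p.δ) * (r N * ((N : ℝ) - 2))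
        = (p.lam * p.δ + (p.lam + p.δ) * r N) * ((N : ℝ) - 2) := by ring
    rw [this, mul_div_mul_right _ _ h0]
  refine Tendsto.congr' e ?_
  rw [fugacity]
  split_ifs at hr ⊢ with h h'
  · have h5 : p.lam * p.δ + (p.lam + p.δ) * 0 ≠ 0 := by positivity
    have := (hnum.add (hr.const_mul (p.α + p.β))).div
      (tendsto_const_nhds.add (hr.const_mul (p.lam + p.δ))) h5
    simpa [Pi.div_def] using this
  · have h5 : p.lam * p.δ + (p.lam + p.δ) * 1 ≠ 0 := by positivity
    have := (hnum.add (hr.const_mul (p.α + p.β))).div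
      (tendsto_const_nhds.add (hr.const_mul (p.lam + p.δ))) h5
    simpa [Pi.div_def, add_assoc] using this
  -- The ratio diverges here, so numerator and denominator are divided by it as well; only the
  -- boundary terms survive.
  · have hs := hr.inv_tendsto_atTop
    have h5 : p.lam * p.δ * 0 + (p.lam + p.δ) ≠ 0 := by
      rw [mul_zero, zero_add]; positivity
    have := ((hnum.mul hs).add (tendsto_const_nhds (x := p.α + p.β))).div
      ((hs.const_mul (p.lam * p.δ)).add (tendsto_const_nhds (x := p.lam + p.δ))) h5
    simp only [mul_zero, zero_add] at this
    refine this.congr' ?_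
    filter_upwards [hr.eventually_gt_atTop 0] with N hN
    have h6 : 0 < p.lam * p.δ + (p.lam + p.δ) * r N := by positivity
    have h7 : 0 < p.lam * p.δ * (r N)⁻¹ + (p.lam + p.δ) := by positivity
    simp only [Pi.inv_apply, Pi.div_apply]
    rw [div_eq_div_iff h7.ne' h6.ne']
    field_simp

/-- The site is within distance 1 of Nu, and the shifts by 1 and 2 in the affine coordinate cost at
most 1 more, whence the error 2/(N - 2). -/
theorem tendsto_site {u : ℝ} (hu : u ∈ Icc (0 : ℝ) 1) :
    Tendsto (fun N : ℕ => ((site N u : ℝ) - 1) / ((N : ℝ) - 2)) atTop (𝓝 u) := by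
  have h0 : Tendsto (fun N : ℕ => 2 / ((N : ℝ) - 2)) atTop (𝓝 0) :=
    (tendsto_const_nhds (x := (2 : ℝ))).div_atTop
      (tendsto_atTop_add_const_right _ (-2) tendsto_natCast_atTop_atTop)
  rw [tendsto_iff_dist_tendsto_zero]
  refine squeeze_zero' (Eventually.of_forall fun _ => dist_nonneg) ?_ h0
  filter_upwards [eventually_ge_atTop 3] with N hN
  have h3 : (3 : ℝ) ≤ N := by exact_mod_cast hN
  have hN0 : 0 ≤ (N : ℝ) * u := mul_nonneg (by linarith) hu.1
  have hf1 := Nat.floor_le hN0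
  have hf2 := Nat.lt_floor_add_one ((N : ℝ) * u)
  have hc : ((N - 1 : ℕ) : ℝ) = (N : ℝ) - 1 := by
    rw [Nat.cast_sub (by omega)]; simp
  have hNu : (N : ℝ) * u ≤ N := by nlinarith [hu.2]
  have hs : (site N u : ℝ) = max 1 (min (⌊(N : ℝ) * u⌋₊ : ℝ) ((N : ℝ) - 1)) := by
    rw [site, Nat.cast_max, Nat.cast_min, hc, Nat.cast_one]
  have hlow : (N : ℝ) * u - 1 ≤ site N u := by
    rw [hs]
    exact le_max_of_le_right (le_min (by linarith) (by linarith))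
  have hup : (site N u : ℝ) ≤ (N : ℝ) * u + 1 := by
    rw [hs]
    exact max_le (by linarith) ((min_le_left _ _).trans (by linarith))
  have hpos : (0 : ℝ) < (N : ℝ) - 2 := by linarith
  rw [Real.dist_eq]
  have e : ((site N u : ℝ) - 1) / ((N : ℝ) - 2) - u
      = ((site N u : ℝ) - 1 - ((N : ℝ) - 2) * u) / ((N : ℝ) - 2) := by field_simp
  rw [e, abs_div, abs_of_pos hpos]
  refine div_le_div_of_nonneg_right ?_ hpos.le
  rw [abs_le]
  constructor <;> nlinarith [hu.1, hu.2]

/-- The fugacity is affine in the site, hence a convex combination of its values at the first and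
last sites. Those converge to points of an open convex set, which yields a rank N that works for all
sites at once. -/
theorem eventually_fugacityN_mem {p : Params} (hp : p.Admissible) :
    ∀ᶠ N : ℕ in atTop, ∀ x ∈ Finset.Icc 1 (N - 1), fugacityN p N x ∈ fugacityDomain p.g := by
  have h0 : Tendsto (fun N : ℕ => (((1 : ℕ) : ℝ) - 1) / ((N : ℝ) - 2)) atTop (𝓝 0) := by
    simp
  have h1 : Tendsto (fun N : ℕ => (((N - 1 : ℕ) : ℝ) - 1) / ((N : ℝ) - 2)) atTop (𝓝 1) := by
    refine tendsto_const_nhds.congr' ?_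
    filter_upwards [eventually_ge_atTop 3] with N hN
    have h3 : (3 : ℝ) ≤ N := by exact_mod_cast hN
    rw [Nat.cast_sub (by omega), Nat.cast_one]
    have : (N : ℝ) - 2 ≠ 0 := by linarith
    field_simp; ring
  have hU := isOpen_fugacityDomain p.g
  filter_upwards [(tendsto_fugacityN hp (x := fun _ => 1) h0).eventually
      (hU.mem_nhds (hp.fugacity_mem (left_mem_Icc.2 zero_le_one))),
    (tendsto_fugacityN hp (x := fun N => N - 1) h1).eventually
      (hU.mem_nhds (hp.fugacity_mem (right_mem_Icc.2 zero_le_one))),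
    eventually_ge_atTop 3] with N ha hb hN x hx
  have h3 : (3 : ℝ) ≤ N := by exact_mod_cast hN
  have hpos : (0 : ℝ) < (N : ℝ) - 2 := by linarith
  obtain ⟨hx1, hx2⟩ := Finset.mem_Icc.1 hx
  have hx1' : (1 : ℝ) ≤ x := by exact_mod_cast hx1
  have hx2' : (x : ℝ) ≤ (N : ℝ) - 1 := by
    have : (x : ℝ) ≤ ((N - 1 : ℕ) : ℝ) := by exact_mod_cast hx2
    rwa [Nat.cast_sub (by omega), Nat.cast_one] at this
  set v := ((x : ℝ) - 1) / ((N : ℝ) - 2) with hv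
  have hv0 : 0 ≤ v := div_nonneg (by linarith) hpos.le
  have hv1 : v ≤ 1 := by rw [hv, div_le_one hpos]; linarith
  have hxv : (x : ℝ) - 1 = v * ((N : ℝ) - 2) := by rw [hv]; field_simp
  have e : fugacityN p N x = (1 - v) • fugacityN p N 1 + v • fugacityN p N (N - 1) := by
    simp only [fugacityN, smul_eq_mul]
    rw [hxv, Nat.cast_sub (by omega : 1 ≤ N), Nat.cast_one]
    ring
  rw [e]
  exact convex_fugacityDomain p.g ha hb (by linarith) hv0 (by ring)

/-- Under the product measure the occupation of a site has the one-site law, and the one-site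
variance is continuous in the fugacity. Control of all sites is needed, not only of the given one:
projecting the product onto a factor requires the other factors to be probability measures. -/
theorem chi_eq {p : Params} (hp : p.Admissible) {u : ℝ} (hu : u ∈ Icc (0 : ℝ) 1) :
    chi p u = siteVar p.g (fugacity p u) := by
  refine Tendsto.limUnder_eq ?_
  have hcont : ContinuousAt (siteVar p.g) (fugacity p u) :=
    ((contDiffOn_siteVar hp.g_pos).continuousOn).continuousAt
      ((isOpen_fugacityDomain p.g).mem_nhds (hp.fugacity_mem hu))
  refine (hcont.tendsto.comp (tendsto_fugacityN hp (tendsto_site hu))).congr' ?_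
  filter_upwards [eventually_fugacityN_mem hp, eventually_ge_atTop 3] with N hN hN3
  have hs : site N u ∈ Finset.Icc 1 (N - 1) := by
    rw [Finset.mem_Icc, site]
    exact ⟨le_max_left _ _, max_le (by omega) (min_le_right _ _)⟩
  have hprob : ∀ x : Bulk N, IsProbabilityMeasure (siteLaw p.g (fugacityN p N x)) := fun x =>
    isProbabilityMeasure_siteLaw hp.g_pos (hN x x.2)
  have hmp := measurePreserving_eval (fun x : Bulk N => siteLaw p.g (fugacityN p N x))
    ⟨site N u, hs⟩
  rw [siteVariance, dif_pos hs, nuBar]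
  have := variance_map (X := fun k : ℕ => (k : ℝ)) (μ := Measure.pi fun x : Bulk N =>
    siteLaw p.g (fugacityN p N x)) (Y := Function.eval (⟨site N u, hs⟩ : Bulk N))
    (measurable_of_countable _).aemeasurable (measurable_pi_apply _).aemeasurable
  rw [hmp.map_eq, variance_siteLaw hp.g_pos (hN _ hs)] at this
  exact this

end ZeroRange

end

open MeasureTheory ProbabilityTheory Filter Set
open scoped Topology ENNReal NNReal

noncomputable section

namespace ZeroRange

/-! ### Calculus on `[0, 1]` -/

theorem ext_coe (h : unitInterval → ℝ) (u : unitInterval) : ext h u = h u :=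
  IccExtend_val zero_le_one h u

theorem ext_of_mem (h : unitInterval → ℝ) {x : ℝ} (hx : x ∈ Icc (0 : ℝ) 1) :
    ext h x = h ⟨x, hx⟩ := IccExtend_of_mem zero_le_one h hx

theorem continuous_ext {h : unitInterval → ℝ} (hc : Continuous h) : Continuous (ext h) :=
  hc.Icc_extend'

theorem IsSmooth.continuous {h : unitInterval → ℝ} (a : IsSmooth h) : Continuous h := by
  have := continuousOn_iff_continuous_domRestrict.1 (ContDiffOn.continuousOn a)
  convert this using 1
  funext u
  exact (ext_coe h u).symm

theorem D_zero_eq (h : unitInterval → ℝ) : D 0 h = h := by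
  funext u
  rw [D, iteratedDerivWithin_zero, ext_coe]

theorem ext_D (k : ℕ) (h : unitInterval → ℝ) :
    EqOn (ext (D k h)) (iteratedDerivWithin k (ext h) (Icc 0 1)) (Icc 0 1) := fun x hx => by
  rw [ext_of_mem _ hx, D]

theorem D_succ (k : ℕ) (h : unitInterval → ℝ) : D (k + 1) h = D 1 (D k h) := by
  funext u
  rw [D, iteratedDerivWithin_succ, D, iteratedDerivWithin_one]
  exact (derivWithin_congr (ext_D k h) (ext_D k h u.2)).symm

theorem D_succ' (k : ℕ) (h : unitInterval → ℝ) : D (k + 1) h = D k (D 1 h) := by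
  induction k with
  | zero => rw [D_zero_eq]
  | succ k ih => rw [D_succ, ih, ← D_succ]

theorem isSmooth_D_one {h : unitInterval → ℝ} (a : IsSmooth h) : IsSmooth (D 1 h) := by
  have h1 : ContDiffOn ℝ ((⊤ : ℕ∞) : WithTop ℕ∞) (derivWithin (ext h) (Icc 0 1)) (Icc 0 1) := by
    rw [contDiffOn_infty]
    intro n
    exact ContDiffOn.derivWithin (m := n) a (uniqueDiffOn_Icc zero_lt_one)
      (by exact_mod_cast le_top)
  refine h1.congr fun x hx => ?_
  rw [ext_D 1 h hx, iteratedDerivWithin_one]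

theorem isSmooth_D (k : ℕ) {h : unitInterval → ℝ} (a : IsSmooth h) : IsSmooth (D k h) := by
  induction k with
  | zero => rwa [D_zero_eq]
  | succ k ih => rw [D_succ]; exact isSmooth_D_one ih

theorem IsSmooth.hasDerivWithinAt {h : unitInterval → ℝ} (a : IsSmooth h) {x : ℝ}
    (hx : x ∈ Icc (0 : ℝ) 1) : HasDerivWithinAt (ext h) (ext (D 1 h) x) (Icc 0 1) x := by
  rw [ext_D 1 h hx, iteratedDerivWithin_one]
  exact ((ContDiffOn.differentiableOn a (by simp)) x hx).hasDerivWithinAt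

theorem D_one_eq_of_hasDerivWithinAt {h h' : unitInterval → ℝ}
    (H : ∀ x ∈ Icc (0 : ℝ) 1, HasDerivWithinAt (ext h) (ext h' x) (Icc 0 1) x) : D 1 h = h' := by
  funext u
  rw [D, iteratedDerivWithin_one, (H u u.2).derivWithin (uniqueDiffOn_Icc zero_lt_one u u.2),
    ext_coe]

theorem IsSmooth.mul {f h : unitInterval → ℝ} (a : IsSmooth f) (b : IsSmooth h) :
    IsSmooth (f * h) := ContDiffOn.mul a b

/-- Bootstrap for the linear equation h'' = fh + r: each pass gains one derivative, simultaneously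
for h and h'. It is what makes the eigenfunctions, a priori only continuous, smooth up to the
boundary. -/
theorem IsSmooth.of_hasDerivWithinAt_two {f r h h' : unitInterval → ℝ} (hf : IsSmooth f)
    (hr : IsSmooth r)
    (H : ∀ x ∈ Icc (0 : ℝ) 1, HasDerivWithinAt (ext h) (ext h' x) (Icc 0 1) x)
    (H' : ∀ x ∈ Icc (0 : ℝ) 1, HasDerivWithinAt (ext h') (ext (f * h + r) x) (Icc 0 1) x) :
    IsSmooth h := by
  have hU := uniqueDiffOn_Icc (zero_lt_one (α := ℝ))
  have key : ∀ n : ℕ, ContDiffOn ℝ n (ext h) (Icc 0 1) ∧ ContDiffOn ℝ n (ext h') (Icc 0 1) := by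
    intro n
    induction n with
    | zero =>
      rw [Nat.cast_zero, contDiffOn_zero, contDiffOn_zero]
      exact ⟨fun x hx => (H x hx).continuousWithinAt, fun x hx => (H' x hx).continuousWithinAt⟩
    | succ n ih =>
      rw [Nat.cast_succ, contDiffOn_succ_iff_derivWithin hU, contDiffOn_succ_iff_derivWithin hU]
      refine ⟨⟨fun x hx => (H x hx).differentiableWithinAt, by simp,
        ih.2.congr fun x hx => (H x hx).derivWithin (hU x hx)⟩,
        fun x hx => (H' x hx).differentiableWithinAt, by simp, ?_⟩
      have : ContDiffOn ℝ n (ext (f * h + r)) (Icc 0 1) :=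
        ((ContDiffOn.of_le hf (by exact_mod_cast le_top)).mul ih.1).add
          (ContDiffOn.of_le hr (by exact_mod_cast le_top))
      exact this.congr fun x hx => (H' x hx).derivWithin (hU x hx)
  exact contDiffOn_infty.2 fun n => (key n).1

theorem D_one_mul {f h : unitInterval → ℝ} (a : IsSmooth f) (b : IsSmooth h) :
    D 1 (f * h) = D 1 f * h + f * D 1 h :=
  D_one_eq_of_hasDerivWithinAt fun _ hx => (a.hasDerivWithinAt hx).mul (b.hasDerivWithinAt hx)

/-- `sup_u |∂_u^k h(u)|`. -/
def supD (k : ℕ) (h : unitInterval → ℝ) : ℝ := ⨆ u : unitInterval, |D k h u|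

theorem abs_D_le (k : ℕ) {h : unitInterval → ℝ} (a : IsSmooth h) (u : unitInterval) :
    |D k h u| ≤ supD k h := le_ciSup (bddAbove_D k a) u

theorem abs_le_supD_zero {h : unitInterval → ℝ} (a : IsSmooth h) (u : unitInterval) :
    |h u| ≤ supD 0 h := by
  have := abs_D_le 0 a u
  rwa [D_zero_eq] at this

theorem supD_le {k : ℕ} {h : unitInterval → ℝ} {C : ℝ} (H : ∀ u, |D k h u| ≤ C) : supD k h ≤ C :=
  ciSup_le H

theorem supD_nonneg (k : ℕ) (h : unitInterval → ℝ) : 0 ≤ supD k h :=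
  Real.iSup_nonneg fun _ => abs_nonneg _

theorem supD_D (j k : ℕ) (h : unitInterval → ℝ) : supD k (D j h) = supD (k + j) h := by
  have : D (k + j) h = D k (D j h) := by
    induction k with
    | zero => rw [Nat.zero_add, D_zero_eq]
    | succ k ih => rw [Nat.succ_add, D_succ, ih, ← D_succ]
  simp only [supD, this]

/-- Leibniz's rule by induction on the order, from (fh)' = f'h + fh'. The induction runs over all
smooth factors f, since f' takes the place of f. -/
theorem exists_supD_mul_le (k : ℕ) {f : unitInterval → ℝ} (hf : IsSmooth f) :
    ∃ C : ℝ, 0 ≤ C ∧ ∀ h : unitInterval → ℝ, IsSmooth h →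
      supD k (f * h) ≤ C * ∑ i ∈ Finset.range (k + 1), supD i h := by
  induction k generalizing f with
  | zero =>
    refine ⟨supD 0 f, supD_nonneg _ _, fun h hh => supD_le fun u => ?_⟩
    rw [D_zero_eq, Pi.mul_apply, abs_mul]
    simp only [zero_add, Finset.range_one, Finset.sum_singleton]
    exact mul_le_mul (abs_le_supD_zero hf u) (abs_le_supD_zero hh u) (abs_nonneg _)
      (supD_nonneg _ _)
  | succ k ih =>
    obtain ⟨C₁, h₁, H₁⟩ := ih (isSmooth_D_one hf)
    obtain ⟨C₂, h₂, H₂⟩ := ih hf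
    refine ⟨C₁ + C₂, by positivity, fun h hh => supD_le fun u => ?_⟩
    have hh1 := isSmooth_D_one hh
    rw [D_succ', D_one_mul hf hh, D_add k ((isSmooth_D_one hf).mul hh) (hf.mul hh1)]
    have e1 : ∑ i ∈ Finset.range (k + 1), supD i h ≤ ∑ i ∈ Finset.range (k + 1 + 1), supD i h :=
      Finset.sum_le_sum_of_subset_of_nonneg (Finset.range_subset_range.2 (by omega))
        fun i _ _ => supD_nonneg i h
    have e2 : ∑ i ∈ Finset.range (k + 1), supD i (D 1 h)
        ≤ ∑ i ∈ Finset.range (k + 1 + 1), supD i h := by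
      rw [Finset.sum_range_succ' _ (k + 1)]
      simp only [supD_D]
      linarith [supD_nonneg 0 h]
    calc |(D k (D 1 f * h) + D k (f * D 1 h)) u|
        ≤ supD k (D 1 f * h) + supD k (f * D 1 h) :=
          (abs_add_le _ _).trans (add_le_add (abs_D_le k ((isSmooth_D_one hf).mul hh) u)
            (abs_D_le k (hf.mul hh1) u))
      _ ≤ C₁ * ∑ i ∈ Finset.range (k + 1 + 1), supD i h
          + C₂ * ∑ i ∈ Finset.range (k + 1 + 1), supD i h :=
        add_le_add ((H₁ h hh).trans (mul_le_mul_of_nonneg_left e1 h₁))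
          ((H₂ _ hh1).trans (mul_le_mul_of_nonneg_left e2 h₂))
      _ = _ := by ring

theorem sub_le_supD_one {h : unitInterval → ℝ} (a : IsSmooth h) (u v : unitInterval) :
    |h u - h v| ≤ supD 1 h * |(u : ℝ) - v| := by
  have := (convex_Icc (0 : ℝ) 1).norm_image_sub_le_of_norm_hasDerivWithin_le (f := ext h)
    (f' := ext (D 1 h)) (C := supD 1 h) (fun x hx => a.hasDerivWithinAt hx)
    (fun x hx => by rw [ext_of_mem _ hx]; exact abs_D_le 1 a _) v.2 u.2
  rwa [ext_coe, ext_coe] at this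

/-- The first derivative is controlled by the function and its second derivative. -/
theorem supD_one_le {h : unitInterval → ℝ} (a : IsSmooth h) :
    supD 1 h ≤ 2 * supD 0 h + supD 2 h := by
  have hc : ContinuousOn (ext h) (Icc 0 1) := ContDiffOn.continuousOn a
  -- At some point c the derivative equals h(1) - h(0); from c to any other point it moves by at
  -- most the sup of h''.
  obtain ⟨c, hc, hcd⟩ := exists_hasDerivAt_eq_slope (ext h) (ext (D 1 h)) zero_lt_one hc
    fun x hx => (a.hasDerivWithinAt (Ioo_subset_Icc_self hx)).hasDerivAt (Icc_mem_nhds hx.1 hx.2)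
  have hcm : c ∈ Icc (0 : ℝ) 1 := Ioo_subset_Icc_self hc
  have e0 := ext_coe h 0
  have e1 := ext_coe h 1
  simp only [Icc.coe_zero, Icc.coe_one] at e0 e1
  rw [ext_of_mem _ hcm, e0, e1, sub_zero, div_one] at hcd
  refine supD_le fun u => ?_
  have h1 := sub_le_supD_one (isSmooth_D_one a) u ⟨c, hcm⟩
  rw [supD_D] at h1
  have h2 : |(u : ℝ) - c| ≤ 1 := by
    rw [abs_le]; constructor <;> linarith [u.2.1, u.2.2, hcm.1, hcm.2]
  have h3 : supD (1 + 1) h * |(u : ℝ) - c| ≤ supD 2 h * 1 :=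
    mul_le_mul_of_nonneg_left h2 (supD_nonneg _ _)
  have h4 := abs_le_supD_zero a 0
  have h5 := abs_le_supD_zero a 1
  have h6 : |D 1 h ⟨c, hcm⟩| ≤ 2 * supD 0 h := by
    rw [hcd]
    exact (abs_sub _ _).trans (by linarith)
  have h7 : |D 1 h u| ≤ |D 1 h u - D 1 h ⟨c, hcm⟩| + |D 1 h ⟨c, hcm⟩| := by
    have := abs_add_le (D 1 h u - D 1 h ⟨c, hcm⟩) (D 1 h ⟨c, hcm⟩)
    rwa [sub_add_cancel] at this
  linarith

theorem integral_unitInterval (f : unitInterval → ℝ) :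
    ∫ u, f u = ∫ x in (0 : ℝ)..1, ext f x := by
  rw [intervalIntegral.integral_of_le zero_le_one, ← integral_Icc_eq_integral_Ioc]
  have := integral_subtype_comap (μ := (volume : Measure ℝ)) (measurableSet_Icc (a := (0 : ℝ))
    (b := 1)) (ext f)
  rw [← this]
  exact integral_congr_ae (Eventually.of_forall fun u => (ext_coe f u).symm)

theorem integral_D_one_mul {f h : unitInterval → ℝ} (a : IsSmooth f) (b : IsSmooth h) :
    ∫ u, D 1 f u * h u = f 1 * h 1 - f 0 * h 0 - ∫ u, f u * D 1 h u := by
  have key := intervalIntegral.integral_deriv_mul_eq_sub_of_hasDerivWithinAt (a := 0) (b := 1)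
    (u := ext f) (v := ext h) (u' := ext (D 1 f)) (v' := ext (D 1 h))
    (by rw [uIcc_of_le zero_le_one]; exact fun x hx => a.hasDerivWithinAt hx)
    (by rw [uIcc_of_le zero_le_one]; exact fun x hx => b.hasDerivWithinAt hx)
    ((continuous_ext (isSmooth_D_one a).continuous).intervalIntegrable _ _)
    ((continuous_ext (isSmooth_D_one b).continuous).intervalIntegrable _ _)
  have e0 : ∀ h : unitInterval → ℝ, ext h 0 = h 0 := fun h => by
    simpa using ext_coe h 0
  have e1 : ∀ h : unitInterval → ℝ, ext h 1 = h 1 := fun h => by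
    simpa using ext_coe h 1
  rw [e0, e0, e1, e1, intervalIntegral.integral_add] at key
  · rw [integral_unitInterval, integral_unitInterval]
    linarith!
  · exact ((continuous_ext (isSmooth_D_one a).continuous).mul
      (continuous_ext b.continuous)).intervalIntegrable _ _
  · exact ((continuous_ext a.continuous).mul
      (continuous_ext (isSmooth_D_one b).continuous)).intervalIntegrable _ _

end ZeroRange

end

open MeasureTheory ProbabilityTheory Filter Set
open scoped Topology ENNReal NNReal

noncomputable section

namespace ZeroRange

/-! ### Symmetric integral operators on a compact space -/

section IntegralOperator

variable {X : Type} [MetricSpace X] [CompactSpace X] [MeasurableSpace X] [BorelSpace X]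

/-- The sections of a continuous kernel, as a continuous function into `L²`. -/
def kernelSection (ν : Measure X) [IsFiniteMeasure ν] (k : C(X × X, ℝ)) : C(X, Lp ℝ 2 ν) :=
  ⟨fun x => ContinuousMap.toLp 2 ν ℝ (k.curry x),
    (ContinuousMap.toLp 2 ν ℝ).continuous.comp k.curry.continuous⟩

/-- The integral operator with continuous kernel `k`, from `L²` to continuous functions. -/
def kernelOp (ν : Measure X) [IsFiniteMeasure ν] (k : C(X × X, ℝ)) :
    Lp ℝ 2 ν →L[ℝ] BoundedContinuousFunction X ℝ :=
  LinearMap.mkContinuous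
    { toFun := fun f => BoundedContinuousFunction.mkOfCompact
        ⟨fun x => inner ℝ (kernelSection ν k x) f, by fun_prop⟩
      map_add' := fun f g => by ext x; simp [inner_add_right]
      map_smul' := fun c f => by ext x; simp [inner_smul_right] }
    ‖kernelSection ν k‖ fun f => by
      refine (BoundedContinuousFunction.norm_le (by positivity)).2 fun x => ?_
      exact (norm_inner_le_norm _ _).trans
        (mul_le_mul_of_nonneg_right ((kernelSection ν k).norm_coe_le_norm x) (norm_nonneg _))

/-- The integral operator with continuous kernel `k` on `L²`. -/
def kernelOpL2 (ν : Measure X) [IsFiniteMeasure ν] (k : C(X × X, ℝ)) :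
    Lp ℝ 2 ν →L[ℝ] Lp ℝ 2 ν :=
  (BoundedContinuousFunction.toLp 2 ν ℝ).comp (kernelOp ν k)

variable (ν : Measure X) [IsFiniteMeasure ν] (k : C(X × X, ℝ))

theorem kernelOp_apply (f : Lp ℝ 2 ν) (x : X) :
    kernelOp ν k f x = inner ℝ (kernelSection ν k x) f := rfl

theorem inner_toLp_toLp (f g : C(X, ℝ)) :
    inner ℝ (ContinuousMap.toLp 2 ν ℝ f) (ContinuousMap.toLp 2 ν ℝ g) = ∫ x, f x * g x ∂ν := by
  rw [ContinuousMap.inner_toLp]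
  exact integral_congr_ae (Eventually.of_forall fun x => by simp [mul_comm])

theorem kernelOp_toLp (f : C(X, ℝ)) (x : X) :
    kernelOp ν k (ContinuousMap.toLp 2 ν ℝ f) x = ∫ y, k (x, y) * f y ∂ν := by
  rw [kernelOp_apply]
  exact inner_toLp_toLp ν (k.curry x) f

theorem integrable_of_continuous {Y : Type*} [TopologicalSpace Y] [CompactSpace Y]
    [MeasurableSpace Y] [OpensMeasurableSpace Y] (ρ : Measure Y) [IsFiniteMeasure ρ]
    {f : Y → ℝ} (hf : Continuous f) : Integrable f ρ :=
  (BoundedContinuousFunction.mkOfCompact ⟨f, hf⟩).integrable ρ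

/-- On continuous functions this is Fubini's theorem together with the symmetry of the kernel;
density and continuity do the rest. -/
theorem kernelOpL2_isSymmetric (hk : ∀ x y, k (x, y) = k (y, x)) :
    (kernelOpL2 ν k : Lp ℝ 2 ν →ₗ[ℝ] Lp ℝ 2 ν).IsSymmetric := by
  intro f g
  have hd : DenseRange (ContinuousMap.toLp 2 ν ℝ : C(X, ℝ) →L[ℝ] Lp ℝ 2 ν) :=
    ContinuousMap.toLp_denseRange ℝ ν ℝ (by norm_num)
  change inner ℝ (kernelOpL2 ν k f) g = inner ℝ f (kernelOpL2 ν k g)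
  refine hd.induction_on₂ (p := fun f g => inner ℝ (kernelOpL2 ν k f) g
    = inner ℝ f (kernelOpL2 ν k g)) (isClosed_eq (by fun_prop) (by fun_prop)) (fun f g => ?_) f g
  have e : ∀ f : C(X, ℝ), kernelOpL2 ν k (ContinuousMap.toLp 2 ν ℝ f)
      = ContinuousMap.toLp 2 ν ℝ ⟨fun x => ∫ y, k (x, y) * f y ∂ν, by
        have := (kernelOp ν k (ContinuousMap.toLp 2 ν ℝ f)).continuous
        convert this using 1
        funext x
        exact (kernelOp_toLp ν k f x).symm⟩ := fun f => by
    apply Lp.ext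
    refine (BoundedContinuousFunction.coeFn_toLp 2 ν ℝ _).trans
      (EventuallyEq.trans (Eventually.of_forall fun x => ?_) (ContinuousMap.coeFn_toLp ν _).symm)
    exact kernelOp_toLp ν k f x
  rw [e, e, inner_toLp_toLp, inner_toLp_toLp]
  simp only [ContinuousMap.coe_mk, ← integral_const_mul, ← integral_mul_const]
  rw [integral_integral_swap]
  · refine integral_congr_ae (Eventually.of_forall fun y => ?_)
    refine integral_congr_ae (Eventually.of_forall fun x => ?_)
    simp only [hk x y]
    ring
  · exact integrable_of_continuous (ν.prod ν) (by simp only [Function.uncurry_def]; fun_prop)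

/-- By Arzelà–Ascoli: x ↦ k(x, ·) is uniformly continuous into L², so the images of the unit ball
are uniformly equicontinuous by Cauchy–Schwarz. -/
theorem isCompactOperator_kernelOp : IsCompactOperator (kernelOp ν k) := by
  have : IsCompactOperator ((kernelOp ν k : Lp ℝ 2 ν →ₗ[ℝ] BoundedContinuousFunction X ℝ)) := by
    rw [isCompactOperator_iff_isCompact_closure_image_closedBall _ one_pos]
    refine BoundedContinuousFunction.arzela_ascoli (Metric.closedBall 0 ‖kernelOp ν k‖)
      (isCompact_closedBall _ _) _ ?_ ?_
    · rintro _ x ⟨f, hf, rfl⟩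
      rw [mem_closedBall_zero_iff] at hf ⊢
      refine ((kernelOp ν k f).norm_coe_le_norm x).trans (((kernelOp ν k).le_opNorm f).trans ?_)
      exact mul_le_of_le_one_right (norm_nonneg _) hf
    · have huc := CompactSpace.uniformContinuous_of_continuous (kernelSection ν k).continuous
      refine UniformEquicontinuous.equicontinuous ?_
      rw [Metric.uniformEquicontinuous_iff]
      intro ε hε
      obtain ⟨d, hd, H⟩ := Metric.uniformContinuous_iff.1 huc ε hε
      refine ⟨d, hd, fun x y hxy => ?_⟩
      rintro ⟨_, f, hf, rfl⟩
      rw [mem_closedBall_zero_iff] at hf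
      have h1 : dist (kernelOp ν k f x) (kernelOp ν k f y)
          = ‖inner ℝ (kernelSection ν k x - kernelSection ν k y) f‖ := by
        rw [inner_sub_left, dist_eq_norm, kernelOp_apply, kernelOp_apply]
      refine lt_of_le_of_lt (h1.le.trans (norm_inner_le_norm _ _)) ?_
      refine lt_of_le_of_lt (mul_le_of_le_one_right (norm_nonneg _) hf) ?_
      rw [← dist_eq_norm]
      exact H hxy
  exact this

theorem isCompactOperator_kernelOpL2 : IsCompactOperator (kernelOpL2 ν k) :=
  (isCompactOperator_kernelOp ν k).clm_comp (BoundedContinuousFunction.toLp 2 ν ℝ)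

/-- An eigenbasis of the closure of the range of a compact symmetric operator. -/
theorem exists_hilbertBasis_eigenvectors {E : Type} [NormedAddCommGroup E]
    [InnerProductSpace ℝ E] [CompleteSpace E] (T : E →L[ℝ] E) (hc : IsCompactOperator T)
    (hs : (T : E →ₗ[ℝ] E).IsSymmetric) :
    ∃ (ι : Type) (b : HilbertBasis ι ℝ E) (μ : ι → ℝ), ∀ i, T (b i) = μ i • b i := by
  have hclosed : ∀ μ : ℝ, IsClosed (Module.End.eigenspace (T : Module.End ℝ E) μ : Set E) := by
    intro μ
    have : (Module.End.eigenspace (T : Module.End ℝ E) μ : Set E) = {x | T x = μ • x} := by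
      ext x; simp
    rw [this]
    exact isClosed_eq T.continuous (continuous_const_smul μ)
  have hcomp : ∀ μ : ℝ, CompleteSpace (Module.End.eigenspace (T : Module.End ℝ E) μ) :=
    fun μ => (hclosed μ).completeSpace_coe
  -- A Hilbert basis is taken in every eigenspace, the kernel included. A vector orthogonal to all
  -- of them is orthogonal to each eigenspace by expansion, hence zero since the eigenspaces of a
  -- compact symmetric operator span a dense subspace.
  choose w b hb using fun μ : ℝ =>
    exists_hilbertBasis ℝ (Module.End.eigenspace (T : Module.End ℝ E) μ)
  have ho := hs.orthogonalFamily_eigenspaces.orthonormal_sigma_orthonormal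
    (v_family := fun μ => (b μ : w μ → _)) fun μ => (b μ).orthonormal
  refine ⟨Σ μ : ℝ, w μ, HilbertBasis.mkOfOrthogonalEqBot ho ?_, fun i => i.1, fun i => ?_⟩
  · rw [eq_bot_iff]
    intro x hx
    have hbot := ContinuousLinearMap.orthogonalComplement_iSup_eigenspaces_eq_bot hc hs
    rw [← hbot, Submodule.mem_orthogonal]
    intro u hu
    rw [Submodule.mem_orthogonal] at hx
    refine Submodule.iSup_induction _ (motive := fun u => inner ℝ u x = 0) hu ?_ (by simp)
      fun y z hy hz => by rw [inner_add_left, hy, hz, add_zero]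
    intro μ y hy
    have h1 := (b μ).hasSum_repr ⟨y, hy⟩
    have h2 := ((innerSL ℝ x).comp
      (Module.End.eigenspace (T : Module.End ℝ E) μ).subtypeL).hasSum h1
    have h3 : ∀ i, ((innerSL ℝ x).comp (Module.End.eigenspace (T : Module.End ℝ E) μ).subtypeL)
        ((b μ).repr ⟨y, hy⟩ i • b μ i) = 0 := fun i => by
      have := hx _ (Submodule.subset_span ⟨⟨μ, i⟩, rfl⟩)
      rw [map_smul]
      have h4 : ((innerSL ℝ x).comp (Module.End.eigenspace (T : Module.End ℝ E) μ).subtypeL)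
        (b μ i) = 0 := by
        rw [real_inner_comm] at this
        exact this
      rw [h4, smul_zero]
    simp only [h3] at h2
    rw [real_inner_comm]
    exact h2.unique hasSum_zero
  · rw [HilbertBasis.coe_mkOfOrthogonalEqBot]
    exact Module.End.mem_eigenspace_iff.1 (b i.1 i.2).2

/-- Spectral decomposition of a symmetric integral operator with continuous kernel. -/
theorem exists_eigenfunctions (hk : ∀ x y, k (x, y) = k (y, x)) :
    ∃ (ι : Type) (μ : ι → ℝ) (φ : ι → C(X, ℝ)), Countable ι ∧ (∀ i, μ i ≠ 0) ∧
      (∀ i x, ∫ y, k (x, y) * φ i y ∂ν = μ i * φ i x) ∧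
      (∀ i, ∫ x, φ i x * φ i x ∂ν = 1) ∧
      (∀ i j, i ≠ j → ∫ x, φ i x * φ j x ∂ν = 0) ∧
      (Summable fun i => μ i ^ 2) ∧
      ∀ g h : C(X, ℝ), (∀ x, h x = ∫ y, k (x, y) * g y ∂ν) →
        HasSum (fun i => (∫ x, φ i x * h x ∂ν) ^ 2) (∫ x, h x * h x ∂ν) := by
  have hsym := kernelOpL2_isSymmetric ν k hk
  obtain ⟨J, b, μ, hμ⟩ := exists_hilbertBasis_eigenvectors _ (isCompactOperator_kernelOpL2 ν k) hsym
  set S := kernelOp ν k with hS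
  -- For a non-zero eigenvalue the operator itself supplies the continuous representative of the
  -- eigenvector.
  let ψ : J → C(X, ℝ) := fun j => ((μ j)⁻¹ • S (b j)).toContinuousMap
  have hψ : ∀ j, μ j ≠ 0 → ContinuousMap.toLp 2 ν ℝ (ψ j) = b j := fun j hj => by
    have h1 : ContinuousMap.toLp 2 ν ℝ (ψ j)
        = BoundedContinuousFunction.toLp 2 ν ℝ ((μ j)⁻¹ • S (b j)) := by
      apply Lp.ext
      exact (ContinuousMap.coeFn_toLp ν _).trans
        (BoundedContinuousFunction.coeFn_toLp 2 ν ℝ _).symm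
    have h2 : BoundedContinuousFunction.toLp 2 ν ℝ (S (b j)) = μ j • b j := hμ j
    rw [h1, map_smul, h2, smul_smul, inv_mul_cancel₀ hj, one_smul]
  have hSb : ∀ j, μ j ≠ 0 → ∀ x, S (b j) x = μ j * ψ j x := fun j hj x => by
    change S (b j) x = μ j * ((μ j)⁻¹ * S (b j) x)
    rw [← mul_assoc, mul_inv_cancel₀ hj, one_mul]
  -- The Hilbert–Schmidt bound: Bessel's inequality for the section k(x, ·) at each x, integrated
  -- over x.
  have hsum : Summable fun j => μ j ^ 2 := by
    refine summable_of_sum_le (c := ‖kernelSection ν k‖ ^ 2 * ν.real univ)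
      (fun j => sq_nonneg _) fun F => ?_
    have h1 : ∀ x, ∑ j ∈ F, (S (b j) x) ^ 2 ≤ ‖kernelSection ν k‖ ^ 2 := fun x => by
      have := b.orthonormal.sum_inner_products_le (kernelSection ν k x) (s := F)
      refine le_trans (le_of_eq ?_) (this.trans
        (pow_le_pow_left₀ (norm_nonneg _) ((kernelSection ν k).norm_coe_le_norm x) 2))
      refine Finset.sum_congr rfl fun j _ => ?_
      rw [hS, kernelOp_apply, real_inner_comm, Real.norm_eq_abs, sq_abs]
    have h2 : ∀ j, ∫ x, (S (b j) x) ^ 2 ∂ν = μ j ^ 2 := fun j => by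
      by_cases hj : μ j = 0
      · have h3 : BoundedContinuousFunction.toLp 2 ν ℝ (S (b j)) = 0 := by
          have : BoundedContinuousFunction.toLp 2 ν ℝ (S (b j)) = μ j • b j := hμ j
          rw [this, hj, zero_smul]
        have h4 := BoundedContinuousFunction.coeFn_toLp 2 ν ℝ (S (b j))
        rw [h3] at h4
        rw [hj, zero_pow two_ne_zero]
        refine integral_eq_zero_of_ae ?_
        filter_upwards [h4, Lp.coeFn_zero ℝ 2 ν] with x h5 h6
        rw [← h5, h6]; simp
      · have h3 := b.orthonormal.1 j
        rw [← hψ j hj] at h3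
        have h4 := inner_toLp_toLp ν (ψ j) (ψ j)
        rw [real_inner_self_eq_norm_sq, h3] at h4
        simp only [hSb j hj, mul_pow]
        rw [integral_const_mul]
        simp only [pow_two (ψ j _), ← h4]
        simp
    calc ∑ j ∈ F, μ j ^ 2 = ∫ x, ∑ j ∈ F, (S (b j) x) ^ 2 ∂ν := by
          rw [integral_finsetSum]
          · exact Finset.sum_congr rfl fun j _ => (h2 j).symm
          · exact fun j _ => integrable_of_continuous ν ((S (b j)).continuous.pow 2)
      _ ≤ ∫ _x, ‖kernelSection ν k‖ ^ 2 ∂ν := by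
          refine integral_mono ?_ (integrable_const _) h1
          exact integrable_finsetSum _ fun j _ =>
            integrable_of_continuous ν ((S (b j)).continuous.pow 2)
      _ = _ := by rw [integral_const, smul_eq_mul, mul_comm]
  -- Countability is read off from the summability of the squared eigenvalues, without appeal to
  -- separability of L².
  have hcount : Countable {j // μ j ≠ 0} := by
    have := hsum.countable_support
    have e : Function.support (fun j => μ j ^ 2) = {j | μ j ≠ 0} := by
      ext j; simp
    rw [e] at this
    exact this.to_subtype
  refine ⟨{j // μ j ≠ 0}, fun j => μ j, fun j => ψ j, hcount, fun j => j.2, fun j x => ?_,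
    fun j => ?_, fun i j hij => ?_, hsum.subtype _, fun g h hgh => ?_⟩
  · rw [← kernelOp_toLp, hψ j j.2, hSb j j.2]
  · have h3 := b.orthonormal.1 j
    rw [← hψ j j.2] at h3
    have h4 := inner_toLp_toLp ν (ψ j) (ψ j)
    rw [real_inner_self_eq_norm_sq, h3] at h4
    rw [← h4]; norm_num
  · rw [← inner_toLp_toLp, hψ i i.2, hψ j j.2]
    exact b.orthonormal.2 fun h => hij (Subtype.ext h)
  · have hTg : kernelOpL2 ν k (ContinuousMap.toLp 2 ν ℝ g) = ContinuousMap.toLp 2 ν ℝ h := by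
      apply Lp.ext
      refine (BoundedContinuousFunction.coeFn_toLp 2 ν ℝ _).trans
        (EventuallyEq.trans (Eventually.of_forall fun x => ?_) (ContinuousMap.coeFn_toLp ν _).symm)
      exact (kernelOp_toLp ν k g x).trans (hgh x).symm
    have h1 := b.hasSum_inner_mul_inner (ContinuousMap.toLp 2 ν ℝ h) (ContinuousMap.toLp 2 ν ℝ h)
    rw [inner_toLp_toLp] at h1
    rw [← hasSum_subtype_iff_of_support_subset (s := {j | μ j ≠ 0})] at h1
    · have h3 : HasSum (fun j : {j // μ j ≠ 0} => inner ℝ (ContinuousMap.toLp 2 ν ℝ h) (b j)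
          * inner ℝ (b j) (ContinuousMap.toLp 2 ν ℝ h)) (∫ x, h x * h x ∂ν) := h1
      convert h3 using 2 with j
      have h2 := inner_toLp_toLp ν (ψ j) h
      rw [hψ j j.2] at h2
      rw [← h2, real_inner_comm (b j), pow_two]
    -- Eigenvectors for the eigenvalue 0 are orthogonal to the range by symmetry, so Parseval's
    -- identity for h in the range involves only the non-zero eigenvalues.
    · intro j hj hj0
      refine hj ?_
      have h2 : inner ℝ (b j) (ContinuousMap.toLp 2 ν ℝ h) = 0 := by
        rw [← hTg]
        have := hsym (b j) (ContinuousMap.toLp 2 ν ℝ g)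
        have h3 : kernelOpL2 ν k (b j) = μ j • b j := hμ j
        rw [ContinuousLinearMap.coe_coe, h3, hj0, zero_smul, inner_zero_left] at this
        exact this.symm
      simp only [h2, mul_zero]

end IntegralOperator

end ZeroRange

end

open MeasureTheory ProbabilityTheory Filter Set
open scoped Topology ENNReal NNReal

noncomputable section

namespace ZeroRange

/-! ### Green operators of the one-dimensional Laplacian -/

theorem IsSmooth.of_hasDerivWithinAt {h h' : unitInterval → ℝ} (hs : IsSmooth h')
    (H : ∀ x ∈ Icc (0 : ℝ) 1, HasDerivWithinAt (ext h) (ext h' x) (Icc 0 1) x) :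
    IsSmooth h := by
  have hU := uniqueDiffOn_Icc (zero_lt_one (α := ℝ))
  refine contDiffOn_infty.2 fun n => ?_
  refine ContDiffOn.of_le (n := (n : WithTop ℕ∞) + 1) ?_ (by exact_mod_cast Nat.le_succ n)
  rw [contDiffOn_succ_iff_derivWithin hU]
  refine ⟨fun x hx => (H x hx).differentiableWithinAt, by simp, ?_⟩
  exact (ContDiffOn.of_le hs (by exact_mod_cast le_top)).congr
    fun x hx => (H x hx).derivWithin (hU x hx)

/-- `x ↦ ∫_0^x (x - y) f(y) dy`. -/
def doubleIntegral (f : ℝ → ℝ) (x : ℝ) : ℝ := ∫ y in (0 : ℝ)..x, (x - y) * f y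

theorem hasDerivAt_doubleIntegral {f : ℝ → ℝ} (hf : Continuous f) (x : ℝ) :
    HasDerivAt (doubleIntegral f) (∫ y in (0 : ℝ)..x, f y) x := by
  have h1 : doubleIntegral f
      = fun x => x * (∫ y in (0 : ℝ)..x, f y) - ∫ y in (0 : ℝ)..x, y * f y := by
    funext x
    rw [doubleIntegral, ← intervalIntegral.integral_const_mul, ← intervalIntegral.integral_sub]
    · exact intervalIntegral.integral_congr fun y _ => by ring
    · exact (continuous_const.mul hf).intervalIntegrable _ _
    · exact (continuous_id.mul hf).intervalIntegrable _ _
  rw [h1]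
  have h2 := (hasDerivAt_id x).mul (hf.integral_hasStrictDerivAt 0 x).hasDerivAt
  have h3 := ((continuous_id.mul hf).integral_hasStrictDerivAt 0 x).hasDerivAt
  refine (h2.sub h3).congr_deriv ?_
  simp

/-- Because |x - y| is twice the positive part of x - y minus x - y, the integral becomes a double
primitive plus affine terms, which can be differentiated directly. -/
theorem integral_abs_sub_mul {f : ℝ → ℝ} (hf : Continuous f) {x : ℝ} (hx : x ∈ Icc (0 : ℝ) 1) :
    ∫ y in (0 : ℝ)..1, |x - y| * f y
      = 2 * doubleIntegral f x - x * (∫ y in (0 : ℝ)..1, f y) + ∫ y in (0 : ℝ)..1, y * f y := by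
  have hi : ∀ (c : ℝ → ℝ), Continuous c → ∀ a b : ℝ,
      IntervalIntegrable (fun y => c y * f y) volume a b := fun c hc a b =>
    (hc.mul hf).intervalIntegrable a b
  have h1 : ∫ y in (0 : ℝ)..x, |x - y| * f y = ∫ y in (0 : ℝ)..x, (x - y) * f y :=
    intervalIntegral.integral_congr fun y hy => by
      rw [uIcc_of_le hx.1] at hy
      simp only [abs_of_nonneg (sub_nonneg.2 hy.2)]
  have h2 : ∫ y in x..(1 : ℝ), |x - y| * f y = -∫ y in x..(1 : ℝ), (x - y) * f y := by
    rw [← intervalIntegral.integral_neg]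
    refine intervalIntegral.integral_congr fun y hy => ?_
    rw [uIcc_of_le hx.2] at hy
    simp only [abs_of_nonpos (sub_nonpos.2 hy.1)]
    ring
  have h3 : (∫ y in (0 : ℝ)..x, (x - y) * f y) + ∫ y in x..(1 : ℝ), (x - y) * f y
      = x * (∫ y in (0 : ℝ)..1, f y) - ∫ y in (0 : ℝ)..1, y * f y := by
    rw [intervalIntegral.integral_add_adjacent_intervals (hi (fun y => x - y) (by fun_prop) _ _)
      (hi (fun y => x - y) (by fun_prop) _ _), ← intervalIntegral.integral_const_mul,
      ← intervalIntegral.integral_sub (hi (fun _ => x) (by fun_prop) _ _)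
        (hi (fun y => y) (by fun_prop) _ _)]
    exact intervalIntegral.integral_congr fun y _ => by ring
  rw [← intervalIntegral.integral_add_adjacent_intervals (hi (fun y => |x - y|) (by fun_prop) 0 x)
    (hi (fun y => |x - y|) (by fun_prop) x 1), h1, h2, doubleIntegral]
  linarith

/-- The kernel `-|x - y| / 2 + s(x) + s(y) + C x y`. -/
def greenKernel (s : unitInterval → ℝ) (C : ℝ) (x y : unitInterval) : ℝ :=
  -|(x : ℝ) - y| / 2 + s x + s y + C * x * y

/-- The integral operator with kernel `greenKernel s C`, relative to the measure `w(y) dy`. -/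
def greenOp (w s : unitInterval → ℝ) (C : ℝ) (f : unitInterval → ℝ) (x : unitInterval) : ℝ :=
  ∫ y, greenKernel s C x y * (f y * w y)

/-- The derivative of `greenOp w s C f`. -/
def greenOpDeriv (w s : unitInterval → ℝ) (C : ℝ) (f : unitInterval → ℝ) (x : unitInterval) : ℝ :=
  -(∫ y in (0 : ℝ)..x, ext (f * w) y) + (∫ y, f y * w y) / 2 + D 1 s x * (∫ y, f y * w y)
    + C * ∫ y : unitInterval, (y : ℝ) * (f y * w y)

section Green

variable {w s f : unitInterval → ℝ} {C : ℝ}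

/-- The term -|x - y|/2 is a fundamental solution of -Δ. The corrections s(x) + s(y) + Cxy preserve
the symmetry of the kernel while leaving enough freedom to meet each boundary condition. -/
theorem greenOp_eq (hw : Continuous w) (hs : Continuous s) (hf : Continuous f)
    (x : unitInterval) :
    greenOp w s C f x = -doubleIntegral (ext (f * w)) x + x * (∫ y, f y * w y) / 2
      - (∫ y : unitInterval, (y : ℝ) * (f y * w y)) / 2 + s x * (∫ y, f y * w y)
      + (∫ y, s y * (f y * w y)) + C * x * ∫ y : unitInterval, (y : ℝ) * (f y * w y) := by
  have hg : Continuous (ext (f * w)) := continuous_ext (hf.mul hw)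
  have h0 : ∫ y, f y * w y = ∫ y in (0 : ℝ)..1, ext (f * w) y := integral_unitInterval (f * w)
  have h1 : ∫ y : unitInterval, (y : ℝ) * (f y * w y) = ∫ y in (0 : ℝ)..1, y * ext (f * w) y := by
    rw [integral_unitInterval]
    refine intervalIntegral.integral_congr fun y hy => ?_
    rw [uIcc_of_le zero_le_one] at hy
    simp only [ext_of_mem _ hy, Pi.mul_apply]
  have h2 : ∫ y : unitInterval, |(x : ℝ) - y| * (f y * w y)
      = ∫ y in (0 : ℝ)..1, |(x : ℝ) - y| * ext (f * w) y := by
    rw [integral_unitInterval]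
    refine intervalIntegral.integral_congr fun y hy => ?_
    rw [uIcc_of_le zero_le_one] at hy
    simp only [ext_of_mem _ hy, Pi.mul_apply]
  rw [integral_abs_sub_mul hg x.2, ← h0, ← h1] at h2
  have hi : ∀ c : unitInterval → ℝ, Continuous c →
      Integrable (fun y => c y * (f y * w y)) volume := fun c hc =>
    integrable_of_continuous volume (hc.mul (hf.mul hw))
  have e : greenOp w s C f x = ∫ y : unitInterval, ((-1 / 2) * (|(x : ℝ) - y| * (f y * w y))
      + s x * (f y * w y) + s y * (f y * w y) + (C * x) * ((y : ℝ) * (f y * w y))) :=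
    integral_congr_ae (Eventually.of_forall fun y => by simp only [greenKernel]; ring)
  have i1 := (hi (fun y => |(x : ℝ) - y|) (by fun_prop)).const_mul (-1 / 2)
  have i2 := (hi (fun _ => s x) (by fun_prop))
  have i3 := (hi s hs)
  have i4 := (hi (fun y => (y : ℝ)) (by fun_prop)).const_mul (C * x)
  have i12 : Integrable (fun y : unitInterval => -1 / 2 * (|(x : ℝ) - y| * (f y * w y))
    + s x * (f y * w y)) volume := i1.add i2
  have i123 : Integrable (fun y : unitInterval => -1 / 2 * (|(x : ℝ) - y| * (f y * w y))
    + s x * (f y * w y) + s y * (f y * w y)) volume := i12.add i3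
  rw [e, integral_add i123 i4, integral_add i12 i3, integral_add i1 i2, integral_const_mul, integral_const_mul, integral_const_mul, h2]
  ring

theorem hasDerivWithinAt_coe (x : ℝ) : HasDerivWithinAt (fun y : ℝ => y) 1 (Icc 0 1) x :=
  hasDerivWithinAt_id x _

theorem hasDerivWithinAt_greenOp (hw : Continuous w) (hs : IsSmooth s) (hf : Continuous f)
    {x : ℝ} (hx : x ∈ Icc (0 : ℝ) 1) :
    HasDerivWithinAt (ext (greenOp w s C f)) (ext (greenOpDeriv w s C f) x) (Icc 0 1) x := by
  have hg : Continuous (ext (f * w)) := continuous_ext (hf.mul hw)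
  have h1 := (((((hasDerivAt_doubleIntegral hg x).hasDerivWithinAt (s := Icc 0 1)).neg.add
    (((hasDerivWithinAt_coe x).mul_const (∫ y, f y * w y)).div_const 2)).sub_const
    ((∫ y : unitInterval, (y : ℝ) * (f y * w y)) / 2)).add
    ((hs.hasDerivWithinAt hx).mul_const (∫ y, f y * w y))).add_const
    (∫ y, s y * (f y * w y))
  have h2 := h1.add (((hasDerivWithinAt_coe x).const_mul C).mul_const
    (∫ y : unitInterval, (y : ℝ) * (f y * w y)))
  refine (h2.congr_of_mem (fun y hy => ?_) hx).congr_deriv ?_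
  · rw [ext_of_mem _ hy, greenOp_eq hw hs.continuous hf]
    simp [ext_of_mem _ hy]
  · rw [ext_of_mem _ hx, ext_of_mem _ hx, greenOpDeriv]
    simp

/-- With s'' = κw the second derivative is -w(f - κ∫fw). The value κ = 0 gives a true inverse of
-w⁻¹Δ; κ = 1/∫w subtracts the weighted mean first, as the Neumann condition requires. -/
theorem hasDerivWithinAt_greenOpDeriv (hw : Continuous w) (hs : IsSmooth s) (hf : Continuous f)
    {κ : ℝ} (hκ : D 2 s = κ • w) {x : ℝ} (hx : x ∈ Icc (0 : ℝ) 1) :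
    HasDerivWithinAt (ext (greenOpDeriv w s C f))
      (ext (fun y => -(f y * w y) + κ * w y * ∫ z, f z * w z) x) (Icc 0 1) x := by
  have hg : Continuous (ext (f * w)) := continuous_ext (hf.mul hw)
  have h1 := ((((hg.integral_hasStrictDerivAt 0 x).hasDerivAt.hasDerivWithinAt
    (s := Icc 0 1)).neg.add_const ((∫ y, f y * w y) / 2)).add
    (((isSmooth_D_one hs).hasDerivWithinAt hx).mul_const (∫ y, f y * w y))).add_const
    (C * ∫ y : unitInterval, (y : ℝ) * (f y * w y))
  refine (h1.congr_of_mem (fun y hy => ?_) hx).congr_deriv ?_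
  · rw [ext_of_mem _ hy, greenOpDeriv]
    simp [ext_of_mem _ hy]
  · rw [← D_succ, hκ]
    simp [ext_of_mem _ hx]

theorem D_one_greenOp (hw : Continuous w) (hs : IsSmooth s) (hf : Continuous f) :
    D 1 (greenOp w s C f) = greenOpDeriv w s C f :=
  D_one_eq_of_hasDerivWithinAt fun _ hx => hasDerivWithinAt_greenOp hw hs hf hx

theorem D_two_greenOp (hw : Continuous w) (hs : IsSmooth s) (hf : Continuous f) {κ : ℝ}
    (hκ : D 2 s = κ • w) :
    D 2 (greenOp w s C f) = fun y => -(f y * w y) + κ * w y * ∫ z, f z * w z := by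
  rw [D_succ, D_one_greenOp hw hs hf]
  exact D_one_eq_of_hasDerivWithinAt fun _ hx => hasDerivWithinAt_greenOpDeriv hw hs hf hκ hx

theorem isSmooth_greenOp (hw : IsSmooth w) (hs : IsSmooth s) (hf : IsSmooth f) {κ : ℝ}
    (hκ : D 2 s = κ • w) : IsSmooth (greenOp w s C f) := by
  refine IsSmooth.of_hasDerivWithinAt ?_
    fun x hx => hasDerivWithinAt_greenOp hw.continuous hs hf.continuous hx
  refine IsSmooth.of_hasDerivWithinAt ?_
    fun x hx => hasDerivWithinAt_greenOpDeriv hw.continuous hs hf.continuous hκ hx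
  have e : (fun y => -(f y * w y) + κ * w y * ∫ z, f z * w z)
      = (-1 : ℝ) • (f * w) + (κ * ∫ z, f z * w z) • w := by
    funext y; simp; ring
  rw [e]
  exact ((hf.mul hw).smul _).add (hw.smul _)

theorem greenOp_zero (hw : Continuous w) (hs : Continuous s) (hf : Continuous f) :
    greenOp w s C f 0 = -(∫ y : unitInterval, (y : ℝ) * (f y * w y)) / 2
      + s 0 * (∫ y, f y * w y) + ∫ y, s y * (f y * w y) := by
  rw [greenOp_eq hw hs hf]
  simp [doubleIntegral]
  ring

theorem greenOp_one (hw : Continuous w) (hs : Continuous s) (hf : Continuous f) :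
    greenOp w s C f 1 = -(∫ y, f y * w y) / 2
      + (∫ y : unitInterval, (y : ℝ) * (f y * w y)) / 2 + s 1 * (∫ y, f y * w y)
      + (∫ y, s y * (f y * w y)) + C * ∫ y : unitInterval, (y : ℝ) * (f y * w y) := by
  have hg : Continuous (ext (f * w)) := continuous_ext (hf.mul hw)
  have h := integral_abs_sub_mul hg (right_mem_Icc.2 zero_le_one)
  have h' : ∫ y in (0 : ℝ)..1, |1 - y| * ext (f * w) y
      = (∫ y in (0 : ℝ)..1, ext (f * w) y) - ∫ y in (0 : ℝ)..1, y * ext (f * w) y := by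
    rw [← intervalIntegral.integral_sub (hg.intervalIntegrable _ _)
      ((show Continuous fun y : ℝ => y * ext (f * w) y by fun_prop).intervalIntegrable _ _)]
    refine intervalIntegral.integral_congr fun y hy => ?_
    rw [uIcc_of_le zero_le_one] at hy
    simp only [abs_of_nonneg (sub_nonneg.2 hy.2)]
    ring
  have h0 : ∫ y, f y * w y = ∫ y in (0 : ℝ)..1, ext (f * w) y := integral_unitInterval (f * w)
  have h1 : ∫ y : unitInterval, (y : ℝ) * (f y * w y) = ∫ y in (0 : ℝ)..1, y * ext (f * w) y := by
    rw [integral_unitInterval]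
    refine intervalIntegral.integral_congr fun y hy => ?_
    rw [uIcc_of_le zero_le_one] at hy
    simp only [ext_of_mem _ hy, Pi.mul_apply]
  rw [h', ← h0, ← h1] at h
  rw [greenOp_eq hw hs hf]
  simp only [Icc.coe_one]
  linarith

theorem greenOpDeriv_zero : greenOpDeriv w s C f 0 = (∫ y, f y * w y) / 2
    + D 1 s 0 * (∫ y, f y * w y) + C * ∫ y : unitInterval, (y : ℝ) * (f y * w y) := by
  simp [greenOpDeriv]

theorem greenOpDeriv_one : greenOpDeriv w s C f 1 = -(∫ y, f y * w y) / 2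
    + D 1 s 1 * (∫ y, f y * w y) + C * ∫ y : unitInterval, (y : ℝ) * (f y * w y) := by
  have h0 : ∫ y, f y * w y = ∫ y in (0 : ℝ)..1, ext (f * w) y := integral_unitInterval (f * w)
  rw [greenOpDeriv, Icc.coe_one, ← h0]
  ring

/-- A smooth function with vanishing second derivative is affine. -/
theorem eq_affine_of_D_two_eq_zero {L : unitInterval → ℝ} (hL : IsSmooth L) (h : D 2 L = 0)
    (u : unitInterval) : L u = L 0 + D 1 L 0 * u ∧ D 1 L u = D 1 L 0 := by
  have h1 : ∀ u, D 1 L u = D 1 L 0 := fun u => by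
    have := sub_le_supD_one (isSmooth_D_one hL) u 0
    rw [supD_D] at this
    have h0 : supD (1 + 1) L ≤ 0 := supD_le fun v => by
      have : D (1 + 1) L = 0 := h
      rw [this]; simp
    have h2 : |D 1 L u - D 1 L 0| ≤ 0 :=
      this.trans (mul_nonpos_of_nonpos_of_nonneg h0 (abs_nonneg _))
    exact sub_eq_zero.1 (abs_nonpos_iff.1 h2)
  refine ⟨?_, h1 u⟩
  have h2 := (convex_Icc (0 : ℝ) 1).norm_image_sub_le_of_norm_hasDerivWithin_le
    (f := fun x => ext L x - D 1 L 0 * x)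
    (f' := fun x => ext (D 1 L) x - D 1 L 0 * 1) (C := 0)
    (fun x hx => (hL.hasDerivWithinAt hx).sub ((hasDerivWithinAt_coe x).const_mul _))
    (fun x hx => by rw [ext_of_mem _ hx, h1]; simp) (left_mem_Icc.2 zero_le_one) u.2
  have e0 : ext L 0 = L 0 := by simpa using ext_coe L 0
  rw [ext_coe, e0, zero_mul, norm_le_zero_iff] at h2
  linarith

end Green

end ZeroRange

end

open MeasureTheory ProbabilityTheory Filter Set
open scoped Topology ENNReal NNReal

noncomputable section

namespace ZeroRange

/-! ### The Sturm–Liouville problem -/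

/-- The density `1 / Φ'(ρ̄_θ)` with respect to which `𝔄_θ` is symmetric. -/
def weight (p : Params) (u : unitInterval) : ℝ := (diffusivity p u)⁻¹

theorem isSmooth_diffusivity {p : Params} (hp : p.Admissible) :
    IsSmooth fun u => diffusivity p u :=
  hp.contDiffOn_diffusivity.congr fun _ hx => ext_of_mem _ hx

theorem isSmooth_weight {p : Params} (hp : p.Admissible) : IsSmooth (weight p) :=
  (hp.contDiffOn_diffusivity.inv fun _ hx => (hp.diffusivity_pos hx).ne').congr
    fun _ hx => ext_of_mem _ hx

theorem weight_pos {p : Params} (hp : p.Admissible) (u : unitInterval) : 0 < weight p u :=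
  inv_pos.2 (hp.diffusivity_pos u.2)

theorem weight_mul_opA {p : Params} (hp : p.Admissible) (h : unitInterval → ℝ)
    (u : unitInterval) : weight p u * opA p h u = D 2 h u := by
  rw [weight, opA, ← mul_assoc, inv_mul_cancel₀ (hp.diffusivity_pos u.2).ne', one_mul]

theorem integral_D_two_mul {F G : unitInterval → ℝ} (hF : IsSmooth F) (hG : IsSmooth G) :
    ∫ u, D 2 F u * G u = D 1 F 1 * G 1 - D 1 F 0 * G 0 - ∫ u, D 1 F u * D 1 G u := by
  rw [D_succ 1 F]
  exact integral_D_one_mul (isSmooth_D_one hF) hG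

/-- Two integrations by parts leave the boundary values of F'G - FG', which vanish under each of the
three conditions. -/
theorem integral_D_two_mul_symm {p : Params} {F G : unitInterval → ℝ}
    (hF : IsSmooth F) (hG : IsSmooth G) (bF : BoundaryCondition p F) (bG : BoundaryCondition p G) :
    ∫ u, D 2 F u * G u = ∫ u, F u * D 2 G u := by
  have h1 := integral_D_two_mul hF hG
  have h2 := integral_D_two_mul hG hF
  have h3 : ∫ u, D 1 F u * D 1 G u = ∫ u, D 1 G u * D 1 F u := by simp only [mul_comm]
  have h4 : ∫ u, F u * D 2 G u = ∫ u, D 2 G u * F u := by simp only [mul_comm]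
  rw [h4, h1, h2, h3]
  unfold BoundaryCondition at bF bG
  split_ifs at bF bG <;> rw [bF.1, bF.2, bG.1, bG.2] <;> ring

/-- The boundary terms vanish for Dirichlet and Neumann conditions and equal -δF(1)² - λF(0)² for
Robin conditions, so they have a favourable sign. -/
theorem integral_D_two_mul_self_le {p : Params} (hp : p.Admissible) {F : unitInterval → ℝ}
    (hF : IsSmooth F) (bF : BoundaryCondition p F) :
    ∫ u, D 2 F u * F u ≤ -∫ u, D 1 F u * D 1 F u := by
  rw [integral_D_two_mul hF hF]
  have h1 := hp.lam_pos
  have h2 := hp.δ_pos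
  unfold BoundaryCondition at bF
  split_ifs at bF
  · rw [bF.1, bF.2]; simp
  · rw [bF.1, bF.2]
    have h3 : 0 ≤ p.lam * (F 0 * F 0) := mul_nonneg h1.le (mul_self_nonneg _)
    have h4 : 0 ≤ p.δ * (F 1 * F 1) := mul_nonneg h2.le (mul_self_nonneg _)
    linarith
  · rw [bF.1, bF.2]; simp

theorem eq_zero_of_integral_eq_zero {f : unitInterval → ℝ} (hf : Continuous f)
    (h0 : ∀ u, 0 ≤ f u) (h : ∫ u, f u = 0) : f = 0 := by
  by_contra hne
  obtain ⟨u, hu⟩ := Function.ne_iff.1 hne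
  have := intervalIntegral.integral_pos (f := ext f) zero_lt_one (continuous_ext hf).continuousOn
    (fun x hx => by rw [ext_of_mem _ (Ioc_subset_Icc_self hx)]; exact h0 _)
    ⟨u, u.2, by rw [ext_coe]; exact lt_of_le_of_ne (h0 u) (Ne.symm hu)⟩
  rw [← integral_unitInterval, h] at this
  exact lt_irrefl _ this

theorem isSmooth_affine (a b : ℝ) : IsSmooth fun u : unitInterval => a + b * (u : ℝ) := by
  have : ContDiff ℝ ((⊤ : ℕ∞) : WithTop ℕ∞) fun x : ℝ => a + b * x := by fun_prop
  exact this.contDiffOn.congr fun x hx => ext_of_mem _ hx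

theorem D_one_affine (a b : ℝ) :
    D 1 (fun u : unitInterval => a + b * (u : ℝ)) = fun _ => b := by
  refine D_one_eq_of_hasDerivWithinAt fun x hx => ?_
  have h := ((hasDerivWithinAt_coe x).const_mul b).const_add a
  refine (h.congr_of_mem (fun y hy => ext_of_mem _ hy) hx).congr_deriv ?_
  rw [ext_of_mem _ hx, mul_one]

theorem D_two_affine (a b : ℝ) : D 2 (fun u : unitInterval => a + b * (u : ℝ)) = 0 := by
  rw [D_succ, D_one_affine]
  have := D_one_affine b 0
  simp only [zero_mul, add_zero] at this
  rw [this]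
  rfl

/-- `greenOp w s C` inverts `-w⁻¹ Δ` with the boundary conditions, up to a correction on constants:
its eigenfunctions are eigenfunctions of `w⁻¹ Δ`, and its range contains the smooth functions that
satisfy the boundary conditions. -/
structure IsGreen (p : Params) (w s : unitInterval → ℝ) (C : ℝ) : Prop where
  continuous : Continuous s
  eigen : ∀ (φ : unitInterval → ℝ) (μ : ℝ), Continuous φ → μ ≠ 0 →
    (∀ x, greenOp w s C φ x = μ * φ x) → ∫ x, φ x * φ x * w x = 1 →
    ∃ l : ℝ, 0 ≤ l ∧ IsSmooth φ ∧ BoundaryCondition p φ ∧ D 2 φ = -l • (w * φ) ∧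
      ((1 + l) ^ 2)⁻¹ ≤ μ ^ 2
  range : ∀ H : unitInterval → ℝ, IsSmooth H → BoundaryCondition p H →
    ∃ g : unitInterval → ℝ, Continuous g ∧ ∀ x, H x = greenOp w s C g x

section Green

variable {w s : unitInterval → ℝ} {C κ : ℝ}

/-- Since μ ≠ 0, φ is μ⁻¹ times its own Green potential and solves a linear second-order equation
with smooth coefficients; the non-local term ∫φw is just a number multiplying w. -/
theorem isSmooth_of_greenOp_eq (hw : IsSmooth w) (hs : IsSmooth s) (hκ : D 2 s = κ • w)
    {φ : unitInterval → ℝ} {μ : ℝ} (hφ : Continuous φ) (hμ : μ ≠ 0)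
    (he : ∀ x, greenOp w s C φ x = μ * φ x) :
    IsSmooth φ ∧ ∀ x, μ * D 2 φ x = -(φ x * w x) + κ * w x * ∫ z, φ z * w z := by
  have e : φ = μ⁻¹ • greenOp w s C φ := by
    funext x; rw [Pi.smul_apply, he, smul_eq_mul, ← mul_assoc, inv_mul_cancel₀ hμ, one_mul]
  have hsm : IsSmooth φ := by
    refine IsSmooth.of_hasDerivWithinAt_two (h := φ) (h' := μ⁻¹ • greenOpDeriv w s C φ)
      (f := (-μ⁻¹) • w) (r := (μ⁻¹ * (κ * ∫ z, φ z * w z)) • w) (hw.smul _) (hw.smul _) ?_ ?_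
    · intro x hx
      have := (hasDerivWithinAt_greenOp (C := C) hw.continuous hs hφ hx).const_mul μ⁻¹
      have e' : ext φ = fun x => μ⁻¹ * ext (greenOp w s C φ) x := by
        conv_lhs => rw [e]
        rfl
      rw [e']
      exact this
    · intro x hx
      have := (hasDerivWithinAt_greenOpDeriv (C := C) hw.continuous hs hφ hκ hx).const_mul μ⁻¹
      refine this.congr_deriv ?_
      simp only [ext_of_mem _ hx, Pi.add_apply, Pi.mul_apply, Pi.smul_apply, smul_eq_mul]
      ring
  refine ⟨hsm, fun x => ?_⟩
  have h2 := congrFun (D_two_greenOp (C := C) hw.continuous hs hφ hκ) x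
  have h3 : D 2 φ x = μ⁻¹ * D 2 (greenOp w s C φ) x := by
    conv_lhs => rw [e]
    rw [D_smul]; rfl
  rw [h3, h2, ← mul_assoc, mul_inv_cancel₀ hμ, one_mul]

theorem boundaryCondition_of_greenOp_eq {p : Params}
    (hbc : ∀ f, Continuous f → BoundaryCondition p (greenOp w s C f))
    {φ : unitInterval → ℝ} {μ : ℝ} (hφ : Continuous φ) (hμ : μ ≠ 0)
    (he : ∀ x, greenOp w s C φ x = μ * φ x) : BoundaryCondition p φ := by
  have e : φ = μ⁻¹ • greenOp w s C φ := by
    funext x; rw [Pi.smul_apply, he, smul_eq_mul, ← mul_assoc, inv_mul_cancel₀ hμ, one_mul]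
  rw [e]
  exact (hbc φ hφ).smul _

/-- Here l = 1/μ, non-negative by dissipativity and the normalisation of φ. The final bound is
stated with 1 + l in place of l so that it also makes sense for l = 0, which occurs for the Neumann
condition. -/
theorem eigenvalue_of_D_two {p : Params} (hp : p.Admissible) {φ : unitInterval → ℝ} {μ : ℝ}
    (hμ : μ ≠ 0) (hsm : IsSmooth φ) (hb : BoundaryCondition p φ)
    (h2 : ∀ x, μ * D 2 φ x = -(φ x * w x)) (h1 : ∫ x, φ x * φ x * w x = 1) :
    ∃ l : ℝ, 0 ≤ l ∧ IsSmooth φ ∧ BoundaryCondition p φ ∧ D 2 φ = -l • (w * φ) ∧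
      ((1 + l) ^ 2)⁻¹ ≤ μ ^ 2 := by
  have h3 : ∀ x, D 2 φ x = -μ⁻¹ * (w x * φ x) := fun x => by
    have := h2 x
    field_simp
    linarith
  have h4 := integral_D_two_mul_self_le hp hsm hb
  have h5 : ∫ u, D 2 φ u * φ u = -μ⁻¹ := by
    have : ∀ u, D 2 φ u * φ u = -μ⁻¹ * (φ u * φ u * w u) := fun u => by rw [h3]; ring
    simp only [this]
    rw [integral_const_mul, h1, mul_one]
  have h6 : 0 ≤ ∫ u, D 1 φ u * D 1 φ u := integral_nonneg fun u => mul_self_nonneg _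
  have h7 : 0 ≤ μ⁻¹ := by linarith
  have h8 : 0 < μ := lt_of_le_of_ne (inv_nonneg.1 h7) hμ.symm
  refine ⟨μ⁻¹, h7, hsm, hb, funext fun x => ?_, ?_⟩
  · simpa using h3 x
  · rw [inv_le_comm₀ (by positivity) (by positivity), ← inv_pow]
    exact pow_le_pow_left₀ h7 (by linarith) 2

/-- The case where -w⁻¹Δ is invertible. For given H the preimage is -H''/w: its Green potential
differs from H by an affine function satisfying the boundary condition, which vanishes by `huniq`.
-/
theorem isGreen_of_D_two_eq_zero {p : Params} (hp : p.Admissible) (hw : IsSmooth w)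
    (hwpos : ∀ x, 0 < w x) (hs : IsSmooth s) (hκ : D 2 s = 0)
    (hbc : ∀ f, Continuous f → BoundaryCondition p (greenOp w s C f))
    (huniq : ∀ L, IsSmooth L → BoundaryCondition p L → D 2 L = 0 → L = 0) :
    IsGreen p w s C := by
  have hκ' : D 2 s = (0 : ℝ) • w := by rw [hκ, zero_smul]
  refine ⟨hs.continuous, fun φ μ hφ hμ he h1 => ?_, fun H hH hb => ?_⟩
  · obtain ⟨hsm, h2⟩ := isSmooth_of_greenOp_eq hw hs hκ' hφ hμ he
    refine eigenvalue_of_D_two hp hμ hsm (boundaryCondition_of_greenOp_eq hbc hφ hμ he)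
      (fun x => ?_) h1
    rw [h2]; ring
  · have hg : Continuous fun x => -(D 2 H x / w x) :=
      ((isSmooth_D 2 hH).continuous.div hw.continuous fun x => (hwpos x).ne').neg
    refine ⟨_, hg, fun x => ?_⟩
    set g := fun x => -(D 2 H x / w x) with hgdef
    have h2 : D 2 (greenOp w s C g) = D 2 H := by
      rw [D_two_greenOp hw.continuous hs hg hκ']
      funext y
      have := (hwpos y).ne'
      simp only [hgdef]; field_simp; ring
    have hU : IsSmooth (greenOp w s C g) := by
      refine IsSmooth.of_hasDerivWithinAt ?_
        fun x hx => hasDerivWithinAt_greenOp hw.continuous hs hg hx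
      refine IsSmooth.of_hasDerivWithinAt (isSmooth_D 2 hH) fun x hx => ?_
      refine (hasDerivWithinAt_greenOpDeriv hw.continuous hs hg hκ' hx).congr_deriv ?_
      rw [← D_two_greenOp (C := C) hw.continuous hs hg hκ', h2]
    have hn : IsSmooth ((-1 : ℝ) • H) := hH.smul _
    have := huniq (greenOp w s C g + (-1 : ℝ) • H) (hU.add hn)
      ((hbc g hg).add hU hn (hb.smul _)) (by rw [D_add 2 hU hn, D_smul, h2]; simp)
    have := congrFun this x
    simp only [Pi.add_apply, Pi.smul_apply, smul_eq_mul, Pi.zero_apply] at this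
    linarith

theorem integral_affine_mul {f : unitInterval → ℝ} (hw : Continuous w) (hf : Continuous f)
    (a b : ℝ) : ∫ y : unitInterval, (a + b * (y : ℝ)) * (f y * w y)
      = a * (∫ y, f y * w y) + b * ∫ y : unitInterval, (y : ℝ) * (f y * w y) := by
  have h1 : Integrable (fun y => a * (f y * w y)) (volume : Measure unitInterval) :=
    integrable_of_continuous volume (by fun_prop)
  have h2 : Integrable (fun y : unitInterval => b * ((y : ℝ) * (f y * w y))) volume :=
    integrable_of_continuous volume (by fun_prop)
  rw [← integral_const_mul, ← integral_const_mul, ← integral_add h1 h2]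
  exact integral_congr_ae (Eventually.of_forall fun y => by ring)

/-- For these s and C the kernel is min(x, y) - xy. -/
theorem isGreen_dirichlet {p : Params} (hp : p.Admissible) (hθ : p.θ < 1) (hw : IsSmooth w)
    (hwpos : ∀ x, 0 < w x) :
    IsGreen p w (fun u => 0 + 1 / 2 * (u : ℝ)) (-1) := by
  refine isGreen_of_D_two_eq_zero hp hw hwpos (isSmooth_affine _ _) (D_two_affine _ _) ?_ ?_
  · intro f hf
    have hs := (isSmooth_affine 0 (1 / 2)).continuous
    rw [BoundaryCondition, if_pos hθ, greenOp_zero hw.continuous hs hf,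
      greenOp_one hw.continuous hs hf, integral_affine_mul hw.continuous hf]
    simp only [Icc.coe_zero, Icc.coe_one]
    constructor <;> ring
  · intro L hL hb h2
    rw [BoundaryCondition, if_pos hθ] at hb
    have h1 := (eq_affine_of_D_two_eq_zero hL h2 1).1
    rw [hb.1, hb.2] at h1
    simp only [Icc.coe_one, zero_add, mul_one] at h1
    funext u
    rw [(eq_affine_of_D_two_eq_zero hL h2 u).1, hb.1, ← h1]
    simp

/-- For these s and C the kernel is (1 + λx)(1 + δ(1 - y)) / (λ + δ + λδ) when x ≤ y: the product of
the affine solutions of the left and right conditions, divided by their Wronskian. -/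
theorem isGreen_robin {p : Params} (hp : p.Admissible) (hθ : p.θ = 1) (hw : IsSmooth w)
    (hwpos : ∀ x, 0 < w x) :
    IsGreen p w (fun u => (1 + p.δ) / (2 * (p.lam + p.δ + p.lam * p.δ))
      + (p.lam * (1 + p.δ) - p.δ) / (2 * (p.lam + p.δ + p.lam * p.δ)) * (u : ℝ))
      (-(p.lam * p.δ) / (p.lam + p.δ + p.lam * p.δ)) := by
  have hl := hp.lam_pos
  have hd := hp.δ_pos
  have hW : p.lam + p.δ + p.lam * p.δ ≠ 0 := by positivity
  have hθ' : ¬ p.θ < 1 := by rw [hθ]; exact lt_irrefl _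
  refine isGreen_of_D_two_eq_zero hp hw hwpos (isSmooth_affine _ _) (D_two_affine _ _) ?_ ?_
  · intro f hf
    have hs := isSmooth_affine ((1 + p.δ) / (2 * (p.lam + p.δ + p.lam * p.δ)))
      ((p.lam * (1 + p.δ) - p.δ) / (2 * (p.lam + p.δ + p.lam * p.δ)))
    rw [BoundaryCondition, if_neg hθ', if_pos hθ, D_one_greenOp hw.continuous hs hf,
      greenOpDeriv_zero, greenOpDeriv_one, greenOp_zero hw.continuous hs.continuous hf,
      greenOp_one hw.continuous hs.continuous hf, integral_affine_mul hw.continuous hf,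
      D_one_affine]
    simp only [Icc.coe_zero, Icc.coe_one]
    constructor <;> field_simp <;> ring
  · intro L hL hb h2
    rw [BoundaryCondition, if_neg hθ', if_pos hθ] at hb
    have h1 := eq_affine_of_D_two_eq_zero hL h2 1
    simp only [Icc.coe_one, mul_one] at h1
    have hb0 := hb.1
    rw [h1.2, h1.1, hb.1] at hb
    have h3 : (p.lam + p.δ + p.lam * p.δ) * L 0 = 0 := by linarith [hb.2]
    have h4 : L 0 = 0 := (mul_eq_zero.1 h3).resolve_left hW
    have h5 : D 1 L 0 = 0 := by rw [hb0, h4, mul_zero]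
    funext u
    rw [(eq_affine_of_D_two_eq_zero hL h2 u).1, h4, h5]
    simp

/-- The primitive of second order of `κ w` with slopes `∓ 1/2` at the endpoints, when
`κ ∫ w = 1`. -/
def neumannProfile (w : unitInterval → ℝ) (c : ℝ) (u : unitInterval) : ℝ :=
  (∫ y, w y)⁻¹ * doubleIntegral (ext w) u - (u : ℝ) / 2 + c

theorem hasDerivWithinAt_neumannProfile (hw : Continuous w) (c : ℝ) {x : ℝ}
    (hx : x ∈ Icc (0 : ℝ) 1) :
    HasDerivWithinAt (ext (neumannProfile w c))
      (ext (fun u => (∫ y, w y)⁻¹ * (∫ y in (0 : ℝ)..u, ext w y) - 1 / 2) x) (Icc 0 1) x := by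
  have h := ((((hasDerivAt_doubleIntegral (continuous_ext hw) x).hasDerivWithinAt
    (s := Icc 0 1)).const_mul (∫ y, w y)⁻¹).sub ((hasDerivWithinAt_coe x).div_const 2)).add_const c
  refine (h.congr_of_mem (fun y hy => ?_) hx).congr_deriv ?_
  · rw [ext_of_mem _ hy]; rfl
  · rw [ext_of_mem _ hx]

theorem D_one_neumannProfile (hw : Continuous w) (c : ℝ) : D 1 (neumannProfile w c)
    = fun u : unitInterval => (∫ y, w y)⁻¹ * (∫ y in (0 : ℝ)..u, ext w y) - 1 / 2 :=
  D_one_eq_of_hasDerivWithinAt fun _ hx => hasDerivWithinAt_neumannProfile hw c hx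

theorem hasDerivWithinAt_D_one_neumannProfile (hw : Continuous w) (c : ℝ) {x : ℝ}
    (hx : x ∈ Icc (0 : ℝ) 1) :
    HasDerivWithinAt (ext (D 1 (neumannProfile w c))) (ext ((∫ y, w y)⁻¹ • w) x) (Icc 0 1) x := by
  rw [D_one_neumannProfile hw]
  have h := ((((continuous_ext hw).integral_hasStrictDerivAt 0 x).hasDerivAt.hasDerivWithinAt
    (s := Icc 0 1)).const_mul (∫ y, w y)⁻¹).sub_const (1 / 2)
  refine (h.congr_of_mem (fun y hy => ?_) hx).congr_deriv ?_
  · rw [ext_of_mem _ hy]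
  · rw [ext_of_mem _ hx, ext_of_mem _ hx]; rfl

theorem isSmooth_neumannProfile (hw : IsSmooth w) (c : ℝ) : IsSmooth (neumannProfile w c) := by
  have h1 : IsSmooth (D 1 (neumannProfile w c)) :=
    IsSmooth.of_hasDerivWithinAt (hw.smul (∫ y, w y)⁻¹)
      fun _ hx => hasDerivWithinAt_D_one_neumannProfile hw.continuous c hx
  refine IsSmooth.of_hasDerivWithinAt h1 fun x hx => ?_
  rw [D_one_neumannProfile hw.continuous]
  exact hasDerivWithinAt_neumannProfile hw.continuous c hx

theorem D_two_neumannProfile (hw : Continuous w) (c : ℝ) :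
    D 2 (neumannProfile w c) = (∫ y, w y)⁻¹ • w := by
  rw [D_succ]
  exact D_one_eq_of_hasDerivWithinAt fun _ hx => hasDerivWithinAt_D_one_neumannProfile hw c hx

theorem integral_weight_pos (hw : Continuous w) (hwpos : ∀ x, 0 < w x) : 0 < ∫ y, w y := by
  refine (integral_pos_iff_support_of_nonneg (fun x => (hwpos x).le)
    (integrable_of_continuous volume hw)).2 ?_
  have : Function.support w = univ := by
    ext x; simp [(hwpos x).ne']
  rw [this]
  simp

theorem integral_greenOp_mul (hw : Continuous w) (hs : Continuous s) {f g : unitInterval → ℝ}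
    (hf : Continuous f) (hg : Continuous g) :
    ∫ x, greenOp w s C f x * (g x * w x) = ∫ x, greenOp w s C g x * (f x * w x) := by
  simp only [greenOp, ← integral_mul_const]
  rw [integral_integral_swap]
  · refine integral_congr_ae (Eventually.of_forall fun y => ?_)
    refine integral_congr_ae (Eventually.of_forall fun x => ?_)
    simp only [greenKernel, abs_sub_comm (x : ℝ) y]
    ring
  · exact integrable_of_continuous (volume.prod volume)
      (by simp only [Function.uncurry_def, greenKernel]; fun_prop)

/-- Constants lie in the kernel of Δ, so the Green operator inverts -w⁻¹Δ only modulo constants and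
maps 1 to a constant, which the shift c normalises to -1. A non-zero value brings the constants into
the range. The negative sign separates them from the other eigenvalues 1/l > 0, and the absolute
value 1 matches the bound (1 + l)⁻² ≤ μ² at l = 0. -/
theorem exists_isGreen_neumann {p : Params} (hp : p.Admissible) (hθ : 1 < p.θ)
    (hw : IsSmooth w) (hwpos : ∀ x, 0 < w x) : ∃ c, IsGreen p w (neumannProfile w c) 0 := by
  have hθ1 : ¬ p.θ < 1 := by linarith
  have hθ2 : ¬ p.θ = 1 := by linarith
  have hW := integral_weight_pos hw.continuous hwpos
  set W := ∫ y, w y with hWdef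
  have hbc : ∀ c f, Continuous f → BoundaryCondition p (greenOp w (neumannProfile w c) 0 f) := by
    intro c f hf
    have hs := isSmooth_neumannProfile hw c
    have h1 : ∫ y in (0 : ℝ)..1, ext w y = W := (integral_unitInterval w).symm
    rw [BoundaryCondition, if_neg hθ1, if_neg hθ2, D_one_greenOp hw.continuous hs hf,
      greenOpDeriv_zero, greenOpDeriv_one, D_one_neumannProfile hw.continuous]
    simp only [Icc.coe_zero, Icc.coe_one, intervalIntegral.integral_same, h1, ← hWdef]
    rw [inv_mul_cancel₀ hW.ne']
    constructor <;> ring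
  have hconst : ∀ L, IsSmooth L → BoundaryCondition p L → D 2 L = 0 → ∀ u, L u = L 0 := by
    intro L hL hb h2 u
    rw [BoundaryCondition, if_neg hθ1, if_neg hθ2] at hb
    rw [(eq_affine_of_D_two_eq_zero hL h2 u).1, hb.1, zero_mul, add_zero]
  have hone : IsSmooth fun _ : unitInterval => (1 : ℝ) := by
    simpa using isSmooth_affine 1 0
  have hU : ∃ c, ∀ x, greenOp w (neumannProfile w c) 0 (fun _ => 1) x = -1 := by
    have h0 := hconst (greenOp w (neumannProfile w 0) 0 fun _ => 1)
      (isSmooth_greenOp hw (isSmooth_neumannProfile hw 0) hone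
        (D_two_neumannProfile hw.continuous 0)) (hbc 0 _ hone.continuous) (by
        rw [D_two_greenOp hw.continuous (isSmooth_neumannProfile hw 0) hone.continuous
          (D_two_neumannProfile hw.continuous 0)]
        funext y
        simp only [one_mul, ← hWdef, Pi.zero_apply]
        field_simp
        ring)
    set c₁ := greenOp w (neumannProfile w 0) 0 (fun _ => 1) 0 with hc₁
    -- The shift d enters the kernel through both s(x) and s(y), so it adds 2d∫w.
    have h1 : ∀ d x, greenOp w (neumannProfile w d) 0 (fun _ => 1) x
        = greenOp w (neumannProfile w 0) 0 (fun _ => 1) x + 2 * d * W := by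
      intro d x
      have hi : Integrable (fun y => greenKernel (neumannProfile w 0) 0 x y * (1 * w y))
          (volume : Measure unitInterval) := by
        refine integrable_of_continuous volume ?_
        have := (isSmooth_neumannProfile hw 0).continuous
        have := hw.continuous
        simp only [greenKernel]
        fun_prop
      have hi2 : Integrable (fun y => 2 * d * w y) (volume : Measure unitInterval) :=
        (integrable_of_continuous volume hw.continuous).const_mul _
      rw [hWdef, ← integral_const_mul, greenOp, greenOp, ← integral_add hi hi2]
      refine integral_congr_ae (Eventually.of_forall fun y => ?_)
      simp only [greenKernel, neumannProfile]
      ring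
    refine ⟨(-1 - c₁) / (2 * W), fun x => ?_⟩
    rw [h1, h0 x]
    field_simp
    ring
  obtain ⟨c, hc⟩ := hU
  have hs := isSmooth_neumannProfile hw c
  have hκ := D_two_neumannProfile hw.continuous c
  refine ⟨c, hs.continuous, fun φ μ hφ hμ he h1 => ?_, fun H hH hb => ?_⟩
  · obtain ⟨hsm, h2⟩ := isSmooth_of_greenOp_eq hw hs hκ hφ hμ he
    have hb := boundaryCondition_of_greenOp_eq (hbc c) hφ hμ he
    set m := ∫ z, φ z * w z with hm
    -- Pairing the eigenvalue equation with 1 and using symmetry: either μ = -1 or φ has weighted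
    -- mean zero, and in the latter case the non-local term drops out.
    have h3 : (μ + 1) * m = 0 := by
      have := integral_greenOp_mul (C := 0) hw.continuous hs.continuous hφ hone.continuous
      simp only [he, hc, one_mul, neg_mul] at this
      rw [integral_neg, ← hm] at this
      have e : ∫ x, μ * φ x * w x = μ * m := by
        rw [hm, ← integral_const_mul]
        exact integral_congr_ae (Eventually.of_forall fun x => by ring)
      rw [e] at this
      linarith
    rcases mul_eq_zero.1 h3 with hμ1 | hm0
    · have hμ1 : μ = -1 := by linarith
      -- When μ = -1, the centred eigenfunction satisfies F'' = wF with Neumann conditions, so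
      -- dissipativity forces F = 0 and φ is constant.
      set F : unitInterval → ℝ := φ + (-(W⁻¹ * m)) • fun _ => (1 : ℝ) with hF
      have hFs : IsSmooth F := hsm.add (hone.smul _)
      have hb1 : BoundaryCondition p fun _ : unitInterval => (1 : ℝ) := by
        have := D_one_affine 1 0
        simp only [zero_mul, add_zero] at this
        rw [BoundaryCondition, if_neg hθ1, if_neg hθ2, this]
        simp
      have hFb : BoundaryCondition p F := hb.add hsm (hone.smul _) (hb1.smul _)
      have hD1 : D 2 (fun _ : unitInterval => (1 : ℝ)) = 0 := by
        simpa using D_two_affine 1 0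
      have hD : ∀ x, D 2 φ x = F x * w x := fun x => by
        have := h2 x
        rw [hμ1] at this
        simp only [hF, Pi.add_apply, Pi.smul_apply, smul_eq_mul]
        linarith
      have hDF : D 2 F = D 2 φ := by
        rw [hF, D_add 2 hsm (hone.smul _), D_smul, hD1, smul_zero, add_zero]
      have h5 := integral_D_two_mul_self_le hp hFs hFb
      have h6 : 0 ≤ ∫ u, D 1 F u * D 1 F u := integral_nonneg fun u => mul_self_nonneg _
      have h7 : ∫ u, D 2 F u * F u = ∫ u, F u * F u * w u := by
        refine integral_congr_ae (Eventually.of_forall fun u => ?_)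
        simp only [hDF, hD]; ring
      have hc2 : Continuous fun u => F u * F u * w u :=
        (hFs.continuous.mul hFs.continuous).mul hw.continuous
      have h8 : ∫ u, F u * F u * w u = 0 :=
        le_antisymm (by linarith) (integral_nonneg fun u =>
          mul_nonneg (mul_self_nonneg _) (hwpos u).le)
      have h9 := eq_zero_of_integral_eq_zero hc2
        (fun u => mul_nonneg (mul_self_nonneg _) (hwpos u).le) h8
      have h10 : ∀ u, F u = 0 := fun u => by
        have := congrFun h9 u
        simp only [Pi.zero_apply] at this
        exact mul_self_eq_zero.1 ((mul_eq_zero.1 this).resolve_right (hwpos u).ne')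
      refine ⟨0, le_rfl, hsm, hb, ?_, by rw [hμ1]; norm_num⟩
      funext x
      rw [hD, h10]; simp
    · refine eigenvalue_of_D_two hp hμ hsm hb (fun x => ?_) h1
      rw [h2, hm0]; ring
  · have hb' := hb
    rw [BoundaryCondition, if_neg hθ1, if_neg hθ2] at hb'
    set g := fun x => -(D 2 H x / w x) with hgdef
    have hg : Continuous g :=
      ((isSmooth_D 2 hH).continuous.div hw.continuous fun x => (hwpos x).ne').neg
    have hgw : ∀ y, g y * w y = -D 2 H y := fun y => by
      have := (hwpos y).ne'
      simp only [hgdef]; field_simp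
    have hg0 : ∫ z, g z * w z = 0 := by
      simp only [hgw]
      rw [integral_neg]
      have := integral_D_two_mul hH hone
      have hd := D_one_affine 1 0
      simp only [zero_mul, add_zero] at hd
      rw [hb'.1, hb'.2, hd] at this
      simp only [mul_one, mul_zero, integral_zero, sub_zero] at this
      rw [this, neg_zero]
    have h2 : D 2 (greenOp w (neumannProfile w c) 0 g) = D 2 H := by
      rw [D_two_greenOp hw.continuous hs hg hκ]
      funext y
      rw [hg0, hgw]; ring
    have hU : IsSmooth (greenOp w (neumannProfile w c) 0 g) := by
      refine IsSmooth.of_hasDerivWithinAt ?_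
        fun x hx => hasDerivWithinAt_greenOp hw.continuous hs hg hx
      refine IsSmooth.of_hasDerivWithinAt (isSmooth_D 2 hH) fun x hx => ?_
      refine (hasDerivWithinAt_greenOpDeriv hw.continuous hs hg hκ hx).congr_deriv ?_
      rw [← D_two_greenOp (C := 0) hw.continuous hs hg hκ, h2]
    have hn : IsSmooth ((-1 : ℝ) • H) := hH.smul _
    have hL := hconst (greenOp w (neumannProfile w c) 0 g + (-1 : ℝ) • H) (hU.add hn)
      ((hbc c g hg).add hU hn (hb.smul _)) (by rw [D_add 2 hU hn, D_smul, h2]; simp)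
    set b := (greenOp w (neumannProfile w c) 0 g + (-1 : ℝ) • H) 0 with hbdef
    -- The potential of g exceeds H by the constant b, and adding b to g lowers the potential by b,
    -- since 1 is mapped to -1.
    refine ⟨fun x => g x + b, by fun_prop, fun x => ?_⟩
    have h3 := hL x
    simp only [Pi.add_apply, Pi.smul_apply, smul_eq_mul] at h3
    have hsc := hs.continuous
    have hwc := hw.continuous
    have hk : Continuous (greenKernel (neumannProfile w c) 0 x) := by
      unfold greenKernel; fun_prop
    have h4 : greenOp w (neumannProfile w c) 0 (fun x => g x + b) x
        = greenOp w (neumannProfile w c) 0 g x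
          + b * greenOp w (neumannProfile w c) 0 (fun _ => 1) x := by
      rw [greenOp, greenOp, greenOp, ← integral_const_mul, ← integral_add
        (integrable_of_continuous volume (by fun_prop))
        (integrable_of_continuous volume (by fun_prop))]
      exact integral_congr_ae (Eventually.of_forall fun y => by ring)
    rw [h4, hc]
    linarith

/-- Each of the three boundary conditions has a Green operator. -/
theorem exists_isGreen {p : Params} (hp : p.Admissible) :
    ∃ s C, IsGreen p (weight p) s C := by
  have hw := isSmooth_weight hp
  have hwpos := weight_pos hp
  rcases lt_trichotomy p.θ 1 with h | h | h
  · exact ⟨_, _, isGreen_dirichlet hp h hw hwpos⟩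
  · exact ⟨_, _, isGreen_robin hp h hw hwpos⟩
  · obtain ⟨c, hc⟩ := exists_isGreen_neumann hp h hw hwpos
    exact ⟨_, _, hc⟩

end Green

end ZeroRange

end

open MeasureTheory ProbabilityTheory Filter Set
open scoped Topology ENNReal NNReal

noncomputable section

namespace ZeroRange

/-! ### The topology of the space of test functions -/

section TestSpace

variable {p : Params}

theorem TestSpace.ext_fn {H G : TestSpace p} (h : H.fn = G.fn) : H = G :=
  Subtype.ext (Subtype.ext h)

theorem TestSpace.isSmooth (H : TestSpace p) : IsSmooth H.fn := H.1.isSmooth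

theorem TestSpace.boundaryCondition (H : TestSpace p) : BoundaryCondition p H.fn := (H.2 0).2

@[simp] theorem TestSpace.add_fn (H G : TestSpace p) : (H + G).fn = H.fn + G.fn := rfl

@[simp] theorem TestSpace.smul_fn (c : ℝ) (H : TestSpace p) : (c • H).fn = c • H.fn := rfl

@[simp] theorem testA_fn (H : TestSpace p) : (testA p H).fn = opA p H.fn := rfl

/-- The function underlying a test function, as a linear map. -/
def TestSpace.fnL (p : Params) : TestSpace p →ₗ[ℝ] (unitInterval → ℝ) where
  toFun := TestSpace.fn
  map_add' _ _ := rfl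
  map_smul' _ _ := rfl

@[simp] theorem TestSpace.fnL_apply (H : TestSpace p) : TestSpace.fnL p H = H.fn := rfl

/-- The operator `𝔄_θ` as a linear endomorphism of `𝒮_θ`. -/
def testAL (p : Params) : TestSpace p →ₗ[ℝ] TestSpace p where
  toFun := testA p
  map_add' H G := TestSpace.ext_fn (opA_add p H.isSmooth G.isSmooth)
  map_smul' c H := TestSpace.ext_fn (opA_smul p c H.fn)

@[simp] theorem testAL_apply (H : TestSpace p) : testAL p H = testA p H := rfl

theorem withSeminorms_smoothFun : WithSeminorms smoothSeminormFamily := ⟨rfl⟩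

/-- The semi-norm `‖·‖_k` on `𝒮_θ`. -/
def testSeminorm (p : Params) : SeminormFamily ℝ (TestSpace p) ℕ :=
  fun k => (smoothSeminorm k).comp (testSubmodule p).subtype

theorem testSeminorm_apply (k : ℕ) (H : TestSpace p) : testSeminorm p k H = supD k H.fn := rfl

theorem withSeminorms_testSpace : WithSeminorms (testSeminorm p) :=
  LinearMap.withSeminorms_induced withSeminorms_smoothFun (testSubmodule p).subtype

instance : IsTopologicalAddGroup (TestSpace p) := withSeminorms_testSpace.topologicalAddGroup

instance : ContinuousSMul ℝ (TestSpace p) := withSeminorms_testSpace.continuousSMul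

theorem continuous_testSeminorm (k : ℕ) : Continuous (testSeminorm p k) :=
  withSeminorms_testSpace.continuous_seminorm k

theorem opA_eq (h : unitInterval → ℝ) : opA p h = (fun u : unitInterval => diffusivity p u) * D 2 h :=
  rfl

theorem continuous_testAL (hp : p.Admissible) : Continuous (testAL p) := by
  refine withSeminorms_testSpace.continuous_of_isBounded withSeminorms_testSpace _ ?_
  intro k
  obtain ⟨C, hC, H⟩ := exists_supD_mul_le k (isSmooth_diffusivity hp)
  refine ⟨(Finset.range (k + 1)).image (· + 2), (C * (k + 1)).toNNReal, fun F => ?_⟩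
  rw [Seminorm.comp_apply, testAL_apply, testSeminorm_apply, testA_fn, opA_eq, smul_apply]
  refine (H _ (isSmooth_D 2 F.isSmooth)).trans ?_
  have h1 : ∀ i ∈ Finset.range (k + 1), supD i (D 2 F.fn)
      ≤ (((Finset.range (k + 1)).image (· + 2)).sup (testSeminorm p)) F := fun i hi => by
    rw [supD_D]
    exact Seminorm.le_finset_sup_apply (p := testSeminorm p)
      (Finset.mem_image.2 ⟨i, hi, rfl⟩) (x := F)
  have h2 := Finset.sum_le_sum h1
  rw [Finset.sum_const, Finset.card_range, nsmul_eq_mul] at h2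
  calc C * ∑ i ∈ Finset.range (k + 1), supD i (D 2 F.fn)
      ≤ C * (((k + 1 : ℕ) : ℝ)
        * (((Finset.range (k + 1)).image (· + 2)).sup (testSeminorm p)) F) :=
        mul_le_mul_of_nonneg_left h2 hC
    _ = _ := by
      rw [NNReal.smul_def, smul_eq_mul, Real.coe_toNNReal _ (by positivity)]; push_cast; ring

/-- `∫ H² / Φ'(ρ̄_θ)`. -/
def weightedSq (p : Params) (h : unitInterval → ℝ) : ℝ := ∫ u, h u * h u * weight p u

theorem weightedSq_le (hp : p.Admissible) {h : unitInterval → ℝ} (hs : IsSmooth h) :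
    weightedSq p h ≤ supD 0 h ^ 2 * ∫ u, weight p u := by
  have hw := (isSmooth_weight hp).continuous
  rw [weightedSq, ← integral_const_mul]
  refine integral_mono (integrable_of_continuous volume ((hs.continuous.mul hs.continuous).mul hw))
    ((integrable_of_continuous volume hw).const_mul _) fun u => ?_
  refine mul_le_mul_of_nonneg_right ?_ (weight_pos hp u).le
  rw [← pow_two, ← sq_abs]
  exact pow_le_pow_left₀ (abs_nonneg _) (abs_le_supD_zero hs u) 2

/-- The variance of |f| under Lebesgue measure on [0, 1], a probability measure, is non-negative. -/
theorem sq_integral_le {f : unitInterval → ℝ} (hf : Continuous f) :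
    (∫ u, |f u|) ^ 2 ≤ ∫ u, f u * f u := by
  set m := ∫ u, |f u| with hm
  have h1 : 0 ≤ ∫ u, (|f u| - m) ^ 2 := integral_nonneg fun u => sq_nonneg _
  have e : ∀ u, (|f u| - m) ^ 2 = f u * f u + (-(2 * m) * |f u| + m ^ 2) := fun u => by
    rw [sub_sq, sq_abs]; ring
  simp only [e] at h1
  have i1 : Integrable (fun u => f u * f u) (volume : Measure unitInterval) :=
    integrable_of_continuous volume (hf.mul hf)
  have i2 := (integrable_of_continuous (volume : Measure unitInterval) hf.abs).const_mul (-(2 * m))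
  have i3 : Integrable (fun u => -(2 * m) * |f u| + m ^ 2) (volume : Measure unitInterval) :=
    i2.add (integrable_const _)
  rw [integral_add i1 i3, integral_add i2 (integrable_const _),
    integral_const_mul, ← hm, integral_const] at h1
  simp only [Measure.real, measure_univ, ENNReal.toReal_one, one_smul] at h1
  linarith

theorem abs_sub_le_integral_D_one {h : unitInterval → ℝ} (hs : IsSmooth h) (u v : unitInterval) :
    |h u - h v| ≤ ∫ x, |D 1 h x| := by
  have hc := continuous_ext (isSmooth_D_one hs).continuous
  wlog huv : (v : ℝ) ≤ u generalizing u v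
  · rw [abs_sub_comm]
    exact this v u (le_of_not_ge huv)
  have h1 : ∫ x in (v : ℝ)..u, ext (D 1 h) x = ext h u - ext h v := by
    refine intervalIntegral.integral_eq_sub_of_hasDerivAt_of_le huv
      ((ContDiffOn.continuousOn hs).mono (Icc_subset_Icc v.2.1 u.2.2)) (fun x hx => ?_)
      (hc.intervalIntegrable _ _)
    have hx1 : 0 < x := lt_of_le_of_lt v.2.1 hx.1
    have hx2 : x < 1 := lt_of_lt_of_le hx.2 u.2.2
    exact (hs.hasDerivWithinAt ⟨hx1.le, hx2.le⟩).hasDerivAt (Icc_mem_nhds hx1 hx2)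
  rw [ext_coe, ext_coe] at h1
  rw [← h1, integral_unitInterval]
  have h2 := intervalIntegral.abs_integral_le_integral_abs (f := ext (D 1 h)) (μ := volume) huv
  refine h2.trans ?_
  have e : ∀ x ∈ uIcc (0 : ℝ) 1, ext (fun x => |D 1 h x|) x = |ext (D 1 h) x| := fun x hx => by
    rw [uIcc_of_le zero_le_one] at hx
    rw [ext_of_mem _ hx, ext_of_mem _ hx]
  rw [intervalIntegral.integral_congr e]
  exact intervalIntegral.integral_mono_interval v.2.1 huv u.2.2
    (Eventually.of_forall fun x => abs_nonneg _) (hc.abs.intervalIntegrable _ _)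

/-- The sup norm is controlled by the graph norm of `𝔄_θ` in weighted `L²`. -/
theorem exists_supD_zero_le (hp : p.Admissible) : ∃ C : ℝ, 0 ≤ C ∧ ∀ H : TestSpace p,
    supD 0 H.fn ^ 2 ≤ C * (weightedSq p H.fn + weightedSq p (testA p H).fn) := by
  have hw := (isSmooth_weight hp).continuous
  have hd := (isSmooth_diffusivity hp).continuous
  set K := supD 0 (fun u : unitInterval => diffusivity p u) with hK
  have hK0 : 0 ≤ K := supD_nonneg _ _
  refine ⟨2 * K + 1, by positivity, fun H => ?_⟩
  have hH := H.isSmooth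
  set N := weightedSq p H.fn with hN
  set N' := weightedSq p (testA p H).fn with hN'
  have hN0' : 0 ≤ N' := integral_nonneg fun u => mul_nonneg (mul_self_nonneg _) (weight_pos hp u).le
  have hN0 : 0 ≤ N := integral_nonneg fun u => mul_nonneg (mul_self_nonneg _) (weight_pos hp u).le
  -- The energy is at most -∫H''H = -∫w(𝔄H)H, and completing the square in w(H + 𝔄H)² ≥ 0 bounds
  -- this by half the squared graph norm.
  have h1 : ∫ u, D 1 H.fn u * D 1 H.fn u ≤ (N + N') / 2 := by
    have h2 := integral_D_two_mul_self_le hp hH H.boundaryCondition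
    have h3 : -∫ u, D 2 H.fn u * H.fn u ≤ (N + N') / 2 := by
      rw [hN, hN', weightedSq, weightedSq, ← integral_add, ← integral_neg, ← integral_div]
      · refine integral_mono (integrable_of_continuous volume
          (((isSmooth_D 2 hH).continuous.mul hH.continuous).neg)) ?_ fun u => ?_
        · exact ((integrable_of_continuous volume
            ((hH.continuous.mul hH.continuous).mul hw)).add (integrable_of_continuous volume
            (((testA p H).isSmooth.continuous.mul (testA p H).isSmooth.continuous).mul
              hw))).div_const 2
        · have h4 := weight_mul_opA hp H.fn u
          simp only [← h4, testA_fn]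
          have := weight_pos hp u
          nlinarith [mul_nonneg this.le (sq_nonneg (H.fn u + opA p H.fn u))]
      · exact integrable_of_continuous volume ((hH.continuous.mul hH.continuous).mul hw)
      · exact integrable_of_continuous volume
          (((testA p H).isSmooth.continuous.mul (testA p H).isSmooth.continuous).mul hw)
    linarith
  have h2 := (sq_integral_le (isSmooth_D_one hH).continuous).trans h1
  set I := ∫ x, |D 1 H.fn x| with hI
  have h3 : ∫ v, H.fn v * H.fn v ≤ K * N := by
    rw [hN, weightedSq, ← integral_const_mul]
    refine integral_mono (integrable_of_continuous volume (hH.continuous.mul hH.continuous))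
      ((integrable_of_continuous volume ((hH.continuous.mul hH.continuous).mul hw)).const_mul _)
      fun u => ?_
    have h4 : 1 ≤ K * weight p u := by
      rw [weight, ← div_eq_mul_inv, one_le_div (hp.diffusivity_pos u.2)]
      exact (le_abs_self _).trans (abs_le_supD_zero (isSmooth_diffusivity hp) u)
    have := mul_le_mul_of_nonneg_left h4 (mul_self_nonneg (H.fn u))
    simp only
    linarith
  -- One-dimensional Sobolev inequality: compare H(u) with H(v) through ∫|H'|, then average over v.
  have h4 : ∀ u, H.fn u ^ 2 ≤ 2 * (K * N) + 2 * ((N + N') / 2) := fun u => by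
    have h5 : ∀ v, H.fn u ^ 2 ≤ 2 * (H.fn v * H.fn v) + 2 * I ^ 2 := fun v => by
      have h6 := abs_sub_le_integral_D_one hH u v
      have h7 : (H.fn u - H.fn v) ^ 2 ≤ I ^ 2 := by
        rw [← sq_abs]; exact pow_le_pow_left₀ (abs_nonneg _) h6 2
      nlinarith [sq_nonneg (H.fn u - 2 * H.fn v)]
    have h8 := integral_mono (μ := (volume : Measure unitInterval)) (integrable_const (H.fn u ^ 2))
      (((integrable_of_continuous volume (hH.continuous.mul hH.continuous)).const_mul 2).add
        (integrable_const (2 * I ^ 2))) h5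
    rw [integral_const, Pi.add_def, integral_add ((integrable_of_continuous volume
      (hH.continuous.mul hH.continuous)).const_mul 2) (integrable_const (2 * I ^ 2)),
      integral_const_mul, integral_const] at h8
    simp only [Measure.real, measure_univ, ENNReal.toReal_one, one_smul, Pi.mul_apply] at h8
    linarith
  have h5 : supD 0 H.fn ≤ Real.sqrt (2 * (K * N) + 2 * ((N + N') / 2)) :=
    supD_le fun u => by
      rw [D_zero_eq]
      exact Real.abs_le_sqrt (h4 u)
  have h6 : 0 ≤ 2 * (K * N) + 2 * ((N + N') / 2) := by positivity
  calc supD 0 H.fn ^ 2 ≤ (Real.sqrt (2 * (K * N) + 2 * ((N + N') / 2))) ^ 2 :=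
        pow_le_pow_left₀ (supD_nonneg _ _) h5 2
    _ = 2 * (K * N) + 2 * ((N + N') / 2) := Real.sq_sqrt h6
    _ ≤ _ := by nlinarith [mul_nonneg hK0 hN0']

/-- Elliptic regularity: `‖·‖_k` is controlled by the sup norms of `𝔄_θ^j H`, `j ≤ k`. -/
theorem exists_supD_le (hp : p.Admissible) (k : ℕ) : ∃ C : ℝ, 0 ≤ C ∧ ∀ H : TestSpace p,
    supD k H.fn ≤ C * ∑ j ∈ Finset.range (k + 1), supD 0 ((testA p)^[j] H).fn := by
  induction k using Nat.strong_induction_on with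
  | _ k ih =>
  -- Since H'' = w𝔄H, the k + 2 derivatives of H are controlled by k derivatives of 𝔄H, to which the
  -- induction hypothesis applies.
  have key : ∀ k, (∀ m < k + 2, ∃ C : ℝ, 0 ≤ C ∧ ∀ H : TestSpace p,
      supD m H.fn ≤ C * ∑ j ∈ Finset.range (m + 1), supD 0 ((testA p)^[j] H).fn) →
      ∃ C : ℝ, 0 ≤ C ∧ ∀ H : TestSpace p,
        supD (k + 2) H.fn ≤ C * ∑ j ∈ Finset.range (k + 2), supD 0 ((testA p)^[j] H).fn := by
    intro k ih
    choose! C hC HC using ih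
    obtain ⟨B, hB, HB⟩ := exists_supD_mul_le k (isSmooth_weight hp)
    refine ⟨B * ∑ i ∈ Finset.range (k + 1), C i,
      mul_nonneg hB (Finset.sum_nonneg fun i hi => hC i (by
        have := Finset.mem_range.1 hi; omega)), fun H => ?_⟩
    have h1 : D 2 H.fn = weight p * (testA p H).fn :=
      funext fun u => (weight_mul_opA hp H.fn u).symm
    have h2 : supD (k + 2) H.fn = supD k (weight p * (testA p H).fn) := by rw [← h1, supD_D]
    rw [h2, mul_assoc, Finset.sum_mul]
    refine (HB _ (testA p H).isSmooth).trans (mul_le_mul_of_nonneg_left ?_ hB)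
    refine Finset.sum_le_sum fun i hi => ?_
    have hi' := Finset.mem_range.1 hi
    refine (HC i (by omega) _).trans (mul_le_mul_of_nonneg_left ?_ (hC i (by omega)))
    have h3 : ∑ j ∈ Finset.range (i + 1), supD 0 ((testA p)^[j] (testA p H)).fn
        = ∑ j ∈ Finset.range (i + 1), supD 0 ((testA p)^[j + 1] H).fn := rfl
    rw [h3]
    have h4 := Finset.sum_range_succ' (fun j => supD 0 ((testA p)^[j] H).fn) (i + 1)
    have h5 : ∑ j ∈ Finset.range (i + 1 + 1), supD 0 ((testA p)^[j] H).fn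
        ≤ ∑ j ∈ Finset.range (k + 2), supD 0 ((testA p)^[j] H).fn :=
      Finset.sum_le_sum_of_subset_of_nonneg (Finset.range_subset_range.2 (by omega))
        fun i _ _ => supD_nonneg _ _
    have h6 := supD_nonneg 0 ((testA p)^[0] H).fn
    linarith
  have mono : ∀ m k : ℕ, m ≤ k → ∀ H : TestSpace p,
      ∑ j ∈ Finset.range m, supD 0 ((testA p)^[j] H).fn
        ≤ ∑ j ∈ Finset.range k, supD 0 ((testA p)^[j] H).fn := fun m k hmk H =>
    Finset.sum_le_sum_of_subset_of_nonneg (Finset.range_subset_range.2 hmk)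
      fun i _ _ => supD_nonneg _ _
  match k, ih with
  | 0, _ => exact ⟨1, zero_le_one, fun H => by simp⟩
  -- One derivative cannot be reduced by two; it is interpolated between H and H''.
  | 1, _ =>
    obtain ⟨B, hB, HB⟩ := exists_supD_mul_le 0 (isSmooth_weight hp)
    refine ⟨2 + B, by positivity, fun H => ?_⟩
    have h1 : D 2 H.fn = weight p * (testA p H).fn :=
      funext fun u => (weight_mul_opA hp H.fn u).symm
    have h2 : supD 2 H.fn = supD 0 (weight p * (testA p H).fn) := by rw [← h1, supD_D]
    have h3 := supD_one_le H.isSmooth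
    have h4 := HB _ (testA p H).isSmooth
    simp only [zero_add, Finset.range_one, Finset.sum_singleton] at h4
    rw [Finset.sum_range_succ, Finset.sum_range_one]
    simp only [Function.iterate_zero, id, Function.iterate_one]
    nlinarith [supD_nonneg 0 H.fn, supD_nonneg 0 (testA p H).fn]
  | k + 2, ih =>
    obtain ⟨C, hC, H⟩ := key k ih
    exact ⟨C, hC, fun F => (H F).trans (mul_le_mul_of_nonneg_left
      (mono (k + 2) (k + 2 + 1) (by omega) F) hC)⟩

end TestSpace

end ZeroRange

end

open MeasureTheory ProbabilityTheory Filter Set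
open scoped Topology ENNReal NNReal

noncomputable section

namespace ZeroRange

/-! ### The eigenfunction expansion in the space of test functions -/

/-- An expansion of the test functions along eigenvectors of `𝔄_θ`. -/
structure SpectralData (p : Params) where
  ι : Type
  countable : Countable ι
  lam : ι → ℝ
  lam_nonneg : ∀ i, 0 ≤ lam i
  e : ι → TestSpace p
  coef : ι → TestSpace p →ₗ[ℝ] ℝ
  testA_e : ∀ i, testA p (e i) = -lam i • e i
  coef_testA : ∀ i H, coef i (testA p H) = -lam i * coef i H
  summable_inv : Summable fun i => ((1 + lam i) ^ 2)⁻¹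
  exists_abs_coef_le : ∃ C, 0 ≤ C ∧ ∀ i H, |coef i H| ≤ C * supD 0 H.fn
  exists_supD_e_le : ∀ k, ∃ (C : ℝ) (m : ℕ), 0 ≤ C ∧ ∀ i, supD k (e i).fn ≤ C * (1 + lam i) ^ m
  hasSum : ∀ H, HasSum (fun i => coef i H • e i) H

section Spectral

variable {p : Params}

theorem continuous_weight (hp : p.Admissible) : Continuous (weight p) :=
  (isSmooth_weight hp).continuous

/-- The measure `du / Φ'(ρ̄_θ(u))`. -/
def weightMeasure (p : Params) : Measure unitInterval :=
  volume.withDensity fun u => ENNReal.ofReal (weight p u)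

theorem isFiniteMeasure_weightMeasure (hp : p.Admissible) : IsFiniteMeasure (weightMeasure p) :=
  isFiniteMeasure_withDensity_ofReal
    (integrable_of_continuous volume (continuous_weight hp)).hasFiniteIntegral

theorem integral_weightMeasure (hp : p.Admissible) (f : unitInterval → ℝ) :
    ∫ u, f u ∂(weightMeasure p) = ∫ u, f u * weight p u := by
  rw [weightMeasure, integral_withDensity_eq_integral_toReal_smul
    (continuous_weight hp).measurable.ennreal_ofReal
    (Eventually.of_forall fun _ => ENNReal.ofReal_lt_top)]
  refine integral_congr_ae (Eventually.of_forall fun u => ?_)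
  simp only [ENNReal.toReal_ofReal (weight_pos hp u).le, smul_eq_mul]
  ring

theorem opA_eq_of_D_two {φ : unitInterval → ℝ} {l : ℝ} (hp : p.Admissible)
    (h : D 2 φ = -l • (weight p * φ)) : opA p φ = -l • φ := by
  funext u
  rw [opA_eq, Pi.mul_apply, h]
  simp only [Pi.smul_apply, Pi.mul_apply, smul_eq_mul, weight]
  have := (hp.diffusivity_pos u.2).ne'
  field_simp

theorem iterate_opA_eq {φ : unitInterval → ℝ} {c : ℝ} (h : opA p φ = c • φ) (k : ℕ) :
    (opA p)^[k] φ = c ^ k • φ := by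
  induction k with
  | zero => simp
  | succ k ih => rw [Function.iterate_succ_apply', ih, opA_smul, h, smul_smul, pow_succ]

/-- An eigenfunction of `𝔄_θ` as a test function. -/
def eigenTest (φ : unitInterval → ℝ) (c : ℝ) (hs : IsSmooth φ) (hb : BoundaryCondition p φ)
    (h : opA p φ = c • φ) : TestSpace p :=
  ⟨(⟨φ, hs⟩ : ↥smoothSubmodule), fun k => by
    rw [show (opA p)^[k] (SmoothFun.toFun (⟨φ, hs⟩ : ↥smoothSubmodule)) = c ^ k • φ from
      iterate_opA_eq h k]
    exact ⟨hs.smul _, hb.smul _⟩⟩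

theorem integrable_mul_mul_weight (hp : p.Admissible) {f g : unitInterval → ℝ}
    (hf : Continuous f) (hg : Continuous g) :
    Integrable (fun u => f u * g u * weight p u) volume :=
  integrable_of_continuous volume ((hf.mul hg).mul (continuous_weight hp))

/-- The functional `H ↦ ∫ φ H / Φ'(ρ̄_θ)`. -/
def weightedCoef (hp : p.Admissible) (φ : unitInterval → ℝ) (hφ : Continuous φ) :
    TestSpace p →ₗ[ℝ] ℝ where
  toFun H := ∫ u, φ u * H.fn u * weight p u
  map_add' H G := by
    rw [← integral_add (integrable_mul_mul_weight hp hφ H.isSmooth.continuous)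
      (integrable_mul_mul_weight hp hφ G.isSmooth.continuous)]
    refine integral_congr_ae (Eventually.of_forall fun u => ?_)
    simp only [TestSpace.add_fn, Pi.add_apply]
    ring
  map_smul' c H := by
    rw [RingHom.id_apply, smul_eq_mul, ← integral_const_mul]
    refine integral_congr_ae (Eventually.of_forall fun u => ?_)
    simp only [TestSpace.smul_fn, Pi.smul_apply, smul_eq_mul]
    ring

theorem testA_iterate_sub_sum {ι : Type} (c : ι → ℝ) (e : ι → TestSpace p) (F : Finset ι)
    (H : TestSpace p) (j : ℕ) :
    (testA p)^[j] (H - ∑ i ∈ F, c i • e i)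
      = (testA p)^[j] H - ∑ i ∈ F, c i • (testA p)^[j] (e i) := by
  have h : ∀ G : TestSpace p, (testA p)^[j] G = ((testAL p) ^ j) G := fun G => by
    rw [Module.End.pow_apply]; rfl
  simp only [h, map_sub, map_sum, map_smul]

/-- The eigenfunctions come from the Green operator in L²(w du), and the Hilbert–Schmidt bound gives
the summability of (1 + λ_i)⁻². Parseval's identity holds on all of 𝒮_θ because the range of the
Green operator contains it. Applied to 𝔄^j H for every j, it makes the remainders of the expansion
tend to zero in all graph norms, and elliptic regularity turns this into convergence in 𝒮_θ. -/
theorem nonempty_spectralData (hp : p.Admissible) : Nonempty (SpectralData p) := by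
  classical
  obtain ⟨s, C, hG⟩ := exists_isGreen hp
  have hfin := isFiniteMeasure_weightMeasure hp
  have hkc : Continuous fun z : unitInterval × unitInterval => greenKernel s C z.1 z.2 := by
    have := hG.continuous
    unfold greenKernel
    fun_prop
  obtain ⟨ι, μ, φ, hι, hμ, hφ, hn, ho, hsum, hpars⟩ :=
    exists_eigenfunctions (weightMeasure p) (k := ⟨_, hkc⟩) fun x y => by
      simp only [ContinuousMap.coe_mk, greenKernel]
      rw [abs_sub_comm]; ring
  simp only [integral_weightMeasure hp, ContinuousMap.coe_mk] at hφ hn ho hpars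
  have hgr : ∀ (f : unitInterval → ℝ) (x : unitInterval),
      ∫ y, greenKernel s C x y * f y * weight p y = greenOp (weight p) s C f x := fun f x => by
    simp only [greenOp, mul_assoc]
  simp only [hgr] at hφ hpars
  choose l hl hsm hbc hD2 hlμ using fun i =>
    hG.eigen (φ i) (μ i) (φ i).continuous (hμ i) (hφ i) (hn i)
  have hop : ∀ i, opA p (φ i) = -l i • ⇑(φ i) := fun i => opA_eq_of_D_two hp (hD2 i)
  let e : ι → TestSpace p := fun i => eigenTest (φ i) (-l i) (hsm i) (hbc i) (hop i)
  have hefn : ∀ i, (e i).fn = φ i := fun i => rfl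
  let coef : ι → TestSpace p →ₗ[ℝ] ℝ := fun i => weightedCoef hp (φ i) (φ i).continuous
  have hcoef : ∀ i H, coef i H = ∫ u, φ i u * H.fn u * weight p u := fun i H => rfl
  have hAe : ∀ i, testA p (e i) = -l i • e i := fun i => TestSpace.ext_fn (hop i)
  have hcA : ∀ i H, coef i (testA p H) = -l i * coef i H := by
    intro i H
    have h1 : coef i (testA p H) = ∫ u, φ i u * D 2 H.fn u := by
      rw [hcoef]
      refine integral_congr_ae (Eventually.of_forall fun u => ?_)
      simp only [testA_fn, ← weight_mul_opA hp H.fn u]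
      ring
    rw [h1, ← integral_D_two_mul_symm (hsm i) H.isSmooth (hbc i) H.boundaryCondition, hcoef,
      ← integral_const_mul, hD2 i]
    refine integral_congr_ae (Eventually.of_forall fun u => ?_)
    simp only [Pi.smul_apply, Pi.mul_apply, smul_eq_mul]
    ring
  have hce : ∀ i, coef i (e i) = 1 := fun i => hn i
  have hce' : ∀ i j, i ≠ j → coef i (e j) = 0 := fun i j hij => ho i j hij
  -- Test functions satisfy the boundary condition, hence are Green potentials, for which only the
  -- non-zero eigenvalues contribute to Parseval's identity.
  have hP : ∀ H, HasSum (fun i => coef i H ^ 2) (weightedSq p H.fn) := by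
    intro H
    obtain ⟨g, hg, hgH⟩ := hG.range H.fn H.isSmooth H.boundaryCondition
    exact hpars ⟨g, hg⟩ ⟨H.fn, H.isSmooth.continuous⟩ hgH
  set W := ∫ u, weight p u with hW
  have hW0 : 0 ≤ W := integral_nonneg fun u => (weight_pos hp u).le
  have hcb : ∀ i H, |coef i H| ≤ Real.sqrt W * supD 0 H.fn := by
    intro i H
    have h1 : coef i H ^ 2 ≤ supD 0 H.fn ^ 2 * W :=
      (le_hasSum (hP H) i fun j _ => sq_nonneg _).trans (weightedSq_le hp H.isSmooth)
    have h2 := Real.abs_le_sqrt h1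
    rwa [Real.sqrt_mul (sq_nonneg _), Real.sqrt_sq (supD_nonneg _ _), mul_comm] at h2
  obtain ⟨B, hB, hB'⟩ := exists_supD_zero_le hp
  have hsup0 : ∀ i, supD 0 (e i).fn ≤ (1 + B) * (1 + l i) := by
    intro i
    have h1 := hB' (e i)
    have h2 : weightedSq p (e i).fn = 1 := hn i
    have h3 : weightedSq p (testA p (e i)).fn = l i ^ 2 := by
      have : weightedSq p (testA p (e i)).fn = l i ^ 2 * weightedSq p (e i).fn := by
        rw [hAe, weightedSq, weightedSq, ← integral_const_mul]
        refine integral_congr_ae (Eventually.of_forall fun u => ?_)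
        simp only [TestSpace.smul_fn, Pi.smul_apply, smul_eq_mul]
        ring
      rw [this, h2, mul_one]
    rw [h2, h3] at h1
    have h4 : 0 ≤ (1 + B) * (1 + l i) := mul_nonneg (by linarith) (by linarith [hl i])
    refine abs_le_of_sq_le_sq' ?_ h4 |>.2
    have := hl i
    have : B ≤ (1 + B) ^ 2 := by nlinarith
    have : 1 + l i ^ 2 ≤ (1 + l i) ^ 2 := by nlinarith
    calc _ ≤ _ := h1
      _ ≤ (1 + B) ^ 2 * (1 + l i) ^ 2 := by gcongr
      _ = _ := by ring
  have hAje : ∀ j i, (testA p)^[j] (e i) = (-l i) ^ j • e i := fun j i => by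
    induction j with
    | zero => simp
    | succ j ih =>
      rw [Function.iterate_succ_apply', ih, ← testAL_apply, map_smul, testAL_apply, hAe, smul_smul,
        pow_succ]
  have hsupk : ∀ k, ∃ (C : ℝ) (m : ℕ), 0 ≤ C ∧ ∀ i, supD k (e i).fn ≤ C * (1 + l i) ^ m := by
    intro k
    obtain ⟨C, hC, H⟩ := exists_supD_le hp k
    refine ⟨C * ((k + 1 : ℕ) * (1 + B)), k + 1, by positivity, fun i => (H (e i)).trans ?_⟩
    rw [mul_assoc]
    refine mul_le_mul_of_nonneg_left ?_ hC
    have h1 : ∀ j ∈ Finset.range (k + 1), supD 0 ((testA p)^[j] (e i)).fn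
        ≤ (1 + B) * (1 + l i) ^ (k + 1) := by
      intro j hj
      have hj' := Finset.mem_range.1 hj
      have hli := hl i
      rw [hAje, ← testSeminorm_apply, map_smul_eq_mul, testSeminorm_apply, norm_pow, norm_neg,
        Real.norm_of_nonneg hli]
      calc l i ^ j * supD 0 (e i).fn ≤ (1 + l i) ^ j * ((1 + B) * (1 + l i)) :=
            mul_le_mul (pow_le_pow_left₀ hli (by linarith) _) (hsup0 i) (supD_nonneg _ _)
              (by positivity)
        _ = (1 + B) * (1 + l i) ^ (j + 1) := by ring
        _ ≤ _ := by
          refine mul_le_mul_of_nonneg_left (pow_le_pow_right₀ (by linarith) (by omega))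
            (by linarith)
    have h2 := Finset.sum_le_sum h1
    rw [Finset.sum_const, Finset.card_range, nsmul_eq_mul] at h2
    linarith
  refine ⟨⟨ι, hι, l, hl, e, coef, hAe, hcA, hsum.of_nonneg_of_le (fun i => by positivity) hlμ,
    ⟨_, Real.sqrt_nonneg W, hcb⟩, hsupk, fun H => ?_⟩⟩
  -- Subtracting a partial sum annihilates the coefficients with index in F and leaves the others
  -- unchanged, also after applying 𝔄^j.
  have hcR : ∀ (F : Finset ι) (j : ℕ) (i : ι),
      coef i ((testA p)^[j] (H - ∑ i ∈ F, coef i H • e i)) ^ 2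
        = coef i ((testA p)^[j] H) ^ 2 - (if i ∈ F then coef i ((testA p)^[j] H) ^ 2 else 0) := by
    intro F j i
    have hcj : coef i ((testA p)^[j] H) = (-l i) ^ j * coef i H := by
      induction j with
      | zero => simp
      | succ j ih => rw [Function.iterate_succ_apply', hcA, ih]; ring
    rw [testA_iterate_sub_sum]
    simp only [hAje, map_sub, map_sum, map_smul, smul_eq_mul]
    by_cases hi : i ∈ F
    · rw [Finset.sum_eq_single i (fun k _ hk => by rw [hce' i k hk.symm]; ring)
        (fun h => absurd hi h), hce, hcj, if_pos hi]
      ring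
    · rw [Finset.sum_eq_zero fun k hk => by
        rw [hce' i k (fun h => hi (h ▸ hk))]; ring, if_neg hi]
      ring
  -- The weighted norm of the remainder is the tail of the Parseval series of 𝔄^j H.
  have hN : ∀ j, Tendsto (fun F : Finset ι =>
      weightedSq p ((testA p)^[j] (H - ∑ i ∈ F, coef i H • e i)).fn) atTop (𝓝 0) := by
    intro j
    have h1 : ∀ F : Finset ι, weightedSq p ((testA p)^[j] (H - ∑ i ∈ F, coef i H • e i)).fn
        = weightedSq p ((testA p)^[j] H).fn - ∑ i ∈ F, coef i ((testA p)^[j] H) ^ 2 := by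
      intro F
      have h2 := hP ((testA p)^[j] (H - ∑ i ∈ F, coef i H • e i))
      simp only [hcR] at h2
      refine h2.unique ((hP _).sub ?_)
      have h3 := hasSum_sum_of_ne_finset_zero (s := F) (L := SummationFilter.unconditional ι)
        (f := fun i => if i ∈ F then coef i ((testA p)^[j] H) ^ 2 else 0)
        (fun i hi => if_neg hi)
      rwa [Finset.sum_congr rfl fun i hi => if_pos hi] at h3
    simp only [h1]
    have := (tendsto_const_nhds (x := weightedSq p ((testA p)^[j] H).fn)).sub
      (hP ((testA p)^[j] H))
    simpa using this
  have hS : ∀ j, Tendsto (fun F : Finset ι =>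
      supD 0 ((testA p)^[j] (H - ∑ i ∈ F, coef i H • e i)).fn) atTop (𝓝 0) := by
    intro j
    have h1 : Tendsto (fun F : Finset ι => Real.sqrt (B *
        (weightedSq p ((testA p)^[j] (H - ∑ i ∈ F, coef i H • e i)).fn
          + weightedSq p ((testA p)^[j + 1] (H - ∑ i ∈ F, coef i H • e i)).fn)))
        atTop (𝓝 0) := by
      have := (((hN j).add (hN (j + 1))).const_mul B).sqrt
      simpa using this
    refine squeeze_zero (fun _ => supD_nonneg _ _) (fun F => ?_) h1
    have h2 := hB' ((testA p)^[j] (H - ∑ i ∈ F, coef i H • e i))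
    rw [← Function.iterate_succ_apply' (testA p)] at h2
    exact Real.le_sqrt_of_sq_le h2
  rw [HasSum, SummationFilter.unconditional_filter, withSeminorms_testSpace.tendsto_nhds]
  intro k ε hε
  obtain ⟨K, hK, hK'⟩ := exists_supD_le hp k
  have h1 : Tendsto (fun F : Finset ι => K * ∑ j ∈ Finset.range (k + 1),
      supD 0 ((testA p)^[j] (H - ∑ i ∈ F, coef i H • e i)).fn) atTop (𝓝 0) := by
    have := (tendsto_finsetSum (Finset.range (k + 1)) fun j _ => hS j).const_mul K
    simpa using this
  filter_upwards [h1.eventually (gt_mem_nhds hε)] with F hF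
  rw [map_sub_rev, testSeminorm_apply]
  exact (hK' _).trans_lt hF

end Spectral

namespace SpectralData

variable {p : Params} (S : SpectralData p)

instance : Countable S.ι := S.countable

theorem one_le (i : S.ι) : 1 ≤ 1 + S.lam i := by linarith [S.lam_nonneg i]

theorem one_add_pos (i : S.ι) : 0 < 1 + S.lam i := by linarith [S.lam_nonneg i]

/-- The operator 1 - 𝔄 multiplies the i-th coefficient by 1 + λ_i and is continuous on 𝒮_θ, so its
powers give decay of any polynomial order. -/
theorem exists_pow_mul_abs_coef_le (hp : p.Admissible) (m : ℕ) :
    ∃ q : Seminorm ℝ (TestSpace p), Continuous q ∧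
      ∀ i H, (1 + S.lam i) ^ m * |S.coef i H| ≤ q H := by
  obtain ⟨C, hC, h⟩ := S.exists_abs_coef_le
  have hA := continuous_testAL hp
  set B : Module.End ℝ (TestSpace p) := LinearMap.id - testAL p with hBdef
  have hB : Continuous B := continuous_id.sub hA
  refine ⟨C.toNNReal • (testSeminorm p 0).comp (B ^ m), ?_, fun i H => ?_⟩
  · have h1 : Continuous (B ^ m) := by
      rw [Module.End.coe_pow]; exact hB.iterate m
    exact ((continuous_testSeminorm 0).comp h1).const_smul C.toNNReal
  · have h2 : S.coef i ((B ^ m) H) = (1 + S.lam i) ^ m * S.coef i H := by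
      induction m with
      | zero => simp
      | succ m ih =>
        rw [pow_succ', Module.End.mul_apply, LinearMap.sub_apply, map_sub, testAL_apply,
          S.coef_testA, LinearMap.id_apply, ih]
        ring
    have h3 := h i ((B ^ m) H)
    rw [h2, abs_mul, abs_of_nonneg (pow_nonneg (S.one_add_pos i).le m)] at h3
    refine h3.trans (le_of_eq ?_)
    rw [smul_apply, Seminorm.comp_apply, testSeminorm_apply, NNReal.smul_def, smul_eq_mul,
      Real.coe_toNNReal _ hC]

end SpectralData

end ZeroRange

end

open MeasureTheory ProbabilityTheory Filter Set
open scoped Topology ENNReal NNReal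

noncomputable section

namespace ZeroRange

/-! ### The covariance forms as inner products -/

section Forms

variable {p : Params}

theorem continuous_fugacity (p : Params) :
    Continuous fun u : unitInterval => fugacity p u :=
  (contDiff_fugacity p).continuous.comp continuous_subtype_val

theorem isFiniteMeasure_withDensity_of_continuous {f : unitInterval → ℝ} (hf : Continuous f) :
    IsFiniteMeasure (volume.withDensity fun u => ENNReal.ofReal (f u)) :=
  isFiniteMeasure_withDensity_ofReal (integrable_of_continuous volume hf).hasFiniteIntegral

theorem integral_withDensity_ofReal {f : unitInterval → ℝ} (hf : Continuous f)
    (h0 : ∀ u, 0 ≤ f u) (g : unitInterval → ℝ) :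
    ∫ u, g u ∂(volume.withDensity fun u => ENNReal.ofReal (f u)) = ∫ u, f u * g u := by
  rw [integral_withDensity_eq_integral_toReal_smul hf.measurable.ennreal_ofReal
    (Eventually.of_forall fun _ => ENNReal.ofReal_lt_top)]
  refine integral_congr_ae (Eventually.of_forall fun u => ?_)
  simp only [ENNReal.toReal_ofReal (h0 u), smul_eq_mul]

/-- A linear map from the test functions to the continuous functions, composed with the inclusion
into `L²(ρ)`. -/
theorem exists_toLp (ρ : Measure unitInterval) [IsFiniteMeasure ρ]
    (L : TestSpace p →ₗ[ℝ] (unitInterval → ℝ)) (hL : ∀ H, Continuous (L H)) :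
    ∃ b : TestSpace p →ₗ[ℝ] Lp ℝ 2 ρ, ∀ H G, inner ℝ (b H) (b G) = ∫ u, L H u * L G u ∂ρ := by
  let c : TestSpace p →ₗ[ℝ] C(unitInterval, ℝ) :=
    { toFun := fun H => ⟨L H, hL H⟩
      map_add' := fun H G => ContinuousMap.ext fun u => by simp
      map_smul' := fun a H => ContinuousMap.ext fun u => by simp }
  exact ⟨(ContinuousMap.toLp 2 ρ ℝ).toLinearMap ∘ₗ c, fun H G => inner_toLp_toLp ρ (c H) (c G)⟩

theorem continuous_of_norm_le {E : Type} [NormedAddCommGroup E] [NormedSpace ℝ E]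
    (b : TestSpace p →ₗ[ℝ] E) (C : ℝ) (k : ℕ) (hC : 0 ≤ C)
    (h : ∀ H, ‖b H‖ ≤ C * supD k H.fn) : Continuous b := by
  refine withSeminorms_testSpace.continuous_of_isBounded (norm_withSeminorms ℝ E) b fun _ =>
    ⟨{k}, C.toNNReal, fun H => ?_⟩
  rw [Seminorm.comp_apply, coe_normSeminorm, Finset.sup_singleton, smul_apply, NNReal.smul_def,
    Real.coe_toNNReal _ hC, testSeminorm_apply]
  exact h H

theorem norm_le_of_inner_eq {E : Type} [NormedAddCommGroup E] [InnerProductSpace ℝ E]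
    {ρ : Measure unitInterval} [IsFiniteMeasure ρ] {x : E} {f : unitInterval → ℝ}
    (hf : Continuous f) (h : inner ℝ x x = ∫ u, f u * f u ∂ρ) {s : ℝ} (hs0 : 0 ≤ s)
    (hs : ∀ u, |f u| ≤ s) : ‖x‖ ≤ Real.sqrt (ρ.real univ) * s := by
  rw [real_inner_self_eq_norm_sq] at h
  have h1 : ‖x‖ ^ 2 ≤ ρ.real univ * s ^ 2 := by
    rw [h, ← smul_eq_mul, ← integral_const]
    refine integral_mono (integrable_of_continuous ρ (hf.mul hf)) (integrable_const _) fun u => ?_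
    show f u * f u ≤ s ^ 2
    rw [← pow_two, ← sq_abs]
    exact pow_le_pow_left₀ (abs_nonneg _) (hs u) 2
  have h2 := Real.le_sqrt_of_sq_le h1
  rwa [Real.sqrt_mul measureReal_nonneg, Real.sqrt_sq hs0] at h2

/-- The initial covariance is the inner product of a Hilbert space. -/
theorem exists_initialForm (hp : p.Admissible) :
    ∃ (E : Type) (_ : NormedAddCommGroup E) (_ : InnerProductSpace ℝ E) (_ : CompleteSpace E)
      (b : TestSpace p →ₗ[ℝ] E), (∃ C, 0 ≤ C ∧ ∀ H, ‖b H‖ ≤ C * supD 0 H.fn) ∧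
      ∀ H G, inner ℝ (b H) (b G) = ∫ u in (0 : ℝ)..1, ext H.fn u * ext G.fn u * chi p u := by
  have hf : Continuous fun u : unitInterval => siteVar p.g (fugacity p u) :=
    continuousOn_iff_continuous_domRestrict.1 hp.contDiffOn_siteVar_fugacity.continuousOn
  have h0 : ∀ u : unitInterval, 0 ≤ siteVar p.g (fugacity p u) := fun u =>
    (siteVar_pos hp.g_pos (hp.fugacity_mem u.2)).le
  have hfin := isFiniteMeasure_withDensity_of_continuous hf
  obtain ⟨b, hb⟩ := exists_toLp (p := p)
    (volume.withDensity fun u : unitInterval => ENNReal.ofReal (siteVar p.g (fugacity p u)))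
    (TestSpace.fnL p) (fun H => H.isSmooth.continuous)
  refine ⟨_, _, _, inferInstance, b, ⟨_, Real.sqrt_nonneg _, fun H => norm_le_of_inner_eq
    H.isSmooth.continuous (hb H H) (supD_nonneg _ _) (abs_le_supD_zero H.isSmooth)⟩, fun H G => ?_⟩
  rw [hb, integral_withDensity_ofReal hf h0, integral_unitInterval]
  refine intervalIntegral.integral_congr fun x hx => ?_
  rw [uIcc_of_le zero_le_one] at hx
  simp only [TestSpace.fnL_apply]
  rw [ext_of_mem _ hx, ext_of_mem _ hx, ext_of_mem _ hx, chi_eq hp hx]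
  simp only
  ring

/-- The square of the norm of `L^{2,θ}` of the gradient is the square of a Hilbert norm. -/
theorem exists_noiseForm (hp : p.Admissible) :
    ∃ (E : Type) (_ : NormedAddCommGroup E) (_ : InnerProductSpace ℝ E) (_ : CompleteSpace E)
      (b : TestSpace p →ₗ[ℝ] E), (∃ C, 0 ≤ C ∧ ∀ H, ‖b H‖ ≤ C * supD 1 H.fn) ∧
      ∀ H, ‖b H‖ ^ 2 = normSq p (D 1 H.fn) := by
  have hm0 : (0 : ℝ) ∈ Icc (0 : ℝ) 1 := left_mem_Icc.2 zero_le_one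
  have hm1 : (1 : ℝ) ∈ Icc (0 : ℝ) 1 := right_mem_Icc.2 zero_le_one
  have hf : Continuous fun u : unitInterval => 2 * fugacity p u :=
    continuous_const.mul (continuous_fugacity p)
  have h0 : ∀ u : unitInterval, 0 ≤ 2 * fugacity p u := fun u => by
    have := (hp.fugacity_mem u.2).1; positivity
  have hfin := isFiniteMeasure_withDensity_of_continuous hf
  set c0 : ℝ := if p.θ = 1 then p.α / p.lam ^ 2 + Phi p.g (rhoBar p 0) / p.lam else 0 with hc0
  set c1 : ℝ := if p.θ = 1 then p.β / p.δ ^ 2 + Phi p.g (rhoBar p 1) / p.δ else 0 with hc1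
  have e0 : 0 ≤ c0 := by
    rw [hc0, hp.Phi_rhoBar hm0]
    have := (hp.fugacity_mem hm0).1
    have := hp.α_pos
    have := hp.lam_pos
    split_ifs <;> positivity
  have e1 : 0 ≤ c1 := by
    rw [hc1, hp.Phi_rhoBar hm1]
    have := (hp.fugacity_mem hm1).1
    have := hp.β_pos
    have := hp.δ_pos
    split_ifs <;> positivity
  let μ₁ : Measure unitInterval := volume.withDensity fun u => ENNReal.ofReal (2 * fugacity p u)
  -- The boundary terms of the norm become Dirac masses at the endpoints; their weights are zero
  -- unless θ = 1.
  let ρ : Measure unitInterval := μ₁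
    + (c0.toNNReal • Measure.dirac (0 : unitInterval) + c1.toNNReal • Measure.dirac 1)
  let L : TestSpace p →ₗ[ℝ] (unitInterval → ℝ) :=
    { toFun := fun H => D 1 H.fn
      map_add' := fun H G => D_add 1 H.isSmooth G.isSmooth
      map_smul' := fun c H => D_smul 1 c H.fn }
  have hL : ∀ H, Continuous (L H) := fun H => (isSmooth_D_one H.isSmooth).continuous
  obtain ⟨b, hb⟩ := exists_toLp (p := p) ρ L hL
  refine ⟨_, _, _, inferInstance, b, ⟨_, Real.sqrt_nonneg _, fun H => norm_le_of_inner_eq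
    (hL H) (hb H H) (supD_nonneg _ _) (abs_D_le 1 H.isSmooth)⟩, fun H => ?_⟩
  rw [← real_inner_self_eq_norm_sq, hb]
  have hi : ∀ μ : Measure unitInterval, ∀ _ : IsFiniteMeasure μ,
      Integrable (fun u => L H u * L H u) μ := fun μ _ =>
    integrable_of_continuous μ ((hL H).mul (hL H))
  rw [integral_add_measure (hi _ inferInstance) (hi _ inferInstance),
    integral_add_measure (hi _ inferInstance) (hi _ inferInstance), integral_smul_nnreal_measure,
    integral_smul_nnreal_measure, integral_dirac, integral_dirac,
    integral_withDensity_ofReal hf h0, normSq, NNReal.smul_def, NNReal.smul_def,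
    Real.coe_toNNReal _ e0, Real.coe_toNNReal _ e1, smul_eq_mul, smul_eq_mul, ← add_assoc]
  have e2 : ∫ u : unitInterval, 2 * fugacity p u * (L H u * L H u)
      = 2 * ∫ u in (0 : ℝ)..1, Phi p.g (rhoBar p u) * ext (D 1 H.fn) u * ext (D 1 H.fn) u := by
    rw [integral_unitInterval, ← intervalIntegral.integral_const_mul]
    refine intervalIntegral.integral_congr fun x hx => ?_
    rw [uIcc_of_le zero_le_one] at hx
    rw [ext_of_mem _ hx, ext_of_mem _ hx, hp.Phi_rhoBar hx]
    change 2 * fugacity p x * (D 1 H.fn ⟨x, hx⟩ * D 1 H.fn ⟨x, hx⟩) = _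
    ring
  rw [e2]
  congr 1
  · congr 1
    rw [hc0]
    change _ * (D 1 H.fn 0 * D 1 H.fn 0) = _
    split_ifs <;> ring
  · rw [hc1]
    change _ * (D 1 H.fn 1 * D 1 H.fn 1) = _
    split_ifs <;> ring

end Forms

end ZeroRange

end

open MeasureTheory ProbabilityTheory Filter Set
open scoped Topology ENNReal NNReal

noncomputable section

namespace ZeroRange

/-! ### Isonormal Gaussian processes -/

section Isonormal

theorem norm_exp_mul_I_sub_exp_mul_I_le (x y : ℝ) :
    ‖Complex.exp (x * Complex.I) - Complex.exp (y * Complex.I)‖ ≤ |x - y| := by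
  have h : Complex.exp (x * Complex.I) - Complex.exp (y * Complex.I)
      = Complex.exp (y * Complex.I) * (Complex.exp (Complex.I * ((x - y : ℝ) : ℂ)) - 1) := by
    rw [mul_sub, mul_one, ← Complex.exp_add]
    congr 2
    push_cast
    ring
  rw [h, norm_mul, Complex.norm_exp_ofReal_mul_I, one_mul, ← Real.norm_eq_abs]
  exact Real.norm_exp_I_mul_ofReal_sub_one_le

theorem integral_abs_le_norm_Lp {Ω : Type*} [MeasurableSpace Ω] {P : Measure Ω}
    [IsProbabilityMeasure P] (f : Lp ℝ 2 P) : ∫ ω, |f ω| ∂P ≤ ‖f‖ := by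
  have h1 : (∫⁻ ω, ‖f ω‖ₑ ∂P) ≤ eLpNorm f 2 P := by
    rw [← eLpNorm_one_eq_lintegral_enorm]
    exact eLpNorm_le_eLpNorm_of_exponent_le (by norm_num) (Lp.aestronglyMeasurable f)
  have h2 : ∫ ω, |f ω| ∂P = (∫⁻ ω, ‖f ω‖ₑ ∂P).toReal :=
    integral_norm_eq_lintegral_enorm (Lp.aestronglyMeasurable f)
  rw [h2, Lp.norm_def]
  exact ENNReal.toReal_mono (Lp.eLpNorm_ne_top f) h1

theorem charFun_map {Ω : Type*} [MeasurableSpace Ω] {P : Measure Ω} {X : Ω → ℝ}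
    (hX : AEMeasurable X P) (t : ℝ) :
    charFun (P.map X) t = ∫ ω, Complex.exp (((t * X ω : ℝ) : ℂ) * Complex.I) ∂P := by
  rw [charFun_apply_real, integral_map hX (by fun_prop)]
  push_cast
  rfl

theorem integrable_exp_mul_I {Ω : Type*} [MeasurableSpace Ω] {P : Measure Ω}
    [IsFiniteMeasure P] {X : Ω → ℝ} (hX : AEMeasurable X P) :
    Integrable (fun ω => Complex.exp ((X ω : ℂ) * Complex.I)) P :=
  Integrable.of_bound (by fun_prop) 1
    (Eventually.of_forall fun ω => (Complex.norm_exp_ofReal_mul_I _).le)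

/-- Because x ↦ exp(ix) is 1-Lipschitz, the difference of the characteristic functions is at most
|t| times the L² distance. This passes Gaussian laws to L² limits. -/
theorem tendsto_charFun_of_tendsto_Lp {Ω α : Type*} [MeasurableSpace Ω] {P : Measure Ω}
    [IsProbabilityMeasure P] {l : Filter α} {f : α → Lp ℝ 2 P} {g : Lp ℝ 2 P}
    (h : Tendsto f l (𝓝 g)) (t : ℝ) :
    Tendsto (fun a => charFun (P.map (f a)) t) l (𝓝 (charFun (P.map g) t)) := by
  have hm : ∀ f : Lp ℝ 2 P, AEMeasurable f P := fun f => (Lp.aestronglyMeasurable f).aemeasurable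
  rw [tendsto_iff_norm_sub_tendsto_zero] at h ⊢
  have h1 : Tendsto (fun a => |t| * ‖f a - g‖) l (𝓝 0) := by simpa using h.const_mul |t|
  refine squeeze_zero (fun _ => norm_nonneg _) (fun a => ?_) h1
  rw [charFun_map (hm _), charFun_map (hm _), ← integral_sub
    (integrable_exp_mul_I ((hm (f a)).const_mul t)) (integrable_exp_mul_I ((hm g).const_mul t))]
  refine (norm_integral_le_integral_norm _).trans ?_
  refine le_trans ?_ (mul_le_mul_of_nonneg_left (integral_abs_le_norm_Lp (f a - g)) (abs_nonneg t))
  rw [← integral_const_mul]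
  refine integral_mono_of_nonneg (Eventually.of_forall fun _ => norm_nonneg _) ?_ ?_
  · exact ((Lp.memLp (f a - g)).integrable (by norm_num)).abs.const_mul _
  · filter_upwards [Lp.coeFn_sub (f a) g] with ω hω
    refine (norm_exp_mul_I_sub_exp_mul_I_le _ _).trans ?_
    rw [hω, Pi.sub_apply, ← abs_mul, mul_sub]

/-- An isometry into a space of square integrable random variables with centred Gaussian laws. -/
structure IsIsonormal {E Ω : Type*} [NormedAddCommGroup E] [InnerProductSpace ℝ E]
    [MeasurableSpace Ω] (P : Measure Ω) (W : E →ₗᵢ[ℝ] Lp ℝ 2 P) : Prop where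
  isProbabilityMeasure : IsProbabilityMeasure P
  map_eq : ∀ v, P.map (W v) = gaussianReal 0 (‖v‖₊ ^ 2)

/-- Independent standard Gaussian coordinates indexed by a Hilbert basis are orthonormal in L²,
which defines the isometry. Images of finite combinations are Gaussian by independence; the general
case follows by convergence of characteristic functions. -/
theorem exists_isIsonormal (E : Type) [NormedAddCommGroup E] [InnerProductSpace ℝ E]
    [CompleteSpace E] :
    ∃ (Ω : Type) (_ : MeasurableSpace Ω) (P : Measure Ω) (W : E →ₗᵢ[ℝ] Lp ℝ 2 P),
      IsIsonormal P W := by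
  classical
  obtain ⟨I, b, -⟩ := exists_hilbertBasis ℝ E
  let P : Measure (I → ℝ) := Measure.infinitePi fun _ => gaussianReal 0 1
  have hev : ∀ i : I, P.map (fun ω => ω i) = gaussianReal 0 1 := fun i =>
    Measure.infinitePi_map_eval _ i
  have hind : iIndepFun (fun (i : I) (ω : I → ℝ) => ω i) P :=
    iIndepFun_infinitePi (P := fun _ : I => gaussianReal 0 1) (X := fun _ x => x)
      (fun _ => measurable_id)
  have hg : ∀ i : I, HasGaussianLaw (fun ω : I → ℝ => ω i) P := fun i =>
    ⟨by rw [hev]; infer_instance⟩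
  have hmem : ∀ i : I, MemLp (fun ω : I → ℝ => ω i) 2 P := fun i => (hg i).memLp_two
  have hmean : ∀ i : I, ∫ ω, ω i ∂P = 0 := fun i => by
    have := integral_map (μ := P) (φ := fun ω : I → ℝ => ω i) (measurable_pi_apply i).aemeasurable
      (f := fun x : ℝ => x) (by fun_prop)
    rw [← this, hev, integral_id_gaussianReal]
  have hsq : ∀ i : I, ∫ ω, ω i * ω i ∂P = 1 := fun i => by
    have h1 := integral_map (μ := P) (φ := fun ω : I → ℝ => ω i)
      (measurable_pi_apply i).aemeasurable (f := fun x : ℝ => x * x) (by fun_prop)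
    rw [← h1, hev]
    have h2 := variance_fun_id_gaussianReal (μ := 0) (v := 1)
    rw [variance_of_integral_eq_zero (by fun_prop) integral_id_gaussianReal] at h2
    simpa [pow_two] using h2
  let ξ : I → Lp ℝ 2 P := fun i => (hmem i).toLp
  have hinner : ∀ i j, inner ℝ (ξ i) (ξ j) = ∫ ω, ω j * ω i ∂P := fun i j => by
    rw [L2.inner_def]
    refine integral_congr_ae ?_
    filter_upwards [(hmem i).coeFn_toLp, (hmem j).coeFn_toLp] with ω h1 h2
    simp only [ξ, h1, h2]
    rfl
  have hξ : Orthonormal ℝ ξ := by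
    rw [orthonormal_iff_ite]
    intro i j
    rw [hinner]
    split_ifs with h
    · rw [h, hsq]
    · have := (hind.indepFun (Ne.symm h)).integral_fun_mul_eq_mul_integral
        (hmem j).aestronglyMeasurable (hmem i).aestronglyMeasurable
      rw [this, hmean, zero_mul]
  let W : E →ₗᵢ[ℝ] Lp ℝ 2 P :=
    hξ.orthogonalFamily.linearIsometry.comp b.repr.toLinearIsometry
  have hPP : IsProbabilityMeasure P := inferInstance
  refine ⟨I → ℝ, inferInstance, P, W, hPP, fun v => ?_⟩
  have hWb : ∀ i, W (b i) = ξ i := fun i => by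
    change hξ.orthogonalFamily.linearIsometry (b.repr (b i)) = _
    rw [b.repr_self, OrthogonalFamily.linearIsometry_apply_single]
    simp
  have key : ∀ (c : I → ℝ) (F : Finset I), P.map (W (∑ i ∈ F, c i • b i))
      = gaussianReal 0 (‖∑ i ∈ F, c i • b i‖₊ ^ 2) := by
    intro c F
    have h1 : (W (∑ i ∈ F, c i • b i) : (I → ℝ) → ℝ)
        =ᵐ[P] fun ω => ∑ i : F, c i * ω i := by
      have h2 : W (∑ i ∈ F, c i • b i) = ∑ i ∈ F, c i • ξ i := by
        rw [map_sum]
        simp only [map_smul, hWb]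
      have h3 : ∀ F : Finset I, (∑ i ∈ F, c i • ξ i : Lp ℝ 2 P)
          =ᵐ[P] fun ω => ∑ i ∈ F, c i * ω i := by
        intro F
        induction F using Finset.induction_on with
        | empty =>
          simp only [Finset.sum_empty]
          exact Lp.coeFn_zero _ _ _
        | insert i F hi ih =>
          simp only [Finset.sum_insert hi]
          filter_upwards [Lp.coeFn_add (c i • ξ i) (∑ i ∈ F, c i • ξ i), ih,
            Lp.coeFn_smul (c i) (ξ i), (hmem i).coeFn_toLp] with ω g1 g2 g3 g4
          rw [g1, Pi.add_apply, g2, g3, Pi.smul_apply, g4, smul_eq_mul]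
      rw [h2]
      refine (h3 F).trans (Eventually.of_forall fun ω => ?_)
      exact (Finset.sum_coe_sort F fun i => c i * ω i).symm
    have h4 : HasGaussianLaw (fun ω : I → ℝ => ∑ i : F, c i * ω i) P := by
      refine iIndepFun.hasGaussianLaw_fun_sum (X := fun (i : F) (ω : I → ℝ) => c i * ω i)
        (fun i => (hg i).fun_smul (c i)) ?_
      have h5 := hind.precomp (g := fun i : F => (i : I)) Subtype.val_injective
      exact h5.comp (fun i x => c i * x) fun i => by fun_prop
    have h5 : HasGaussianLaw (W (∑ i ∈ F, c i • b i)) P := h4.congr h1.symm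
    have h6 : ∫ ω, W (∑ i ∈ F, c i • b i) ω ∂P = 0 := by
      rw [integral_congr_ae h1, integral_finsetSum (f := fun (i : F) (ω : I → ℝ) => c i * ω i)
        Finset.univ fun i _ => ((hmem i).integrable (by norm_num)).const_mul _]
      simp [integral_const_mul, hmean]
    have h7 : Var[W (∑ i ∈ F, c i • b i); P] = ‖∑ i ∈ F, c i • b i‖ ^ 2 := by
      rw [variance_of_integral_eq_zero h5.aemeasurable h6, ← W.norm_map,
        ← real_inner_self_eq_norm_sq, L2.inner_def]
      refine integral_congr_ae (Eventually.of_forall fun ω => ?_)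
      simp [pow_two]
    rw [h5.map_eq_gaussianReal, h6, h7]
    congr 1
    rw [Real.toNNReal_pow (norm_nonneg _), norm_toNNReal]
  have hlim : Tendsto (fun F : Finset I => ∑ i ∈ F, b.repr v i • b i) atTop (𝓝 v) :=
    b.hasSum_repr v
  have : IsProbabilityMeasure (P.map (W v)) :=
    Measure.isProbabilityMeasure_map (Lp.aestronglyMeasurable _).aemeasurable
  refine Measure.ext_of_charFun (funext fun t => ?_)
  have h1 := tendsto_charFun_of_tendsto_Lp ((W.continuous.tendsto v).comp hlim) t
  refine tendsto_nhds_unique h1 ?_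
  simp only [Function.comp_apply, key, charFun_gaussianReal]
  have h2 : Tendsto (fun F : Finset I => ‖∑ i ∈ F, b.repr v i • b i‖) atTop (𝓝 ‖v‖) := hlim.norm
  have h3 : Continuous fun x : ℝ => Complex.exp ((t : ℂ) * ((0 : ℝ) : ℂ) * Complex.I
      - ((x ^ 2 : ℝ) : ℂ) * t ^ 2 / 2) := by fun_prop
  have h4 := (h3.tendsto ‖v‖).comp h2
  simpa [Function.comp_def] using h4

namespace IsIsonormal

variable {E Ω : Type*} [NormedAddCommGroup E] [InnerProductSpace ℝ E]
  [mΩ : MeasurableSpace Ω] {P : Measure Ω} {W : E →ₗᵢ[ℝ] Lp ℝ 2 P}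

theorem hasGaussianLaw (h : IsIsonormal P W) (v : E) : HasGaussianLaw (W v) P :=
  ⟨by rw [h.map_eq]; infer_instance⟩

theorem aemeasurable (v : E) : AEMeasurable (W v) P :=
  (Lp.aestronglyMeasurable (W v)).aemeasurable

theorem integral_eq_zero (h : IsIsonormal P W) (v : E) : ∫ ω, W v ω ∂P = 0 := by
  have := integral_map (μ := P) (φ := W v) (aemeasurable v) (f := fun x : ℝ => x) (by fun_prop)
  rw [← this, h.map_eq, integral_id_gaussianReal]

theorem integral_mul (W : E →ₗᵢ[ℝ] Lp ℝ 2 P) (v w : E) :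
    ∫ ω, W v ω * W w ω ∂P = inner ℝ v w := by
  rw [← W.inner_map_map, L2.inner_def]
  refine integral_congr_ae (Eventually.of_forall fun ω => ?_)
  simp [mul_comm]

/-- The fourth moment of the standard Gaussian law. -/
def gaussianFourthMoment : ℝ := ∫ x, x ^ 4 ∂(gaussianReal 0 1)

theorem memLp_four (h : IsIsonormal P W) (v : E) : MemLp (W v) 4 P :=
  (h.hasGaussianLaw v).memLp (by norm_num)

/-- Scaling of the centred Gaussian law. The value of the constant plays no role in what follows. -/
theorem integral_pow_four (h : IsIsonormal P W) (v : E) :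
    ∫ ω, W v ω ^ 4 ∂P = gaussianFourthMoment * ‖v‖ ^ 4 := by
  have h1 := integral_map (μ := P) (φ := W v) (aemeasurable v) (f := fun x : ℝ => x ^ 4)
    (by fun_prop)
  have h2 := gaussianReal_map_const_mul (μ := 0) (v := 1) ‖v‖
  have h3 : gaussianReal 0 (‖v‖₊ ^ 2) = (gaussianReal 0 1).map (fun x => ‖v‖ * x) := by
    rw [h2, mul_zero, mul_one]
    congr 1
  rw [← h1, h.map_eq, h3, integral_map (by fun_prop) (by fun_prop), gaussianFourthMoment,
    ← integral_mul_const]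
  refine integral_congr_ae (Eventually.of_forall fun x => ?_)
  simp only
  ring

/-- Random variables that are almost surely values of an isonormal process form a Gaussian
process. -/
theorem isGaussian_family (h : IsIsonormal P W) {S : Type*} {X : S → Ω → ℝ} {v : S → E}
    (hX : ∀ s, X s =ᵐ[P] W (v s)) : IsGaussianProcess X P where
  hasGaussianLaw I := by
    classical
    have hP := h.isProbabilityMeasure
    constructor
    have hm : AEMeasurable (fun ω => I.restrict (X · ω)) P := by
      refine aemeasurable_pi_lambda _ fun i => ?_
      exact (aemeasurable (v i)).congr (hX i).symm
    refine isGaussian_of_isGaussian_map fun L => ?_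
    rw [AEMeasurable.map_map_of_aemeasurable (by fun_prop) hm]
    have h1 : (L ∘ fun ω => I.restrict (X · ω))
        =ᵐ[P] W (∑ i : I, L (Pi.single i 1) • v i) := by
      have h2 : ∀ᵐ ω ∂P, ∀ i : I, X i ω = W (v i) ω := ae_all_iff.2 fun i => hX i
      have h3 : ∀ (F : Finset I) (c : I → ℝ), W (∑ i ∈ F, c i • v i)
          =ᵐ[P] fun ω => ∑ i ∈ F, c i * W (v i) ω := by
        intro F c
        induction F using Finset.induction_on with
        | empty =>
          simp only [Finset.sum_empty, map_zero]
          exact Lp.coeFn_zero _ _ _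
        | insert i F hi ih =>
          simp only [Finset.sum_insert hi, map_add, map_smul]
          filter_upwards [Lp.coeFn_add (c i • W (v i)) (W (∑ i ∈ F, c i • v i)), ih,
            Lp.coeFn_smul (c i) (W (v i))] with ω g1 g2 g3
          rw [g1, Pi.add_apply, g2, g3, Pi.smul_apply, smul_eq_mul]
      filter_upwards [h2, h3 Finset.univ fun i => L (Pi.single i 1)] with ω g1 g2
      rw [g2, Function.comp_apply]
      refine (LinearMap.pi_apply_eq_sum_univ L.toLinearMap _).trans ?_
      refine Finset.sum_congr rfl fun i _ => ?_
      have e : (fun j => if i = j then (1 : ℝ) else 0) = Pi.single i 1 := by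
        funext j
        by_cases hij : i = j
        · subst hij; simp
        · rw [if_neg hij, Pi.single_eq_of_ne (Ne.symm hij)]
      rw [e, ← g1 i, smul_eq_mul, mul_comm]
      rfl
    rw [Measure.map_congr h1, h.map_eq]
    infer_instance

/-- Both families together are still a Gaussian process, in which vanishing covariance, here
orthogonality in the Hilbert space, amounts to independence. -/
theorem indepFun (h : IsIsonormal P W) {S T : Type*} {X : S → Ω → ℝ} {Y : T → Ω → ℝ}
    {v : S → E} {w : T → E} (hX : ∀ s, X s =ᵐ[P] W (v s)) (hY : ∀ t, Y t =ᵐ[P] W (w t))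
    (hvw : ∀ s t, inner ℝ (v s) (w t) = 0) :
    IndepFun (fun ω s => X s ω) (fun ω t => Y t ω) P := by
  have hP := h.isProbabilityMeasure
  have hXY : IsGaussianProcess (Sum.elim X Y) P :=
    h.isGaussian_family (v := Sum.elim v w) fun s => by cases s <;> simp [hX, hY]
  refine hXY.indepFun_of_covariance_eq_zero (fun s => (aemeasurable (v s)).congr (hX s).symm)
    (fun t => (aemeasurable (w t)).congr (hY t).symm) fun s t => ?_
  have e : cov[X s, Y t; P] = cov[W (v s), W (w t); P] := by
    rw [covariance, covariance, integral_congr_ae (hX s), integral_congr_ae (hY t)]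
    refine integral_congr_ae ?_
    filter_upwards [hX s, hY t] with ω h1 h2
    rw [h1, h2]
  rw [e, covariance_eq_sub (h.hasGaussianLaw _).memLp_two
    (h.hasGaussianLaw _).memLp_two, h.integral_eq_zero, zero_mul, sub_zero]
  exact (integral_mul W _ _).trans (hvw s t)

end IsIsonormal

end Isonormal

end ZeroRange

end

open MeasureTheory ProbabilityTheory Filter Set
open scoped Topology ENNReal NNReal

noncomputable section

namespace ZeroRange

/-! ### Continuous versions of isonormal processes indexed by time -/

/-! ### Chaining along dyadic points. -/

section DyadicLimit

/-- The largest multiple of `2⁻ⁿ` below `t`. -/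
def dyadicFloor (n : ℕ) (t : ℝ) : ℝ := (⌊2 ^ n * t⌋₊ : ℝ) / 2 ^ n

/-- The limit of a function along dyadic approximations of its argument. -/
def dyadicLim (G : ℝ → ℝ) (t : ℝ) : ℝ := limUnder atTop fun n => G (dyadicFloor n t)

theorem dyadicFloor_le (n : ℕ) {t : ℝ} (ht : 0 ≤ t) : dyadicFloor n t ≤ t := by
  rw [dyadicFloor, div_le_iff₀ (by positivity), mul_comm t]
  exact Nat.floor_le (by positivity)

theorem dyadicFloor_nonneg (n : ℕ) (t : ℝ) : 0 ≤ dyadicFloor n t := by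
  rw [dyadicFloor]; positivity

theorem abs_dyadicFloor_sub_le (n : ℕ) {t : ℝ} (ht : 0 ≤ t) :
    |dyadicFloor n t - t| ≤ (1 / 2) ^ n := by
  rw [abs_sub_comm, abs_of_nonneg (sub_nonneg.2 (dyadicFloor_le n ht)), dyadicFloor,
    one_div, inv_pow, sub_le_iff_le_add, ← one_div, ← add_div, le_div_iff₀ (by positivity)]
  have := Nat.lt_floor_add_one (2 ^ n * t)
  linarith

theorem tendsto_dyadicFloor {t : ℝ} (ht : 0 ≤ t) :
    Tendsto (fun n => dyadicFloor n t) atTop (𝓝 t) := by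
  rw [tendsto_iff_dist_tendsto_zero]
  refine squeeze_zero (fun _ => dist_nonneg) (fun n => ?_)
    (tendsto_pow_atTop_nhds_zero_of_lt_one (r := (1 / 2 : ℝ)) (by norm_num) (by norm_num))
  rw [Real.dist_eq]
  exact abs_dyadicFloor_sub_le n ht

variable {G : ℝ → ℝ} {C r : ℝ} {N : ℕ}

theorem dyadicFloor_index_lt {t : ℝ} (h0 : 0 ≤ t) (ht : t < N) (n : ℕ) :
    ⌊2 ^ n * t⌋₊ + 1 ≤ 2 ^ n * N := by
  rw [Nat.succ_le_iff, Nat.floor_lt (by positivity)]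
  push_cast
  exact mul_lt_mul_of_pos_left ht (by positivity)

theorem abs_sub_le_of_floor_le (hC : 0 ≤ C) (hr : 0 ≤ r)
    (h : ∀ n k : ℕ, k + 1 ≤ 2 ^ n * N → |G (((k : ℝ) + 1) / 2 ^ n) - G (k / 2 ^ n)| ≤ C * r ^ n)
    (n j k : ℕ) (hjk : j ≤ k) (hk : k ≤ j + 1) (hkN : k ≤ 2 ^ n * N) :
    |G ((k : ℝ) / 2 ^ n) - G (j / 2 ^ n)| ≤ C * r ^ n := by
  rcases Nat.eq_or_lt_of_le hjk with rfl | hlt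
  · rw [sub_self, abs_zero]; positivity
  · obtain rfl : k = j + 1 := by omega
    have := h n j hkN
    push_cast
    exact this

/-- From 2⌊x⌋ ≤ ⌊2x⌋ ≤ 2⌊x⌋ + 1, successive dyadic approximations either coincide or are neighbours
on the finer grid. -/
theorem abs_dyadic_succ_sub_le (hC : 0 ≤ C) (hr : 0 ≤ r)
    (h : ∀ n k : ℕ, k + 1 ≤ 2 ^ n * N → |G (((k : ℝ) + 1) / 2 ^ n) - G (k / 2 ^ n)| ≤ C * r ^ n)
    {t : ℝ} (h0 : 0 ≤ t) (ht : t < N) (n : ℕ) :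
    |G (dyadicFloor (n + 1) t) - G (dyadicFloor n t)| ≤ C * r ^ (n + 1) := by
  have e : dyadicFloor n t = ((2 * ⌊2 ^ n * t⌋₊ : ℕ) : ℝ) / 2 ^ (n + 1) := by
    rw [dyadicFloor, pow_succ]
    push_cast
    field_simp
  rw [e]
  have h1 : (⌊2 ^ n * t⌋₊ : ℝ) ≤ 2 ^ n * t := Nat.floor_le (by positivity)
  have h2 := Nat.lt_floor_add_one (2 ^ n * t)
  have h3 : (2 : ℝ) ^ (n + 1) * t = 2 * (2 ^ n * t) := by ring
  refine abs_sub_le_of_floor_le hC hr h (n + 1) _ _ ?_ ?_ ?_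
  · refine Nat.le_floor ?_
    push_cast
    linarith
  · rw [← Nat.lt_succ_iff, Nat.floor_lt (by positivity)]
    push_cast
    linarith
  · have := dyadicFloor_index_lt h0 ht (n + 1)
    omega

theorem tendsto_dyadicLim (hC : 0 ≤ C) (hr : 0 ≤ r) (hr1 : r < 1)
    (h : ∀ n k : ℕ, k + 1 ≤ 2 ^ n * N → |G (((k : ℝ) + 1) / 2 ^ n) - G (k / 2 ^ n)| ≤ C * r ^ n)
    {t : ℝ} (h0 : 0 ≤ t) (ht : t < N) :
    Tendsto (fun n => G (dyadicFloor n t)) atTop (𝓝 (dyadicLim G t)) := by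
  refine (cauchySeq_of_le_geometric r C hr1 fun n => ?_).tendsto_limUnder
  rw [dist_comm, Real.dist_eq]
  refine (abs_dyadic_succ_sub_le hC hr h h0 ht n).trans ?_
  exact mul_le_mul_of_nonneg_left (pow_le_pow_of_le_one hr hr1.le (by omega)) hC

theorem abs_sub_dyadicLim_le (hC : 0 ≤ C) (hr : 0 ≤ r) (hr1 : r < 1)
    (h : ∀ n k : ℕ, k + 1 ≤ 2 ^ n * N → |G (((k : ℝ) + 1) / 2 ^ n) - G (k / 2 ^ n)| ≤ C * r ^ n)
    {t : ℝ} (h0 : 0 ≤ t) (ht : t < N) (n : ℕ) :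
    |G (dyadicFloor n t) - dyadicLim G t| ≤ C * r ^ n / (1 - r) := by
  have := dist_le_of_le_geometric_of_tendsto (f := fun n => G (dyadicFloor n t)) r C hr1
    (fun n => ?_) (tendsto_dyadicLim hC hr hr1 h h0 ht) n
  · rwa [Real.dist_eq] at this
  · rw [dist_comm, Real.dist_eq]
    refine (abs_dyadic_succ_sub_le hC hr h h0 ht n).trans ?_
    exact mul_le_mul_of_nonneg_left (pow_le_pow_of_le_one hr hr1.le (by omega)) hC

/-- Two times at distance less than 2⁻ⁿ have equal or adjacent dyadic floors of level n, so their
limits differ by one increment and two geometric tails. -/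
theorem continuousOn_dyadicLim (hC : 0 ≤ C) (hr : 0 ≤ r) (hr1 : r < 1)
    (h : ∀ n k : ℕ, k + 1 ≤ 2 ^ n * N → |G (((k : ℝ) + 1) / 2 ^ n) - G (k / 2 ^ n)| ≤ C * r ^ n) :
    ContinuousOn (dyadicLim G) (Ico 0 (N : ℝ)) := by
  have key : ∀ s ∈ Ico (0 : ℝ) N, ∀ t ∈ Ico (0 : ℝ) N, s ≤ t → ∀ n : ℕ, t - s < (1 / 2) ^ n →
      |dyadicLim G t - dyadicLim G s| ≤ (2 * C / (1 - r) + C) * r ^ n := by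
    intro s hs t ht hst n hn
    have h1 := abs_sub_dyadicLim_le hC hr hr1 h hs.1 hs.2 n
    have h2 := abs_sub_dyadicLim_le hC hr hr1 h ht.1 ht.2 n
    have h3 : |G (dyadicFloor n t) - G (dyadicFloor n s)| ≤ C * r ^ n := by
      refine abs_sub_le_of_floor_le hC hr h n _ _ ?_ ?_ ?_
      · exact Nat.floor_le_floor (mul_le_mul_of_nonneg_left hst (by positivity))
      · rw [← Nat.lt_succ_iff, Nat.floor_lt (by have := ht.1; positivity)]
        have h4 := Nat.lt_floor_add_one (2 ^ n * s)
        rw [one_div, inv_pow, ← one_div, lt_div_iff₀ (by positivity)] at hn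
        push_cast
        linarith
      · have := dyadicFloor_index_lt ht.1 ht.2 n
        omega
    have e : (2 * C / (1 - r) + C) * r ^ n = C * r ^ n / (1 - r) + C * r ^ n
        + C * r ^ n / (1 - r) := by ring
    rw [e]
    have e2 : dyadicLim G t - dyadicLim G s = -(G (dyadicFloor n t) - dyadicLim G t)
        + (G (dyadicFloor n t) - G (dyadicFloor n s)) + (G (dyadicFloor n s) - dyadicLim G s) := by
      ring
    rw [e2]
    refine (abs_add_three _ _ _).trans ?_
    rw [abs_neg]
    linarith
  rw [Metric.continuousOn_iff]
  intro t ht ε hε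
  have h1 : Tendsto (fun n : ℕ => (2 * C / (1 - r) + C) * r ^ n) atTop (𝓝 0) := by
    have := (tendsto_pow_atTop_nhds_zero_of_lt_one hr hr1).const_mul (2 * C / (1 - r) + C)
    simpa using this
  obtain ⟨n, hn⟩ := (h1.eventually (gt_mem_nhds hε)).exists
  refine ⟨(1 / 2) ^ n, by positivity, fun s hs hst => ?_⟩
  rw [Real.dist_eq] at hst ⊢
  rcases le_total s t with hle | hle
  · rw [abs_sub_comm]
    refine (key s hs t ht hle n ?_).trans_lt hn
    rw [abs_sub_comm, abs_of_nonneg (by linarith)] at hst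
    exact hst
  · refine (key t ht s hs hle n ?_).trans_lt hn
    rw [abs_of_nonneg (by linarith)] at hst
    exact hst

/-- The increments of level 0 bound the values at integers by CN; the geometric tail from level 0
adds C/(1 - r). -/
theorem abs_dyadicLim_le (hC : 0 ≤ C) (hr : 0 ≤ r) (hr1 : r < 1)
    (h : ∀ n k : ℕ, k + 1 ≤ 2 ^ n * N → |G (((k : ℝ) + 1) / 2 ^ n) - G (k / 2 ^ n)| ≤ C * r ^ n)
    (hG : G 0 = 0) {t : ℝ} (h0 : 0 ≤ t) (ht : t < N) :
    |dyadicLim G t| ≤ C * (N + 1 / (1 - r)) := by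
  have h1 := abs_sub_dyadicLim_le hC hr hr1 h h0 ht 0
  have h2 : ∀ k : ℕ, k ≤ N → |G k| ≤ C * k := by
    intro k
    induction k with
    | zero => intro _; simp [hG]
    | succ k ih =>
      intro hk
      have h3 := h 0 k (by simpa using hk)
      have h4 := ih (by omega)
      simp only [pow_zero, div_one, mul_one] at h3
      push_cast
      have := abs_add_le (G ((k : ℝ) + 1) - G k) (G k)
      rw [sub_add_cancel] at this
      linarith
  have h3 : dyadicFloor 0 t = (⌊t⌋₊ : ℝ) := by simp [dyadicFloor]
  have h5 : ⌊t⌋₊ ≤ N := by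
    have := dyadicFloor_index_lt h0 ht 0
    simp only [pow_zero, one_mul] at this
    omega
  have h4 := h2 _ h5
  rw [h3, pow_zero, mul_one] at h1
  have h6 : (⌊t⌋₊ : ℝ) ≤ N := by exact_mod_cast h5
  have h7 := mul_le_mul_of_nonneg_left h6 hC
  have := abs_add_le (-(G (⌊t⌋₊ : ℝ) - dyadicLim G t)) (G (⌊t⌋₊ : ℝ))
  rw [show -(G (⌊t⌋₊ : ℝ) - dyadicLim G t) + G (⌊t⌋₊ : ℝ) = dyadicLim G t by ring, abs_neg] at this
  have e : C * (N + 1 / (1 - r)) = C * N + C / (1 - r) := by ring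
  rw [e]
  linarith

end DyadicLimit

/-! ### Versions of isonormal processes with pathwise bounds. -/

section Version

/-- A subsequence of an L²-convergent family converges almost surely, so an almost sure limit agrees
with the L² limit. -/
theorem ae_eq_of_tendsto {Ω α : Type*} [MeasurableSpace Ω] {P : Measure Ω}
    {l : Filter α} [l.NeBot] [l.IsCountablyGenerated] {f : α → Ω → ℝ} {g : Ω → ℝ}
    {F : α → Lp ℝ 2 P} {F' : Lp ℝ 2 P} (hF : Tendsto F l (𝓝 F')) (hf : ∀ a, f a =ᵐ[P] F a)
    (hfg : ∀ᵐ ω ∂P, Tendsto (fun a => f a ω) l (𝓝 (g ω))) : g =ᵐ[P] F' := by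
  obtain ⟨n, hn, h⟩ := (tendstoInMeasure_of_tendsto_Lp hF).exists_seq_tendsto_ae'
  filter_upwards [h, hfg, ae_all_iff.2 fun i => hf (n i)] with ω h1 h2 h3
  simp only [← h3] at h1
  exact tendsto_nhds_unique (h2.comp hn) h1

namespace IsIsonormal

variable {E Ω : Type*} [NormedAddCommGroup E] [InnerProductSpace ℝ E]
  [mΩ : MeasurableSpace Ω] {P : Measure Ω} {W : E →ₗᵢ[ℝ] Lp ℝ 2 P}

theorem measurable_coe (W : E →ₗᵢ[ℝ] Lp ℝ 2 P) (v : E) : Measurable (W v) :=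
  (Lp.stronglyMeasurable (W v)).measurable

theorem lintegral_sub_pow_four (h : IsIsonormal P W) (v w : E) {c : ℝ} (hc : 0 ≤ c) :
    ∫⁻ ω, ENNReal.ofReal (c * (W v ω - W w ω) ^ 4) ∂P
      = ENNReal.ofReal (c * (gaussianFourthMoment * ‖v - w‖ ^ 4)) := by
  have hP := h.isProbabilityMeasure
  have e : (fun ω => W v ω - W w ω) =ᵐ[P] W (v - w) := by
    rw [map_sub]; exact (Lp.coeFn_sub _ _).symm
  have h1 : ∫⁻ ω, ENNReal.ofReal (c * (W v ω - W w ω) ^ 4) ∂P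
      = ∫⁻ ω, ENNReal.ofReal (c * W (v - w) ω ^ 4) ∂P :=
    lintegral_congr_ae (e.mono fun ω hω => by simp only [hω])
  have hi : Integrable (fun ω => W (v - w) ω ^ 4) P := by
    have := (h.memLp_four (v - w)).integrable_norm_pow (p := 4) (by norm_num)
    refine this.congr (Eventually.of_forall fun ω => ?_)
    simp only [Real.norm_eq_abs]
    exact Even.pow_abs (by decide) _
  rw [h1, ← ofReal_integral_eq_lintegral_ofReal (hi.const_mul c)
    (Eventually.of_forall fun ω => by positivity), integral_const_mul, h.integral_pow_four]

theorem lintegral_sq (W : E →ₗᵢ[ℝ] Lp ℝ 2 P) (v : E) {c : ℝ} (hc : 0 ≤ c) :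
    ∫⁻ ω, ENNReal.ofReal (c * W v ω ^ 2) ∂P = ENNReal.ofReal (c * ‖v‖ ^ 2) := by
  rw [← ofReal_integral_eq_lintegral_ofReal ((Lp.memLp (W v)).integrable_sq.const_mul c)
    (Eventually.of_forall fun ω => by positivity), integral_const_mul,
    ← real_inner_self_eq_norm_sq, ← integral_mul W v v]
  simp only [pow_two]

/-- Simultaneous versions of countably many values of an isonormal process, bounded by a common
random multiple of given constants. -/
theorem exists_bounded_version (W : E →ₗᵢ[ℝ] Lp ℝ 2 P) {ι : Type*} [Countable ι] (v : ι → E)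
    {c : ι → ℝ} (hc : ∀ i, 0 < c i) (hs : Summable fun i => (‖v i‖ / c i) ^ 2) :
    ∃ (ξ : ι → Ω → ℝ) (A : Ω → ℝ), (∀ i, Measurable (ξ i)) ∧ (∀ i, ξ i =ᵐ[P] W (v i)) ∧
      (∀ ω, 0 ≤ A ω) ∧ ∀ i ω, |ξ i ω| ≤ A ω * c i := by
  -- This sum of squared ratios has finite expectation, and its square root is the common random
  -- factor. Setting the variables to zero where the sum is infinite makes the bound hold for every
  -- ω.
  let X : Ω → ℝ≥0∞ := fun ω => ∑' i, ENNReal.ofReal ((c i ^ 2)⁻¹ * W (v i) ω ^ 2)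
  have hm : ∀ i, Measurable fun ω => ENNReal.ofReal ((c i ^ 2)⁻¹ * W (v i) ω ^ 2) := fun i =>
    (((measurable_coe W (v i)).pow_const 2).const_mul _).ennreal_ofReal
  have hX : Measurable X := Measurable.tsum hm
  have hfin : ∫⁻ ω, X ω ∂P ≠ ∞ := by
    rw [lintegral_tsum fun i => (hm i).aemeasurable]
    simp only [lintegral_sq W _ (inv_nonneg.2 (sq_nonneg (c _)))]
    have e : ∀ i, (c i ^ 2)⁻¹ * ‖v i‖ ^ 2 = (‖v i‖ / c i) ^ 2 := fun i => by
      rw [div_pow]; ring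
    simp only [e]
    exact hs.tsum_ofReal_ne_top
  have hae : ∀ᵐ ω ∂P, X ω < ∞ := ae_lt_top hX hfin
  have hB : MeasurableSet {ω | X ω < ∞} := measurableSet_lt hX measurable_const
  refine ⟨fun i => {ω | X ω < ∞}.indicator (W (v i)), fun ω => Real.sqrt (X ω).toReal,
    fun i => (measurable_coe W (v i)).indicator hB, fun i => ?_, fun ω => Real.sqrt_nonneg _,
    fun i ω => ?_⟩
  · filter_upwards [hae] with ω hω
    exact indicator_of_mem (s := {ω | X ω < ∞}) hω _
  · beta_reduce
    by_cases hω : X ω < ∞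
    · rw [indicator_of_mem (s := {ω | X ω < ∞}) hω]
      have h1 : ENNReal.ofReal ((c i ^ 2)⁻¹ * W (v i) ω ^ 2) ≤ X ω :=
        ENNReal.le_tsum (f := fun i => ENNReal.ofReal ((c i ^ 2)⁻¹ * W (v i) ω ^ 2)) i
      have h2 := (ENNReal.ofReal_le_iff_le_toReal hω.ne).1 h1
      rw [inv_mul_le_iff₀ (by have := hc i; positivity)] at h2
      have h3 := Real.abs_le_sqrt h2
      rwa [Real.sqrt_mul (sq_nonneg _), Real.sqrt_sq (hc i).le, mul_comm] at h3
    · rw [indicator_of_notMem (s := {ω | X ω < ∞}) hω, abs_zero]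
      exact mul_nonneg (Real.sqrt_nonneg _) (hc i).le

/-- Simultaneous continuous versions of countably many Brownian motions extracted from an isonormal
process, bounded by a common random multiple of given constants. -/
theorem exists_continuous_version (h : IsIsonormal P W) {ι : Type*} [Countable ι]
    (v : ι → ℝ → E) (q : ι → ℝ) (hv0 : ∀ i, v i 0 = 0)
    (hq : ∀ i s t, 0 ≤ s → s ≤ t → ‖v i t - v i s‖ ^ 2 = q i * (t - s))
    {c : ι → ℝ} (hc : ∀ i, 0 < c i) (hs : Summable fun i => (q i / c i ^ 2) ^ 2)
    (T : ℝ) (hT : 0 ≤ T) :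
    ∃ (m : ι → ℝ → Ω → ℝ) (A : Ω → ℝ), (∀ i t, Measurable (m i t)) ∧
      (∀ i ω, Continuous fun t => m i t ω) ∧ (∀ i, ∀ t ∈ Icc 0 T, m i t =ᵐ[P] W (v i t)) ∧
      (∀ ω, 0 ≤ A ω) ∧ (∀ i t ω, |m i t ω| ≤ A ω * c i) ∧ ∀ i ω, m i 0 ω = 0 := by
  have hP := h.isProbabilityMeasure
  obtain ⟨N, hN⟩ := exists_nat_gt T
  have hκ : 0 ≤ gaussianFourthMoment := integral_nonneg fun x => by positivity
  -- The rate has to satisfy r < 1 for the chaining and r⁻⁴ / 2 < 1 for the expectation below; any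
  -- number between 2^(-1/4) and 1 would do.
  set r : ℝ := 9 / 10 with hr
  let f : ι → ℕ → ℕ → Ω → ℝ≥0∞ := fun i n k ω => ENNReal.ofReal (((c i * r ^ n) ^ 4)⁻¹
    * (W (v i (((k : ℝ) + 1) / 2 ^ n)) ω - W (v i (k / 2 ^ n)) ω) ^ 4)
  let X : Ω → ℝ≥0∞ := fun ω => ∑' i, ∑' n, ∑ k ∈ Finset.range (2 ^ n * N), f i n k ω
  have hm : ∀ i n k, Measurable (f i n k) := fun i n k =>
    ((((measurable_coe W _).sub (measurable_coe W _)).pow_const 4).const_mul _).ennreal_ofReal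
  have hm1 : ∀ i n, Measurable fun ω => ∑ k ∈ Finset.range (2 ^ n * N), f i n k ω := fun i n =>
    Finset.measurable_fun_sum _ fun k _ => hm i n k
  have hm2 : ∀ i, Measurable fun ω => ∑' n, ∑ k ∈ Finset.range (2 ^ n * N), f i n k ω := fun i =>
    Measurable.tsum (hm1 i)
  have hX : Measurable X := Measurable.tsum hm2
  have hfin : ∫⁻ ω, X ω ∂P ≠ ∞ := by
    -- The squared norm of an increment of level n is q 2⁻ⁿ, so its fourth moment is of order 4⁻ⁿ;
    -- summing over the 2ⁿN increments of that level leaves the ratio r⁻⁴ / 2. One sum over all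
    -- indices, levels and positions gives a random constant common to all i.
    have e1 : ∀ i n k, ∫⁻ ω, f i n k ω ∂P = ENNReal.ofReal (gaussianFourthMoment
        * (q i / c i ^ 2) ^ 2 * ((r ^ 4)⁻¹ / 4) ^ n) := by
      intro i n k
      have hcr : 0 ≤ ((c i * r ^ n) ^ 4)⁻¹ := by positivity
      have h1 := hq i (k / 2 ^ n) (((k : ℝ) + 1) / 2 ^ n) (by positivity) (by gcongr; linarith)
      rw [h.lintegral_sub_pow_four _ _ hcr,
        show ∀ x : E, ‖x‖ ^ 4 = (‖x‖ ^ 2) ^ 2 from fun x => by ring, h1]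
      congr 1
      have h2 : (4 : ℝ) ^ n = 2 ^ n * 2 ^ n := by rw [← mul_pow]; norm_num
      have h3 := (hc i).ne'
      have h4 : r ^ n ≠ 0 := by positivity
      rw [div_pow ((r ^ 4)⁻¹), inv_pow, h2, ← pow_mul, mul_comm 4 n, pow_mul]
      field_simp
      ring
    have e2 : ∀ i n, ∫⁻ ω, ∑ k ∈ Finset.range (2 ^ n * N), f i n k ω ∂P
        = ENNReal.ofReal (N * gaussianFourthMoment * (q i / c i ^ 2) ^ 2)
          * ENNReal.ofReal (((r ^ 4)⁻¹ / 2) ^ n) := by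
      intro i n
      rw [lintegral_finsetSum _ fun k _ => hm i n k]
      simp only [e1]
      rw [Finset.sum_const, Finset.card_range, nsmul_eq_mul, ← ENNReal.ofReal_natCast,
        ← ENNReal.ofReal_mul (by positivity), ← ENNReal.ofReal_mul (by positivity)]
      congr 1
      have h2 : (4 : ℝ) ^ n = 2 ^ n * 2 ^ n := by rw [← mul_pow]; norm_num
      have h3 : (2 : ℝ) ^ n ≠ 0 := by positivity
      push_cast
      rw [div_pow ((r ^ 4)⁻¹) 4, div_pow ((r ^ 4)⁻¹) 2, h2]
      generalize ((r ^ 4)⁻¹) ^ n = x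
      field_simp
    rw [lintegral_tsum fun i => (hm2 i).aemeasurable]
    have e3 : ∀ i, ∫⁻ ω, ∑' n, ∑ k ∈ Finset.range (2 ^ n * N), f i n k ω ∂P
        = ENNReal.ofReal (N * gaussianFourthMoment * (q i / c i ^ 2) ^ 2)
          * ∑' n, ENNReal.ofReal (((r ^ 4)⁻¹ / 2) ^ n) := by
      intro i
      rw [lintegral_tsum fun n => (hm1 i n).aemeasurable, ← ENNReal.tsum_mul_left]
      exact tsum_congr fun n => e2 i n
    simp only [e3]
    rw [ENNReal.tsum_mul_right]
    refine ENNReal.mul_ne_top (hs.mul_left _).tsum_ofReal_ne_top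
      (Summable.tsum_ofReal_ne_top ?_)
    refine summable_geometric_of_lt_one (by positivity) ?_
    rw [hr]; norm_num
  have hae : ∀ᵐ ω ∂P, X ω < ∞ := ae_lt_top hX hfin
  have hB : MeasurableSet {ω | X ω < ∞} := measurableSet_lt hX measurable_const
  -- Subtracting the almost surely vanishing value at time 0, and cutting off where the sum is
  -- infinite, make the start at 0 and the increment bounds hold for every ω.
  let G : ι → Ω → ℝ → ℝ := fun i ω t =>
    {ω | X ω < ∞}.indicator (fun ω => W (v i t) ω - W (v i 0) ω) ω
  let B : Ω → ℝ := fun ω => Real.sqrt (Real.sqrt (X ω).toReal)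
  have hB0 : ∀ ω, 0 ≤ B ω := fun ω => Real.sqrt_nonneg _
  have hr0 : 0 ≤ r := by rw [hr]; norm_num
  have hr1 : r < 1 := by rw [hr]; norm_num
  have hG : ∀ i ω (n k : ℕ), k + 1 ≤ 2 ^ n * N →
      |G i ω (((k : ℝ) + 1) / 2 ^ n) - G i ω (k / 2 ^ n)| ≤ B ω * c i * r ^ n := by
    intro i ω n k hk
    have hci := hc i
    by_cases hω : X ω < ∞
    · simp only [G, indicator_of_mem (s := {ω | X ω < ∞}) hω, sub_sub_sub_cancel_right]
      set d := W (v i (((k : ℝ) + 1) / 2 ^ n)) ω - W (v i (k / 2 ^ n)) ω with hd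
      have h1 : f i n k ω ≤ X ω := by
        refine le_trans ?_ (ENNReal.le_tsum i)
        refine le_trans ?_ (ENNReal.le_tsum n)
        exact Finset.single_le_sum (f := fun k => f i n k ω) (fun _ _ => zero_le)
          (Finset.mem_range.2 hk)
      have h2 : ((c i * r ^ n) ^ 4)⁻¹ * d ^ 4 ≤ (X ω).toReal :=
        (ENNReal.ofReal_le_iff_le_toReal hω.ne).1 h1
      rw [inv_mul_le_iff₀ (by positivity)] at h2
      have h3 : B ω ^ 4 = (X ω).toReal := by
        rw [show B ω ^ 4 = (B ω ^ 2) ^ 2 by ring, Real.sq_sqrt (Real.sqrt_nonneg _),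
          Real.sq_sqrt ENNReal.toReal_nonneg]
      rw [← h3, ← mul_pow, ← Even.pow_abs (by decide) d] at h2
      have h4 := le_of_pow_le_pow_left₀ (by norm_num)
        (mul_nonneg (mul_nonneg hci.le (by positivity)) (hB0 ω)) h2
      linarith
    · simp only [G, indicator_of_notMem (s := {ω | X ω < ∞}) hω, sub_self, abs_zero]
      have := hB0 ω
      positivity
  have hC0 : ∀ i ω, 0 ≤ B ω * c i := fun i ω => mul_nonneg (hB0 ω) (hc i).le
  have hG0 : ∀ i ω, G i ω 0 = 0 := fun i ω => by
    simp only [G, sub_self]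
    exact indicator_apply_eq_zero.2 fun _ => rfl
  have hproj : ∀ t, ((projIcc 0 T hT t : Icc 0 T) : ℝ) ∈ Ico (0 : ℝ) N := fun t =>
    ⟨(projIcc 0 T hT t).2.1, (projIcc 0 T hT t).2.2.trans_lt hN⟩
  refine ⟨fun i t ω => dyadicLim (G i ω) (projIcc 0 T hT t),
    fun ω => B ω * (N + 1 / (1 - r)), fun i t => ?_, fun i ω => ?_, fun i t ht => ?_, fun ω => ?_,
    fun i t ω => ?_, fun i ω => ?_⟩
  · refine measurable_of_tendsto_metrizable
      (f := fun n ω => G i ω (dyadicFloor n (projIcc 0 T hT t))) (fun n => ?_) ?_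
    · exact ((measurable_coe W _).sub (measurable_coe W _)).indicator hB
    · exact tendsto_pi_nhds.2 fun ω =>
        tendsto_dyadicLim (hC0 i ω) hr0 hr1 (hG i ω) (hproj t).1 (hproj t).2
  · exact (continuousOn_dyadicLim (hC0 i ω) hr0 hr1 (hG i ω)).comp_continuous
      (continuous_subtype_val.comp continuous_projIcc) hproj
  · beta_reduce
    rw [projIcc_of_mem hT ht]
    have hlim : Tendsto (fun n => v i (dyadicFloor n t)) atTop (𝓝 (v i t)) := by
      rw [tendsto_iff_norm_sub_tendsto_zero]
      have h1 : Tendsto (fun n => Real.sqrt (q i * (t - dyadicFloor n t))) atTop (𝓝 0) := by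
        have h2 := ((tendsto_const_nhds (x := t)).sub (tendsto_dyadicFloor ht.1)).const_mul (q i)
        simpa using h2.sqrt
      refine h1.congr fun n => ?_
      rw [← hq i _ _ (dyadicFloor_nonneg n t) (dyadicFloor_le n ht.1), Real.sqrt_sq (norm_nonneg _),
        norm_sub_rev]
    refine ae_eq_of_tendsto (f := fun n ω => G i ω (dyadicFloor n t))
      ((W.continuous.tendsto _).comp hlim) (fun n => ?_) (Eventually.of_forall fun ω =>
        tendsto_dyadicLim (hC0 i ω) hr0 hr1 (hG i ω) ht.1 (ht.2.trans_lt hN))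
    have h0 : W (v i 0) =ᵐ[P] (0 : Ω → ℝ) := by
      rw [hv0, map_zero]; exact Lp.coeFn_zero _ _ _
    filter_upwards [hae, h0] with ω hω h0
    simp only [G, indicator_of_mem (s := {ω | X ω < ∞}) hω, h0, Function.comp_apply]
    simp
  · have := hB0 ω
    have : 0 < 1 - r := by linarith
    positivity
  · refine (abs_dyadicLim_le (hC0 i ω) hr0 hr1 (hG i ω) (hG0 i ω) (hproj t).1 (hproj t).2).trans
      (le_of_eq ?_)
    ring
  · have h1 := tendsto_dyadicLim (hC0 i ω) hr0 hr1 (hG i ω) (hproj 0).1 (hproj 0).2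
    refine tendsto_nhds_unique h1 ?_
    have h2 : ∀ n, dyadicFloor n (projIcc 0 T hT 0 : Icc 0 T) = 0 := fun n => by
      simp [dyadicFloor]
    simp only [h2, hG0]
    exact tendsto_const_nhds

end IsIsonormal

end Version

end ZeroRange

end

open MeasureTheory ProbabilityTheory Filter Set
open scoped Topology ENNReal NNReal

noncomputable section

namespace ZeroRange

/-! ### Distributions from their coefficients -/

namespace SpectralData

variable {p : Params} (S : SpectralData p)

/-- Two powers of 1 + λ_i beyond the growth of z are taken from the decay of the coefficients, which
leaves the summable factor (1 + λ_i)⁻². -/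
theorem exists_abs_coef_mul_le (hp : p.Admissible) (k : ℕ) :
    ∃ q : Seminorm ℝ (TestSpace p), Continuous q ∧ ∀ (z : S.ι → ℝ) (K : ℝ),
      (∀ i, |z i| ≤ K * (1 + S.lam i) ^ k) →
      ∀ i H, |S.coef i H * z i| ≤ q H * (K * ((1 + S.lam i) ^ 2)⁻¹) := by
  obtain ⟨q, hq, h⟩ := S.exists_pow_mul_abs_coef_le hp (k + 2)
  refine ⟨q, hq, fun z K hz i H => ?_⟩
  have h1 := h i H
  have h2 := hz i
  have h3 := S.one_add_pos i
  have hK : 0 ≤ K := by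
    by_contra hK
    have := (abs_nonneg _).trans h2
    have := mul_neg_of_neg_of_pos (not_le.1 hK) (pow_pos h3 k)
    linarith
  rw [abs_mul]
  calc |S.coef i H| * |z i| ≤ |S.coef i H| * (K * (1 + S.lam i) ^ k) := by gcongr
    _ = ((1 + S.lam i) ^ (k + 2) * |S.coef i H|) * (K * ((1 + S.lam i) ^ 2)⁻¹) := by
      rw [pow_add]; field_simp
    _ ≤ _ := by gcongr

theorem summable_coef_mul (hp : p.Admissible) {z : S.ι → ℝ} {K : ℝ} {k : ℕ}
    (hz : ∀ i, |z i| ≤ K * (1 + S.lam i) ^ k) (H : TestSpace p) :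
    Summable fun i => S.coef i H * z i := by
  obtain ⟨q, -, h⟩ := S.exists_abs_coef_mul_le hp k
  exact ((S.summable_inv.mul_left K).mul_left (q H)).of_norm_bounded fun i => h z K hz i H

/-- The linear form with coefficients `z`, provided these are of polynomial growth. -/
def fieldL (hp : p.Admissible) (z : S.ι → ℝ) {K : ℝ} {k : ℕ}
    (hz : ∀ i, |z i| ≤ K * (1 + S.lam i) ^ k) : TestSpace p →ₗ[ℝ] ℝ where
  toFun H := ∑' i, S.coef i H * z i
  map_add' H G := by
    simp only [map_add, add_mul]
    exact (S.summable_coef_mul hp hz H).tsum_add (S.summable_coef_mul hp hz G)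
  map_smul' c H := by
    simp only [map_smul, smul_eq_mul, mul_assoc, RingHom.id_apply]
    exact tsum_mul_left

theorem continuous_fieldL (hp : p.Admissible) (z : S.ι → ℝ) {K : ℝ} {k : ℕ}
    (hz : ∀ i, |z i| ≤ K * (1 + S.lam i) ^ k) : Continuous (S.fieldL hp z hz) := by
  obtain ⟨q, hq, h⟩ := S.exists_abs_coef_mul_le hp k
  refine continuous_of_continuousAt_zero (S.fieldL hp z hz) ?_
  have h1 : Tendsto (fun H => q H * ∑' i, K * ((1 + S.lam i) ^ 2)⁻¹) (𝓝 (0 : TestSpace p))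
      (𝓝 0) := by
    have := (hq.tendsto 0).mul_const (∑' i, K * ((1 + S.lam i) ^ 2)⁻¹)
    simpa using this
  rw [ContinuousAt, map_zero]
  refine squeeze_zero_norm (fun H => ?_) h1
  rw [← tsum_mul_left]
  exact tsum_of_norm_bounded ((S.summable_inv.mul_left K).mul_left (q H)).hasSum
    fun i => h z K hz i H

/-- The distribution with coefficients `z`, provided these are of polynomial growth. -/
def field (hp : p.Admissible) (z : S.ι → ℝ) {K : ℝ} {k : ℕ}
    (hz : ∀ i, |z i| ≤ K * (1 + S.lam i) ^ k) : DualSpace p :=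
  ⟨S.fieldL hp z hz, S.continuous_fieldL hp z hz⟩

theorem field_apply (hp : p.Admissible) (z : S.ι → ℝ) {K : ℝ} {k : ℕ}
    (hz : ∀ i, |z i| ≤ K * (1 + S.lam i) ^ k) (H : TestSpace p) :
    S.field hp z hz H = ∑' i, S.coef i H * z i := rfl

/-- Strong convergence is uniform convergence on bounded sets, where the semi-norm controlling the
weighted coefficients is bounded. The rest is dominated convergence for ∑ |z_b(i) - z_a(i)| (1 +
λ_i)^(-(k + 2)), which no longer involves the test function. -/
theorem continuous_field (hp : p.Admissible) {α : Type*} [TopologicalSpace α] {z : α → S.ι → ℝ}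
    {K : ℝ} {k : ℕ} (hz : ∀ a i, |z a i| ≤ K * (1 + S.lam i) ^ k)
    (hc : ∀ i, Continuous fun a => z a i) :
    Continuous fun a => S.field hp (z a) (hz a) := by
  obtain ⟨q, hq, h⟩ := S.exists_pow_mul_abs_coef_le hp (k + 2)
  obtain ⟨s, C, -, hqs⟩ := Seminorm.bound_of_continuous withSeminorms_testSpace q hq
  rw [continuous_iff_continuousAt]
  intro a
  have key : ∀ B : Set (TestSpace p), Bornology.IsVonNBounded ℝ B →
      TendstoUniformlyOn (fun b H => S.field hp (z b) (hz b) H) (S.field hp (z a) (hz a)) (𝓝 a)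
        B := by
    intro B hB
    obtain ⟨M, hM, hB'⟩ :=
      (withSeminorms_testSpace.isVonNBounded_iff_finset_seminorm_bounded.1 hB) s
    have hqB : ∀ H ∈ B, q H ≤ C * M := fun H hH => (hqs H).trans (by
      rw [smul_apply, NNReal.smul_def, smul_eq_mul]
      exact mul_le_mul_of_nonneg_left (hB' H hH).le C.2)
    have hdiff : ∀ b i, |z b i - z a i| * ((1 + S.lam i) ^ (k + 2))⁻¹
        ≤ 2 * K * ((1 + S.lam i) ^ 2)⁻¹ := fun b i => by
      have h3 := S.one_add_pos i
      have h1 : |z b i - z a i| ≤ 2 * K * (1 + S.lam i) ^ k := by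
        have := abs_sub (z b i) (z a i)
        linarith [hz b i, hz a i]
      calc _ ≤ 2 * K * (1 + S.lam i) ^ k * ((1 + S.lam i) ^ (k + 2))⁻¹ := by gcongr
        _ = _ := by rw [pow_add]; field_simp
    have hd : Tendsto (fun b => ∑' i, |z b i - z a i| * ((1 + S.lam i) ^ (k + 2))⁻¹) (𝓝 a)
        (𝓝 0) := by
      have h1 := tendsto_tsum_of_dominated_convergence
        (f := fun b i => |z b i - z a i| * ((1 + S.lam i) ^ (k + 2))⁻¹) (g := fun _ => 0)
        (𝓕 := 𝓝 a) (S.summable_inv.mul_left (2 * K)) (fun i => ?_)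
        (Eventually.of_forall fun b i => ?_)
      · simpa using h1
      · have := (((hc i).tendsto a).sub_const (z a i)).abs.mul_const ((1 + S.lam i) ^ (k + 2))⁻¹
        simpa using this
      · rw [Real.norm_of_nonneg (by have := S.one_add_pos i; positivity)]
        exact hdiff b i
    have hds : ∀ b, Summable fun i => |z b i - z a i| * ((1 + S.lam i) ^ (k + 2))⁻¹ := fun b =>
      (S.summable_inv.mul_left (2 * K)).of_nonneg_of_le
        (fun i => by have := S.one_add_pos i; positivity) (hdiff b)
    rw [Metric.tendstoUniformlyOn_iff]
    intro ε hε
    have hd' := hd.mul_const ((C : ℝ) * M)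
    rw [zero_mul] at hd'
    filter_upwards [hd'.eventually (gt_mem_nhds hε)] with b hb H hH
    refine lt_of_le_of_lt ?_ hb
    rw [dist_comm, Real.dist_eq, field_apply, field_apply,
      ← (S.summable_coef_mul hp (hz b) H).tsum_sub (S.summable_coef_mul hp (hz a) H),
      ← Real.norm_eq_abs]
    refine tsum_of_norm_bounded ((hds b).hasSum.mul_right _) fun i => ?_
    have h3 := S.one_add_pos i
    have h4 := (h i H).trans (hqB H hH)
    rw [← mul_sub, Real.norm_eq_abs, abs_mul]
    have h5 : |S.coef i H| ≤ ((1 + S.lam i) ^ (k + 2))⁻¹ * (C * M) := by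
      rw [le_inv_mul_iff₀ (by positivity)]; exact h4
    calc _ ≤ ((1 + S.lam i) ^ (k + 2))⁻¹ * (C * M) * |z b i - z a i| := by gcongr
      _ = _ := by ring
  exact (UniformConvergenceCLM.tendsto_iff_tendstoUniformlyOn (σ := RingHom.id ℝ)
    (E := TestSpace p) (F := ℝ) (𝔖 := {B : Set (TestSpace p) | Bornology.IsVonNBounded ℝ B})).2 key

end SpectralData

/-! ### The Ornstein–Uhlenbeck equation for the coefficients -/

section OrnsteinUhlenbeck

/-- The solution of `y(t) = a + m(t) - l ∫_0^t y`. -/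
def ouSol (l a : ℝ) (m : ℝ → ℝ) (t : ℝ) : ℝ :=
  Real.exp (-(l * t)) * (a - l * ∫ s in (0 : ℝ)..t, Real.exp (l * s) * m s) + m t

variable {l a : ℝ} {m : ℝ → ℝ}

theorem continuous_ouSol (hm : Continuous m) : Continuous (ouSol l a m) := by
  have h : Continuous fun t => ∫ s in (0 : ℝ)..t, Real.exp (l * s) * m s :=
    intervalIntegral.continuous_primitive
      (fun _ _ => Continuous.intervalIntegrable (by fun_prop) _ _) 0
  unfold ouSol
  fun_prop

/-- The difference u = y - m satisfies u' = -ly with u(0) = a. Solving for u needs only an ordinary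
integral of m, so no stochastic integral appears. -/
theorem ouSol_eq (hm : Continuous m) (t : ℝ) :
    ouSol l a m t = a + m t - l * ∫ s in (0 : ℝ)..t, ouSol l a m s := by
  have hd : ∀ s, HasDerivAt (fun t => Real.exp (-(l * t))
      * (a - l * ∫ s in (0 : ℝ)..t, Real.exp (l * s) * m s)) (-l * ouSol l a m s) s := by
    intro s
    have h1 : HasDerivAt (fun t => ∫ s in (0 : ℝ)..t, Real.exp (l * s) * m s)
        (Real.exp (l * s) * m s) s :=
      intervalIntegral.integral_hasDerivAt_right (Continuous.intervalIntegrable (by fun_prop) _ _)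
        (Continuous.stronglyMeasurableAtFilter (by fun_prop) _ _)
        (Continuous.continuousAt (by fun_prop))
    have h2 : HasDerivAt (fun t : ℝ => Real.exp (-(l * t))) (Real.exp (-(l * s)) * -(l * 1)) s :=
      (((hasDerivAt_id s).const_mul l).neg).exp
    have h3 := h2.mul ((hasDerivAt_const s a).sub (h1.const_mul l))
    refine h3.congr_deriv ?_
    have h4 : Real.exp (-(l * s)) * Real.exp (l * s) = 1 := by
      rw [← Real.exp_add, neg_add_cancel, Real.exp_zero]
    simp only [ouSol, Pi.sub_apply]
    linear_combination (-l * m s) * h4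
  have h1 := intervalIntegral.integral_eq_sub_of_hasDerivAt (a := 0) (b := t) (fun s _ => hd s)
    ((continuous_ouSol hm).const_mul (-l) |>.intervalIntegrable _ _)
  rw [intervalIntegral.integral_const_mul] at h1
  simp only [mul_zero, neg_zero, Real.exp_zero, intervalIntegral.integral_same, sub_zero,
    one_mul] at h1
  rw [ouSol]
  linarith

/-- The growth exp(lt) of the integral is cancelled by the prefactor, leaving l t B. The loss is a
single power of 1 + l, harmless for coefficients of polynomial growth. -/
theorem abs_ouSol_le (hl : 0 ≤ l) {B T : ℝ} (ha : |a| ≤ B) (hm : ∀ t, |m t| ≤ B)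
    (t : ℝ) (ht : t ∈ Icc 0 T) : |ouSol l a m t| ≤ (2 + T) * B * (1 + l) := by
  have hB : 0 ≤ B := (abs_nonneg _).trans ha
  have h1 : |∫ s in (0 : ℝ)..t, Real.exp (l * s) * m s| ≤ Real.exp (l * t) * B * |t - 0| := by
    rw [← Real.norm_eq_abs]
    refine intervalIntegral.norm_integral_le_of_norm_le_const fun s hs => ?_
    rw [uIoc_of_le ht.1] at hs
    rw [norm_mul, Real.norm_of_nonneg (Real.exp_pos _).le]
    have h3 : Real.exp (l * s) ≤ Real.exp (l * t) :=
      Real.exp_le_exp.2 (mul_le_mul_of_nonneg_left hs.2 hl)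
    exact mul_le_mul h3 (hm s) (norm_nonneg _) (Real.exp_pos _).le
  rw [sub_zero, abs_of_nonneg ht.1] at h1
  have h4 : Real.exp (-(l * t)) * Real.exp (l * t) = 1 := by
    rw [← Real.exp_add, neg_add_cancel, Real.exp_zero]
  have h5 : Real.exp (-(l * t)) ≤ 1 := Real.exp_le_one_iff.2 (by nlinarith [ht.1])
  have h6 := (Real.exp_pos (-(l * t))).le
  have h7 : |Real.exp (-(l * t)) * (a - l * ∫ s in (0 : ℝ)..t, Real.exp (l * s) * m s)|
      ≤ B + l * (B * t) := by
    rw [abs_mul, abs_of_nonneg h6]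
    have h8 : |a - l * ∫ s in (0 : ℝ)..t, Real.exp (l * s) * m s|
        ≤ B + l * (Real.exp (l * t) * B * t) := by
      refine (abs_sub _ _).trans (add_le_add ha ?_)
      rw [abs_mul, abs_of_nonneg hl]
      exact mul_le_mul_of_nonneg_left h1 hl
    calc _ ≤ Real.exp (-(l * t)) * (B + l * (Real.exp (l * t) * B * t)) := by gcongr
      _ = Real.exp (-(l * t)) * B + l * (B * t) * (Real.exp (-(l * t)) * Real.exp (l * t)) := by
        ring
      _ ≤ _ := by rw [h4, mul_one]; nlinarith
  refine (abs_add_le _ _).trans ?_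
  have h9 := hm t
  have h10 : l * (B * t) ≤ l * (B * T) := by
    have := ht.2
    gcongr
  have h11 : 0 ≤ T := ht.1.trans ht.2
  nlinarith [mul_nonneg hB hl, mul_nonneg hB h11]

end OrnsteinUhlenbeck

end ZeroRange

end

open MeasureTheory ProbabilityTheory Filter Set
open scoped Topology ENNReal NNReal

noncomputable section

namespace ZeroRange

/-! ### The Hilbert space of the driving noise -/

section Driving

variable {p : Params}

/-- Vectors of a Hilbert space whose inner products are the covariances of the initial field and of
the driving noise. -/
structure Driving (p : Params) (E : Type) [NormedAddCommGroup E] [InnerProductSpace ℝ E] where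
  init : TestSpace p →ₗ[ℝ] E
  noise : ℝ → TestSpace p →ₗ[ℝ] E
  form : TestSpace p → TestSpace p → ℝ
  exists_norm_init_le : ∃ C, 0 ≤ C ∧ ∀ H, ‖init H‖ ≤ C * supD 0 H.fn
  exists_form_le : ∃ C, 0 ≤ C ∧ ∀ H, form H H ≤ (C * supD 1 H.fn) ^ 2
  form_self : ∀ H, form H H = normSq p (D 1 H.fn)
  inner_init : ∀ H G, inner ℝ (init H) (init G)
    = ∫ u in (0 : ℝ)..1, ext H.fn u * ext G.fn u * chi p u
  inner_init_noise : ∀ H t G, inner ℝ (init H) (noise t G) = 0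
  inner_noise : ∀ s t, 0 ≤ s → 0 ≤ t → ∀ H G,
    inner ℝ (noise s H) (noise t G) = min s t * form H G

variable {K : Type} [NormedAddCommGroup K] [InnerProductSpace ℝ K] [CompleteSpace K]

/-- The function `1_{(0, t]} x` in `L²(ℝ; K)`. -/
def timeIndicator (t : ℝ) : K →ₗ[ℝ] Lp K 2 (volume : Measure ℝ) where
  toFun x := indicatorConstLp 2 (measurableSet_Ioc (a := 0) (b := t)) measure_Ioc_lt_top.ne x
  map_add' x y := by
    unfold indicatorConstLp
    rw [← MemLp.toLp_add]
    congr 1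
    exact indicator_add (Ioc 0 t) (fun _ => x) fun _ => y
  map_smul' c x := by
    unfold indicatorConstLp
    rw [RingHom.id_apply, ← MemLp.toLp_const_smul]
    congr 1
    exact indicator_const_smul (Ioc 0 t) c fun _ => x

theorem inner_timeIndicator {s t : ℝ} (hs : 0 ≤ s) (ht : 0 ≤ t) (x y : K) :
    inner ℝ (timeIndicator s x) (timeIndicator t y) = min s t * inner ℝ x y := by
  have h := L2.inner_indicatorConstLp_indicatorConstLp (𝕜 := ℝ) (μ := (volume : Measure ℝ))
    (measurableSet_Ioc (a := 0) (b := s)) (measurableSet_Ioc (a := 0) (b := t))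
    measure_Ioc_lt_top.ne measure_Ioc_lt_top.ne x y
  refine h.trans ?_
  rw [Ioc_inter_Ioc, Real.volume_real_Ioc, smul_eq_mul, max_self, sub_zero,
    max_eq_left (le_min hs ht)]

/-- The orthogonal sum of two Hilbert spaces. -/
theorem exists_orthogonal_sum (E K : Type) [NormedAddCommGroup E] [InnerProductSpace ℝ E]
    [CompleteSpace E] [NormedAddCommGroup K] [InnerProductSpace ℝ K] [CompleteSpace K] :
    ∃ (F : Type) (_ : NormedAddCommGroup F) (_ : InnerProductSpace ℝ F) (_ : CompleteSpace F)
      (i₁ : E →ₗ[ℝ] F) (i₂ : K →ₗ[ℝ] F), (∀ x y, inner ℝ (i₁ x) (i₁ y) = inner ℝ x y) ∧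
      (∀ x y, inner ℝ (i₁ x) (i₂ y) = 0) ∧ ∀ x y, inner ℝ (i₂ x) (i₂ y) = inner ℝ x y := by
  refine ⟨WithLp 2 (E × K), inferInstance, inferInstance, inferInstance,
    (WithLp.linearEquiv 2 ℝ (E × K)).symm.toLinearMap ∘ₗ LinearMap.inl ℝ E K,
    (WithLp.linearEquiv 2 ℝ (E × K)).symm.toLinearMap ∘ₗ LinearMap.inr ℝ E K,
    fun x y => ?_, fun x y => ?_, fun x y => ?_⟩ <;>
  simp [WithLp.prod_inner_apply]

/-- The space is the initial Hilbert space plus L²(ℝ; K), where K carries the noise form. The noise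
at time t is represented by the indicator of (0, t], which yields the Brownian covariance min(s, t).
-/
theorem exists_driving (hp : p.Admissible) :
    ∃ (E : Type) (_ : NormedAddCommGroup E) (_ : InnerProductSpace ℝ E) (_ : CompleteSpace E),
      Nonempty (Driving p E) := by
  obtain ⟨E, _, _, _, a, ⟨C, hC, hCa⟩, ha⟩ := exists_initialForm hp
  obtain ⟨K, _, _, _, b, ⟨B, hB, hBb⟩, hb⟩ := exists_noiseForm hp
  obtain ⟨F, _, _, _, i1, i2, h11, h12, h22⟩ :=
    exists_orthogonal_sum E (Lp K 2 (volume : Measure ℝ))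
  have hn : ∀ x, ‖i1 x‖ = ‖x‖ := fun x => by
    rw [← sq_eq_sq₀ (norm_nonneg _) (norm_nonneg _), ← real_inner_self_eq_norm_sq, h11,
      real_inner_self_eq_norm_sq]
  refine ⟨F, inferInstance, inferInstance, inferInstance,
    ⟨⟨i1 ∘ₗ a, fun t => i2 ∘ₗ timeIndicator t ∘ₗ b, fun H G => inner ℝ (b H) (b G),
      ⟨C, hC, fun H => ?_⟩, ⟨B, hB, fun H => ?_⟩, fun H => ?_, fun H G => ?_, fun H t G => ?_,
      fun s t hs ht H G => ?_⟩⟩⟩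
  · rw [LinearMap.comp_apply, hn]; exact hCa H
  · rw [real_inner_self_eq_norm_sq]; exact pow_le_pow_left₀ (norm_nonneg _) (hBb H) 2
  · rw [real_inner_self_eq_norm_sq, hb]
  · rw [LinearMap.comp_apply, LinearMap.comp_apply, h11, ha]
  · exact h12 _ _
  · rw [LinearMap.comp_apply, LinearMap.comp_apply, LinearMap.comp_apply, LinearMap.comp_apply,
      h22, inner_timeIndicator hs ht]

namespace Driving

variable {E : Type} [NormedAddCommGroup E] [InnerProductSpace ℝ E] (d : Driving p E)

theorem norm_noise_sub_sq {s t : ℝ} (hs : 0 ≤ s) (hst : s ≤ t) (H : TestSpace p) :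
    ‖d.noise t H - d.noise s H‖ ^ 2 = d.form H H * (t - s) := by
  have ht := hs.trans hst
  rw [← real_inner_self_eq_norm_sq, inner_sub_left, inner_sub_right, inner_sub_right,
    d.inner_noise t t ht ht, d.inner_noise s s hs hs, d.inner_noise t s ht hs,
    d.inner_noise s t hs ht, min_self, min_self, min_eq_left hst, min_eq_right hst]
  ring

theorem noise_zero (H : TestSpace p) : d.noise 0 H = 0 := by
  have h := d.inner_noise 0 0 le_rfl le_rfl H H
  rw [min_self, zero_mul] at h
  exact inner_self_eq_zero.1 h

theorem form_self_nonneg (H : TestSpace p) : 0 ≤ d.form H H := by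
  have h := d.norm_noise_sub_sq le_rfl zero_le_one H
  rw [sub_zero, mul_one] at h
  rw [← h]
  positivity

theorem continuous_init : Continuous d.init := by
  obtain ⟨C, hC, h⟩ := d.exists_norm_init_le
  exact continuous_of_norm_le d.init C 0 hC h

theorem continuous_noise {t : ℝ} (ht : 0 ≤ t) : Continuous (d.noise t) := by
  obtain ⟨C, hC, h⟩ := d.exists_form_le
  refine continuous_of_norm_le (d.noise t) (Real.sqrt t * C) 1 (by positivity) fun H => ?_
  have h1 := d.norm_noise_sub_sq le_rfl ht H
  rw [noise_zero, sub_zero, sub_zero] at h1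
  have h2 : ‖d.noise t H‖ ^ 2 ≤ (C * supD 1 H.fn) ^ 2 * t := by
    rw [h1]; exact mul_le_mul_of_nonneg_right (h H) ht
  have h3 := Real.le_sqrt_of_sq_le h2
  rw [Real.sqrt_mul (sq_nonneg _), Real.sqrt_sq (mul_nonneg hC (supD_nonneg _ _))] at h3
  linarith

theorem inner_noise_noise_sub {r s t : ℝ} (hr : 0 ≤ r) (hrs : r ≤ s) (hst : s ≤ t)
    (H G : TestSpace p) : inner ℝ (d.noise r H) (d.noise t G - d.noise s G) = 0 := by
  rw [inner_sub_right, d.inner_noise r t hr (hr.trans (hrs.trans hst)),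
    d.inner_noise r s hr (hr.trans hrs), min_eq_left hrs, min_eq_left (hrs.trans hst), sub_self]

/-- Constants of polynomial growth dominating the norms of the coefficients. -/
theorem exists_growth (S : SpectralData p) : ∃ k : ℕ,
    (Summable fun i => (‖d.init (S.e i)‖ / (1 + S.lam i) ^ k) ^ 2) ∧
    Summable fun i => (d.form (S.e i) (S.e i) / ((1 + S.lam i) ^ k) ^ 2) ^ 2 := by
  obtain ⟨C, hC, hCi⟩ := d.exists_norm_init_le
  obtain ⟨B, hB, hBi⟩ := d.exists_form_le
  obtain ⟨C0, m0, hC0, h0⟩ := S.exists_supD_e_le 0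
  obtain ⟨C1, m1, hC1, h1⟩ := S.exists_supD_e_le 1
  -- The exponents m0 and m1 absorb the growth of the eigenfunctions; the extra unit leaves at least
  -- one factor (1 + λ_i)⁻¹, whose square is summable.
  refine ⟨m0 + m1 + 1, ?_, ?_⟩
  · refine (S.summable_inv.mul_left ((C * C0) ^ 2)).of_nonneg_of_le (fun i => sq_nonneg _)
      fun i => ?_
    have hl := S.one_le i
    have hl0 := S.one_add_pos i
    rw [← inv_pow, ← mul_pow]
    have h2 : ‖d.init (S.e i)‖ ≤ C * C0 * (1 + S.lam i) ^ m0 := by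
      refine (hCi _).trans ?_
      rw [mul_assoc]
      exact mul_le_mul_of_nonneg_left (h0 i) hC
    refine pow_le_pow_left₀ (by positivity) ?_ 2
    rw [div_le_iff₀ (by positivity)]
    refine h2.trans ?_
    rw [mul_assoc (C * C0)]
    refine mul_le_mul_of_nonneg_left ?_ (by positivity)
    rw [pow_succ, ← div_eq_inv_mul, mul_div_assoc, div_self hl0.ne', mul_one]
    exact pow_le_pow_right₀ hl (by omega)
  · refine (S.summable_inv.mul_left (((B * C1) ^ 2) ^ 2)).of_nonneg_of_le (fun i => sq_nonneg _)
      fun i => ?_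
    have hl := S.one_le i
    have hl0 := S.one_add_pos i
    rw [← inv_pow ((1 : ℝ) + S.lam i), ← mul_pow]
    have h2 : d.form (S.e i) (S.e i) ≤ (B * C1) ^ 2 * ((1 + S.lam i) ^ m1) ^ 2 := by
      refine (hBi _).trans ?_
      rw [← mul_pow, mul_assoc]
      exact pow_le_pow_left₀ (mul_nonneg hB (supD_nonneg _ _))
        (mul_le_mul_of_nonneg_left (h1 i) hB) 2
    refine pow_le_pow_left₀ (div_nonneg (d.form_self_nonneg _) (by positivity)) ?_ 2
    rw [div_le_iff₀ (by positivity)]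
    refine h2.trans ?_
    rw [mul_assoc]
    refine mul_le_mul_of_nonneg_left ?_ (by positivity)
    have h3 : (1 + S.lam i)⁻¹ * ((1 + S.lam i) ^ (m0 + m1 + 1)) ^ 2
        = (1 + S.lam i) ^ (2 * (m0 + m1) + 1) := by
      rw [← pow_mul, show (m0 + m1 + 1) * 2 = (2 * (m0 + m1) + 1) + 1 by ring, pow_succ]
      field_simp
    rw [h3, ← pow_mul]
    exact pow_le_pow_right₀ hl (by omega)

end Driving

end Driving

/-! ### Martingales with independent increments -/

section Increments

/-- For the second martingale, M_t² is split as (M_t - M_s)² + 2M_s(M_t - M_s) + M_s²: independence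
makes the conditional expectation of the first term constant, and the second vanishes. -/
theorem martingale_of_indep_increments {Ω ι : Type*} [Preorder ι] {mΩ : MeasurableSpace Ω}
    {P : Measure Ω} [IsProbabilityMeasure P] {ℱ : Filtration ι mΩ} {M : ι → Ω → ℝ} {v : ι → ℝ}
    (hM : ∀ t, StronglyMeasurable[ℱ t] (M t)) (hL : ∀ t, MemLp (M t) 2 P)
    (hind : ∀ s t, s ≤ t → Indep (MeasurableSpace.comap (fun ω => M t ω - M s ω) inferInstance)
      (ℱ s) P)
    (hmean : ∀ s t, s ≤ t → ∫ ω, (M t ω - M s ω) ∂P = 0)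
    (hsq : ∀ s t, s ≤ t → ∫ ω, (M t ω - M s ω) ^ 2 ∂P = v t - v s) :
    Martingale M ℱ P ∧ Martingale (fun t ω => M t ω ^ 2 - v t) ℱ P := by
  have hi : ∀ t, Integrable (M t) P := fun t => (hL t).integrable (by norm_num)
  have hLd : ∀ s t, MemLp (fun ω => M t ω - M s ω) 2 P := fun s t => (hL t).sub (hL s)
  have hid : ∀ s t, Integrable (fun ω => M t ω - M s ω) P := fun s t => (hi t).sub (hi s)
  have hmd : ∀ s t, Measurable fun ω => M t ω - M s ω := fun s t =>
    ((hM t).mono (ℱ.le t)).measurable.sub ((hM s).mono (ℱ.le s)).measurable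
  have hc : ∀ s t, s ≤ t → P[fun ω => M t ω - M s ω | ℱ s] =ᵐ[P] fun _ => 0 := fun s t hst => by
    have := condExp_indep_eq (hmd s t).comap_le (ℱ.le s)
      (f := fun ω => M t ω - M s ω) (Measurable.of_comap_le le_rfl).stronglyMeasurable
      (hind s t hst)
    rwa [hmean s t hst] at this
  have hc2 : ∀ s t, s ≤ t → P[fun ω => (M t ω - M s ω) ^ 2 | ℱ s] =ᵐ[P] fun _ => v t - v s :=
    fun s t hst => by
    have := condExp_indep_eq (hmd s t).comap_le (ℱ.le s)
      (f := fun ω => (M t ω - M s ω) ^ 2)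
      ((Measurable.of_comap_le le_rfl).pow_const 2).stronglyMeasurable (hind s t hst)
    rwa [hsq s t hst] at this
  refine ⟨⟨hM, fun s t hst => ?_⟩, ⟨fun t => ((hM t).pow 2).sub stronglyMeasurable_const,
    fun s t hst => ?_⟩⟩
  · have e : M t = (fun ω => M t ω - M s ω) + M s := by funext ω; simp
    have h1 := condExp_add (hid s t) (hi s) (ℱ s)
    rw [← e] at h1
    have h2 : P[M s | ℱ s] = M s := condExp_of_stronglyMeasurable (ℱ.le s) (hM s) (hi s)
    filter_upwards [h1, hc s t hst] with ω g1 g2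
    rw [g1, Pi.add_apply, g2, h2, zero_add]
  · have hmul : Integrable (M s * fun ω => M t ω - M s ω) P := (hL s).integrable_mul (hLd s t)
    have hms : Integrable (fun ω => M s ω ^ 2 - v t) P :=
      (hL s).integrable_sq.sub (integrable_const _)
    have e : (fun ω => M t ω ^ 2 - v t) = (fun ω => (M t ω - M s ω) ^ 2)
        + ((2 : ℝ) • (M s * fun ω => M t ω - M s ω) + fun ω => M s ω ^ 2 - v t) := by
      funext ω
      simp only [Pi.add_apply, Pi.smul_apply, Pi.mul_apply, smul_eq_mul]
      ring
    have h1 := condExp_add (hLd s t).integrable_sq ((hmul.smul (2 : ℝ)).add hms) (ℱ s)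
    have h2 := condExp_add (hmul.smul (2 : ℝ)) hms (ℱ s)
    have h3 := condExp_smul (2 : ℝ) (M s * fun ω => M t ω - M s ω) (ℱ s) (μ := P)
    have h4 := condExp_mul_of_stronglyMeasurable_left (hM s) hmul (hid s t)
    have h5 : P[fun ω => M s ω ^ 2 - v t | ℱ s] = fun ω => M s ω ^ 2 - v t :=
      condExp_of_stronglyMeasurable (ℱ.le s) (((hM s).pow 2).sub stronglyMeasurable_const) hms
    beta_reduce
    rw [e]
    filter_upwards [h1, h2, h3, h4, hc s t hst, hc2 s t hst] with ω g1 g2 g3 g4 g5 g6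
    rw [g1, Pi.add_apply, g2, Pi.add_apply, g3, Pi.smul_apply, g4, Pi.mul_apply, g5, g6, h5]
    simp

/-- Measurability is assumed only for times in [0, t], so the lemma applies to the σ-algebra of the
past. Clamping the integration variable by `projIcc` keeps later times out. -/
theorem measurable_intervalIntegral {Ω : Type*} [MeasurableSpace Ω] {f : ℝ → Ω → ℝ} {t : ℝ}
    (ht : 0 ≤ t) (hf : ∀ r ∈ Icc 0 t, Measurable (f r)) (hc : ∀ ω, Continuous fun r => f r ω) :
    Measurable fun ω => ∫ r in (0 : ℝ)..t, f r ω := by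
  have e : ∀ ω, ∫ r in (0 : ℝ)..t, f r ω = ∫ r in Ioc 0 t, f (projIcc 0 t ht r) ω := fun ω => by
    rw [intervalIntegral.integral_of_le ht]
    exact setIntegral_congr_fun measurableSet_Ioc fun r hr => by
      simp only [projIcc_of_mem ht (Ioc_subset_Icc_self hr)]
  simp only [e]
  have h1 : StronglyMeasurable (Function.uncurry fun (ω : Ω) (r : ℝ) => f (projIcc 0 t ht r) ω) := by
    have h2 := stronglyMeasurable_uncurry_of_continuous_of_stronglyMeasurable
      (u := fun (r : ℝ) (ω : Ω) => f (projIcc 0 t ht r) ω)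
      (fun ω => (hc ω).comp (continuous_subtype_val.comp continuous_projIcc))
      (fun r => (hf _ (projIcc 0 t ht r).2).stronglyMeasurable)
    exact h2.comp_measurable measurable_swap
  exact h1.integral_prod_right.measurable

theorem measurable_ouSol {Ω : Type*} [MeasurableSpace Ω] {l : ℝ} {a : Ω → ℝ} {m : ℝ → Ω → ℝ}
    {t : ℝ} (ht : 0 ≤ t) (ha : Measurable a) (hm : ∀ r ∈ Icc 0 t, Measurable (m r))
    (hc : ∀ ω, Continuous fun r => m r ω) :
    Measurable fun ω => ouSol l (a ω) (fun r => m r ω) t := by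
  have h1 := measurable_intervalIntegral (f := fun r ω => Real.exp (l * r) * m r ω) ht
    (fun r hr => (hm r hr).const_mul _) (fun ω => by have := hc ω; fun_prop)
  exact ((ha.sub (h1.const_mul l)).const_mul _).add (hm t ⟨ht, le_rfl⟩)

end Increments

end ZeroRange

end

open MeasureTheory ProbabilityTheory Filter Set
open scoped Topology ENNReal NNReal

noncomputable section

namespace ZeroRange

/-! ### Existence of a solution -/

section PathMeasurability

variable {p : Params} {T : ℝ} {Ω : Type*} [MeasurableSpace Ω]

theorem PathSpace.continuous_eval (y : PathSpace p T) (H : TestSpace p) :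
    Continuous fun t => y.eval t H :=
  (continuous_eval_const (F := DualSpace p) H).comp
    (show C(↥(Icc (0 : ℝ) T), DualSpace p) from y).continuous

theorem measurable_eval_fieldFiltration {Y : Ω → PathSpace p T} (hY : Measurable Y)
    {s t : ↥(Icc (0 : ℝ) T)} (hst : s ≤ t) (H : TestSpace p) :
    Measurable[fieldFiltration Y hY t] fun ω => (Y ω).eval s H :=
  Measurable.of_comap_le (le_iSup_of_le s (le_iSup_of_le hst (le_iSup_of_le H le_rfl)))

theorem measurable_processM (hT : 0 ≤ T) {Y : Ω → PathSpace p T} (hY : Measurable Y)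
    (H : TestSpace p) (t : ↥(Icc (0 : ℝ) T)) :
    Measurable[fieldFiltration Y hY t] (processM hT Y H t) := by
  refine Measurable.sub (Measurable.sub (measurable_eval_fieldFiltration hY le_rfl H)
    (measurable_eval_fieldFiltration hY t.2.1 H)) ?_
  refine @measurable_intervalIntegral Ω (fieldFiltration Y hY t)
    (fun r ω => (Y ω).eval (projIcc 0 T hT r) (testA p H)) t t.2.1 (fun r hr => ?_) (fun ω => ?_)
  · refine measurable_eval_fieldFiltration hY ?_ _
    rw [projIcc_of_mem hT ⟨hr.1, hr.2.trans t.2.2⟩]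
    exact hr.2
  · exact ((Y ω).continuous_eval _).comp continuous_projIcc

end PathMeasurability

section Existence

theorem measurable_tsum_coef_mul {p : Params} (S : SpectralData p) {Ω : Type*}
    {m : MeasurableSpace Ω} {z : S.ι → Ω → ℝ} (h : ∀ i, Measurable (z i)) (H : TestSpace p) :
    Measurable fun ω => ∑' i, S.coef i H * z i ω :=
  Measurable.tsum fun i => (h i).const_mul _

variable {p : Params} {E Ω : Type} [NormedAddCommGroup E] [InnerProductSpace ℝ E]
  [mΩ : MeasurableSpace Ω]

/-- Versions of the coefficients of the initial field and of the driving noise. -/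
structure DrivenSystem (S : SpectralData p) (d : Driving p E) (P : Measure Ω)
    (W : E →ₗᵢ[ℝ] Lp ℝ 2 P) (T : ℝ) where
  init : S.ι → Ω → ℝ
  noise : S.ι → ℝ → Ω → ℝ
  bound : Ω → ℝ
  growth : ℕ
  measurable_init : ∀ i, Measurable (init i)
  measurable_noise : ∀ i t, Measurable (noise i t)
  continuous_noise : ∀ i ω, Continuous fun t => noise i t ω
  noise_zero : ∀ i ω, noise i 0 ω = 0
  init_ae : ∀ i, init i =ᵐ[P] W (d.init (S.e i))
  noise_ae : ∀ i, ∀ t ∈ Icc 0 T, noise i t =ᵐ[P] W (d.noise t (S.e i))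
  abs_init_le : ∀ i ω, |init i ω| ≤ bound ω * (1 + S.lam i) ^ growth
  abs_noise_le : ∀ i t ω, |noise i t ω| ≤ bound ω * (1 + S.lam i) ^ growth

theorem nonempty_drivenSystem (S : SpectralData p) (d : Driving p E) {P : Measure Ω}
    {W : E →ₗᵢ[ℝ] Lp ℝ 2 P} (hW : IsIsonormal P W) {T : ℝ} (hT : 0 ≤ T) :
    Nonempty (DrivenSystem S d P W T) := by
  obtain ⟨k, hk1, hk2⟩ := d.exists_growth S
  have hc : ∀ i, 0 < (1 + S.lam i) ^ k := fun i => pow_pos (S.one_add_pos i) k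
  obtain ⟨ξ, A, h1, h2, h3, h4⟩ :=
    IsIsonormal.exists_bounded_version W (fun i => d.init (S.e i)) hc hk1
  obtain ⟨m, B, g1, g2, g3, g4, g5, g6⟩ := hW.exists_continuous_version
    (fun i t => d.noise t (S.e i)) (fun i => d.form (S.e i) (S.e i)) (fun i => d.noise_zero _)
    (fun i s t hs hst => d.norm_noise_sub_sq hs hst _) hc hk2 T hT
  refine ⟨⟨ξ, m, fun ω => A ω + B ω, k, h1, g1, g2, g6, h2, g3, fun i ω => (h4 i ω).trans ?_,
    fun i t ω => (g5 i t ω).trans ?_⟩⟩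
  · exact mul_le_mul_of_nonneg_right (le_add_of_nonneg_right (g4 ω)) (hc i).le
  · exact mul_le_mul_of_nonneg_right (le_add_of_nonneg_left (h3 ω)) (hc i).le

namespace DrivenSystem

variable {S : SpectralData p} {d : Driving p E} {P : Measure Ω} {W : E →ₗᵢ[ℝ] Lp ℝ 2 P} {T : ℝ}
  (N : DrivenSystem S d P W T)

/-- The coefficients of the solution. -/
def sol (i : S.ι) (t : ℝ) (ω : Ω) : ℝ := ouSol (S.lam i) (N.init i ω) (fun s => N.noise i s ω) t

theorem continuous_sol (i : S.ι) (ω : Ω) : Continuous fun t => N.sol i t ω :=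
  continuous_ouSol (N.continuous_noise i ω)

theorem sol_zero (i : S.ι) (ω : Ω) : N.sol i 0 ω = N.init i ω := by
  rw [sol, ouSol_eq (N.continuous_noise i ω), N.noise_zero, intervalIntegral.integral_same]
  ring

theorem abs_sol_le (i : S.ι) (t : ℝ) (ht : t ∈ Icc 0 T) (ω : Ω) :
    |N.sol i t ω| ≤ (2 + T) * N.bound ω * (1 + S.lam i) ^ (N.growth + 1) := by
  refine (abs_ouSol_le (S.lam_nonneg i) (N.abs_init_le i ω) (fun s => N.abs_noise_le i s ω) t
    ht).trans (le_of_eq ?_)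
  rw [pow_succ]
  ring

theorem measurable_sol_of_le {m : MeasurableSpace Ω} {i : S.ι} {t : ℝ} (ht : 0 ≤ t)
    (h1 : Measurable[m] (@DrivenSystem.init p E Ω _ _ mΩ S d P W T N i))
    (h2 : ∀ r ∈ Icc 0 t, Measurable[m] (@DrivenSystem.noise p E Ω _ _ mΩ S d P W T N i r)) :
    Measurable[m] (@DrivenSystem.sol p E Ω _ _ mΩ S d P W T N i t) :=
  @measurable_ouSol Ω m (S.lam i) _ _ t ht h1 h2
    (fun ω => @DrivenSystem.continuous_noise p E Ω _ _ mΩ S d P W T N i ω)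

/-- The solution, as a process with values in the path space. -/
def path (hp : p.Admissible) (ω : Ω) : PathSpace p T :=
  (⟨fun t : ↥(Icc (0 : ℝ) T) => S.field hp (fun i => N.sol i t ω) (fun i => N.abs_sol_le i t t.2 ω),
    S.continuous_field hp (fun (t : ↥(Icc (0 : ℝ) T)) i => N.abs_sol_le i t t.2 ω)
      fun i => (N.continuous_sol i ω).comp continuous_subtype_val⟩ : C(↥(Icc (0 : ℝ) T), DualSpace p))

theorem path_eval (hp : p.Admissible) (ω : Ω) (t : ↥(Icc (0 : ℝ) T)) (H : TestSpace p) :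
    (N.path hp ω).eval t H = ∑' i, S.coef i H * N.sol i t ω := rfl

theorem hasSum_path (hp : p.Admissible) (ω : Ω) (t : ↥(Icc (0 : ℝ) T)) (H : TestSpace p) :
    HasSum (fun i => S.coef i H * N.sol i t ω) ((N.path hp ω).eval t H) :=
  (S.summable_coef_mul hp (fun i => N.abs_sol_le i t t.2 ω) H).hasSum

theorem measurable_path (hp : p.Admissible) : Measurable (N.path hp) := by
  refine Measurable.of_le_map (iSup₂_le fun t H => ?_)
  rw [MeasurableSpace.comap_le_iff_le_map, MeasurableSpace.map_comp]
  have h : Measurable fun ω => (N.path hp ω).eval t H := by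
    simp only [path_eval]
    exact measurable_tsum_coef_mul S (fun i => N.measurable_sol_of_le t.2.1 (N.measurable_init i)
      fun r _ => N.measurable_noise i r) H
  exact h.le_map

/-- The driving noise tested against `H`. -/
def noiseSum (H : TestSpace p) (t : ℝ) (ω : Ω) : ℝ := ∑' i, S.coef i H * N.noise i t ω

theorem hasSum_noiseSum (hp : p.Admissible) (H : TestSpace p) (t : ℝ) (ω : Ω) :
    HasSum (fun i => S.coef i H * N.noise i t ω) (N.noiseSum H t ω) :=
  (S.summable_coef_mul hp (fun i => N.abs_noise_le i t ω) H).hasSum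

/-- Sum the scalar equations over i. The term -λ_i∫y_i becomes the i-th term of ∫Y_s(𝔄H) ds since 𝔄
acts on coefficients as -λ_i, and dominated convergence exchanges sum and integral. -/
theorem processM_path (hp : p.Admissible) (hT : 0 ≤ T) (H : TestSpace p) (t : ↥(Icc (0 : ℝ) T))
    (ω : Ω) : processM hT (N.path hp) H t ω = N.noiseSum H t ω := by
  have hcont : ∀ i, Continuous fun s => N.sol i s ω := fun i => N.continuous_sol i ω
  have hint : HasSum (fun i => ∫ s in (0 : ℝ)..t, S.coef i (testA p H) * N.sol i s ω)
      (∫ s in (0 : ℝ)..t, (N.path hp ω).eval (projIcc 0 T hT s) (testA p H)) := by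
    obtain ⟨q, -, hq⟩ := S.exists_abs_coef_mul_le hp (N.growth + 1)
    have hsub : ∀ s ∈ uIoc (0 : ℝ) t, s ∈ Icc 0 T := fun s hs => by
      rw [uIoc_of_le t.2.1] at hs
      exact ⟨hs.1.le, hs.2.trans t.2.2⟩
    refine intervalIntegral.hasSum_integral_of_dominated_convergence
      (fun i _ => q (testA p H) * ((2 + T) * N.bound ω * ((1 + S.lam i) ^ 2)⁻¹))
      (fun i => ((hcont i).const_mul _).aestronglyMeasurable)
      (fun i => Eventually.of_forall fun s hs => ?_)
      (Eventually.of_forall fun s _ => (S.summable_inv.mul_left _).mul_left _)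
      intervalIntegrable_const (Eventually.of_forall fun s hs => ?_)
    · exact (hq (fun i => N.sol i s ω) _ (fun i => N.abs_sol_le i s (hsub s hs) ω)) i _
    · rw [projIcc_of_mem hT (hsub s hs)]
      exact N.hasSum_path hp ω ⟨s, hsub s hs⟩ (testA p H)
  have h1 := ((N.hasSum_path hp ω t H).sub
    (N.hasSum_path hp ω ⟨0, left_mem_Icc.2 hT⟩ H)).sub hint
  refine h1.unique ((N.hasSum_noiseSum hp H t ω).congr_fun fun i => ?_)
  have h2 := ouSol_eq (l := S.lam i) (a := N.init i ω) (N.continuous_noise i ω) t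
  rw [intervalIntegral.integral_const_mul, S.coef_testA, N.sol_zero]
  change N.sol i t ω = _ + _ - _ * ∫ s in (0 : ℝ)..t, N.sol i s ω at h2
  rw [h2]
  ring

/-- The eigenexpansion of H converges in 𝒮_θ, so W ∘ L of its partial sums converges in L², while
their versions converge pointwise to g; the two limits agree almost surely. -/
theorem ae_eq_of_hasSum {L : TestSpace p →ₗ[ℝ] E} (hL : Continuous L) {z : S.ι → Ω → ℝ}
    (hz : ∀ i, z i =ᵐ[P] W (L (S.e i))) {H : TestSpace p} {g : Ω → ℝ}
    (hg : ∀ ω, HasSum (fun i => S.coef i H * z i ω) (g ω)) : g =ᵐ[P] W (L H) := by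
  classical
  have hF : Tendsto (fun A : Finset S.ι => W (L (∑ i ∈ A, S.coef i H • S.e i))) atTop
      (𝓝 (W (L H))) :=
    ((W.continuous.comp hL).tendsto H).comp (S.hasSum H)
  refine ae_eq_of_tendsto hF (f := fun A ω => ∑ i ∈ A, S.coef i H * z i ω) (fun A => ?_)
    (Eventually.of_forall fun ω => hg ω)
  induction A using Finset.induction_on with
  | empty =>
    simp only [Finset.sum_empty, map_zero]
    exact (Lp.coeFn_zero ℝ 2 P).symm
  | insert i A hi ih =>
    simp only [Finset.sum_insert hi, map_add, map_smul] at ih ⊢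
    filter_upwards [ih, hz i, Lp.coeFn_add (S.coef i H • W (L (S.e i)))
      (W (L (∑ i ∈ A, S.coef i H • S.e i))), Lp.coeFn_smul (S.coef i H) (W (L (S.e i)))]
      with ω g1 g2 g3 g4
    simp only [map_sum, map_smul] at g1 g3 ⊢
    rw [g3, Pi.add_apply, g4, Pi.smul_apply, smul_eq_mul, g1, g2]

theorem noiseSum_ae_eq (hp : p.Admissible) (H : TestSpace p) {t : ℝ} (ht : t ∈ Icc 0 T) :
    N.noiseSum H t =ᵐ[P] W (d.noise t H) :=
  ae_eq_of_hasSum (d.continuous_noise ht.1) (fun i => N.noise_ae i t ht)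
    fun ω => N.hasSum_noiseSum hp H t ω

theorem path_zero_ae_eq (hp : p.Admissible) (hT : 0 ≤ T) (H : TestSpace p) :
    (fun ω => (N.path hp ω).eval ⟨0, left_mem_Icc.2 hT⟩ H) =ᵐ[P] W (d.init H) := by
  refine ae_eq_of_hasSum (S := S) d.continuous_init N.init_ae fun ω => ?_
  have h := N.hasSum_path hp ω ⟨0, left_mem_Icc.2 hT⟩ H
  simpa only [N.sol_zero] using h

/-- The initial field and the noise up to time `t`. -/
def past (t : ℝ) : S.ι ⊕ (S.ι × ↥(Icc (0 : ℝ) t)) → Ω → ℝ :=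
  Sum.elim N.init fun q => N.noise q.1 q.2

/-- The solution up to time s is built from the initial coefficients and the noise up to s, so
independence from these variables gives independence from the filtration of the solution. -/
theorem fieldFiltration_le (hp : p.Admissible) (s : ↥(Icc (0 : ℝ) T)) :
    fieldFiltration (N.path hp) (N.measurable_path hp) s
      ≤ MeasurableSpace.comap (fun ω q => N.past s q ω) inferInstance := by
  have hX : ∀ q, Measurable[MeasurableSpace.comap (fun ω q => N.past s q ω) inferInstance]
      (N.past s q) := fun q =>
    (measurable_pi_apply q).comp (comap_measurable fun ω q => N.past s q ω)
  refine iSup_le fun r => iSup_le fun hr => iSup_le fun H => ?_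
  have h (i : S.ι) := N.measurable_sol_of_le r.2.1 (hX (Sum.inl i))
    fun r' hr' => hX (Sum.inr (i, ⟨r', hr'.1, hr'.2.trans hr⟩))
  exact Measurable.comap_le (measurable_tsum_coef_mul S h H)

end DrivenSystem

/-- The martingale part tested against H is a version of the image under `W` of the noise vector.
Its increments after s are orthogonal to the initial vectors and to the noise up to s, hence
independent of ℱ_s, with variance given by the noise form. -/
theorem DrivenSystem.isSolution {S : SpectralData p} {d : Driving p E} {P : Measure Ω}
    {W : E →ₗᵢ[ℝ] Lp ℝ 2 P} {T : ℝ} (N : DrivenSystem S d P W T) (hW : IsIsonormal P W)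
    (hp : p.Admissible) (hT : 0 ≤ T) : IsSolution hT P (N.path hp) := by
  have hP := hW.isProbabilityMeasure
  have hM : ∀ H t, processM hT (N.path hp) H t =ᵐ[P] W (d.noise t H) := fun H t => by
    have : processM hT (N.path hp) H t = N.noiseSum H t :=
      funext fun ω => N.processM_path hp hT H t ω
    rw [this]
    exact N.noiseSum_ae_eq hp H t.2
  have hinc : ∀ H (s t : ↥(Icc (0 : ℝ) T)), (fun ω => processM hT (N.path hp) H t ω
      - processM hT (N.path hp) H s ω) =ᵐ[P] W (d.noise t H - d.noise s H) := fun H s t => by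
    rw [map_sub]
    filter_upwards [hM H t, hM H s, Lp.coeFn_sub (W (d.noise t H)) (W (d.noise s H))]
      with ω h1 h2 h3
    rw [h1, h2, h3, Pi.sub_apply]
  have hmart := fun H => martingale_of_indep_increments (P := P)
    (ℱ := fieldFiltration (N.path hp) (N.measurable_path hp)) (M := processM hT (N.path hp) H)
    (v := fun t => t * normSq p (D 1 H.fn))
    (fun t => (measurable_processM hT (N.measurable_path hp) H t).stronglyMeasurable)
    (fun t => (Lp.memLp (W (d.noise t H))).ae_eq (hM H t).symm)
    (fun s t hst => by
      have h1 := hW.indepFun (X := fun _ : Unit => fun ω => processM hT (N.path hp) H t ω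
          - processM hT (N.path hp) H s ω) (Y := N.past s)
        (v := fun _ => d.noise t H - d.noise s H)
        (w := Sum.elim (fun i => d.init (S.e i)) fun q => d.noise q.2 (S.e q.1))
        (fun _ => hinc H s t) (fun q => by
          rcases q with i | ⟨i, r, hr⟩
          · exact N.init_ae i
          · exact N.noise_ae i r ⟨hr.1, hr.2.trans s.2.2⟩)
        (fun _ q => by
          rw [real_inner_comm]
          rcases q with i | ⟨i, r, hr⟩
          · simp only [Sum.elim_inl, inner_sub_right, d.inner_init_noise, sub_self]
          · exact d.inner_noise_noise_sub hr.1 hr.2 hst _ _)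
      refine indep_of_indep_of_le_left (indep_of_indep_of_le_right h1
        (N.fieldFiltration_le hp s)) ?_
      exact Measurable.comap_le ((measurable_pi_apply ()).comp (comap_measurable
        fun ω (_ : Unit) => processM hT (N.path hp) H t ω - processM hT (N.path hp) H s ω)))
    (fun s t _ => by rw [integral_congr_ae (hinc H s t), hW.integral_eq_zero])
    (fun s t hst => by
      have h1 : (fun ω => (processM hT (N.path hp) H t ω - processM hT (N.path hp) H s ω) ^ 2)
          =ᵐ[P] fun ω => W (d.noise t H - d.noise s H) ω * W (d.noise t H - d.noise s H) ω := by
        filter_upwards [hinc H s t] with ω h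
        rw [h, sq]
      rw [integral_congr_ae h1, IsIsonormal.integral_mul, real_inner_self_eq_norm_sq,
        d.norm_noise_sub_sq s.2.1 hst, d.form_self]
      ring)
  refine ⟨N.measurable_path hp, fun H => (hmart H).1, fun H => (hmart H).2,
    hW.isGaussian_family fun H => N.path_zero_ae_eq hp hT H, fun H => ?_, fun H G => ?_⟩
  · rw [integral_congr_ae (N.path_zero_ae_eq hp hT H), hW.integral_eq_zero]
  · rw [← d.inner_init, ← IsIsonormal.integral_mul W]
    exact integral_congr_ae ((N.path_zero_ae_eq hp hT H).mul (N.path_zero_ae_eq hp hT G))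

theorem exists_isSolution (hp : p.Admissible) {T : ℝ} (hT : 0 ≤ T) :
    ∃ (Ω : Type) (_ : MeasurableSpace Ω) (P : Measure Ω) (Y : Ω → PathSpace p T),
      IsProbabilityMeasure P ∧ IsSolution hT P Y := by
  obtain ⟨S⟩ := nonempty_spectralData hp
  obtain ⟨E, _, _, _, ⟨d⟩⟩ := exists_driving hp
  obtain ⟨Ω, _, P, W, hW⟩ := exists_isIsonormal E
  obtain ⟨N⟩ := nonempty_drivenSystem S d hW hT
  exact ⟨Ω, _, P, N.path hp, hW.isProbabilityMeasure, N.isSolution hW hp hT⟩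

end Existence

end ZeroRange

end

open MeasureTheory ProbabilityTheory Filter Set
open scoped Topology ENNReal NNReal

noncomputable section

namespace ZeroRange

/-! ### Square-integrable martingales with deterministic bracket -/

/-! ### Second-order expansion of exp(ix). -/

section Taylor

/-- The remainder in the expansion of `exp (i x)` to the second order. -/
def expRemainder (x : ℝ) : ℂ := Complex.exp (x * Complex.I) - (1 + x * Complex.I - x ^ 2 / 2)

theorem norm_expRemainder_le_pow_three {x : ℝ} (hx : |x| ≤ 1) : ‖expRemainder x‖ ≤ |x| ^ 3 := by
  have hn : ‖(x * Complex.I : ℂ)‖ = |x| := by simp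
  have h := Complex.exp_bound (x := x * Complex.I) (by rw [hn]; exact hx) (n := 3) (by norm_num)
  have e : expRemainder x = Complex.exp (x * Complex.I)
      - ∑ m ∈ Finset.range 3, (x * Complex.I : ℂ) ^ m / (m.factorial : ℂ) := by
    simp only [expRemainder, Finset.sum_range_succ, Finset.range_zero, Finset.sum_empty, mul_pow,
      Complex.I_sq, Nat.factorial]
    push_cast
    ring
  rw [e]
  refine h.trans ?_
  rw [hn]
  refine mul_le_of_le_one_right (by positivity) ?_
  norm_num [Nat.factorial]

/-- The cubic bound serves for small increments; this quadratic one is for an exceptional large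
increment, where only a second moment is available. -/
theorem norm_expRemainder_le_sq (x : ℝ) : ‖expRemainder x‖ ≤ 4 * x ^ 2 := by
  rcases le_or_gt |x| 1 with hx | hx
  · refine (norm_expRemainder_le_pow_three hx).trans ?_
    rw [pow_succ, sq_abs]
    nlinarith [sq_nonneg x, abs_nonneg x]
  · have h1 : ‖expRemainder x‖ ≤ 1 + (1 + |x| + x ^ 2 / 2) := by
      refine (norm_sub_le _ _).trans (add_le_add (Complex.norm_exp_ofReal_mul_I x).le ?_)
      refine (norm_sub_le _ _).trans (add_le_add ((norm_add_le _ _).trans ?_) ?_)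
      · simp
      · simp
    have h2 : x ^ 2 = |x| ^ 2 := (sq_abs x).symm
    nlinarith

end Taylor

/-! ### Orthogonality relations for martingales with a deterministic bracket. -/

section Martingale

variable {Ω ι : Type*} [Preorder ι] {mΩ : MeasurableSpace Ω} {P : Measure Ω}
  {ℱ : Filtration ι mΩ} {X : ι → Ω → ℝ} {v : ι → ℝ}

/-- A square-integrable martingale `X` for which `X_t² - v_t` is a martingale. -/
structure HasBracket (X : ι → Ω → ℝ) (v : ι → ℝ) (ℱ : Filtration ι mΩ) (P : Measure Ω) :
    Prop where
  martingale : Martingale X ℱ P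
  martingale_sq : Martingale (fun t ω => X t ω ^ 2 - v t) ℱ P

namespace HasBracket

theorem stronglyMeasurable (h : HasBracket X v ℱ P) (t : ι) : StronglyMeasurable[ℱ t] (X t) :=
  h.martingale.1 t

theorem measurable (h : HasBracket X v ℱ P) (t : ι) : Measurable (X t) :=
  ((h.stronglyMeasurable t).mono (ℱ.le t)).measurable

end HasBracket

theorem integral_complex_mul_ofReal {w : Ω → ℂ} {C : ℝ} (hw : AEStronglyMeasurable w P)
    (hC : ∀ ω, ‖w ω‖ ≤ C) {g : Ω → ℝ} (hg : Integrable g P) :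
    ∫ ω, w ω * (g ω : ℂ) ∂P
      = (∫ ω, (w ω).re * g ω ∂P : ℝ) + (∫ ω, (w ω).im * g ω ∂P : ℝ) * Complex.I := by
  have hi : Integrable (fun ω => w ω * (g ω : ℂ)) P :=
    hg.ofReal.bdd_mul hw (Eventually.of_forall hC)
  have h1 := integral_re_add_im (𝕜 := ℂ) hi
  rw [← h1]
  simp

variable [IsProbabilityMeasure P]

/-- Only the product is assumed integrable, not f bounded, so that f may contain the unbounded
factor X_s in `HasBracket.integral_mul_sub_sq`. -/
theorem integral_mul_sub_eq_zero {M : ι → Ω → ℝ} (hM : Martingale M ℱ P) {s t : ι} (hst : s ≤ t)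
    {f : Ω → ℝ} (hf : StronglyMeasurable[ℱ s] f)
    (hi : Integrable (fun ω => f ω * (M t ω - M s ω)) P) :
    ∫ ω, f ω * (M t ω - M s ω) ∂P = 0 := by
  have hd : Integrable (M t - M s) P := (hM.integrable t).sub (hM.integrable s)
  have h1 := condExp_mul_of_stronglyMeasurable_left (μ := P) hf (g := M t - M s) hi hd
  have h2 : P[M t - M s | ℱ s] =ᵐ[P] 0 := by
    filter_upwards [condExp_sub (m := ℱ s) (hM.integrable t) (hM.integrable s), hM.2 s t hst,
      hM.2 s s le_rfl] with ω g1 g2 g3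
    rw [g1, Pi.sub_apply, g2, g3, sub_self]
    rfl
  have h3 : P[f * (M t - M s) | ℱ s] =ᵐ[P] 0 := by
    filter_upwards [h1, h2] with ω g1 g2
    rw [g1, Pi.mul_apply, g2]
    simp
  have h4 := integral_condExp (μ := P) (ℱ.le s) (f := f * (M t - M s))
  rw [integral_congr_ae h3] at h4
  simpa using h4.symm

namespace HasBracket

theorem integrable_sq (h : HasBracket X v ℱ P) (t : ι) : Integrable (fun ω => X t ω ^ 2) P := by
  refine ((h.martingale_sq.integrable t).add (integrable_const (v t))).congr
    (Eventually.of_forall fun ω => ?_)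
  simp

theorem memLp (h : HasBracket X v ℱ P) (t : ι) : MemLp (X t) 2 P :=
  (memLp_two_iff_integrable_sq (h.measurable t).aestronglyMeasurable).2 (h.integrable_sq t)

theorem integrable_mul (h : HasBracket X v ℱ P) (s t : ι) :
    Integrable (fun ω => X s ω * X t ω) P := (h.memLp s).integrable_mul (h.memLp t)

theorem integrable_sub_sq (h : HasBracket X v ℱ P) (s t : ι) :
    Integrable (fun ω => (X t ω - X s ω) ^ 2) P :=
  ((h.memLp t).sub (h.memLp s)).integrable_sq

theorem integral_mul_sq_sub_sq (h : HasBracket X v ℱ P) {s t : ι} (hst : s ≤ t) {f : Ω → ℝ}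
    (hf : StronglyMeasurable[ℱ s] f) {C : ℝ} (hC : ∀ ω, |f ω| ≤ C) :
    ∫ ω, f ω * (X t ω ^ 2 - X s ω ^ 2) ∂P = (v t - v s) * ∫ ω, f ω ∂P := by
  have hfm : AEStronglyMeasurable f P := (hf.mono (ℱ.le s)).aestronglyMeasurable
  have hfi : Integrable f P := Integrable.of_bound hfm C (Eventually.of_forall hC)
  have hb : ∀ {g : Ω → ℝ}, Integrable g P → Integrable (fun ω => f ω * g ω) P := fun hg =>
    hg.bdd_mul hfm (Eventually.of_forall hC)
  have h1 := integral_mul_sub_eq_zero h.martingale_sq hst hf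
    (hb ((h.martingale_sq.integrable t).sub (h.martingale_sq.integrable s)))
  have e : ∀ ω, f ω * (X t ω ^ 2 - X s ω ^ 2)
      = f ω * (X t ω ^ 2 - v t - (X s ω ^ 2 - v s)) + (v t - v s) * f ω := fun ω => by ring
  have hi : Integrable (fun ω => f ω * (X t ω ^ 2 - v t - (X s ω ^ 2 - v s))) P :=
    hb ((h.martingale_sq.integrable t).sub (h.martingale_sq.integrable s))
  simp only [e]
  rw [integral_add hi (hfi.const_mul _), h1, zero_add, integral_const_mul]

theorem integral_mul_sub_sq (h : HasBracket X v ℱ P) {s t : ι} (hst : s ≤ t) {f : Ω → ℝ}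
    (hf : StronglyMeasurable[ℱ s] f) {C : ℝ} (hC : ∀ ω, |f ω| ≤ C) :
    ∫ ω, f ω * (X t ω - X s ω) ^ 2 ∂P = (v t - v s) * ∫ ω, f ω ∂P := by
  have hfm : AEStronglyMeasurable f P := (hf.mono (ℱ.le s)).aestronglyMeasurable
  have hb : ∀ {g : Ω → ℝ}, Integrable g P → Integrable (fun ω => f ω * g ω) P := fun hg =>
    hg.bdd_mul hfm (Eventually.of_forall hC)
  have hi : Integrable (fun ω => f ω * X s ω * (X t ω - X s ω)) P := by
    have := hb ((h.integrable_mul s t).sub (h.integrable_mul s s))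
    refine this.congr (Eventually.of_forall fun ω => ?_)
    simp only [Pi.sub_apply]
    ring
  have h1 := integral_mul_sub_eq_zero h.martingale hst (hf.mul (h.stronglyMeasurable s)) hi
  have e : ∀ ω, f ω * (X t ω - X s ω) ^ 2
      = f ω * (X t ω ^ 2 - X s ω ^ 2) - 2 * (f ω * X s ω * (X t ω - X s ω)) := fun ω => by ring
  have hi2 : Integrable (fun ω => f ω * (X t ω ^ 2 - X s ω ^ 2)) P :=
    hb ((h.integrable_sq t).sub (h.integrable_sq s))
  simp only [e]
  rw [integral_sub hi2 (hi.const_mul _),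
    integral_const_mul]
  simp only [Pi.mul_apply] at h1
  rw [h1, h.integral_mul_sq_sub_sq hst hf hC]
  ring

/-- The submartingale property of X², which moves a bound at an intermediate time to the final time.
-/
theorem integral_mul_sq_le (h : HasBracket X v ℱ P) {s t : ι} (hst : s ≤ t) (hv : v s ≤ v t)
    {f : Ω → ℝ} (hf : StronglyMeasurable[ℱ s] f) {C : ℝ} (hC : ∀ ω, |f ω| ≤ C)
    (hf0 : ∀ ω, 0 ≤ f ω) : ∫ ω, f ω * X s ω ^ 2 ∂P ≤ ∫ ω, f ω * X t ω ^ 2 ∂P := by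
  have hfm : AEStronglyMeasurable f P := (hf.mono (ℱ.le s)).aestronglyMeasurable
  have hb : ∀ {g : Ω → ℝ}, Integrable g P → Integrable (fun ω => f ω * g ω) P := fun hg =>
    hg.bdd_mul hfm (Eventually.of_forall hC)
  have h1 := h.integral_mul_sq_sub_sq hst hf hC
  have h2 : 0 ≤ (v t - v s) * ∫ ω, f ω ∂P :=
    mul_nonneg (sub_nonneg.2 hv) (integral_nonneg hf0)
  simp only [mul_sub] at h1
  rw [integral_sub (hb (h.integrable_sq t)) (hb (h.integrable_sq s))] at h1
  linarith

theorem integral_complex_mul_sub (h : HasBracket X v ℱ P) {s t : ι} (hst : s ≤ t) {w : Ω → ℂ}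
    (hw : StronglyMeasurable[ℱ s] w) {C : ℝ} (hC : ∀ ω, ‖w ω‖ ≤ C) :
    ∫ ω, w ω * ((X t ω - X s ω : ℝ) : ℂ) ∂P = 0 := by
  have hwm : AEStronglyMeasurable w P := (hw.mono (ℱ.le s)).aestronglyMeasurable
  have hd : Integrable (fun ω => X t ω - X s ω) P :=
    (h.martingale.integrable t).sub (h.martingale.integrable s)
  have hre : StronglyMeasurable[ℱ s] fun ω => (w ω).re := 
    Complex.continuous_re.comp_stronglyMeasurable hw
  have him : StronglyMeasurable[ℱ s] fun ω => (w ω).im := 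
    Complex.continuous_im.comp_stronglyMeasurable hw
  rw [integral_complex_mul_ofReal hwm hC hd,
    integral_mul_sub_eq_zero h.martingale hst hre (hd.bdd_mul (hre.mono (ℱ.le s)).aestronglyMeasurable
      (Eventually.of_forall fun ω => (Complex.abs_re_le_norm _).trans (hC ω))),
    integral_mul_sub_eq_zero h.martingale hst him (hd.bdd_mul (him.mono (ℱ.le s)).aestronglyMeasurable
      (Eventually.of_forall fun ω => (Complex.abs_im_le_norm _).trans (hC ω)))]
  simp

theorem integral_complex_mul_sub_sq (h : HasBracket X v ℱ P) {s t : ι} (hst : s ≤ t) {w : Ω → ℂ}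
    (hw : StronglyMeasurable[ℱ s] w) {C : ℝ} (hC : ∀ ω, ‖w ω‖ ≤ C) :
    ∫ ω, w ω * (((X t ω - X s ω) ^ 2 : ℝ) : ℂ) ∂P = ((v t - v s : ℝ) : ℂ) * ∫ ω, w ω ∂P := by
  have hwm : AEStronglyMeasurable w P := (hw.mono (ℱ.le s)).aestronglyMeasurable
  have hre : StronglyMeasurable[ℱ s] fun ω => (w ω).re := 
    Complex.continuous_re.comp_stronglyMeasurable hw
  have him : StronglyMeasurable[ℱ s] fun ω => (w ω).im := 
    Complex.continuous_im.comp_stronglyMeasurable hw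
  have h1 := integral_complex_mul_ofReal hwm hC (integrable_const (μ := P) (1 : ℝ))
  simp only [Complex.ofReal_one, mul_one] at h1
  rw [integral_complex_mul_ofReal hwm hC (h.integrable_sub_sq s t), h1,
    h.integral_mul_sub_sq hst hre fun ω => (Complex.abs_re_le_norm _).trans (hC ω),
    h.integral_mul_sub_sq hst him fun ω => (Complex.abs_im_le_norm _).trans (hC ω)]
  push_cast
  ring

end HasBracket

end Martingale

/-! ### The Taylor expansion along a discrete grid, stopped at large values or increments. -/

section Discrete

theorem integral_sub_add_sub {Ω E : Type*} [MeasurableSpace Ω] {P : Measure Ω}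
    [NormedAddCommGroup E] [NormedSpace ℝ E] {a b c d : Ω → E} (ha : Integrable a P)
    (hb : Integrable b P) (hc : Integrable c P) (hd : Integrable d P) :
    ∫ ω, (a ω - (b ω + c ω - d ω)) ∂P
      = (∫ ω, a ω ∂P) - ((∫ ω, b ω ∂P) + (∫ ω, c ω ∂P) - ∫ ω, d ω ∂P) := by
  have h1 : Integrable (fun ω => b ω + c ω) P := hb.add hc
  have h2 : Integrable (fun ω => b ω + c ω - d ω) P := h1.sub hd
  rw [integral_sub ha h2, integral_sub h1 hd, integral_add hb hc]

theorem integral_add_add {Ω E : Type*} [MeasurableSpace Ω] {P : Measure Ω}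
    [NormedAddCommGroup E] [NormedSpace ℝ E] {a b c : Ω → E} (ha : Integrable a P)
    (hb : Integrable b P) (hc : Integrable c P) :
    ∫ ω, (a ω + b ω + c ω) ∂P = (∫ ω, a ω ∂P) + (∫ ω, b ω ∂P) + ∫ ω, c ω ∂P := by
  have h1 : Integrable (fun ω => a ω + b ω) P := ha.add hb
  rw [integral_add h1 hc, integral_add ha hb]

/-- The event that `X` is bounded by `K` up to step `k`, and its increments by `ε`. -/
def goodSet {Ω : Type*} (X : ℕ → Ω → ℝ) (ε K : ℝ) (k : ℕ) : Set Ω :=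
  {ω | (∀ j ≤ k, |X j ω| ≤ K) ∧ ∀ j < k, |X (j + 1) ω - X j ω| ≤ ε}

theorem measurableSet_goodSet {Ω : Type*} {m : MeasurableSpace Ω} {X : ℕ → Ω → ℝ} (ε K : ℝ)
    {k : ℕ} (hX : ∀ j ≤ k, Measurable (X j)) : MeasurableSet (goodSet X ε K k) := by
  have h1 : ∀ j ≤ k, MeasurableSet {ω | |X j ω| ≤ K} := fun j hj =>
    measurableSet_le (hX j hj).abs measurable_const
  have h2 : ∀ j < k, MeasurableSet {ω | |X (j + 1) ω - X j ω| ≤ ε} := fun j hj =>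
    measurableSet_le ((hX (j + 1) hj).sub (hX j hj.le)).abs measurable_const
  have e : goodSet X ε K k = (⋂ j, ⋂ (_ : j ≤ k), {ω | |X j ω| ≤ K})
      ∩ ⋂ j, ⋂ (_ : j < k), {ω | |X (j + 1) ω - X j ω| ≤ ε} := by
    ext ω
    simp [goodSet]
  rw [e]
  exact (MeasurableSet.iInter fun j => MeasurableSet.iInter fun hj => h1 j hj).inter
    (MeasurableSet.iInter fun j => MeasurableSet.iInter fun hj => h2 j hj)

theorem goodSet_succ_subset {Ω : Type*} (X : ℕ → Ω → ℝ) (ε K : ℝ) (k : ℕ) :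
    goodSet X ε K (k + 1) ⊆ goodSet X ε K k :=
  fun _ h => ⟨fun j hj => h.1 j (by omega), fun j hj => h.2 j (by omega)⟩

/-- The event that the first increment larger than `ε` is the one after step `k`. -/
def jumpSet {Ω : Type*} (X : ℕ → Ω → ℝ) (ε K : ℝ) (k : ℕ) : Set Ω :=
  goodSet X ε K k ∩ {ω | ε < |X (k + 1) ω - X k ω|}

theorem measurableSet_jumpSet {Ω : Type*} {m : MeasurableSpace Ω} {X : ℕ → Ω → ℝ} (ε K : ℝ)
    {k : ℕ} (hX : ∀ j ≤ k + 1, Measurable (X j)) : MeasurableSet (jumpSet X ε K k) :=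
  (measurableSet_goodSet ε K fun j hj => hX j (by omega)).inter
    (measurableSet_lt measurable_const ((hX (k + 1) le_rfl).sub (hX k (by omega))).abs)

theorem indicator_jumpSet_le {Ω : Type*} (X : ℕ → Ω → ℝ) (ε K : ℝ) (k : ℕ) (ω : Ω) :
    (jumpSet X ε K k).indicator 1 ω
      ≤ (goodSet X ε K k).indicator (1 : Ω → ℝ) ω - (goodSet X ε K (k + 1)).indicator 1 ω := by
  by_cases h : ω ∈ jumpSet X ε K k
  · have h' : ω ∉ goodSet X ε K (k + 1) := fun h' => absurd (h'.2 k (by omega)) (not_le.2 h.2)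
    simp [h, h', h.1]
  · rw [indicator_of_notMem h, sub_nonneg]
    exact indicator_le_indicator_of_subset (goodSet_succ_subset X ε K k) (fun _ => zero_le_one) ω

/-- At most one step can carry the first large increment: each jump set lies in the decrement of the
good sets, so the sum telescopes to at most 1, and it vanishes off J. -/
theorem sum_indicator_jumpSet_le {Ω : Type*} (X : ℕ → Ω → ℝ) (ε K : ℝ) (n : ℕ) {J : Set Ω}
    (hJ : ∀ ω ∉ J, ∀ k < n, |X (k + 1) ω - X k ω| ≤ ε) (ω : Ω) :
    ∑ k ∈ Finset.range n, (jumpSet X ε K k).indicator (1 : Ω → ℝ) ω ≤ J.indicator 1 ω := by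
  by_cases h : ω ∈ J
  · rw [indicator_of_mem h]
    refine (Finset.sum_le_sum fun k _ => indicator_jumpSet_le X ε K k ω).trans ?_
    rw [Finset.sum_range_sub']
    have h1 : (goodSet X ε K 0).indicator (1 : Ω → ℝ) ω ≤ 1 :=
      indicator_le_self' (fun _ _ => zero_le_one) ω
    have h2 : 0 ≤ (goodSet X ε K n).indicator (1 : Ω → ℝ) ω :=
      indicator_nonneg (fun _ _ => zero_le_one) ω
    rw [Pi.one_apply]
    linarith
  · rw [indicator_of_notMem h]
    refine (Finset.sum_eq_zero fun k hk => indicator_of_notMem (fun h' => ?_) _).le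
    exact absurd (hJ ω h k (Finset.mem_range.1 hk)) (not_le.2 h'.2)

/-- In a recursion a_{k+1} = c a_k + error with |c| ≤ 1, the errors are not amplified and simply add
up. -/
theorem norm_sub_pow_mul_le_sum {a : ℕ → ℂ} {c : ℂ} (hc : ‖c‖ ≤ 1) {e : ℕ → ℝ} {n : ℕ}
    (h : ∀ k < n, ‖a (k + 1) - c * a k‖ ≤ e k) :
    ‖a n - c ^ n * a 0‖ ≤ ∑ k ∈ Finset.range n, e k := by
  induction n with
  | zero => simp
  | succ n ih =>
    have h1 : a (n + 1) - c ^ (n + 1) * a 0 = (a (n + 1) - c * a n) + c * (a n - c ^ n * a 0) := by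
      ring
    rw [h1, Finset.sum_range_succ]
    refine (norm_add_le _ _).trans ?_
    rw [add_comm]
    refine add_le_add ?_ (h n (by omega))
    rw [norm_mul]
    exact (mul_le_of_le_one_left (norm_nonneg _) hc).trans (ih fun k hk => h k (by omega))

/-- Here x, y, z are the indicators of the good sets before and after the step and of the jump set.
A path that stays good costs the cubic remainder; one that leaves costs at most x - y = 1 plus its
Taylor remainder, which is cubic after a small increment and quadratic, charged to z, after a large
one. -/
theorem norm_indicator_step_le {Z U : ℂ} (hZ : ‖Z‖ ≤ 1) (hU : ‖U‖ ≤ 1) {d ε : ℝ} (hε0 : 0 ≤ ε)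
    (hε : ε ≤ 1) {x y z : ℝ} (hz : 0 ≤ z) (h : (x = 0 ∧ y = 0) ∨ (x = 1 ∧ y = 1 ∧ |d| ≤ ε) ∨
      (x = 1 ∧ y = 0 ∧ |d| ≤ ε) ∨ (x = 1 ∧ y = 0 ∧ z = 1)) :
    ‖(y : ℂ) * (Z * (U * Complex.exp (d * Complex.I)))
        - (x : ℂ) * (Z * U) * (1 + d * Complex.I - d ^ 2 / 2)‖
      ≤ ε * d ^ 2 + 4 * (z * d ^ 2) + (x - y) := by
  have hZU : ‖Z * U‖ ≤ 1 := by
    rw [norm_mul]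
    exact mul_le_one₀ hZ (norm_nonneg _) hU
  have hr : |d| ≤ ε → ‖expRemainder d‖ ≤ ε * d ^ 2 := fun hd => by
    refine (norm_expRemainder_le_pow_three (hd.trans hε)).trans ?_
    rw [pow_succ', sq_abs]
    exact mul_le_mul_of_nonneg_right hd (sq_nonneg d)
  have hmul : ∀ w : ℂ, ‖Z * U * w‖ ≤ ‖w‖ := fun w => by
    rw [norm_mul]
    exact mul_le_of_le_one_left (norm_nonneg _) hZU
  have hp : (1 + d * Complex.I - d ^ 2 / 2 : ℂ) = Complex.exp (d * Complex.I) - expRemainder d := by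
    rw [expRemainder]
    ring
  have hp' : ‖Z * U * (1 + d * Complex.I - d ^ 2 / 2 : ℂ)‖ ≤ 1 + ‖expRemainder d‖ := by
    rw [hp]
    refine (hmul _).trans ((norm_sub_le _ _).trans ?_)
    rw [Complex.norm_exp_ofReal_mul_I]
  have hd0 := mul_nonneg hε0 (sq_nonneg d)
  have hz0 := mul_nonneg hz (sq_nonneg d)
  rcases h with ⟨rfl, rfl⟩ | ⟨rfl, rfl, hd⟩ | ⟨rfl, rfl, hd⟩ | ⟨rfl, rfl, rfl⟩
  · simp only [Complex.ofReal_zero, zero_mul, sub_zero, norm_zero]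
    linarith
  · have e : ((1 : ℝ) : ℂ) * (Z * (U * Complex.exp (d * Complex.I)))
        - ((1 : ℝ) : ℂ) * (Z * U) * (1 + d * Complex.I - d ^ 2 / 2) = Z * U * expRemainder d := by
      rw [hp]
      push_cast
      ring
    rw [e]
    linarith [(hmul (expRemainder d)).trans (hr hd)]
  · simp only [Complex.ofReal_zero, Complex.ofReal_one, zero_mul, zero_sub, norm_neg, one_mul]
    linarith [hr hd]
  · simp only [Complex.ofReal_zero, Complex.ofReal_one, zero_mul, zero_sub, norm_neg, one_mul]
    linarith [norm_expRemainder_le_sq d]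

theorem goodSet_cases {Ω : Type*} (X : ℕ → Ω → ℝ) (ε K : ℝ) (k : ℕ) (ω : Ω) {x y z : ℝ}
    (hx : x = (goodSet X ε K k).indicator 1 ω) (hy : y = (goodSet X ε K (k + 1)).indicator 1 ω)
    (hz : z = (jumpSet X ε K k).indicator 1 ω) :
    (x = 0 ∧ y = 0) ∨ (x = 1 ∧ y = 1 ∧ |X (k + 1) ω - X k ω| ≤ ε) ∨
      (x = 1 ∧ y = 0 ∧ |X (k + 1) ω - X k ω| ≤ ε) ∨ (x = 1 ∧ y = 0 ∧ z = 1) := by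
  subst hx hy hz
  by_cases h1 : ω ∈ goodSet X ε K k
  · by_cases h2 : ω ∈ goodSet X ε K (k + 1)
    · exact Or.inr (Or.inl ⟨by simp [h1], by simp [h2], h2.2 k (by omega)⟩)
    · rcases le_or_gt |X (k + 1) ω - X k ω| ε with h3 | h3
      · exact Or.inr (Or.inr (Or.inl ⟨by simp [h1], by simp [h2], h3⟩))
      · have h4 : ω ∈ jumpSet X ε K k := ⟨h1, h3⟩
        exact Or.inr (Or.inr (Or.inr ⟨by simp [h1], by simp [h2], by simp [h4]⟩))
  · have h2 : ω ∉ goodSet X ε K (k + 1) := fun h => h1 (goodSet_succ_subset X ε K k h)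
    exact Or.inl ⟨by simp [h1], by simp [h2]⟩

variable {Ω : Type*} {mΩ : MeasurableSpace Ω} {P : Measure Ω}
  {ℱ : Filtration ℕ mΩ} {X : ℕ → Ω → ℝ} {v : ℕ → ℝ}

namespace HasBracket

theorem measurable_of_le (h : HasBracket X v ℱ P) {j k : ℕ} (hjk : j ≤ k) :
    Measurable[ℱ k] (X j) := ((h.stronglyMeasurable j).mono (ℱ.mono hjk)).measurable

theorem measurableSet_goodSet (h : HasBracket X v ℱ P) (ε K : ℝ) (k : ℕ) :
    MeasurableSet[ℱ k] (goodSet X ε K k) :=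
  @ZeroRange.measurableSet_goodSet Ω (ℱ k) X ε K k fun _ hj => h.measurable_of_le hj

theorem measurableSet_jumpSet (h : HasBracket X v ℱ P) (ε K : ℝ) (k : ℕ) :
    MeasurableSet[ℱ (k + 1)] (jumpSet X ε K k) :=
  @ZeroRange.measurableSet_jumpSet Ω (ℱ (k + 1)) X ε K k fun _ hj => h.measurable_of_le hj

variable [IsProbabilityMeasure P]

/-- The factor multiplying the expansion is bounded and known at step k, so the martingale property
removes the linear term and the bracket replaces the quadratic one by w. The characteristic integral
is thus multiplied by 1 - w/2, up to the pointwise errors. -/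
theorem norm_integral_step_le (h : HasBracket X v ℱ P) {k n : ℕ} (hkn : k < n) {w : ℝ}
    (hv : v (k + 1) - v k = w) (hvn : v (k + 1) ≤ v n) {Z : Ω → ℂ}
    (hZ : StronglyMeasurable[ℱ 0] Z) (hZ1 : ∀ ω, ‖Z ω‖ ≤ 1) {ε K : ℝ} (hε0 : 0 ≤ ε)
    (hε : ε ≤ 1) :
    ‖(∫ ω, (((goodSet X ε K (k + 1)).indicator (1 : Ω → ℝ) ω : ℝ) : ℂ)
        * (Z ω * Complex.exp (X (k + 1) ω * Complex.I)) ∂P)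
      - (1 - w / 2) * ∫ ω, (((goodSet X ε K k).indicator (1 : Ω → ℝ) ω : ℝ) : ℂ)
        * (Z ω * Complex.exp (X k ω * Complex.I)) ∂P‖
      ≤ ε * w + 8 * (∫ ω, (jumpSet X ε K k).indicator 1 ω * (X n ω ^ 2 + K ^ 2) ∂P)
        + ((∫ ω, (goodSet X ε K k).indicator (1 : Ω → ℝ) ω ∂P)
          - ∫ ω, (goodSet X ε K (k + 1)).indicator (1 : Ω → ℝ) ω ∂P) := by
  have hGk := h.measurableSet_goodSet ε K k
  have hGk' := h.measurableSet_goodSet ε K (k + 1)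
  have hJk := h.measurableSet_jumpSet ε K k
  have hind1 : ∀ (s : Set Ω) ω, |s.indicator (1 : Ω → ℝ) ω| ≤ 1 := fun s ω => by
    by_cases hs : ω ∈ s <;> simp [hs]
  have hind0 : ∀ (s : Set Ω) ω, 0 ≤ s.indicator (1 : Ω → ℝ) ω := fun s ω =>
    indicator_nonneg (fun _ _ => zero_le_one) ω
  have hsm : ∀ {j : ℕ} {s : Set Ω}, MeasurableSet[ℱ j] s →
      StronglyMeasurable[ℱ j] (s.indicator (1 : Ω → ℝ)) := fun hs =>
    stronglyMeasurable_one.indicator hs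
  have hii : ∀ {j : ℕ} {s : Set Ω}, MeasurableSet[ℱ j] s →
      Integrable (s.indicator (1 : Ω → ℝ)) P := fun {j} {s} hs =>
    Integrable.of_bound ((hsm hs).mono (ℱ.le j)).aestronglyMeasurable 1
      (Eventually.of_forall (hind1 s))
  have hU : ∀ j ω, ‖Complex.exp (X j ω * Complex.I)‖ ≤ 1 := fun j ω =>
    (Complex.norm_exp_ofReal_mul_I _).le
  have hW : ∀ {j : ℕ} {s : Set Ω}, MeasurableSet[ℱ j] s → StronglyMeasurable[ℱ j] fun ω =>
      ((s.indicator (1 : Ω → ℝ) ω : ℝ) : ℂ) * (Z ω * Complex.exp (X j ω * Complex.I)) := by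
    intro j s hs
    have h1 : StronglyMeasurable[ℱ j] fun ω => Complex.exp (X j ω * Complex.I) :=
      (by fun_prop : Continuous fun x : ℝ => Complex.exp (x * Complex.I)).comp_stronglyMeasurable
        (h.stronglyMeasurable j)
    exact (Complex.continuous_ofReal.comp_stronglyMeasurable (hsm hs)).mul
      ((hZ.mono (ℱ.mono (Nat.zero_le j))).mul h1)
  have hWb : ∀ (j : ℕ) (s : Set Ω) ω, ‖((s.indicator (1 : Ω → ℝ) ω : ℝ) : ℂ)
      * (Z ω * Complex.exp (X j ω * Complex.I))‖ ≤ 1 := fun j s ω => by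
    rw [norm_mul, norm_mul, Complex.norm_real]
    exact mul_le_one₀ (hind1 s ω) (by positivity)
      (mul_le_one₀ (hZ1 ω) (norm_nonneg _) (hU j ω))
  have hWi : ∀ {j : ℕ} {s : Set Ω}, MeasurableSet[ℱ j] s → Integrable (fun ω =>
      ((s.indicator (1 : Ω → ℝ) ω : ℝ) : ℂ) * (Z ω * Complex.exp (X j ω * Complex.I))) P :=
    fun {j} {s} hs => Integrable.of_bound ((hW hs).mono (ℱ.le j)).aestronglyMeasurable 1
      (Eventually.of_forall (hWb j s))
  have hd : Integrable (fun ω => X (k + 1) ω - X k ω) P :=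
    (h.martingale.integrable _).sub (h.martingale.integrable _)
  have hd2 := h.integrable_sub_sq k (k + 1)
  have hWm := ((hW hGk).mono (ℱ.le k)).aestronglyMeasurable (μ := P)
  have hWd : Integrable (fun ω => (((goodSet X ε K k).indicator (1 : Ω → ℝ) ω : ℝ) : ℂ)
      * (Z ω * Complex.exp (X k ω * Complex.I)) * ((X (k + 1) ω - X k ω : ℝ) : ℂ)) P :=
    hd.ofReal.bdd_mul hWm (Eventually.of_forall (hWb k _))
  have hWd2 : Integrable (fun ω => (((goodSet X ε K k).indicator (1 : Ω → ℝ) ω : ℝ) : ℂ)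
      * (Z ω * Complex.exp (X k ω * Complex.I)) * (((X (k + 1) ω - X k ω) ^ 2 : ℝ) : ℂ)) P :=
    hd2.ofReal.bdd_mul hWm (Eventually.of_forall (hWb k _))
  have e1 := h.integral_complex_mul_sub (Nat.le_succ k) (hW hGk) (hWb k _)
  have e2 := h.integral_complex_mul_sub_sq (Nat.le_succ k) (hW hGk) (hWb k _)
  rw [hv] at e2
  have e3 : ∫ ω, ((((goodSet X ε K (k + 1)).indicator (1 : Ω → ℝ) ω : ℝ) : ℂ)
        * (Z ω * (Complex.exp (X k ω * Complex.I)
          * Complex.exp ((X (k + 1) ω - X k ω : ℝ) * Complex.I)))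
      - (((goodSet X ε K k).indicator (1 : Ω → ℝ) ω : ℝ) : ℂ) * (Z ω * Complex.exp (X k ω * Complex.I))
        * (1 + (X (k + 1) ω - X k ω : ℝ) * Complex.I - (X (k + 1) ω - X k ω : ℝ) ^ 2 / 2)) ∂P
      = (∫ ω, (((goodSet X ε K (k + 1)).indicator (1 : Ω → ℝ) ω : ℝ) : ℂ)
        * (Z ω * Complex.exp (X (k + 1) ω * Complex.I)) ∂P)
      - (1 - w / 2) * ∫ ω, (((goodSet X ε K k).indicator (1 : Ω → ℝ) ω : ℝ) : ℂ)
        * (Z ω * Complex.exp (X k ω * Complex.I)) ∂P := by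
    have e4 : ∀ ω, (((goodSet X ε K (k + 1)).indicator (1 : Ω → ℝ) ω : ℝ) : ℂ)
        * (Z ω * (Complex.exp (X k ω * Complex.I)
          * Complex.exp ((X (k + 1) ω - X k ω : ℝ) * Complex.I)))
      - (((goodSet X ε K k).indicator (1 : Ω → ℝ) ω : ℝ) : ℂ) * (Z ω * Complex.exp (X k ω * Complex.I))
        * (1 + (X (k + 1) ω - X k ω : ℝ) * Complex.I - (X (k + 1) ω - X k ω : ℝ) ^ 2 / 2)
      = (((goodSet X ε K (k + 1)).indicator (1 : Ω → ℝ) ω : ℝ) : ℂ)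
        * (Z ω * Complex.exp (X (k + 1) ω * Complex.I))
      - ((((goodSet X ε K k).indicator (1 : Ω → ℝ) ω : ℝ) : ℂ) * (Z ω * Complex.exp (X k ω * Complex.I))
        + (((goodSet X ε K k).indicator (1 : Ω → ℝ) ω : ℝ) : ℂ) * (Z ω * Complex.exp (X k ω * Complex.I))
          * ((X (k + 1) ω - X k ω : ℝ) : ℂ) * Complex.I
        - (((goodSet X ε K k).indicator (1 : Ω → ℝ) ω : ℝ) : ℂ) * (Z ω * Complex.exp (X k ω * Complex.I))
          * (((X (k + 1) ω - X k ω) ^ 2 : ℝ) : ℂ) * (1 / 2)) := fun ω => by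
      rw [← Complex.exp_add]
      push_cast
      ring_nf
    simp only [e4]
    rw [integral_sub_add_sub (hWi hGk') (hWi hGk) (hWd.mul_const _) (hWd2.mul_const _),
      integral_mul_const, integral_mul_const, e1, e2]
    ring
  have hJi : ∀ {f : Ω → ℝ}, Integrable f P →
      Integrable (fun ω => (jumpSet X ε K k).indicator 1 ω * f ω) P := fun hf =>
    hf.bdd_mul ((hsm hJk).mono (ℱ.le _)).aestronglyMeasurable (Eventually.of_forall (hind1 _))
  have b1 : Integrable (fun ω => ε * (X (k + 1) ω - X k ω) ^ 2) P := hd2.const_mul _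
  have b2 : Integrable (fun ω => 4 * ((jumpSet X ε K k).indicator 1 ω
      * (X (k + 1) ω - X k ω) ^ 2)) P := (hJi hd2).const_mul _
  have b3 : Integrable (fun ω => (goodSet X ε K k).indicator (1 : Ω → ℝ) ω
      - (goodSet X ε K (k + 1)).indicator 1 ω) P := (hii hGk).sub (hii hGk')
  have hmain := norm_integral_le_of_norm_le ((b1.add b2).add b3) (Eventually.of_forall fun ω =>
    norm_indicator_step_le (hZ1 ω) (hU k ω) hε0 hε (hind0 _ ω)
      (goodSet_cases X ε K k ω rfl rfl rfl))
  rw [e3] at hmain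
  refine hmain.trans ?_
  simp only [Pi.add_apply]
  rw [integral_add_add b1 b2 b3, integral_sub (hii hGk) (hii hGk'),
    integral_const_mul, integral_const_mul]
  have c1 : ∫ ω, (X (k + 1) ω - X k ω) ^ 2 ∂P = w := by
    have := h.integral_mul_sub_sq (Nat.le_succ k) (f := fun _ => 1) stronglyMeasurable_const
      (C := 1) (fun _ => by simp)
    simpa [hv] using this
  -- On the jump set |X_k| ≤ K still holds, and (a - b)² ≤ 2a² + 2b². The overshoot X_{k+1}² is then
  -- replaced by X_n², so that all steps are bounded by the same integrable variable.
  have c2 : ∫ ω, (jumpSet X ε K k).indicator 1 ω * (X (k + 1) ω - X k ω) ^ 2 ∂P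
      ≤ ∫ ω, (2 * ((jumpSet X ε K k).indicator 1 ω * X (k + 1) ω ^ 2)
        + 2 * ((jumpSet X ε K k).indicator 1 ω * K ^ 2)) ∂P := by
    refine integral_mono (hJi hd2) (((hJi (h.integrable_sq _)).const_mul _).add
      ((hJi (integrable_const _)).const_mul _)) fun ω => ?_
    by_cases hω : ω ∈ jumpSet X ε K k
    · simp only [indicator_of_mem hω, Pi.one_apply, one_mul]
      have h1 : X k ω ^ 2 ≤ K ^ 2 := sq_le_sq.2 ((hω.1.1 k le_rfl).trans (le_abs_self K))
      nlinarith [sq_nonneg (X (k + 1) ω + X k ω)]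
    · simp [indicator_of_notMem hω]
  have c3 := h.integral_mul_sq_le (Nat.succ_le_of_lt hkn) hvn (hsm hJk) (hind1 _) (hind0 _)
  rw [integral_add ((hJi (h.integrable_sq _)).const_mul _)
      ((hJi (integrable_const _)).const_mul _), integral_const_mul, integral_const_mul] at c2
  simp only [mul_add]
  rw [integral_add (hJi (h.integrable_sq _)) (hJi (integrable_const _)), c1]
  linarith

end HasBracket

end Discrete

end ZeroRange

end

open MeasureTheory ProbabilityTheory Filter Set
open scoped Topology ENNReal NNReal

noncomputable section

namespace ZeroRange

/-! ### Lévy's characterisation -/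

namespace HasBracket

section

variable {Ω : Type*} {mΩ : MeasurableSpace Ω} {P : Measure Ω} [IsProbabilityMeasure P]

/-- Sum the one-step errors. The jump sets together weigh at most the indicator of J. The losses of
good paths, over the steps and when the cut-off is removed at times 0 and n, add up to exactly twice
the probability of not being good at step n. The bound w ≤ 4 ensures |1 - w/2| ≤ 1. -/
theorem norm_integral_exp_sub_le {ℱ : Filtration ℕ mΩ} {X : ℕ → Ω → ℝ} {v : ℕ → ℝ}
    (h : HasBracket X v ℱ P) {n : ℕ} {w : ℝ} (hw0 : 0 ≤ w)
    (hw4 : w ≤ 4) (hv : ∀ k < n, v (k + 1) - v k = w) {Z : Ω → ℂ}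
    (hZ : StronglyMeasurable[ℱ 0] Z) (hZ1 : ∀ ω, ‖Z ω‖ ≤ 1) {ε K : ℝ} (hε0 : 0 ≤ ε)
    (hε : ε ≤ 1) {J L : Set Ω} (hJm : MeasurableSet J) (hLm : MeasurableSet L)
    (hJ : ∀ ω ∉ J, ∀ k < n, |X (k + 1) ω - X k ω| ≤ ε) (hL : ∀ ω ∉ L, ∀ k ≤ n, |X k ω| ≤ K) :
    ‖(∫ ω, Z ω * Complex.exp (X n ω * Complex.I) ∂P)
      - (1 - w / 2) ^ n * ∫ ω, Z ω * Complex.exp (X 0 ω * Complex.I) ∂P‖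
      ≤ n * (ε * w) + 8 * (∫ ω, J.indicator 1 ω * (X n ω ^ 2 + K ^ 2) ∂P)
        + 2 * (P.real J + P.real L) := by
  set g : ℕ → Ω → ℝ := fun k => (goodSet X ε K k).indicator (1 : Ω → ℝ) with hg
  set a : ℕ → ℂ := fun k => ∫ ω, (g k ω : ℂ) * (Z ω * Complex.exp (X k ω * Complex.I)) ∂P with ha
  have hvk : ∀ k ≤ n, v k = v 0 + k * w := by
    intro k
    induction k with
    | zero => simp
    | succ k ih =>
      intro hk
      have h1 := hv k (by omega)
      have h2 := ih (by omega)
      push_cast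
      linarith
  have hvn : ∀ k ≤ n, v k ≤ v n := fun k hk => by
    rw [hvk k hk, hvk n le_rfl]
    have : (k : ℝ) ≤ n := by exact_mod_cast hk
    nlinarith
  have hc : ‖(1 - w / 2 : ℂ)‖ ≤ 1 := by
    have e : (1 - w / 2 : ℂ) = ((1 - w / 2 : ℝ) : ℂ) := by push_cast; rfl
    rw [e, Complex.norm_real, Real.norm_eq_abs, abs_le]
    constructor <;> linarith
  have hGm : ∀ k, MeasurableSet (goodSet X ε K k) := fun k =>
    ℱ.le k _ (h.measurableSet_goodSet ε K k)
  have hJkm : ∀ k, MeasurableSet (jumpSet X ε K k) := fun k =>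
    ℱ.le _ _ (h.measurableSet_jumpSet ε K k)
  have hind1 : ∀ (s : Set Ω) ω, |s.indicator (1 : Ω → ℝ) ω| ≤ 1 := fun s ω => by
    by_cases hs : ω ∈ s <;> simp [hs]
  have hii : ∀ {s : Set Ω}, MeasurableSet s → ∀ {f : Ω → ℝ}, Integrable f P →
      Integrable (fun ω => s.indicator 1 ω * f ω) P := fun {s} hs {f} hf =>
    hf.bdd_mul (stronglyMeasurable_one.indicator hs).aestronglyMeasurable
      (Eventually.of_forall (hind1 s))
  have hgi : ∀ k, Integrable (g k) P := fun k => by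
    simpa using hii (hGm k) (integrable_const (1 : ℝ))
  have hf : Integrable (fun ω => X n ω ^ 2 + K ^ 2) P := (h.integrable_sq n).add
    (integrable_const _)
  have hsum := norm_sub_pow_mul_le_sum (a := a) hc (n := n) fun k hk =>
    h.norm_integral_step_le hk (hv k hk) (hvn (k + 1) hk) hZ hZ1 (K := K) hε0 hε
  have hjump : ∑ k ∈ Finset.range n, ∫ ω, (jumpSet X ε K k).indicator 1 ω * (X n ω ^ 2 + K ^ 2) ∂P
      ≤ ∫ ω, J.indicator 1 ω * (X n ω ^ 2 + K ^ 2) ∂P := by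
    rw [← integral_finsetSum _ fun k _ => hii (hJkm k) hf]
    refine integral_mono (integrable_finsetSum _ fun k _ => hii (hJkm k) hf) (hii hJm hf)
      fun ω => ?_
    simp only
    rw [← Finset.sum_mul]
    exact mul_le_mul_of_nonneg_right (sum_indicator_jumpSet_le X ε K n hJ ω) (by positivity)
  have hZU : ∀ k, Integrable (fun ω => Z ω * Complex.exp (X k ω * Complex.I)) P := fun k => by
    refine Integrable.of_bound ((hZ.mono (ℱ.le 0)).aestronglyMeasurable.mul ?_) 1
      (Eventually.of_forall fun ω => ?_)
    · exact (integrable_exp_mul_I (h.measurable k).aemeasurable).aestronglyMeasurable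
    · rw [norm_mul, Complex.norm_exp_ofReal_mul_I, mul_one]
      exact hZ1 ω
  have hdiff : ∀ k, ‖(∫ ω, Z ω * Complex.exp (X k ω * Complex.I) ∂P) - a k‖
      ≤ 1 - ∫ ω, g k ω ∂P := fun k => by
    have hga : Integrable (fun ω => (g k ω : ℂ) * (Z ω * Complex.exp (X k ω * Complex.I))) P :=
      (hZU k).bdd_mul (hgi k).ofReal.aestronglyMeasurable (c := 1)
        (Eventually.of_forall fun ω => by rw [Complex.norm_real]; exact hind1 _ ω)
    have e1 : (1 : ℝ) - ∫ ω, g k ω ∂P = ∫ ω, (1 - g k ω) ∂P := by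
      rw [integral_sub (integrable_const _) (hgi k)]
      simp
    rw [ha, ← integral_sub (hZU k) hga, e1]
    refine norm_integral_le_of_norm_le ((integrable_const _).sub (hgi k))
      (Eventually.of_forall fun ω => ?_)
    have e2 : Z ω * Complex.exp (X k ω * Complex.I)
        - (g k ω : ℂ) * (Z ω * Complex.exp (X k ω * Complex.I))
        = ((1 - g k ω : ℝ) : ℂ) * (Z ω * Complex.exp (X k ω * Complex.I)) := by
      push_cast
      ring
    have h0 : 0 ≤ 1 - g k ω := sub_nonneg.2 ((le_abs_self _).trans (hind1 _ ω))
    rw [e2, norm_mul, norm_mul, Complex.norm_exp_ofReal_mul_I, mul_one, Complex.norm_real,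
      Real.norm_eq_abs, abs_of_nonneg h0]
    exact mul_le_of_le_one_right h0 (hZ1 ω)
  have hgn : 1 - ∫ ω, g n ω ∂P ≤ P.real J + P.real L := by
    have hi1 : ∀ {s : Set Ω}, MeasurableSet s → Integrable (s.indicator (1 : Ω → ℝ)) P :=
      fun hs => by simpa using hii hs (integrable_const (1 : ℝ))
    have e1 : (1 : ℝ) - ∫ ω, g n ω ∂P = ∫ ω, (1 - g n ω) ∂P := by
      rw [integral_sub (integrable_const _) (hgi n)]
      simp
    rw [e1, ← integral_indicator_one hJm, ← integral_indicator_one hLm,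
      ← integral_add (hi1 hJm) (hi1 hLm)]
    refine integral_mono ((integrable_const _).sub (hgi n)) ((hi1 hJm).add (hi1 hLm)) fun ω => ?_
    have hJ0 : 0 ≤ J.indicator (1 : Ω → ℝ) ω := indicator_nonneg (fun _ _ => zero_le_one) ω
    have hL0 : 0 ≤ L.indicator (1 : Ω → ℝ) ω := indicator_nonneg (fun _ _ => zero_le_one) ω
    have hg0 : 0 ≤ g n ω := indicator_nonneg (fun _ _ => zero_le_one) ω
    change 1 - g n ω ≤ J.indicator (1 : Ω → ℝ) ω + L.indicator (1 : Ω → ℝ) ω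
    by_cases h1 : ω ∈ J
    · rw [indicator_of_mem h1, Pi.one_apply]
      linarith
    · by_cases h2 : ω ∈ L
      · rw [indicator_of_mem h2, Pi.one_apply]
        linarith
      · have h3 : ω ∈ goodSet X ε K n := ⟨hL ω h2, hJ ω h1⟩
        have h4 : g n ω = 1 := by simp [hg, h3]
        linarith
  rw [Finset.sum_add_distrib, Finset.sum_add_distrib, Finset.sum_const, Finset.card_range,
    nsmul_eq_mul, ← Finset.mul_sum, Finset.sum_range_sub' (fun k => ∫ ω, g k ω ∂P) n] at hsum
  have e : (∫ ω, Z ω * Complex.exp (X n ω * Complex.I) ∂P)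
      - (1 - w / 2) ^ n * ∫ ω, Z ω * Complex.exp (X 0 ω * Complex.I) ∂P
      = (a n - (1 - w / 2) ^ n * a 0)
        + ((∫ ω, Z ω * Complex.exp (X n ω * Complex.I) ∂P) - a n)
        - (1 - w / 2) ^ n * ((∫ ω, Z ω * Complex.exp (X 0 ω * Complex.I) ∂P) - a 0) := by ring
  have hlast : ‖(1 - w / 2 : ℂ) ^ n * ((∫ ω, Z ω * Complex.exp (X 0 ω * Complex.I) ∂P) - a 0)‖
      ≤ 1 - ∫ ω, g 0 ω ∂P := by
    rw [norm_mul, norm_pow]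
    exact (mul_le_of_le_one_left (norm_nonneg _) (pow_le_one₀ (norm_nonneg _) hc)).trans (hdiff 0)
  rw [e]
  refine (norm_sub_le _ _).trans ((add_le_add (norm_add_le _ _) hlast).trans ?_)
  linarith [hdiff n]

end

section

variable {Ω ι : Type*} [Preorder ι] {mΩ : MeasurableSpace Ω} {P : Measure Ω}
  {ℱ : Filtration ι mΩ} {X : ι → Ω → ℝ} {v : ι → ℝ}

/-- The filtration obtained by sampling at the times `τ k`. -/
def sampledFiltration (ℱ : Filtration ι mΩ) {τ : ℕ → ι} (hτ : Monotone τ) : Filtration ℕ mΩ where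
  seq k := ℱ (τ k)
  mono' _ _ h := ℱ.mono (hτ h)
  le' k := ℱ.le (τ k)

theorem sampled (h : HasBracket X v ℱ P) {τ : ℕ → ι} (hτ : Monotone τ) :
    HasBracket (fun k => X (τ k)) (fun k => v (τ k)) (sampledFiltration ℱ hτ) P :=
  ⟨⟨fun k => h.martingale.1 (τ k), fun _ _ hij => h.martingale.2 _ _ (hτ hij)⟩,
    ⟨fun k => h.martingale_sq.1 (τ k), fun _ _ hij => h.martingale_sq.2 _ _ (hτ hij)⟩⟩

end

end HasBracket

/-! ### Equidistant grids in a time interval. -/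

section Grid

variable {T : ℝ}

/-- The point at the fraction `k / n` of the interval from `s` to `t`. -/
def gridPoint {s t : ↥(Icc (0 : ℝ) T)} (hst : s ≤ t) (n k : ℕ) : ↥(Icc (0 : ℝ) T) :=
  ⟨s + (t - s) * min ((k : ℝ) / n) 1, by
    have h1 : (s : ℝ) ≤ t := hst
    have h2 : 0 ≤ min ((k : ℝ) / n) 1 := le_min (by positivity) zero_le_one
    have h3 : min ((k : ℝ) / n) 1 ≤ 1 := min_le_right _ _
    have h4 := s.2.1
    have h5 := t.2.2
    constructor <;> nlinarith⟩

theorem monotone_gridPoint {s t : ↥(Icc (0 : ℝ) T)} (hst : s ≤ t) (n : ℕ) :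
    Monotone (gridPoint hst n) := fun k l hkl => by
  have h1 : (s : ℝ) ≤ t := hst
  have h2 : (k : ℝ) ≤ l := by exact_mod_cast hkl
  have h3 : min ((k : ℝ) / n) 1 ≤ min ((l : ℝ) / n) 1 := by gcongr
  exact add_le_add le_rfl (mul_le_mul_of_nonneg_left h3 (sub_nonneg.2 h1))

theorem gridPoint_zero {s t : ↥(Icc (0 : ℝ) T)} (hst : s ≤ t) (n : ℕ) :
    gridPoint hst n 0 = s := Subtype.ext (by simp [gridPoint])

theorem gridPoint_self {s t : ↥(Icc (0 : ℝ) T)} (hst : s ≤ t) {n : ℕ} (hn : n ≠ 0) :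
    gridPoint hst n n = t := Subtype.ext (by simp [gridPoint, hn])

theorem gridPoint_succ_sub {s t : ↥(Icc (0 : ℝ) T)} (hst : s ≤ t) {n k : ℕ} (hk : k < n) :
    (gridPoint hst n (k + 1) : ℝ) - gridPoint hst n k = (t - s) / n := by
  have hn : (0 : ℝ) < n := by exact_mod_cast (Nat.zero_le k).trans_lt hk
  have h1 : ((k + 1 : ℕ) : ℝ) / n ≤ 1 := by
    rw [div_le_one hn]
    exact_mod_cast hk
  have h2 : (k : ℝ) / n ≤ 1 := by
    rw [div_le_one hn]
    exact_mod_cast hk.le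
  simp only [gridPoint]
  rw [min_eq_left h1, min_eq_left h2]
  push_cast
  field_simp
  ring

theorem eventually_abs_gridPoint_le {f : ↥(Icc (0 : ℝ) T) → ℝ} (hf : Continuous f)
    {s t : ↥(Icc (0 : ℝ) T)} (hst : s ≤ t) {ε : ℝ} (hε : 0 < ε) :
    ∀ᶠ n in atTop, ∀ k < n, |f (gridPoint hst n (k + 1)) - f (gridPoint hst n k)| ≤ ε := by
  obtain ⟨δ, hδ, h⟩ := Metric.uniformContinuous_iff.1
    (CompactSpace.uniformContinuous_of_continuous hf) ε hε
  have h1 : Tendsto (fun n : ℕ => ((t : ℝ) - s) / n) atTop (𝓝 0) :=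
    tendsto_const_div_atTop_nhds_zero_nat _
  filter_upwards [h1.eventually (gt_mem_nhds hδ)] with n hn k hk
  rw [← Real.dist_eq]
  refine (h ?_).le
  rw [Subtype.dist_eq, Real.dist_eq, gridPoint_succ_sub hst hk, abs_of_nonneg]
  · exact hn
  · exact div_nonneg (sub_nonneg.2 hst) (Nat.cast_nonneg n)

end Grid

namespace HasBracket

variable {Ω : Type*} {mΩ : MeasurableSpace Ω} {P : Measure Ω} [IsProbabilityMeasure P] {T : ℝ}
  {ℱ : Filtration ↥(Icc (0 : ℝ) T) mΩ} {X : ↥(Icc (0 : ℝ) T) → Ω → ℝ} {q : ℝ}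

/-- The mesh tends to zero with ε and K fixed. Each continuous path eventually has no grid increment
above ε, so the jump errors vanish by dominated convergence, and (1 - w/2)ⁿ tends to the
exponential. The set L covers all grids at once, so it is unaffected by the limit. -/
theorem norm_integral_mul_exp_sub_le (h : HasBracket X (fun t => (t : ℝ) * q) ℱ P) (hq : 0 ≤ q)
    (hc : ∀ ω, Continuous fun t => X t ω) {s t : ↥(Icc (0 : ℝ) T)} (hst : s ≤ t) {Z : Ω → ℂ}
    (hZ : StronglyMeasurable[ℱ s] Z) (hZ1 : ∀ ω, ‖Z ω‖ ≤ 1) {ε K : ℝ} (hε0 : 0 < ε)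
    (hε : ε ≤ 1) {L : Set Ω} (hLm : MeasurableSet L)
    (hL : ∀ ω ∉ L, ∀ n k, |X (gridPoint hst n k) ω| ≤ K) :
    ‖(∫ ω, Z ω * Complex.exp (X t ω * Complex.I) ∂P)
      - Complex.exp (-(q * (t - s) / 2)) * ∫ ω, Z ω * Complex.exp (X s ω * Complex.I) ∂P‖
      ≤ ε * (q * (t - s)) + 2 * P.real L := by
  have hst' : (0 : ℝ) ≤ t - s := sub_nonneg.2 hst
  set J : ℕ → Set Ω := fun n => ⋃ k, ⋃ (_ : k < n),
    {ω | ε < |X (gridPoint hst n (k + 1)) ω - X (gridPoint hst n k) ω|} with hJdef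
  have hJm : ∀ n, MeasurableSet (J n) := fun n => MeasurableSet.iUnion fun k =>
    MeasurableSet.iUnion fun _ =>
      measurableSet_lt measurable_const ((h.measurable _).sub (h.measurable _)).abs
  have hJ : ∀ n, ∀ ω ∉ J n, ∀ k < n,
      |X (gridPoint hst n (k + 1)) ω - X (gridPoint hst n k) ω| ≤ ε := fun n ω hω k hk => by
    simp only [hJdef, mem_iUnion, not_exists, mem_ofPred_eq, not_lt] at hω
    exact hω k hk
  have hJ0 : ∀ {f : Ω → ℝ}, Integrable f P →
      Tendsto (fun n => ∫ ω, (J n).indicator 1 ω * f ω ∂P) atTop (𝓝 0) := by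
    intro f hf
    have := tendsto_integral_of_dominated_convergence (μ := P)
      (F := fun n ω => (J n).indicator 1 ω * f ω) (f := fun _ => 0) (fun ω => |f ω|)
      (fun n => ((stronglyMeasurable_one.indicator (hJm n)).aestronglyMeasurable).mul hf.1) hf.abs
      (fun n => Eventually.of_forall fun ω => ?_) (Eventually.of_forall fun ω => ?_)
    · simpa using this
    · by_cases hω : ω ∈ J n <;> simp [hω]
    · refine tendsto_const_nhds.congr' ?_
      filter_upwards [eventually_abs_gridPoint_le (hc ω) hst hε0] with n hn
      have : ω ∉ J n := by
        simp only [hJdef, mem_iUnion, not_exists, mem_ofPred_eq, not_lt]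
        exact hn
      simp [this]
  have hJ1 : Tendsto (fun n => P.real (J n)) atTop (𝓝 0) := by
    have := hJ0 (integrable_const (1 : ℝ))
    simp only [mul_one] at this
    simpa only [integral_indicator_one (hJm _)] using this
  have hJ2 := hJ0 ((h.integrable_sq t).add (integrable_const (K ^ 2)))
  have hpow : Tendsto (fun n : ℕ => (1 - ((q * (t - s) / n : ℝ) : ℂ) / 2) ^ n) atTop
      (𝓝 (Complex.exp (-(q * (t - s) / 2)))) := by
    have := Complex.tendsto_one_add_div_pow_exp (-(q * ((t : ℝ) - (s : ℝ)) / 2) : ℂ)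
    refine this.congr fun n => ?_
    congr 1
    push_cast
    ring
  have hlim := ((tendsto_const_nhds (x := ∫ ω, Z ω * Complex.exp (X t ω * Complex.I) ∂P)).sub
    (hpow.mul_const (∫ ω, Z ω * Complex.exp (X s ω * Complex.I) ∂P))).norm
  have hrhs : Tendsto (fun n => ε * (q * (t - s))
      + 8 * (∫ ω, (J n).indicator 1 ω * (X t ω ^ 2 + K ^ 2) ∂P)
      + 2 * (P.real (J n) + P.real L)) atTop (𝓝 (ε * (q * (t - s)) + 8 * 0
      + 2 * (0 + P.real L))) :=
    ((hJ2.const_mul 8).const_add _).add ((hJ1.add_const _).const_mul 2)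
  have hfin := le_of_tendsto_of_tendsto hlim hrhs ?_
  · simpa using hfin
  have hsmall : Tendsto (fun n : ℕ => q * ((t : ℝ) - s) / n) atTop (𝓝 0) :=
    tendsto_const_div_atTop_nhds_zero_nat _
  filter_upwards [eventually_ge_atTop 1, hsmall.eventually (gt_mem_nhds (by norm_num : (0 : ℝ) < 4))]
    with n hn hn4
  have hn0 : n ≠ 0 := by omega
  have key := (h.sampled (monotone_gridPoint hst n)).norm_integral_exp_sub_le (n := n)
    (w := q * (t - s) / n) (by positivity) hn4.le (fun k hk => by
      rw [← sub_mul, gridPoint_succ_sub hst hk]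
      ring) (Z := Z) (by
      change StronglyMeasurable[ℱ (gridPoint hst n 0)] Z
      rw [gridPoint_zero]
      exact hZ) hZ1 hε0.le hε (hJm n) hLm (hJ n) (fun ω hω k _ => hL ω hω n k)
  rw [gridPoint_zero, gridPoint_self hst hn0] at key
  have e : (n : ℝ) * (ε * (q * (t - s) / n)) = ε * (q * (t - s)) := by
    have : (n : ℝ) ≠ 0 := by exact_mod_cast hn0
    field_simp
  rw [e] at key
  exact key

/-- The conditional characteristic function of the increments of a continuous martingale with
bracket `q t`. -/
theorem integral_mul_exp (h : HasBracket X (fun t => (t : ℝ) * q) ℱ P) (hq : 0 ≤ q)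
    (hc : ∀ ω, Continuous fun t => X t ω) {s t : ↥(Icc (0 : ℝ) T)} (hst : s ≤ t) {Z : Ω → ℂ}
    (hZ : StronglyMeasurable[ℱ s] Z) (hZ1 : ∀ ω, ‖Z ω‖ ≤ 1) :
    ∫ ω, Z ω * Complex.exp (X t ω * Complex.I) ∂P
      = Complex.exp (-(q * (t - s) / 2)) * ∫ ω, Z ω * Complex.exp (X s ω * Complex.I) ∂P := by
  -- These sets decrease to the empty set because continuous paths on a compact interval are
  -- bounded; the previous estimate is used with K = m and ε = 1/(m + 1).
  set L : ℕ → Set Ω := fun m => ⋃ n, ⋃ k, {ω | (m : ℝ) < |X (gridPoint hst n k) ω|} with hLdef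
  have hLm : ∀ m, MeasurableSet (L m) := fun m => MeasurableSet.iUnion fun n =>
    MeasurableSet.iUnion fun k => measurableSet_lt measurable_const (h.measurable _).abs
  have hL0 : Tendsto (fun m => P.real (L m)) atTop (𝓝 0) := by
    have hanti : Antitone L := fun m m' hmm => iUnion_mono fun n => iUnion_mono fun k ω hω =>
      lt_of_le_of_lt (by exact_mod_cast hmm : (m : ℝ) ≤ m') hω
    have hempty : ⋂ m, L m = ∅ := by
      refine eq_empty_of_forall_notMem fun ω hω => ?_
      obtain ⟨C, hC⟩ := (isCompact_range (hc ω).abs).bddAbove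
      obtain ⟨m, hm⟩ := exists_nat_ge C
      have h1 := mem_iInter.1 hω m
      simp only [hLdef, mem_iUnion, mem_ofPred_eq] at h1
      obtain ⟨n, k, h1⟩ := h1
      exact absurd (hC ⟨gridPoint hst n k, rfl⟩) (not_le.2 (hm.trans_lt h1))
    have h2 := tendsto_measure_iInter_atTop (μ := P) (fun m => (hLm m).nullMeasurableSet) hanti
      ⟨0, measure_ne_top P _⟩
    rw [hempty, measure_empty] at h2
    exact (ENNReal.tendsto_toReal ENNReal.zero_ne_top).comp h2
  have hε : Tendsto (fun m : ℕ => 1 / ((m : ℝ) + 1)) atTop (𝓝 0) :=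
    tendsto_one_div_add_atTop_nhds_zero_nat
  have hlim : Tendsto (fun m : ℕ => 1 / ((m : ℝ) + 1) * (q * (t - s)) + 2 * P.real (L m)) atTop
      (𝓝 (0 * (q * (t - s)) + 2 * 0)) := (hε.mul_const _).add (hL0.const_mul 2)
  rw [zero_mul, mul_zero, add_zero] at hlim
  refine sub_eq_zero.1 (norm_le_zero_iff.1 (ge_of_tendsto' hlim fun m => ?_))
  refine h.norm_integral_mul_exp_sub_le hq hc hst hZ hZ1 (K := m) (by positivity) ?_ (hLm m)
    fun ω hω n k => ?_
  · rw [div_le_one (by positivity)]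
    linarith [Nat.cast_nonneg (α := ℝ) m]
  · simp only [hLdef, mem_iUnion, not_exists, mem_ofPred_eq, not_lt] at hω
    exact hω n k

end HasBracket

end ZeroRange

end

open MeasureTheory ProbabilityTheory Filter Set
open scoped Topology ENNReal NNReal

noncomputable section

namespace ZeroRange

/-! ### Uniqueness in law -/

/-! ### Linear functionals of the initial field and the martingale part. -/

section PathFunctionals

variable {p : Params} {T : ℝ} {Ω : Type*}

theorem PathSpace.eval_add (y : PathSpace p T) (t : ↥(Icc (0 : ℝ) T)) (H G : TestSpace p) :
    y.eval t (H + G) = y.eval t H + y.eval t G := map_add _ H G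

theorem PathSpace.eval_smul (y : PathSpace p T) (t : ↥(Icc (0 : ℝ) T)) (c : ℝ)
    (H : TestSpace p) : y.eval t (c • H) = c * y.eval t H := map_smul _ c H

theorem continuous_eval_projIcc (hT : 0 ≤ T) (y : PathSpace p T) (H : TestSpace p) :
    Continuous fun s => y.eval (projIcc 0 T hT s) H :=
  (y.continuous_eval H).comp continuous_projIcc

theorem processM_add (hT : 0 ≤ T) (Y : Ω → PathSpace p T) (H G : TestSpace p)
    (t : ↥(Icc (0 : ℝ) T)) (ω : Ω) :
    processM hT Y (H + G) t ω = processM hT Y H t ω + processM hT Y G t ω := by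
  have h1 : testA p (H + G) = testA p H + testA p G := map_add (testAL p) H G
  simp only [processM, h1, PathSpace.eval_add]
  rw [intervalIntegral.integral_add ((continuous_eval_projIcc hT _ _).intervalIntegrable _ _)
    ((continuous_eval_projIcc hT _ _).intervalIntegrable _ _)]
  ring

theorem processM_smul (hT : 0 ≤ T) (Y : Ω → PathSpace p T) (c : ℝ) (H : TestSpace p)
    (t : ↥(Icc (0 : ℝ) T)) (ω : Ω) :
    processM hT Y (c • H) t ω = c * processM hT Y H t ω := by
  have h1 : testA p (c • H) = c • testA p H := map_smul (testAL p) c H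
  simp only [processM, h1, PathSpace.eval_smul, intervalIntegral.integral_const_mul]
  ring

theorem processM_at_zero (hT : 0 ≤ T) (Y : Ω → PathSpace p T) (H : TestSpace p) (ω : Ω) :
    processM hT Y H ⟨0, left_mem_Icc.2 hT⟩ ω = 0 := by
  simp [processM]

theorem continuous_processM (hT : 0 ≤ T) (Y : Ω → PathSpace p T) (H : TestSpace p) (ω : Ω) :
    Continuous fun t => processM hT Y H t ω := by
  have h1 : Continuous fun r : ℝ =>
      ∫ s in (0 : ℝ)..r, (Y ω).eval (projIcc 0 T hT s) (testA p H) :=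
    intervalIntegral.continuous_primitive
      (fun _ _ => (continuous_eval_projIcc hT _ _).intervalIntegrable _ _) 0
  exact (((Y ω).continuous_eval H).sub continuous_const).sub (h1.comp continuous_subtype_val)

theorem normSq_D_nonneg (hp : p.Admissible) (H : TestSpace p) : 0 ≤ normSq p (D 1 H.fn) := by
  obtain ⟨E, _, _, _, ⟨d⟩⟩ := exists_driving hp
  rw [← d.form_self]
  exact d.form_self_nonneg H

/-- The initial field tested against `H₀` plus the martingale parts at the times `τ a`, tested
against `G a`. -/
def fieldSum (hT : 0 ≤ T) (Y : Ω → PathSpace p T) {κ : Type*} (τ : κ → ↥(Icc (0 : ℝ) T))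
    (A : Finset κ) (G : κ → TestSpace p) (H₀ : TestSpace p) (ω : Ω) : ℝ :=
  (Y ω).eval ⟨0, left_mem_Icc.2 hT⟩ H₀ + ∑ a ∈ A, processM hT Y (G a) (τ a) ω

theorem fieldSum_insert (hT : 0 ≤ T) (Y : Ω → PathSpace p T) {κ : Type*} [DecidableEq κ]
    (τ : κ → ↥(Icc (0 : ℝ) T)) {A : Finset κ} {a : κ} (ha : a ∉ A) (G : κ → TestSpace p)
    (H₀ : TestSpace p) (ω : Ω) : fieldSum hT Y τ (insert a A) G H₀ ω
      = fieldSum hT Y τ A G H₀ ω + processM hT Y (G a) (τ a) ω := by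
  simp only [fieldSum, Finset.sum_insert ha]
  ring

/-- The martingale part is linear in the test function, so a term at an existing time is absorbed
into the test function there and no new time is created. -/
theorem fieldSum_add_processM (hT : 0 ≤ T) (Y : Ω → PathSpace p T) {κ : Type*} [DecidableEq κ]
    (τ : κ → ↥(Icc (0 : ℝ) T)) {A : Finset κ} {b : κ} (hb : b ∈ A) (G : κ → TestSpace p)
    (H₀ H : TestSpace p) (ω : Ω) : fieldSum hT Y τ A G H₀ ω + processM hT Y H (τ b) ω
      = fieldSum hT Y τ A (fun x => G x + (if x = b then (1 : ℝ) else 0) • H) H₀ ω := by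
  simp only [fieldSum, processM_add, processM_smul, Finset.sum_add_distrib, ite_mul, one_mul,
    zero_mul, Finset.sum_ite_eq', hb, if_true]
  ring

end PathFunctionals

namespace IsSolution

variable {p : Params} {T : ℝ} {hT : 0 ≤ T} {Ω : Type*} [MeasurableSpace Ω] {P : Measure Ω}
  {Y : Ω → PathSpace p T}

theorem measurable_fieldSum (hY : Measurable Y) {κ : Type*} {τ : κ → ↥(Icc (0 : ℝ) T)}
    {A : Finset κ} {s : ↥(Icc (0 : ℝ) T)} (hs : ∀ a ∈ A, τ a ≤ s) (G : κ → TestSpace p)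
    (H₀ : TestSpace p) :
    Measurable[fieldFiltration Y hY s] (fieldSum hT Y τ A G H₀) := by
  refine Measurable.add (measurable_eval_fieldFiltration hY s.2.1 H₀) ?_
  exact Finset.measurable_sum A fun a ha =>
    (measurable_processM hT hY (G a) (τ a)).mono ((fieldFiltration Y hY).mono (hs a ha)) le_rfl

theorem hasBracket (h : IsSolution hT P Y) (H : TestSpace p) :
    HasBracket (processM hT Y H) (fun t => (t : ℝ) * normSq p (D 1 H.fn))
      (fieldFiltration Y h.measurable) P :=
  ⟨h.martingale_M H, h.martingale_N H⟩

theorem integral_exp_initial (h : IsSolution hT P Y) (H : TestSpace p) :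
    ∫ ω, Complex.exp ((Y ω).eval ⟨0, left_mem_Icc.2 hT⟩ H * Complex.I) ∂P
      = charFun (gaussianReal 0
        (∫ u in (0 : ℝ)..1, ext H.fn u * ext H.fn u * chi p u).toNNReal) 1 := by
  have h1 := (h.gaussian.hasGaussianLaw_eval H).map_eq_gaussianReal
  have hm : AEMeasurable (fun ω => (Y ω).eval ⟨0, left_mem_Icc.2 hT⟩ H) P :=
    ((measurable_eval _ H).comp h.measurable).aemeasurable
  have h2 : Var[fun ω => (Y ω).eval ⟨0, left_mem_Icc.2 hT⟩ H; P]
      = ∫ u in (0 : ℝ)..1, ext H.fn u * ext H.fn u * chi p u := by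
    rw [variance_of_integral_eq_zero hm (h.mean_zero H), ← h.covariance]
    exact integral_congr_ae (Eventually.of_forall fun ω => sq _)
  rw [h.mean_zero H, h2] at h1
  rw [← h1, charFun_map hm]
  simp

/-- Lévy's identity with Z the exponential of the earlier terms: the last time is moved back from t
to s at the price of a factor that depends only on the parameters. -/
theorem integral_exp_fieldSum_insert [IsProbabilityMeasure P] (hp : p.Admissible)
    (h : IsSolution hT P Y) {κ : Type*} {τ : κ → ↥(Icc (0 : ℝ) T)} {A : Finset κ}
    {s t : ↥(Icc (0 : ℝ) T)} (hs : ∀ a ∈ A, τ a ≤ s) (hst : s ≤ t) (G : κ → TestSpace p)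
    (H₀ H : TestSpace p) :
    ∫ ω, Complex.exp ((fieldSum hT Y τ A G H₀ ω + processM hT Y H t ω : ℝ) * Complex.I) ∂P
      = Complex.exp (-(normSq p (D 1 H.fn) * (t - s) / 2)) *
        ∫ ω, Complex.exp ((fieldSum hT Y τ A G H₀ ω + processM hT Y H s ω : ℝ) * Complex.I) ∂P := by
  have hZ : StronglyMeasurable[fieldFiltration Y h.measurable s] fun ω =>
      Complex.exp (fieldSum hT Y τ A G H₀ ω * Complex.I) :=
    (by fun_prop : Continuous fun x : ℝ => Complex.exp (x * Complex.I)).comp_stronglyMeasurable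
      (measurable_fieldSum h.measurable hs G H₀).stronglyMeasurable
  have key := (h.hasBracket H).integral_mul_exp (normSq_D_nonneg hp H)
    (fun ω => continuous_processM hT Y H ω) hst hZ
    (fun ω => (Complex.norm_exp_ofReal_mul_I _).le)
  simp only [← Complex.exp_add, ← add_mul, ← Complex.ofReal_add] at key
  exact key

/-- Induction with the latest time added last. Its martingale term is moved back to the latest
remaining time and absorbed there, or back to time 0, where it vanishes. The factors produced are
the same for both solutions, and what finally remains is the Gaussian initial field. -/
theorem integral_exp_fieldSum_eq [IsProbabilityMeasure P] (hp : p.Admissible)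
    (h : IsSolution hT P Y) {Ω' : Type*} [MeasurableSpace Ω'] {P' : Measure Ω'}
    [IsProbabilityMeasure P'] {Y' : Ω' → PathSpace p T} (h' : IsSolution hT P' Y') {κ : Type*}
    (τ : κ → ↥(Icc (0 : ℝ) T)) (A : Finset κ) (G : κ → TestSpace p) (H₀ : TestSpace p) :
    ∫ ω, Complex.exp (fieldSum hT Y τ A G H₀ ω * Complex.I) ∂P
      = ∫ ω, Complex.exp (fieldSum hT Y' τ A G H₀ ω * Complex.I) ∂P' := by
  classical
  induction A using Finset.induction_on_max_value τ generalizing G with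
  | empty =>
    simp only [fieldSum, Finset.sum_empty, add_zero]
    rw [h.integral_exp_initial, h'.integral_exp_initial]
  | insert a A ha hmax ih =>
    simp only [fieldSum_insert hT _ τ ha]
    rcases A.eq_empty_or_nonempty with rfl | hA
    · have h0 : ∀ b ∈ (∅ : Finset κ), τ b ≤ (⟨0, left_mem_Icc.2 hT⟩ : ↥(Icc (0 : ℝ) T)) := by simp
      rw [h.integral_exp_fieldSum_insert hp h0 (τ a).2.1,
        h'.integral_exp_fieldSum_insert hp h0 (τ a).2.1]
      simp only [processM_at_zero, add_zero]
      rw [ih]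
    · obtain ⟨b, hb, hbm⟩ := A.exists_max_image τ hA
      rw [h.integral_exp_fieldSum_insert hp hbm (hmax b hb),
        h'.integral_exp_fieldSum_insert hp hbm (hmax b hb)]
      simp only [fieldSum_add_processM hT _ τ hb]
      rw [ih]

end IsSolution

/-! ### Recovering the path from the initial field and the martingale part. -/

section Coordinates

variable {p : Params} {T : ℝ}

/-- The initial field and the martingale part, as functions of the path. -/
def drivingCoord (hT : 0 ≤ T) (y : PathSpace p T)
    (q : TestSpace p × ↥(Icc (0 : ℝ) T) × TestSpace p) : ℝ :=
  y.eval ⟨0, left_mem_Icc.2 hT⟩ q.1 + processM hT id q.2.2 q.2.1 y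

theorem measurable_drivingCoord (hT : 0 ≤ T) : Measurable (drivingCoord (p := p) hT) :=
  measurable_pi_iff.2 fun q => (measurable_eval _ q.1).add
    ((measurable_processM hT measurable_id q.2.2 q.2.1).mono
      ((fieldFiltration id measurable_id).le _) le_rfl)

-- By linearity in the test functions, every linear functional of finitely many coordinates is a
-- single `fieldSum`; hence the characteristic functions computed above are those of all
-- finite-dimensional marginals.
open Classical in
theorem apply_restrict_drivingCoord (hT : 0 ≤ T) {Ω : Type*} (Y : Ω → PathSpace p T)
    (I : Finset (TestSpace p × ↥(Icc (0 : ℝ) T) × TestSpace p)) (L : StrongDual ℝ (I → ℝ))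
    (ω : Ω) : L (I.restrict (drivingCoord hT (Y ω)))
      = fieldSum hT Y (fun q : I => q.1.2.1) Finset.univ
        (fun q => L (fun r => if q = r then 1 else 0) • q.1.2.2)
        (∑ q : I, L (fun r => if q = r then 1 else 0) • q.1.1) ω := by
  have h1 := LinearMap.pi_apply_eq_sum_univ L.toLinearMap (I.restrict (drivingCoord hT (Y ω)))
  have h2 : (Y ω).eval ⟨0, left_mem_Icc.2 hT⟩
      (∑ q : I, L (fun r => if q = r then 1 else 0) • q.1.1)
      = ∑ q : I, L (fun r => if q = r then 1 else 0)
        * (Y ω).eval ⟨0, left_mem_Icc.2 hT⟩ q.1.1 := by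
    have := map_sum ((show C(↥(Icc (0 : ℝ) T), DualSpace p) from Y ω) ⟨0, left_mem_Icc.2 hT⟩)
      (fun q : I => L (fun r => if q = r then 1 else 0) • q.1.1) Finset.univ
    simp only [map_smul, smul_eq_mul] at this
    exact this
  refine h1.trans ?_
  rw [fieldSum, h2, ← Finset.sum_add_distrib]
  refine Finset.sum_congr rfl fun q _ => ?_
  rw [processM_smul]
  change ((Y ω).eval _ _ + processM hT Y q.1.2.2 q.1.2.1 ω) * _ = _
  rw [add_mul, mul_comm, mul_comm (processM hT Y q.1.2.2 q.1.2.1 ω)]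
  rfl

/-- The difference z of two solutions satisfies z = -l∫z, so exp(ls) times the primitive of z is
constant, and it vanishes at 0. -/
theorem eq_ouSol {l a : ℝ} {m x : ℝ → ℝ} (hm : Continuous m) (hx : Continuous x)
    (h : ∀ t, x t = a + m t - l * ∫ s in (0 : ℝ)..t, x s) (t : ℝ) : x t = ouSol l a m t := by
  have hy := continuous_ouSol (l := l) (a := a) hm
  set z : ℝ → ℝ := fun s => x s - ouSol l a m s with hz
  have hzc : Continuous z := hx.sub hy
  have hzi : ∀ s, z s = -l * ∫ r in (0 : ℝ)..s, z r := fun s => by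
    simp only [hz]
    rw [intervalIntegral.integral_sub (hx.intervalIntegrable _ _) (hy.intervalIntegrable _ _),
      h s, ouSol_eq hm s]
    ring
  have hd : ∀ s, HasDerivAt (fun s => Real.exp (l * s) * ∫ r in (0 : ℝ)..s, z r) 0 s := fun s => by
    have h1 : HasDerivAt (fun s => ∫ r in (0 : ℝ)..s, z r) (z s) s :=
      intervalIntegral.integral_hasDerivAt_right (hzc.intervalIntegrable _ _)
        (hzc.stronglyMeasurableAtFilter _ _) hzc.continuousAt
    have h2 : HasDerivAt (fun s => Real.exp (l * s)) (Real.exp (l * s) * (l * 1)) s :=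
      ((hasDerivAt_id s).const_mul l).exp
    have h3 := h2.mul h1
    have e : Real.exp (l * s) * (l * 1) * (∫ r in (0 : ℝ)..s, z r) + Real.exp (l * s) * z s
        = 0 := by
      rw [hzi s]
      ring
    rwa [e] at h3
  have h4 := is_const_of_deriv_eq_zero (fun s => (hd s).differentiableAt) (fun s => (hd s).deriv)
    t 0
  rw [intervalIntegral.integral_same, mul_zero] at h4
  have h5 : ∫ r in (0 : ℝ)..t, z r = 0 :=
    (mul_eq_zero.1 h4).resolve_left (Real.exp_pos _).ne'
  have h6 := hzi t
  rw [h5, mul_zero] at h6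
  exact sub_eq_zero.1 h6

/-- Since 𝔄e_i = -λ_i e_i, the equation tested against e_i is closed, and y_t(e_i) is the
Ornstein–Uhlenbeck functional of two families of driving coordinates: the initial value and the
martingale part. -/
theorem measurable_eval_eigenfunction (S : SpectralData p) (hT : 0 ≤ T) (i : S.ι)
    (t : ↥(Icc (0 : ℝ) T)) :
    Measurable[MeasurableSpace.comap (drivingCoord (p := p) hT) inferInstance]
      fun y : PathSpace p T => y.eval t (S.e i) := by
  set 𝒢 := MeasurableSpace.comap (drivingCoord (p := p) (T := T) hT) inferInstance with h𝒢
  have hcoord : ∀ q, Measurable[𝒢] fun y : PathSpace p T => drivingCoord hT y q := fun q =>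
    (measurable_pi_apply q).comp (comap_measurable (drivingCoord (p := p) (T := T) hT))
  have h0 : ∀ H : TestSpace p, Measurable[𝒢] fun y : PathSpace p T =>
      y.eval ⟨0, left_mem_Icc.2 hT⟩ H := fun H => by
    have := hcoord (H, ⟨0, left_mem_Icc.2 hT⟩, 0)
    simpa only [drivingCoord, processM_at_zero, add_zero] using this
  have hM : ∀ t H, Measurable[𝒢] fun y : PathSpace p T => processM hT id H t y := fun t H => by
    have := hcoord (0, t, H)
    have e : ∀ y : PathSpace p T, y.eval ⟨0, left_mem_Icc.2 hT⟩ (0 : TestSpace p) = 0 :=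
      fun y => map_zero ((show C(↥(Icc (0 : ℝ) T), DualSpace p) from y) _)
    simpa only [drivingCoord, e, zero_add] using this
  set x : PathSpace p T → ℝ → ℝ := fun y s => y.eval (projIcc 0 T hT s) (S.e i) with hx
  have hxc : ∀ y, Continuous (x y) := fun y => continuous_eval_projIcc hT y _
  -- The driving function is defined on all of ℝ by the equation itself, with the path frozen
  -- outside [0, T], so that uniqueness on ℝ applies; on [0, T] it is the martingale part.
  set m : ℝ → PathSpace p T → ℝ := fun r y => x y r - y.eval ⟨0, left_mem_Icc.2 hT⟩ (S.e i)
    + S.lam i * ∫ s in (0 : ℝ)..r, x y s with hm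
  have hmc : ∀ y, Continuous fun r => m r y := fun y => by
    have h1 : Continuous fun r : ℝ => ∫ s in (0 : ℝ)..r, x y s :=
      intervalIntegral.continuous_primitive
        (fun _ _ => (hxc y).intervalIntegrable _ _) 0
    exact ((hxc y).sub continuous_const).add (h1.const_mul _)
  have hmm : ∀ r (hr : r ∈ Icc (0 : ℝ) T), m r = fun y => processM hT id (S.e i) ⟨r, hr⟩ y :=
    fun r hr => by
      funext y
      simp only [hm, hx, processM, S.testA_e, PathSpace.eval_smul,
        intervalIntegral.integral_const_mul, projIcc_of_mem hT hr, id]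
      ring
  have hsol : (fun y : PathSpace p T => y.eval t (S.e i)) = fun y => ouSol (S.lam i)
      (y.eval ⟨0, left_mem_Icc.2 hT⟩ (S.e i)) (fun r => m r y) t := by
    funext y
    have h1 : x y t = y.eval t (S.e i) := by simp only [hx, projIcc_val]
    rw [← h1]
    refine eq_ouSol (hmc y) (hxc y) (fun r => ?_) t
    simp only [hm]
    ring
  rw [hsol]
  exact @measurable_ouSol _ 𝒢 (S.lam i) _ m t t.2.1 (h0 (S.e i))
    (fun r hr => by
      rw [hmm r ⟨hr.1, hr.2.trans t.2.2⟩]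
      exact hM _ _) hmc

/-- Each y_t is continuous on 𝒮_θ, so y_t(H) is the sum of its values along the eigenexpansion of H,
each measurable with respect to the driving coordinates. -/
theorem measurableSpace_pathSpace_le (hp : p.Admissible) (hT : 0 ≤ T) :
    (inferInstance : MeasurableSpace (PathSpace p T))
      ≤ MeasurableSpace.comap (drivingCoord hT) inferInstance := by
  obtain ⟨S⟩ := nonempty_spectralData hp
  refine iSup₂_le fun t H => Measurable.comap_le ?_
  have e : (fun y : PathSpace p T => y.eval t H)
      = fun y => ∑' i, S.coef i H * y.eval t (S.e i) := by
    funext y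
    have h1 := (S.hasSum H).mapL ((show C(↥(Icc (0 : ℝ) T), DualSpace p) from y) t)
    simp only [map_smul, smul_eq_mul] at h1
    exact h1.tsum_eq.symm
  rw [e]
  exact measurable_tsum_coef_mul S (fun i => measurable_eval_eigenfunction S hT i t) H

theorem measure_pathSpace_ext (hp : p.Admissible) (hT : 0 ≤ T) {Q Q' : Measure (PathSpace p T)}
    (h : Q.map (drivingCoord hT) = Q'.map (drivingCoord hT)) : Q = Q' := by
  ext B hB
  obtain ⟨C, hC, rfl⟩ := measurableSpace_pathSpace_le hp hT B hB
  rw [← Measure.map_apply (measurable_drivingCoord hT) hC, h,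
    Measure.map_apply (measurable_drivingCoord hT) hC]

end Coordinates

/-- The driving coordinates generate the σ-algebra, so it is enough to compare their joint laws.
These are projective limits of finite-dimensional marginals, which are determined by their
characteristic functions. -/
theorem IsSolution.map_eq {p : Params} {T : ℝ} {hT : 0 ≤ T} (hp : p.Admissible) {Ω Ω' : Type*}
    [MeasurableSpace Ω] {P : Measure Ω} [IsProbabilityMeasure P] {Y : Ω → PathSpace p T}
    (h : IsSolution hT P Y) [MeasurableSpace Ω'] {P' : Measure Ω'} [IsProbabilityMeasure P']
    {Y' : Ω' → PathSpace p T} (h' : IsSolution hT P' Y') : P.map Y = P'.map Y' := by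
  have hP : IsProbabilityMeasure (P.map Y) :=
    Measure.isProbabilityMeasure_map h.measurable.aemeasurable
  have hP' : IsProbabilityMeasure (P'.map Y') :=
    Measure.isProbabilityMeasure_map h'.measurable.aemeasurable
  refine measure_pathSpace_ext hp hT ?_
  have hV := measurable_drivingCoord (p := p) hT
  refine IsProjectiveLimit.unique
    (P := fun I => ((P.map Y).map (drivingCoord hT)).map I.restrict)
    (fun I => rfl) fun I => ?_
  have hr : Measurable fun y : PathSpace p T => I.restrict (drivingCoord hT y) :=
    (Finset.measurable_restrict I).comp hV
  have hmap : ∀ Q : Measure (PathSpace p T), (Q.map (drivingCoord hT)).map I.restrict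
      = Q.map fun y => I.restrict (drivingCoord hT y) := fun Q =>
    Measure.map_map (Finset.measurable_restrict I) hV
  beta_reduce
  rw [hmap, hmap, Measure.map_map hr h.measurable, Measure.map_map hr h'.measurable]
  have i1 := Measure.isProbabilityMeasure_map (μ := P) (hr.comp h.measurable).aemeasurable
  have i2 := Measure.isProbabilityMeasure_map (μ := P') (hr.comp h'.measurable).aemeasurable
  refine Measure.ext_of_charFunDual (funext fun L => ?_)
  have hLc : ∀ {μ : Measure ((q : I) → ℝ)}, AEStronglyMeasurable
      (fun x => Complex.exp (L x * Complex.I)) μ := by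
    intro μ
    exact (by fun_prop : Continuous fun x => Complex.exp (L x * Complex.I)).aestronglyMeasurable
  rw [charFunDual_apply, charFunDual_apply, integral_map (hr.comp h'.measurable).aemeasurable hLc,
    integral_map (hr.comp h.measurable).aemeasurable hLc]
  simp only [Function.comp_apply, apply_restrict_drivingCoord]
  exact (h.integral_exp_fieldSum_eq hp h' _ _ _ _).symm

end ZeroRange

end

theorem proposition2p6 (p : ZeroRange.Params)
    (hg0 : p.g 0 = 0) (hgpos : ∀ k : ℕ, 1 ≤ k → 0 < p.g k)
    (hgvar : ∃ C : ℝ, ∀ k : ℕ, 1 ≤ k → |p.g (k + 1) - p.g k| ≤ C)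
    (hZ : Tendsto (fun φ : ℝ≥0 => ZeroRange.Z p.g φ)
      (comap (fun φ : ℝ≥0 => (φ : ℝ≥0∞)) (𝓝[<] ZeroRange.phiStar p.g)) atTop)
    (hα : 0 < p.α) (hlam : 0 < p.lam) (hβ : 0 < p.β) (hδ : 0 < p.δ)
    (hfug : ∀ u ∈ Icc (0 : ℝ) 1,
      ENNReal.ofReal (ZeroRange.fugacity p u) < ZeroRange.phiStar p.g)
    (hθ : 0 ≤ p.θ) (T : ℝ) (hT : 0 < T) :
    ∃ Q : Measure (ZeroRange.PathSpace p T),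
      (∃ (Ω : Type) (_ : MeasurableSpace Ω) (P : Measure Ω) (Y : Ω → ZeroRange.PathSpace p T),
        IsProbabilityMeasure P ∧ ZeroRange.IsSolution hT.le P Y ∧ P.map Y = Q) ∧
      ∀ (Ω : Type*) (_ : MeasurableSpace Ω) (P : Measure Ω) (Y : Ω → ZeroRange.PathSpace p T),
        IsProbabilityMeasure P → ZeroRange.IsSolution hT.le P Y → P.map Y = Q := by
  have hp : p.Admissible := ⟨hgpos, hα, hlam, hβ, hδ, hfug⟩
  obtain ⟨Ω, mΩ, P, Y, hP, hY⟩ := ZeroRange.exists_isSolution hp hT.le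
  refine ⟨P.map Y, ⟨Ω, mΩ, P, Y, hP, hY, rfl⟩, fun Ω' mΩ' P' Y' hP' hY' => ?_⟩
  exact hY'.map_eq hp hY
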